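/- Let $\tau_1,\tau_2,\tau_3\in\mathbb C$ with $\operatorname{Im}\tau_j>0$, $\tau_1\tau_2\tau_3\in\mathbb R_{<0}$ and $(\tau_1-1)(\tau_2-1)(\tau_3-1)\in\mathbb R_{>0}$, and let $Y=\prod_{j=1}^3\mathbb C/(\mathbb Z+\mathbb Z\tau_j)$. Let $L_1,L_2,L_3\subset Y$ be the special Lagrangian $3$-tori that are the images of $\mathbb R^3$, of $\mathbb R\tau_1\times\mathbb R\tau_2\times\mathbb R\tau_3$ and of $(\tfrac12,\tfrac12,\tfrac12)+\mathbb R(\tau_1-1)\times\mathbb R(\tau_2-1)\times\mathbb R(\tau_3-1)$, oriented by $\operatorname{Re}(dz^1\wedge dz^2\wedge dz^3)$; any two of them meet in exactly one point (a node), and the three nodes are distinct. Let $N$ be the (self-)connected sum of $L_1\amalg L_2\amalg L_3$ at the three pairs of points lying over the nodes. Let $\varepsilon>0$ and let $\pi:X\to(-\varepsilon,\varepsilon)$ be a Morse family, i.e. a smooth surjective map from a smooth $4$-manifold all of whose critical points are nondegenerate, whose fibres $X_t=\pi^{-1}(t)$ satisfy: $X_t\simeq L_1\amalg L_2\amalg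 L_3$ for $t<0$, $X_0\simeq L_1\cup L_2\cup L_3$, and $X_t\simeq N$ for $t>0$, where the critical points of $\pi$ are exactly the three points of $X_0$ corresponding to the nodes. Let $c:\hat X\to X$ be a covering map of finite degree $r>1$, and $\hat X_t=(\pi\circ c)^{-1}(t)$. Let $\Gamma$ be the dual graph of $\hat X_0$: it has one vertex for each manifold-component of $\hat X_0$ (closure of a connected component of the manifold locus of $\hat X_0$), and, for any two different components $M,M'$, one edge joining them for each point of $M\cap M'$. Let $\Gamma_{(0)}$ and $\Gamma_{(1)}$ be its sets of vertices and edges, and let $b^1$ denote the first Betti number $\dim H^1(\,\cdot\,;\mathbb R)$. Then 1. $|\Gamma_{(1)}|=3r$ and $3\le|\Gamma_{(0)}|\le 3r$; 2. $b^1(\hat X_t)=3|\Gamma_{(0)}|$ for $t\in(-\varepsilon,0)$; 3. if $\hat X_0$ is connected, then $b^1(\hat X_t)=3r+2|\Gamma_{(0)}|+1$ for $t\in[0,\varepsilon)$; 4. (whether or not $\hat X_0$ is connected) $b^1(\hat X_t)\ge 3r+7>10=b^1(L_1\cup L_2\cup L_3)=b^1(N)$ for $t\in[0,\varepsilon)$.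 -/

import Mathlib

open Set Topology
open scoped Manifold ContDiff

noncomputable section

namespace Necklace

/-! ### First Betti number, through the singular cochain complex -/

/-- Real singular `n`-cochains of `Z`: functions on the singular `n`-simplices of `Z`. -/
abbrev SingularCochain (Z : Type*) [TopologicalSpace Z] (n : ℕ) : Type _ :=
  C(stdSimplex ℝ (Fin (n + 1)), Z) → ℝ

/-- The inclusion of the `i`-th face of the standard `(n+1)`-simplex. -/
def face (n : ℕ) (i : Fin (n + 2)) :
    C(stdSimplex ℝ (Fin (n + 1)), stdSimplex ℝ (Fin (n + 2))) :=
  ⟨stdSimplex.map i.succAbove, stdSimplex.continuous_map _⟩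

/-- The singular coboundary `(δφ)(σ) = ∑ i, (-1)^i φ(σ ∘ face i)`. -/
def coboundary (Z : Type*) [TopologicalSpace Z] (n : ℕ) :
    SingularCochain Z n →ₗ[ℝ] SingularCochain Z (n + 1) where
  toFun φ σ := ∑ i : Fin (n + 2), (-1 : ℝ) ^ (i : ℕ) * φ (σ.comp (face n i))
  map_add' φ ψ := by
    funext σ
    simp [mul_add, Finset.sum_add_distrib]
  map_smul' a φ := by
    funext σ
    simp [Finset.mul_sum, mul_left_comm]

/-- The first real singular cohomology `H¹(Z; ℝ)`: 1-cocycles modulo 1-coboundaries. -/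
abbrev SingularH1 (Z : Type*) [TopologicalSpace Z] : Type _ :=
  LinearMap.ker (coboundary Z 1) ⧸
    (LinearMap.range (coboundary Z 0)).comap (LinearMap.ker (coboundary Z 1)).subtype

/-- The first Betti number `b¹(Z) = dim H¹(Z; ℝ)`. -/
def b1 (Z : Type*) [TopologicalSpace Z] : ℕ := Module.finrank ℝ (SingularH1 Z)

/-! ### The dual graph of a 3-manifold with singularities -/

/-- The manifold locus: the points with an open neighbourhood homeomorphic to `ℝ³`. -/
def manifoldLocus (Z : Type*) [TopologicalSpace Z] : Set Z :=
  {p | ∃ U : Set Z, IsOpen U ∧ p ∈ U ∧ Nonempty (U ≃ₜ EuclideanSpace ℝ (Fin 3))}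

/-- The (irreducible) components of `Z`: closures of the connected components of the
manifold locus. -/
def manifoldComponents (Z : Type*) [TopologicalSpace Z] : Set (Set Z) :=
  {M | ∃ p ∈ manifoldLocus Z, M = closure (connectedComponentIn (manifoldLocus Z) p)}

/-- The dual graph of `Z` (a multigraph): one vertex for each component of `Z`, and, for any two
different components `M`, `M'`, one edge joining them for each point of `M ∩ M'`. The edge given by
`p ∈ M ∩ M'` is the pair `(s(M, M'), p)`. -/
def dualGraph (Z : Type*) [TopologicalSpace Z] : Graph (Set Z) (Sym2 (Set Z) × Z) where
  vertexSet := manifoldComponents Z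
  IsLink e M M' := e.1 = s(M, M') ∧ M ≠ M' ∧ M ∈ manifoldComponents Z ∧
    M' ∈ manifoldComponents Z ∧ e.2 ∈ M ∩ M'
  isLink_symm := by
    rintro e -
    refine ⟨fun M M' h => ?_⟩
    exact ⟨h.1.trans Sym2.eq_swap, h.2.1.symm, h.2.2.2.1, h.2.2.1, h.2.2.2.2.symm⟩
  eq_or_eq_of_isLink_of_isLink := by
    rintro e M M' K K' h h'
    rcases Sym2.eq_iff.1 (h.1.symm.trans h'.1) with h | h
    · exact Or.inl h.1
    · exact Or.inr h.1
  left_mem_of_isLink := by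
    rintro e M M' h
    exact h.2.2.1

/-! ### The complex 3-torus and the necklace of three special Lagrangian 3-tori -/

/-- The elliptic curve `ℂ / (ℤ + ℤ τ)`. -/
abbrev EllipticCurve (τ : ℂ) : Type := ℂ ⧸ AddSubgroup.closure ({1, τ} : Set ℂ)

/-- The product `Y` of three elliptic curves. -/
abbrev Torus (τ : Fin 3 → ℂ) : Type := (j : Fin 3) → EllipticCurve (τ j)

/-- Base points of the three affine 3-planes of `ℂ³`: `0`, `0`, `(1/2, 1/2, 1/2)`. -/
def planeBase : Fin 3 → ℂ := ![0, 0, 1 / 2]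

/-- Directions of the three planes in each coordinate: `1`, `-τ`, `τ - 1`. -/
def planeDir (τ : ℂ) : Fin 3 → ℂ := ![1, -τ, τ - 1]

/-- The parametrization `ℝ³ → L_i ⊆ Y`, which is positively oriented with respect to the
restriction of `Re Ω` to `L_i`. -/
def planeMap (τ : Fin 3 → ℂ) (i : Fin 3) (s : EuclideanSpace ℝ (Fin 3)) : Torus τ :=
  fun j => QuotientAddGroup.mk (planeBase i + (s j : ℂ) * planeDir (τ j) i)

/-- The special Lagrangian 3-torus `L_i` in `Y`. -/
def sLag (τ : Fin 3 → ℂ) (i : Fin 3) : Set (Torus τ) := range (planeMap τ i)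

/-- The disjoint union `L = L₁ ⨿ L₂ ⨿ L₃`. -/
abbrev DisjointTori (τ : Fin 3 → ℂ) : Type := (i : Fin 3) × sLag τ i

/-- The union `L₁ ∪ L₂ ∪ L₃ ⊆ Y`. -/
def unionTori (τ : Fin 3 → ℂ) : Set (Torus τ) := ⋃ i, sLag τ i

/-- The intersection points of different `L_i`'s. -/
def nodes (τ : Fin 3 → ℂ) : Set (Torus τ) := {y | ∃ i i', i ≠ i' ∧ y ∈ sLag τ i ∧ y ∈ sLag τ i'}

/-- `L` with an open round ball (in the parametrization) removed around each preimage of a node. -/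
def puncturedTori (τ : Fin 3 → ℂ) : Set (DisjointTori τ) :=
  {q | ¬ ∃ s u : EuclideanSpace ℝ (Fin 3), planeMap τ q.1 s ∈ nodes τ ∧ ‖u‖ < 1 / 8 ∧
    (q.2 : Torus τ) = planeMap τ q.1 (s + u)}

/-- The gluing of boundary spheres: if `L_i` and `L_i'`, `i ≠ i'`, meet at the point with parameters
`s` and `s'`, then the point `s + u` of the sphere around `s` is glued to the point `s' - u` of the
sphere around `s'`. Since `u ↦ -u` reverses the orientation of the sphere, this is compatible
with the orientations of the `L_i`. -/
def sumRel (τ : Fin 3 → ℂ) (q q' : puncturedTori τ) : Prop :=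
  q.1.1 ≠ q'.1.1 ∧ ∃ s s' u : EuclideanSpace ℝ (Fin 3),
    planeMap τ q.1.1 s = planeMap τ q'.1.1 s' ∧ ‖u‖ = 1 / 8 ∧
    (q.1.2 : Torus τ) = planeMap τ q.1.1 (s + u) ∧
    (q'.1.2 : Torus τ) = planeMap τ q'.1.1 (s' - u)

/-- The oriented (self-)connected sum `N` of `L₁ ⨿ L₂ ⨿ L₃` at the three pairs of points that are
the preimages of the three nodes. -/
abbrev ConnectedSum (τ : Fin 3 → ℂ) : Type := Quot (sumRel τ)

/-! ### Morse families of 3-manifolds over an interval -/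

section Morse

variable {X : Type*} [TopologicalSpace X] [ChartedSpace (EuclideanSpace ℝ (Fin 4)) X]

/-- `p` is a critical point of `π`. -/
def IsCritical (π : X → ℝ) (p : X) : Prop := mfderiv (𝓡 4) 𝓘(ℝ, ℝ) π p = 0

/-- The Hessian of `π` at `p`, computed in the preferred chart at `p`. -/
def hessian (π : X → ℝ) (p : X) :
    EuclideanSpace ℝ (Fin 4) →L[ℝ] EuclideanSpace ℝ (Fin 4) →L[ℝ] ℝ :=
  fderiv ℝ (fderiv ℝ (π ∘ (extChartAt (𝓡 4) p).symm)) (extChartAt (𝓡 4) p p)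

/-- A Morse family over `(-ε, ε)`: a smooth map onto `(-ε, ε)` all of whose critical points are
nondegenerate. -/
structure IsMorseFamily (ε : ℝ) (π : X → ℝ) : Prop where
  smooth : ContMDiff (𝓡 4) 𝓘(ℝ, ℝ) ∞ π
  range_eq : range π = Ioo (-ε) ε
  nondegenerate : ∀ p, IsCritical π p → ∀ v, (∀ w, hessian π p v w = 0) → v = 0

/-- A Morse family over `(-ε, ε)` with fibres `X_t ≃ L₁ ⨿ L₂ ⨿ L₃` for `t < 0`,
`X_0 ≃ L₁ ∪ L₂ ∪ L₃` and `X_t ≃ N` for `t > 0`. The fibres over `t ≠ 0` are smooth, and the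
singular points of `X_0` are the nodes. -/
structure IsNecklaceFamily (τ : Fin 3 → ℂ) (ε : ℝ) (π : X → ℝ) : Prop
    extends IsMorseFamily ε π where
  fiber_neg : ∀ t ∈ Ioo (-ε) 0, Nonempty (π ⁻¹' {t} ≃ₜ DisjointTori τ)
  fiber_zero : ∃ e : π ⁻¹' {0} ≃ₜ unionTori τ,
    ∀ p : π ⁻¹' {0}, IsCritical π (p : X) ↔ (e p : Torus τ) ∈ nodes τ
  fiber_pos : ∀ t ∈ Ioo 0 ε, Nonempty (π ⁻¹' {t} ≃ₜ ConnectedSum τ)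
  smooth_fiber : ∀ p, π p ≠ 0 → ¬ IsCritical π p

end Morse

/-- The fibre `X̂_t` over `t` of the covering `c : X̂ → X` of the family `π : X → (-ε, ε)`. -/
abbrev CoverFiber {X Xhat : Type*} (π : X → ℝ) (c : Xhat → X) (t : ℝ) : Type _ :=
  ((π ∘ c) ⁻¹' {t} : Set Xhat)

end Necklace

end

/-! The covered singular fibre `X̂_0` is a union of 3-tori touching in points. A parametrization of
`L_i` by `ℝ³` lifts to `X̂_0` because `ℝ³` is simply connected, and a lift has a torus as image
because the degree is finite. These tori are the vertices of `Γ`, and the `3r` points over the nodes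
are its edges. Each `L_i` is covered by at least one and at most `r` tori, so `3 ≤ V ≤ 3r`
(`finite_and_card_coverTorus`). Gluing connected pieces at points adds the cohomology of the graph
to that of the pieces (`IsWedge.nonempty_H1_equiv`), so `b¹(X̂_0) = 3V + (3r - V + k) = 2V + 3r +
k`, with `k` the number of components of `Γ`. Here `k = 1` if `X̂_0` is connected; in general `k ≥
1` and `V ≥ 3` give `3r + 7`.

The other fibres are compared with `X̂_0`. By the Morse lemma (`exists_morse_chart`) `π` is a
diagonal quadratic form near a critical point. A node is a local cut point of `X_0`. This excludes
definite forms, whose zero set is a point, and signature `(2,2)`, whose punctured zero cone is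
connected, and leaves `±(|x|² - y²)` with `x ∈ ℝ³` (`nodeAt_of_morseAt`). The sign is `+` at every
node, since a node of the other sign would keep two tori joined in `X_t` for `t < 0`, which has
three components (`nodeAt_of_isCritical`). For `t > 0` the cone becomes a neck `S² × ℝ`; both are
connected without first cohomology, so `b¹` does not change. For `t < 0` the cone becomes two discs,
and at `t = 0` the cone without its vertex is two punctured discs. All of these are connected
without first cohomology, so `X̂_t` has the `b¹` of `X̂_0` minus the nodes, which is `3V`.

These comparisons use no flow but a Čech argument (`rank_H1_fiber_eventually_eq`, resting on
`rank_H1_le`): finitely many open sets cut all nearby fibres in connected sets without first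
cohomology, and their intersection patterns are compared. At regular values the same argument shows
that `b¹` is locally constant.

The fibres are compact, but `π` is not assumed proper, so a nearby fibre might have pieces far from
the given one. This is excluded in `eventually_fiber_subset`: for `t < 0` the near part of `X_t` has
`b¹ ≥ 9`, hence contains all three tori; for `t > 0` the fibre `N` is connected. Of `N` only
compactness and connectedness are checked directly; `b¹(N) = 10` follows from the family itself,
taken with the identity covering and `r = 1`.

The cohomology used is Alexander–Spanier cohomology of subsets, in which primitives are arbitrary
functions and gluing is elementary. The fibres are locally contractible, and there it agrees with
singular cohomology (`nonempty_H1_equiv_singularH1`). -/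

namespace Necklace

/-! ### Germs of 1-cocycles along a subset -/

section Cocycles

variable {Z Z' : Type*} [TopologicalSpace Z] [TopologicalSpace Z']

/-- `h` is a primitive along `S` of the 1-cochain `φ`, near the diagonal. -/
def IsPrim (S : Set Z) (φ : Z → Z → ℝ) (h : Z → ℝ) : Prop :=
  ∀ x ∈ S, ∀ᶠ y in 𝓝[S] x, φ x y = h y - h x

/-- Alexander–Spanier 1-cocycles along `S`: the cocycle identity holds near the diagonal. -/
def Coc (S : Set Z) : Submodule ℝ (Z → Z → ℝ) where
  carrier := {φ | ∀ x ∈ S, ∀ᶠ y in 𝓝[S] x, ∀ᶠ z in 𝓝[S] y, φ x z = φ x y + φ y z}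
  add_mem' := by
    intro φ ψ hφ hψ x hx
    filter_upwards [hφ x hx, hψ x hx] with y h1 h2
    filter_upwards [h1, h2] with z h3 h4
    simp only [Pi.add_apply, h3, h4]; ring
  zero_mem' := by intro x _; simp
  smul_mem' := by
    intro a φ hφ x hx
    filter_upwards [hφ x hx] with y h1
    filter_upwards [h1] with z h3
    simp only [Pi.smul_apply, h3, smul_eq_mul]; ring

/-- Alexander–Spanier 1-coboundaries along `S`. -/
def Ex (S : Set Z) : Submodule ℝ (Z → Z → ℝ) where
  carrier := {φ | ∃ h, IsPrim S φ h}
  add_mem' := by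
    rintro φ ψ ⟨h, hφ⟩ ⟨k, hψ⟩
    refine ⟨h + k, fun x hx => ?_⟩
    filter_upwards [hφ x hx, hψ x hx] with y h1 h2
    simp only [Pi.add_apply, h1, h2]; ring
  zero_mem' := ⟨0, by intro x _; simp⟩
  smul_mem' := by
    rintro a φ ⟨h, hφ⟩
    refine ⟨a • h, fun x hx => ?_⟩
    filter_upwards [hφ x hx] with y h1
    simp only [Pi.smul_apply, h1, smul_eq_mul]; ring

/-- The first Alexander–Spanier cohomology of the subset `S`. -/
abbrev H1 (S : Set Z) : Type _ := Coc S ⧸ (Ex S).submoduleOf (Coc S)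

theorem IsPrim.add {S : Set Z} {φ ψ : Z → Z → ℝ} {h k : Z → ℝ} (hφ : IsPrim S φ h)
    (hψ : IsPrim S ψ k) : IsPrim S (φ + ψ) (h + k) := by
  intro x hx
  filter_upwards [hφ x hx, hψ x hx] with y h1 h2
  simp only [Pi.add_apply, h1, h2]; ring

theorem IsPrim.smul {S : Set Z} {φ : Z → Z → ℝ} {h : Z → ℝ} (hφ : IsPrim S φ h) (a : ℝ) :
    IsPrim S (a • φ) (a • h) := by
  intro x hx
  filter_upwards [hφ x hx] with y h1
  simp only [Pi.smul_apply, h1, smul_eq_mul]; ring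

theorem Ex_le_Coc (S : Set Z) : Ex S ≤ Coc S := by
  rintro φ ⟨h, hφ⟩ x hx
  have := hφ x hx
  filter_upwards [eventually_eventually_nhdsWithin.2 this, this, self_mem_nhdsWithin]
    with y h1 h2 hy
  filter_upwards [h1, hφ y hy] with z h3 h4
  rw [h3, h2, h4]; ring

theorem Coc.self_eq_zero {S : Set Z} {φ : Z → Z → ℝ} (hφ : φ ∈ Coc S) {x : Z} (hx : x ∈ S) :
    φ x x = 0 := by
  have h1 := (hφ x hx).self_of_nhdsWithin hx
  have h2 := h1.self_of_nhdsWithin hx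
  linarith

theorem Coc_mono {S T : Set Z} (h : S ⊆ T) : Coc T ≤ Coc S := by
  intro φ hφ x hx
  refine (Filter.Eventually.filter_mono (nhdsWithin_mono x h) (hφ x (h hx))).mono fun y hy => ?_
  exact hy.filter_mono (nhdsWithin_mono y h)

theorem IsPrim.mono {S T : Set Z} (h : S ⊆ T) {φ : Z → Z → ℝ} {u : Z → ℝ} (hu : IsPrim T φ u) :
    IsPrim S φ u :=
  fun x hx => (hu x (h hx)).filter_mono (nhdsWithin_mono x h)

theorem Ex_mono {S T : Set Z} (h : S ⊆ T) : Ex T ≤ Ex S := fun _ ⟨u, hu⟩ => ⟨u, hu.mono h⟩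

theorem IsPrim.congr {S : Set Z} {φ : Z → Z → ℝ} {u v : Z → ℝ} (hu : IsPrim S φ u)
    (h : ∀ x ∈ S, u x = v x) : IsPrim S φ v := by
  intro x hx
  filter_upwards [hu x hx, self_mem_nhdsWithin] with y h1 h2
  rw [h1, h x hx, h y h2]

theorem IsPrim.add_const {S : Set Z} {φ : Z → Z → ℝ} {u : Z → ℝ} (hu : IsPrim S φ u) (c : ℝ) :
    IsPrim S φ (fun x => u x + c) := by
  intro x hx
  filter_upwards [hu x hx] with y h1
  rw [h1]; ring

/-- A cocycle is exact near each point. -/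
theorem Coc.exists_local_prim {S : Set Z} {φ : Z → Z → ℝ} (hφ : φ ∈ Coc S) {x : Z} (hx : x ∈ S) :
    ∃ U, IsOpen U ∧ x ∈ U ∧ IsPrim (U ∩ S) φ (φ x) := by
  obtain ⟨U, h, hU, hxU⟩ := eventually_nhds_iff.1 (eventually_nhdsWithin_iff.1 (hφ x hx))
  refine ⟨U, hU, hxU, fun y hy => ?_⟩
  refine (Filter.Eventually.filter_mono (nhdsWithin_mono y inter_subset_right)
    (h y hy.1 hy.2)).mono fun z hz => by linarith

theorem Coc.pullback {S : Set Z} {S' : Set Z'} {φ : Z → Z → ℝ} (hφ : φ ∈ Coc S) {g : Z' → Z}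
    (hg : ContinuousOn g S') (hm : MapsTo g S' S) : (fun a b => φ (g a) (g b)) ∈ Coc S' := by
  intro x hx
  have ht : ∀ x ∈ S', Filter.Tendsto g (𝓝[S'] x) (𝓝[S] (g x)) := fun x hx =>
    (hg x hx).tendsto_nhdsWithin hm
  filter_upwards [(ht x hx).eventually (hφ _ (hm hx)), self_mem_nhdsWithin] with y h1 hy
  exact (ht y hy).eventually h1

theorem IsPrim.pullback {S : Set Z} {S' : Set Z'} {φ : Z → Z → ℝ} {h : Z → ℝ} (hφ : IsPrim S φ h)
    {g : Z' → Z} (hg : ContinuousOn g S') (hm : MapsTo g S' S) :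
    IsPrim S' (fun a b => φ (g a) (g b)) (h ∘ g) := by
  intro x hx
  exact ((hg x hx).tendsto_nhdsWithin hm).eventually (hφ _ (hm hx))

/-- With the discrete topology on the target, locally constant means continuous. No structure on `α`
is needed, so this also serves for families of propositions and of cardinals. -/
theorem eq_of_locally_const {α : Type*} {S : Set Z} (hS : IsPreconnected S) {u : Z → α}
    (hu : ∀ x ∈ S, ∀ᶠ y in 𝓝[S] x, u y = u x) {x y : Z} (hx : x ∈ S) (hy : y ∈ S) :
    u x = u y := by
  let _ : TopologicalSpace α := ⊥
  have : DiscreteTopology α := ⟨rfl⟩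
  have hc : ContinuousOn u S := fun z hz => by
    rw [ContinuousWithinAt, nhds_discrete, Filter.tendsto_pure]
    exact hu z hz
  exact hS.constant hc hx hy

theorem IsPrim.sub_locally_const {S : Set Z} {φ : Z → Z → ℝ} {u v : Z → ℝ} (hu : IsPrim S φ u)
    (hv : IsPrim S φ v) : ∀ x ∈ S, ∀ᶠ y in 𝓝[S] x, u y - v y = u x - v x := by
  intro x hx
  filter_upwards [hu x hx, hv x hx] with y h1 h2
  linarith

theorem IsPrim.sub_const {S : Set Z} (hS : IsPreconnected S) {φ : Z → Z → ℝ} {u v : Z → ℝ}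
    (hu : IsPrim S φ u) (hv : IsPrim S φ v) {x y : Z} (hx : x ∈ S) (hy : y ∈ S) :
    u x - v x = u y - v y :=
  eq_of_locally_const hS (u := fun z => u z - v z) (hu.sub_locally_const hv) hx hy

/-- Being a primitive is a local property. -/
theorem IsPrim.of_local {S : Set Z} {φ : Z → Z → ℝ} {h : Z → ℝ}
    (H : ∀ x ∈ S, ∃ U ∈ 𝓝[S] x, ∃ k, IsPrim U φ k ∧ x ∈ U ∧ ∃ c, ∀ y ∈ U, h y = k y + c) :
    IsPrim S φ h := by
  intro x hx
  obtain ⟨U, hU, k, hk, hxU, c, hc⟩ := H x hx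
  have hle : 𝓝[S] x ≤ 𝓝[U] x := le_inf nhdsWithin_le_nhds (Filter.le_principal_iff.2 hU)
  filter_upwards [hle (hk x hxU), hU] with y h1 h2
  rw [h1, hc y h2, hc x hxU]; ring

/-- The degree-one case of Mayer–Vietoris: on the connected overlap two primitives differ by a
constant, and shifting one of them by it makes them agree. -/
theorem Ex_union {S O O' : Set Z} (hO : IsOpen O) (hO' : IsOpen O')
    (hc : IsPreconnected (S ∩ O ∩ O')) {φ : Z → Z → ℝ} (h1 : φ ∈ Ex (S ∩ O))
    (h2 : φ ∈ Ex (S ∩ O')) : φ ∈ Ex (S ∩ (O ∪ O')) := by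
  classical
  obtain ⟨u, hu⟩ := h1
  obtain ⟨v, hv⟩ := h2
  have key : ∃ c, ∀ x ∈ S ∩ O ∩ O', u x = v x + c := by
    rcases (S ∩ O ∩ O').eq_empty_or_nonempty with h | ⟨x, hx⟩
    · exact ⟨0, by simp [h]⟩
    · refine ⟨u x - v x, fun y hy => ?_⟩
      have h1 : S ∩ O ∩ O' ⊆ S ∩ O' := fun a h => ⟨h.1.1, h.2⟩
      have := (hu.mono inter_subset_left).sub_const hc (hv.mono h1) hx hy
      linarith
  obtain ⟨c, hc⟩ := key
  refine ⟨fun x => if x ∈ O then u x else v x + c, ?_⟩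
  refine IsPrim.of_local ?_
  rintro x ⟨hxS, hx | hx⟩
  · refine ⟨S ∩ O, ?_, u, hu, ⟨hxS, hx⟩, 0, fun y hy => by simp [hy.2]⟩
    exact mem_nhdsWithin.2 ⟨O, hO, hx, fun y hy => ⟨hy.2.1, hy.1⟩⟩
  · refine ⟨S ∩ O', ?_, v, hv, ⟨hxS, hx⟩, c, fun y hy => ?_⟩
    · exact mem_nhdsWithin.2 ⟨O', hO', hx, fun y hy => ⟨hy.2.1, hy.1⟩⟩
    · by_cases hyO : y ∈ O
      · simp [hyO, hc y ⟨⟨hy.1, hyO⟩, hy.2⟩]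
      · simp [hyO]

/-- Along `S × [0, 1]`, a cocycle is exact on the tube over a small neighbourhood of a point. -/
theorem exists_tube_prim {S : Set Z} {Φ : Z × ℝ → Z × ℝ → ℝ} (hΦ : Φ ∈ Coc (S ×ˢ Icc (0 : ℝ) 1))
    {z : Z} (hz : z ∈ S) :
    ∃ V, IsOpen V ∧ z ∈ V ∧ Φ ∈ Ex ((V ∩ S) ×ˢ Icc (0 : ℝ) 1) := by
  classical
  -- Continuity argument in the height: `step` and monotonicity make the truth value of `P` locally
  -- constant on `[0, 1]`, so it passes from `P 0` to `P 1`. The neighbourhood `V` may shrink each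
  -- time the height is raised.
  let P : ℝ → Prop := fun s => ∃ V, IsOpen V ∧ z ∈ V ∧ Φ ∈ Ex ((V ∩ S) ×ˢ Icc (0 : ℝ) s)
  have step : ∀ s ∈ Icc (0 : ℝ) 1, ∃ δ > 0, ∀ s' ∈ Icc (0 : ℝ) 1, ∀ s'' ∈ Icc (0 : ℝ) 1,
      |s' - s| < δ → |s'' - s| < δ → s' ≤ s'' → P s' → P s'' := by
    intro s hs
    obtain ⟨U, hU, hmem, hprim⟩ := Coc.exists_local_prim hΦ (x := (z, s)) ⟨hz, hs⟩
    obtain ⟨V₁, I₁, hV₁, hI₁, hzV₁, hsI₁, hsub⟩ := isOpen_prod_iff.1 hU z s hmem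
    obtain ⟨δ, hδ, hball⟩ := Metric.isOpen_iff.1 hI₁ s hsI₁
    refine ⟨δ, hδ, ?_⟩
    rintro s' hs' s'' hs'' h1 h2 h12 ⟨V, hV, hzV, κ, hκ⟩
    set κ' := Φ (z, s)
    have hI : ∀ u ∈ Icc s' s'', u ∈ I₁ := by
      intro u hu
      refine hball ?_
      rw [Metric.mem_ball, Real.dist_eq]
      rw [abs_lt] at *
      constructor <;> linarith [hu.1, hu.2, h1.1, h2.2]
    have hκ' : IsPrim ((V₁ ∩ S) ×ˢ Icc s' s'') Φ κ' := hprim.mono (by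
      rintro ⟨a, u⟩ ⟨⟨ha, haS⟩, hu⟩
      exact ⟨hsub ⟨ha, hI u hu⟩, haS, hs'.1.trans hu.1, hu.2.trans hs''.2⟩)
    -- on the slice at height `s'` the two primitives differ by a constant near `z`
    have hloc : ∀ᶠ y in 𝓝[S] z, κ (y, s') - κ' (y, s') = κ (z, s') - κ' (z, s') := by
      have hsl : IsPrim ((V ∩ V₁ ∩ S) ×ˢ ({s'} : Set ℝ)) Φ κ := hκ.mono (by
        rintro ⟨a, u⟩ ⟨⟨⟨ha, _⟩, haS⟩, rfl⟩
        exact ⟨⟨ha, haS⟩, hs'.1, le_rfl⟩)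
      have hsl' : IsPrim ((V ∩ V₁ ∩ S) ×ˢ ({s'} : Set ℝ)) Φ κ' := hκ'.mono (by
        rintro ⟨a, u⟩ ⟨⟨⟨_, ha⟩, haS⟩, rfl⟩
        exact ⟨⟨ha, haS⟩, le_rfl, h12⟩)
      have hev := hsl.sub_locally_const hsl' (z, s') ⟨⟨⟨hzV, hzV₁⟩, hz⟩, rfl⟩
      have ht : Filter.Tendsto (fun y : Z => (y, s')) (𝓝[S] z)
          (𝓝[(V ∩ V₁ ∩ S) ×ˢ ({s'} : Set ℝ)] (z, s')) := by
        refine tendsto_nhdsWithin_iff.2 ⟨?_, ?_⟩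
        · exact (Continuous.tendsto (by fun_prop) z).mono_left nhdsWithin_le_nhds
        · filter_upwards [self_mem_nhdsWithin, mem_nhdsWithin_of_mem_nhds (hV.mem_nhds hzV),
            mem_nhdsWithin_of_mem_nhds (hV₁.mem_nhds hzV₁)] with y a b c
          exact ⟨⟨⟨b, c⟩, a⟩, rfl⟩
      exact ht.eventually hev
    obtain ⟨V₂, hV₂, hzV₂, hcst⟩ := mem_nhdsWithin.1 hloc
    set c := κ (z, s') - κ' (z, s')
    have hcst' : ∀ y ∈ V₂ ∩ S, κ (y, s') = κ' (y, s') + c := fun y hy => by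
      have : κ (y, s') - κ' (y, s') = c := hcst hy
      linarith
    refine ⟨V ∩ V₁ ∩ V₂, (hV.inter hV₁).inter hV₂, ⟨⟨hzV, hzV₁⟩, hzV₂⟩,
      fun p => if p.2 ≤ s' then κ p else κ' p + c, ?_⟩
    rintro ⟨y, u⟩ ⟨⟨⟨⟨hyV, hyV₁⟩, hyV₂⟩, hyS⟩, hu⟩
    set W := (V ∩ V₁ ∩ V₂ ∩ S) ×ˢ Icc (0 : ℝ) s''
    have hA : IsPrim (W ∩ {p | p.2 ≤ s'}) Φ (fun p => if p.2 ≤ s' then κ p else κ' p + c) :=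
      (hκ.mono (by
        rintro ⟨a, v⟩ ⟨⟨⟨⟨⟨h1, h2⟩, h3⟩, h4⟩, h5⟩, h6⟩
        exact ⟨⟨h1, h4⟩, h5.1, h6⟩)).congr (by rintro ⟨a, v⟩ ⟨_, h⟩; exact (if_pos h).symm)
    have hB : IsPrim (W ∩ {p | s' ≤ p.2}) Φ (fun p => if p.2 ≤ s' then κ p else κ' p + c) :=
      ((hκ'.add_const c).mono (by
        rintro ⟨a, v⟩ ⟨⟨⟨⟨⟨h1, h2⟩, h3⟩, h4⟩, h5⟩, h6⟩
        exact ⟨⟨h2, h4⟩, h6, h5.2⟩)).congr (by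
        rintro ⟨a, v⟩ ⟨⟨⟨⟨⟨h1, h2⟩, h3⟩, h4⟩, h5⟩, h6⟩
        rcases eq_or_lt_of_le (show s' ≤ v from h6) with h | h
        · subst h; simp [hcst' a ⟨h3, h4⟩]
        · simp [not_le.2 h])
    have hW : (y, u) ∈ W := ⟨⟨⟨⟨hyV, hyV₁⟩, hyV₂⟩, hyS⟩, hu⟩
    rcases lt_trichotomy u s' with h | h | h
    · have hle : 𝓝[W] (y, u) ≤ 𝓝[W ∩ {p | p.2 ≤ s'}] (y, u) := by
        rw [nhdsWithin_inter']
        refine le_inf le_rfl (Filter.le_principal_iff.2 (mem_nhdsWithin_of_mem_nhds ?_))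
        exact (continuous_snd.continuousAt.eventually (gt_mem_nhds h)).mono fun p hp =>
          le_of_lt hp
      exact hle (hA _ ⟨hW, h.le⟩)
    -- At the height of the seam a neighbourhood meets both the old and the new part of the tube;
    -- the filter of a union is the supremum, so the two parts are checked separately.
    · have hun : W = (W ∩ {p | p.2 ≤ s'}) ∪ (W ∩ {p | s' ≤ p.2}) := by
        rw [← inter_union_distrib_left]
        refine (inter_eq_left.2 fun p _ => ?_).symm
        exact le_total p.2 s'
      rw [hun, nhdsWithin_union, Filter.eventually_sup]
      exact ⟨hA _ ⟨hW, h.le⟩, hB _ ⟨hW, h.ge⟩⟩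
    · have hle : 𝓝[W] (y, u) ≤ 𝓝[W ∩ {p | s' ≤ p.2}] (y, u) := by
        rw [nhdsWithin_inter']
        refine le_inf le_rfl (Filter.le_principal_iff.2 (mem_nhdsWithin_of_mem_nhds ?_))
        exact (continuous_snd.continuousAt.eventually (lt_mem_nhds h)).mono fun p hp =>
          le_of_lt hp
      exact hle (hB _ ⟨hW, h.le⟩)
  have h0 : P 0 := by
    obtain ⟨U, hU, hmem, hprim⟩ := Coc.exists_local_prim hΦ (x := (z, 0)) ⟨hz, by simp⟩
    obtain ⟨V₁, I₁, hV₁, hI₁, hzV₁, hsI₁, hsub⟩ := isOpen_prod_iff.1 hU z 0 hmem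
    refine ⟨V₁, hV₁, hzV₁, _, hprim.mono ?_⟩
    rintro ⟨a, u⟩ ⟨⟨ha, haS⟩, hu⟩
    have : u = 0 := le_antisymm hu.2 hu.1
    subst this
    exact ⟨hsub ⟨ha, hsI₁⟩, haS, by simp⟩
  have mono : ∀ s s', s ≤ s' → P s' → P s := fun s s' h ⟨V, hV, hz, hE⟩ =>
    ⟨V, hV, hz, Ex_mono (prod_mono le_rfl (Icc_subset_Icc_right h)) hE⟩
  have hloc : ∀ s ∈ Icc (0 : ℝ) 1, ∀ᶠ s' in 𝓝[Icc (0 : ℝ) 1] s, P s' = P s := by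
    intro s hs
    obtain ⟨δ, hδ, hst⟩ := step s hs
    filter_upwards [self_mem_nhdsWithin, mem_nhdsWithin_of_mem_nhds (Metric.ball_mem_nhds s hδ)]
      with s' hs' hb
    rw [Metric.mem_ball, Real.dist_eq] at hb
    have h0 : |s - s| < δ := by simpa using hδ
    rcases le_total s s' with h | h
    · exact propext ⟨mono _ _ h, hst s hs s' hs' h0 hb h⟩
    · exact propext ⟨hst s' hs' s hs hb h0 h, mono _ _ h⟩
  have h01 : P 0 = P 1 :=
    eq_of_locally_const isPreconnected_Icc hloc (x := 0) (y := 1) (by simp) (by simp)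
  exact h01.mp h0

/-- A set contracting to a point carries only exact cocycles. -/
theorem Coc_le_Ex_of_contraction {S : Set Z} {H : Z × ℝ → Z}
    (hH : ContinuousOn H (S ×ˢ Icc (0 : ℝ) 1)) (hm : MapsTo H (S ×ˢ Icc (0 : ℝ) 1) S)
    (h1 : ∀ x ∈ S, H (x, 1) = x) {o : Z} (h0 : ∀ x ∈ S, H (x, 0) = o) : Coc S ≤ Ex S := by
  intro φ hφ
  -- The value of the primitive at `z` is the increment of a primitive of `Φ` along the track `t ↦
  -- (z, t)`. At height `1` the form `Φ` is `φ`; at height `0` it is pulled back from the point `o`,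
  -- where `φ o o = 0`, and contributes nothing.
  set Φ : Z × ℝ → Z × ℝ → ℝ := fun a b => φ (H a) (H b)
  have hΦ : Φ ∈ Coc (S ×ˢ Icc (0 : ℝ) 1) := Coc.pullback hφ hH hm
  have hex : ∀ z : Z, ∃ u : ℝ → ℝ, z ∈ S → IsPrim (Icc 0 1) (fun a b => Φ (z, a) (z, b)) u := by
    intro z
    by_cases hz : z ∈ S
    · obtain ⟨V, _, hzV, k, hk⟩ := exists_tube_prim hΦ hz
      refine ⟨fun t => k (z, t), fun _ => ?_⟩
      exact hk.pullback (g := fun t : ℝ => (z, t)) (by fun_prop) fun t ht => ⟨⟨hzV, hz⟩, ht⟩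
    · exact ⟨0, fun h => absurd h hz⟩
  choose u hu using hex
  refine ⟨fun z => u z 1 - u z 0, IsPrim.of_local fun z hz => ?_⟩
  obtain ⟨V, hV, hzV, k, hk⟩ := exists_tube_prim hΦ hz
  have hval : ∀ y ∈ V ∩ S, u y 1 - u y 0 = k (y, 1) - k (y, 0) := by
    rintro y ⟨hyV, hyS⟩
    have := (hu y hyS).sub_const isPreconnected_Icc
      (hk.pullback (g := fun t : ℝ => (y, t)) (S' := Icc 0 1) (by fun_prop)
        fun t ht => ⟨⟨hyV, hyS⟩, ht⟩) (x := 0) (y := 1) (by simp) (by simp)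
    simp only [Function.comp] at this
    linarith
  have hk1 : IsPrim (V ∩ S) φ (fun y => k (y, 1)) := by
    intro y hy
    have := (hk.pullback (g := fun y : Z => (y, (1 : ℝ))) (S' := V ∩ S) (by fun_prop)
      fun t ht => ⟨ht, by simp⟩) y hy
    filter_upwards [this, self_mem_nhdsWithin] with w hw hw'
    simpa [Φ, h1 y hy.2, h1 w hw'.2] using hw
  have hk0 : ∀ y ∈ V ∩ S, ∀ᶠ w in 𝓝[V ∩ S] y, k (w, 0) = k (y, 0) := by
    intro y hy
    have := (hk.pullback (g := fun y : Z => (y, (0 : ℝ))) (S' := V ∩ S) (by fun_prop)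
      fun t ht => ⟨ht, by simp⟩) y hy
    have ho : o ∈ S := h0 y hy.2 ▸ hm (x := (y, 0)) ⟨hy.2, by simp⟩
    filter_upwards [this, self_mem_nhdsWithin] with w hw hw'
    have hw2 : φ o o = k (w, 0) - k (y, 0) := by
      simpa [Φ, h0 y hy.2, h0 w hw'.2] using hw
    rw [Coc.self_eq_zero hφ ho] at hw2
    linarith
  have hd : IsPrim (V ∩ S) φ (fun y => k (y, 1) - k (y, 0)) := by
    intro y hy
    filter_upwards [hk1 y hy, hk0 y hy] with w h2 h3
    rw [h2, h3]; ring
  exact ⟨V ∩ S, mem_nhdsWithin.2 ⟨V, hV, hzV, subset_rfl⟩, _, hd, ⟨hzV, hz⟩, 0,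
    fun y hy => by simpa using hval y hy⟩

theorem StarConvex.Coc_le_Ex {E : Type*} [AddCommGroup E] [Module ℝ E] [TopologicalSpace E]
    [IsTopologicalAddGroup E] [ContinuousSMul ℝ E] {S : Set E} {o : E} (hS : StarConvex ℝ o S) :
    Coc S ≤ Ex S := by
  refine Coc_le_Ex_of_contraction (H := fun p : E × ℝ => (1 - p.2) • o + p.2 • p.1) (o := o)
    (by fun_prop) ?_ (by simp) (by simp)
  rintro ⟨x, t⟩ ⟨hx, ht⟩
  exact hS hx (by linarith [ht.2]) ht.1 (by ring)

/-- Only one of the two composites has to be the identity, so exactness passes to retracts. -/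
theorem Coc_le_Ex_of_homeo {S : Set Z} {S' : Set Z'} {g : Z → Z'} {g' : Z' → Z}
    (hg : ContinuousOn g S) (hg' : ContinuousOn g' S') (hm : MapsTo g S S') (hm' : MapsTo g' S' S)
    (hl : ∀ x ∈ S, g' (g x) = x) (h : Coc S' ≤ Ex S') : Coc S ≤ Ex S := by
  intro φ hφ
  obtain ⟨u, hu⟩ := h (Coc.pullback hφ hg' hm')
  refine ⟨u ∘ g, fun x hx => ?_⟩
  filter_upwards [(hu.pullback hg hm) x hx, self_mem_nhdsWithin] with y hy hyS
  simpa [hl x hx, hl y hyS] using hy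

/-- Homeomorphic subsets have isomorphic first cohomology. -/
theorem nonempty_H1_equiv {S : Set Z} {S' : Set Z'} {g : Z → Z'} {g' : Z' → Z}
    (hg : ContinuousOn g S) (hg' : ContinuousOn g' S') (hm : MapsTo g S S') (hm' : MapsTo g' S' S)
    (hl : ∀ x ∈ S, g' (g x) = x) (hr : ∀ x ∈ S', g (g' x) = x) : Nonempty (H1 S ≃ₗ[ℝ] H1 S') := by
  let P : Coc S →ₗ[ℝ] Coc S' :=
    { toFun := fun φ => ⟨fun a b => φ.1 (g' a) (g' b), Coc.pullback φ.2 hg' hm'⟩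
      map_add' := fun _ _ => rfl
      map_smul' := fun _ _ => rfl }
  let L : Coc S →ₗ[ℝ] H1 S' := (Submodule.mkQ _).comp P
  have hsurj : Function.Surjective L := by
    intro q
    obtain ⟨ψ, rfl⟩ := Submodule.mkQ_surjective _ q
    refine ⟨⟨fun a b => ψ.1 (g a) (g b), Coc.pullback ψ.2 hg hm⟩, ?_⟩
    refine (Submodule.Quotient.eq _).2 ?_
    refine ⟨0, fun x hx => ?_⟩
    filter_upwards [self_mem_nhdsWithin] with y hy
    simp [P, hr x hx, hr y hy]
  have hker : LinearMap.ker L = (Ex S).submoduleOf (Coc S) := by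
    ext φ
    simp only [LinearMap.mem_ker, L, LinearMap.comp_apply, Submodule.mkQ_apply,
      Submodule.Quotient.mk_eq_zero]
    constructor
    · rintro ⟨u, hu⟩
      refine ⟨u ∘ g, fun x hx => ?_⟩
      filter_upwards [(hu.pullback hg hm) x hx, self_mem_nhdsWithin] with y hy hyS
      simpa [P, hl x hx, hl y hyS] using hy
    · rintro ⟨u, hu⟩
      exact ⟨u ∘ g', hu.pullback hg' hm'⟩
  exact ⟨(Submodule.quotEquivOfEq _ _ hker.symm).trans (L.quotKerEquivOfSurjective hsurj)⟩

/-- Computing `H1 S` through a surjective linear map with kernel the coboundaries. -/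
theorem nonempty_H1_equiv_of_surjective {S : Set Z} {M : Type*} [AddCommMonoid M] [Module ℝ M]
    (L : Coc S →ₗ[ℝ] M) (hs : Function.Surjective L)
    (hk : ∀ φ : Coc S, L φ = 0 ↔ (φ : Z → Z → ℝ) ∈ Ex S) : Nonempty (H1 S ≃ₗ[ℝ] M) := by
  let _ : AddCommGroup M := Module.addCommMonoidToAddCommGroup ℝ
  have hker : LinearMap.ker L = (Ex S).submoduleOf (Coc S) := by
    ext φ
    exact hk φ
  exact ⟨(Submodule.quotEquivOfEq _ _ hker.symm).trans (L.quotKerEquivOfSurjective hs)⟩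

end Cocycles


/-! ### Comparison of first cohomology through the combinatorics of covers -/

section Comparison

variable {Z : Type*} [TopologicalSpace Z]

open Classical in
/-- The primitive of `φ` along `S` which vanishes at `b` (zero if `φ` is not exact). -/
noncomputable def prim (S : Set Z) (b : Z) (φ : Z → Z → ℝ) : Z → ℝ :=
  if h : ∃ u, IsPrim S φ u then fun x => h.choose x - h.choose b else 0

theorem isPrim_prim {S : Set Z} (b : Z) {φ : Z → Z → ℝ} (h : φ ∈ Ex S) :
    IsPrim S φ (prim S b φ) := by
  have h' : ∃ u, IsPrim S φ u := h
  simpa [prim, h', sub_eq_add_neg] using h'.choose_spec.add_const (-h'.choose b)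

theorem prim_eq {S : Set Z} (hS : IsPreconnected S) {b x : Z} (hb : b ∈ S) (hx : x ∈ S)
    {φ : Z → Z → ℝ} {u : Z → ℝ} (hu : IsPrim S φ u) : prim S b φ x = u x - u b := by
  have h' : ∃ u, IsPrim S φ u := ⟨u, hu⟩
  have := h'.choose_spec.sub_const hS hu hx hb
  simp only [prim, h', dif_pos]
  linarith

theorem prim_add {S : Set Z} (hS : IsPreconnected S) {b x : Z} (hb : b ∈ S) (hx : x ∈ S)
    {φ ψ : Z → Z → ℝ} (hφ : φ ∈ Ex S) (hψ : ψ ∈ Ex S) :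
    prim S b (φ + ψ) x = prim S b φ x + prim S b ψ x := by
  obtain ⟨u, hu⟩ := hφ
  obtain ⟨v, hv⟩ := hψ
  rw [prim_eq hS hb hx hu, prim_eq hS hb hx hv, prim_eq hS hb hx (hu.add hv)]
  simp only [Pi.add_apply]; ring

theorem prim_smul {S : Set Z} (hS : IsPreconnected S) {b x : Z} (hb : b ∈ S) (hx : x ∈ S)
    {φ : Z → Z → ℝ} (hφ : φ ∈ Ex S) (a : ℝ) : prim S b (a • φ) x = a * prim S b φ x := by
  obtain ⟨u, hu⟩ := hφ
  rw [prim_eq hS hb hx hu, prim_eq hS hb hx (hu.smul a)]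
  simp only [Pi.smul_apply, smul_eq_mul]; ring

/-- Comparison of the first cohomology of two sets with combinatorially related good covers. -/
theorem rank_H1_le {A B : Set Z} {M : Type*} {V' V U : M → Set Z}
    (hV' : ∀ m, IsOpen (V' m)) (hU : ∀ m, IsOpen (U m))
    (hVV : ∀ m, V' m ⊆ V m) (hcA : A ⊆ ⋃ m, V' m) (hcB : B ⊆ ⋃ m, U m)
    (hpA : ∀ m, IsPreconnected (A ∩ V m)) (hpB : ∀ m, IsPreconnected (B ∩ U m))
    (hex : ∀ m n, (A ∩ V m ∩ V n).Nonempty → Coc A ≤ Ex (A ∩ (V m ∪ V n)))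
    (h2 : ∀ m n, (A ∩ V' m ∩ V' n).Nonempty → (B ∩ U m ∩ U n).Nonempty)
    (h3 : ∀ m n p, (B ∩ U m ∩ U n ∩ U p).Nonempty → (A ∩ V m ∩ V n ∩ V p).Nonempty) :
    Module.rank ℝ (H1 A) ≤ Module.rank ℝ (H1 B) := by
  classical
  rcases A.eq_empty_or_nonempty with rfl | ⟨z₀, hz₀⟩
  · have : Subsingleton (H1 (∅ : Set Z)) := by
      refine Submodule.Quotient.subsingleton_iff.2 (eq_top_iff.2 fun φ _ => ?_)
      exact ⟨0, fun x hx => hx.elim⟩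
    rw [rank_subsingleton']
    exact zero_le
  have : Nonempty M := (mem_iUnion.1 (hcA hz₀)).nonempty
  -- The point `z₀` is a default value for members of the cover that do not meet `A`.
  have hbase : ∀ m, ∃ a, (A ∩ V m).Nonempty → a ∈ A ∩ V m := fun m =>
    if h : (A ∩ V m).Nonempty then ⟨h.some, fun _ => h.some_mem⟩ else ⟨z₀, fun h' => absurd h' h⟩
  choose a ha using hbase
  choose! μ hμ using fun b (hb : b ∈ B) => mem_iUnion.1 (hcB hb)
  -- exactness on the members of the cover
  have hex1 : ∀ m, (A ∩ V m).Nonempty → Coc A ≤ Ex (A ∩ V m) := fun m hm => by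
    simpa using hex m m (by simpa [inter_assoc] using hm)
  -- the transition constants
  let c : M → M → (Z → Z → ℝ) → ℝ := fun m n φ =>
    if h : (A ∩ V m ∩ V n).Nonempty then
      prim (A ∩ V m) (a m) φ h.some - prim (A ∩ V n) (a n) φ h.some else 0
  have hc : ∀ m n, ∀ φ ∈ Coc A, ∀ z ∈ A ∩ V m ∩ V n,
      c m n φ = prim (A ∩ V m) (a m) φ z - prim (A ∩ V n) (a n) φ z := by
    intro m n φ hφ z hz
    have h : (A ∩ V m ∩ V n).Nonempty := ⟨z, hz⟩
    obtain ⟨u, hu⟩ := hex m n h hφ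
    have hm : IsPrim (A ∩ V m) φ u := hu.mono (inter_subset_inter_right _ subset_union_left)
    have hn : IsPrim (A ∩ V n) φ u := hu.mono (inter_subset_inter_right _ subset_union_right)
    have key : ∀ w ∈ A ∩ V m ∩ V n, prim (A ∩ V m) (a m) φ w - prim (A ∩ V n) (a n) φ w =
        u (a n) - u (a m) := by
      intro w hw
      have hwm : w ∈ A ∩ V m := hw.1
      have hwn : w ∈ A ∩ V n := ⟨hw.1.1, hw.2⟩
      rw [prim_eq (hpA m) (ha m ⟨w, hwm⟩) hwm hm, prim_eq (hpA n) (ha n ⟨w, hwn⟩) hwn hn]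
      ring
    simp only [c, h, dif_pos, key _ h.some_mem, key z hz]
  have hcadd : ∀ m n, ∀ φ ∈ Coc A, ∀ ψ ∈ Coc A, c m n (φ + ψ) = c m n φ + c m n ψ := by
    intro m n φ hφ ψ hψ
    by_cases h : (A ∩ V m ∩ V n).Nonempty
    · obtain ⟨w, hw⟩ := h
      have hwm : w ∈ A ∩ V m := hw.1
      have hwn : w ∈ A ∩ V n := ⟨hw.1.1, hw.2⟩
      rw [hc m n _ hφ w hw, hc m n _ hψ w hw, hc m n _ (add_mem hφ hψ) w hw,
        prim_add (hpA m) (ha m ⟨w, hwm⟩) hwm (hex1 m ⟨w, hwm⟩ hφ) (hex1 m ⟨w, hwm⟩ hψ),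
        prim_add (hpA n) (ha n ⟨w, hwn⟩) hwn (hex1 n ⟨w, hwn⟩ hφ) (hex1 n ⟨w, hwn⟩ hψ)]
      ring
    · simp [c, h]
  have hcsmul : ∀ m n, ∀ φ ∈ Coc A, ∀ r : ℝ, c m n (r • φ) = r * c m n φ := by
    intro m n φ hφ r
    by_cases h : (A ∩ V m ∩ V n).Nonempty
    · obtain ⟨w, hw⟩ := h
      have hwm : w ∈ A ∩ V m := hw.1
      have hwn : w ∈ A ∩ V n := ⟨hw.1.1, hw.2⟩
      rw [hc m n _ hφ w hw, hc m n _ (Submodule.smul_mem _ r hφ) w hw,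
        prim_smul (hpA m) (ha m ⟨w, hwm⟩) hwm (hex1 m ⟨w, hwm⟩ hφ),
        prim_smul (hpA n) (ha n ⟨w, hwn⟩) hwn (hex1 n ⟨w, hwn⟩ hφ)]
      ring
    · simp [c, h]
  have hccoc : ∀ φ ∈ Coc A, ∀ b ∈ B, ∀ m n p, b ∈ U m → b ∈ U n → b ∈ U p →
      c m p φ = c m n φ + c n p φ := by
    intro φ hφ b hb m n p hm hn hp
    obtain ⟨w, ⟨⟨hwA, hwm⟩, hwn⟩, hwp⟩ := h3 m n p ⟨b, ⟨⟨hb, hm⟩, hn⟩, hp⟩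
    rw [hc m p φ hφ w ⟨⟨hwA, hwm⟩, hwp⟩, hc m n φ hφ w ⟨⟨hwA, hwm⟩, hwn⟩,
      hc n p φ hφ w ⟨⟨hwA, hwn⟩, hwp⟩]
    ring
  have hUB : ∀ m, ∀ b ∈ B, b ∈ U m → ∀ᶠ b' in 𝓝[B] b, b' ∈ U m := fun m b _ hb =>
    mem_nhdsWithin_of_mem_nhds ((hU m).mem_nhds hb)
  -- The transition constants form a Čech 1-cocycle. It becomes an Alexander–Spanier cocycle on `B`
  -- through the choice `μ` of a member of the cover containing each point.
  let Ψ : Coc A →ₗ[ℝ] Coc B :=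
    { toFun := fun φ => ⟨fun b b' => c (μ b) (μ b') φ.1, by
        intro b hb
        filter_upwards [hUB _ b hb (hμ b hb), self_mem_nhdsWithin] with b' hb' hB'
        filter_upwards [hUB _ b' hB' hb', hUB _ b' hB' (hμ b' hB'), self_mem_nhdsWithin]
          with b'' h1 h2 h3
        exact hccoc φ.1 φ.2 b'' h3 _ _ _ h1 h2 (hμ b'' h3)⟩
      map_add' := fun φ ψ => by
        ext b b'
        exact hcadd _ _ _ φ.2 _ ψ.2
      map_smul' := fun r φ => by
        ext b b'
        exact hcsmul _ _ _ φ.2 r }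
  -- Both directions are needed: one makes the map on `H1` well defined, the other makes it
  -- injective.
  have hΨ : ∀ φ : Coc A, (φ : Z → Z → ℝ) ∈ Ex A ↔ (Ψ φ : Z → Z → ℝ) ∈ Ex B := by
    intro φ
    constructor
    · rintro ⟨h, hh⟩
      refine ⟨fun b => h (a (μ b)), fun b hb => ?_⟩
      filter_upwards [hUB _ b hb (hμ b hb), self_mem_nhdsWithin] with b' hb' hB'
      obtain ⟨w, ⟨⟨hwA, hwm⟩, hwn⟩, -⟩ := h3 _ _ _ ⟨b', ⟨⟨hB', hb'⟩, hμ b' hB'⟩, hb'⟩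
      change c (μ b) (μ b') φ.1 = _
      rw [hc _ _ φ.1 φ.2 w ⟨⟨hwA, hwm⟩, hwn⟩,
        prim_eq (hpA _) (ha _ ⟨w, hwA, hwm⟩) ⟨hwA, hwm⟩ (hh.mono inter_subset_left),
        prim_eq (hpA _) (ha _ ⟨w, hwA, hwn⟩) ⟨hwA, hwn⟩ (hh.mono inter_subset_left)]
      ring
    · rintro ⟨k, hk⟩
      have hk' : ∀ b ∈ B, ∀ᶠ b' in 𝓝[B] b, c (μ b) (μ b') φ.1 = k b' - k b := hk
      -- On the connected set `B ∩ U m` the function `k b - c m (μ b)` is locally constant. Its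
      -- values `κ` exhibit the Čech cocycle as a coboundary, and the local primitives on `A`,
      -- shifted by `κ`, then agree.
      have hconst : ∀ m, ∃ κ, ∀ b ∈ B ∩ U m, k b = κ + c m (μ b) φ.1 := by
        intro m
        rcases (B ∩ U m).eq_empty_or_nonempty with h | ⟨b₀, hb₀⟩
        · exact ⟨0, by simp [h]⟩
        refine ⟨k b₀ - c m (μ b₀) φ.1, fun b hb => ?_⟩
        have := eq_of_locally_const (hpB m) (u := fun b => k b - c m (μ b) φ.1) ?_ hb hb₀
        · linarith
        intro x hx
        filter_upwards [(hk' x hx.1).filter_mono (nhdsWithin_mono x inter_subset_left),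
          (hUB _ x hx.1 (hμ x hx.1)).filter_mono (nhdsWithin_mono x inter_subset_left),
          self_mem_nhdsWithin] with y h1 h2 h4
        have := hccoc φ.1 φ.2 y h4.1 m (μ x) (μ y) h4.2 h2 (hμ y h4.1)
        linarith
      choose κ hκ using hconst
      have hdiff : ∀ m n b, b ∈ B → b ∈ U m → b ∈ U n → c m n φ.1 = κ n - κ m := by
        intro m n b hb hm hn
        have h1 := hκ m b ⟨hb, hm⟩
        have h2 := hκ n b ⟨hb, hn⟩
        have := hccoc φ.1 φ.2 b hb m n (μ b) hm hn (hμ b hb)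
        linarith
      -- The index is chosen in the smaller cover `V'`, since `h2` transfers only intersections of
      -- its members to `B`.
      choose! ν hν using fun z (hz : z ∈ A) => mem_iUnion.1 (hcA hz)
      have hval : ∀ m, ∀ z ∈ A ∩ V' m, prim (A ∩ V (ν z)) (a (ν z)) φ.1 z + κ (ν z) =
          prim (A ∩ V m) (a m) φ.1 z + κ m := by
        rintro m z ⟨hz, hzm⟩
        obtain ⟨b, ⟨hb, hb1⟩, hb2⟩ := h2 m (ν z) ⟨z, ⟨hz, hzm⟩, hν z hz⟩
        have h1 := hdiff m (ν z) b hb hb1 hb2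
        rw [hc m (ν z) φ.1 φ.2 z ⟨⟨hz, hVV _ hzm⟩, hVV _ (hν z hz)⟩] at h1
        linarith
      refine ⟨fun z => prim (A ∩ V (ν z)) (a (ν z)) φ.1 z + κ (ν z), ?_⟩
      refine IsPrim.of_local fun z hz => ?_
      have hzV : (A ∩ V (ν z)).Nonempty := ⟨z, hz, hVV _ (hν z hz)⟩
      refine ⟨A ∩ V' (ν z), ?_, _, (isPrim_prim (a (ν z)) (hex1 _ hzV φ.2)).mono
        (inter_subset_inter_right _ (hVV _)), ⟨hz, hν z hz⟩, κ (ν z), fun y hy => ?_⟩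
      · exact Filter.inter_mem self_mem_nhdsWithin
          (mem_nhdsWithin_of_mem_nhds ((hV' _).mem_nhds (hν z hz)))
      · exact hval _ y hy
  let L : H1 A →ₗ[ℝ] H1 B := Submodule.mapQ _ _ Ψ fun φ hφ => (hΨ φ).1 hφ
  refine LinearMap.rank_le_of_injective L ?_
  rw [← LinearMap.ker_eq_bot, eq_bot_iff]
  intro q hq
  obtain ⟨φ, rfl⟩ := Submodule.mkQ_surjective _ q
  have h1 : Submodule.Quotient.mk (p := (Ex B).submoduleOf (Coc B)) (Ψ φ) = 0 := hq
  rw [Submodule.Quotient.mk_eq_zero] at h1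
  refine (Submodule.Quotient.mk_eq_zero _).2 ?_
  exact (hΨ φ).2 h1

/-- Transfer of locally constant functions between sets with related covers. -/
theorem exists_locally_const_transfer {A B : Set Z} {M α : Type*} {V U : M → Set Z}
    (hV : ∀ m, IsOpen (V m))
    (hcA : A ⊆ ⋃ m, V m) (hcB : B ⊆ ⋃ m, U m) (hpB : ∀ m, IsPreconnected (B ∩ U m))
    (h1 : ∀ m, (A ∩ V m).Nonempty ↔ (B ∩ U m).Nonempty)
    (h2 : ∀ m n, (A ∩ V m ∩ V n).Nonempty → (B ∩ U m ∩ U n).Nonempty)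
    {u : Z → α} (hu : ∀ x ∈ B, ∀ᶠ y in 𝓝[B] x, u y = u x) :
    ∃ v : Z → α, (∀ x ∈ A, ∀ᶠ y in 𝓝[A] x, v y = v x) ∧ u '' B ⊆ v '' A := by
  classical
  rcases B.eq_empty_or_nonempty with rfl | ⟨b₀, hb₀⟩
  · by_cases h : Nonempty α
    · exact ⟨fun _ => h.some, by simp, by simp⟩
    · exact ⟨u, fun x => (h ⟨u x⟩).elim, by simp⟩
  have : Nonempty M := (mem_iUnion.1 (hcB hb₀)).nonempty
  have : ∀ m, ∃ c, ∀ b ∈ B ∩ U m, u b = c := by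
    intro m
    rcases (B ∩ U m).eq_empty_or_nonempty with h | ⟨b₁, hb₁⟩
    · exact ⟨u b₀, by simp [h]⟩
    · exact ⟨u b₁, fun b hb => eq_of_locally_const (hpB m)
        (fun x hx => (hu x hx.1).filter_mono (nhdsWithin_mono x inter_subset_left)) hb hb₁⟩
  choose c hc using this
  choose! ν hν using fun z (hz : z ∈ A) => mem_iUnion.1 (hcA hz)
  have key : ∀ m, ∀ z ∈ A ∩ V m, c (ν z) = c m := by
    rintro m z ⟨hz, hzm⟩
    obtain ⟨b, ⟨hb, hb1⟩, hb2⟩ := h2 m (ν z) ⟨z, ⟨hz, hzm⟩, hν z hz⟩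
    rw [← hc _ b ⟨hb, hb2⟩, ← hc _ b ⟨hb, hb1⟩]
  refine ⟨fun z => c (ν z), fun z hz => ?_, ?_⟩
  · filter_upwards [self_mem_nhdsWithin,
      mem_nhdsWithin_of_mem_nhds ((hV _).mem_nhds (hν z hz))] with y hy hy'
    exact key _ y ⟨hy, hy'⟩
  · rintro _ ⟨b, hb, rfl⟩
    obtain ⟨m, hm⟩ := mem_iUnion.1 (hcB hb)
    obtain ⟨z, hz⟩ := (h1 m).2 ⟨b, hb, hm⟩
    exact ⟨z, hz.1, by rw [hc m b ⟨hb, hm⟩]; exact key m z hz⟩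

end Comparison


/-! ### Local constancy of the cohomology of fibres -/

section LocalConstancy

variable {Z : Type*} [TopologicalSpace Z]

/-- An open set meeting the fibres `F t`, for `t ∈ J` near `t₀`, in nonempty connected sets without
first cohomology. -/
def IsGood (F : ℝ → Set Z) (J : Set ℝ) (t₀ : ℝ) (U : Set Z) : Prop :=
  IsOpen U ∧ ∀ᶠ t in 𝓝[J] t₀, (F t ∩ U).Nonempty ∧ IsPreconnected (F t ∩ U) ∧
    Coc (F t ∩ U) ≤ Ex (F t ∩ U)

/-- The image of a compact set is closed. In the absence of properness, this is how information
about one fibre reaches the nearby ones. -/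
theorem IsCompact.eventually_disjoint_fiber {f : Z → ℝ} (hf : Continuous f) {C : Set Z}
    (hC : IsCompact C) {t₀ : ℝ} (h : ∀ z ∈ C, f z ≠ t₀) (J : Set ℝ) :
    ∀ᶠ t in 𝓝[J] t₀, ∀ z ∈ C, f z ≠ t := by
  have : (f '' C)ᶜ ∈ 𝓝 t₀ := (hC.image hf).isClosed.isOpen_compl.mem_nhds (by
    rintro ⟨z, hz, h'⟩
    exact h z hz h')
  filter_upwards [mem_nhdsWithin_of_mem_nhds this] with t ht z hz h'
  exact ht ⟨z, hz, h'⟩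

/-- Local constancy of the first cohomology of the fibres of a map whose fibres are locally
connected and acyclic, uniformly in the parameter. The points of `Q` are removed from the fibres;
near these points the sets `U p` describe the ends of the fibres. -/
theorem rank_H1_fiber_eventually_eq [T2Space Z] [LocallyCompactSpace Z] {f : Z → ℝ}
    (hf : Continuous f) {J : Set ℝ} {t₀ : ℝ} (ht₀ : t₀ ∈ J) {Q : Set Z} (hQ : IsClosed Q)
    {F : ℝ → Set Z} (hF : ∀ t, F t = f ⁻¹' {t} \ Q) (hK : IsCompact (f ⁻¹' {t₀}))
    (hgood : ∀ e ∈ F t₀, ∀ O ∈ 𝓝 e, ∃ U, e ∈ U ∧ U ⊆ O ∧ IsGood F J t₀ U)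
    {P : Type*} [Finite P] {W' W U : P → Set Z} (hW'g : ∀ p, IsGood F J t₀ (W' p))
    (hWg : ∀ p, IsGood F J t₀ (W p)) (hUg : ∀ p, IsGood F J t₀ (U p))
    (hW'W : ∀ p, W' p ⊆ W p) (hWU : ∀ p, W p ⊆ U p)
    (hW'c : ∀ p, closure (W' p) ∩ (f ⁻¹' J \ Q) ⊆ W p)
    (hWc : ∀ p, closure (W p) ∩ (f ⁻¹' J \ Q) ⊆ U p)
    (hdisj : ∀ p q, (W p ∩ W q).Nonempty → p = q)
    {N : Set Z} (hN : IsOpen N) (hQN : f ⁻¹' {t₀} ∩ Q ⊆ N)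
    (hNJ : N ∩ (f ⁻¹' J \ Q) ⊆ ⋃ p, W' p)
    {G : Set Z} (hG : IsOpen G) (hGc : IsCompact (closure G)) (htG : f ⁻¹' {t₀} ⊆ G)
    (hUG : ∀ p, U p ⊆ G) :
    ∀ᶠ t in 𝓝[J] t₀, Module.rank ℝ (H1 (F t ∩ G)) = Module.rank ℝ (H1 (F t₀)) ∧
      ∀ u : Z → ℕ, (∀ x ∈ F t ∩ G, ∀ᶠ y in 𝓝[F t ∩ G] x, u y = u x) →
        ∃ v : Z → ℕ, (∀ x ∈ F t₀, ∀ᶠ y in 𝓝[F t₀] x, v y = v x) ∧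
          u '' (F t ∩ G) ⊆ v '' (F t₀) := by
  classical
  have hFJ : ∀ t ∈ J, F t ⊆ f ⁻¹' J \ Q := fun t ht z hz => by
    rw [hF] at hz
    exact ⟨by rw [mem_preimage, show f z = t from hz.1]; exact ht, hz.2⟩
  have hmeet : ∀ O : Set Z, IsOpen O → (F t₀ ∩ O).Nonempty → ∀ᶠ t in 𝓝[J] t₀,
      (F t ∩ O).Nonempty := by
    rintro O hO ⟨e, he, heO⟩
    obtain ⟨U, heU, hUO, -, hU⟩ := hgood e he O (hO.mem_nhds heO)
    exact hU.mono fun t ht => ht.1.mono (inter_subset_inter_right _ hUO)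
  -- the compact core of the central fibre
  set K := f ⁻¹' {t₀} \ N with hKdef
  have hKc : IsCompact K := hK.diff hN
  have hKF : K ⊆ F t₀ := fun z hz => by
    rw [hF]
    exact ⟨hz.1, fun h => hz.2 (hQN ⟨hz.1, h⟩)⟩
  have h1 : ∀ x : K, ∃ Ux Cx, x.1 ∈ interior Cx ∧ IsClosed Cx ∧ Cx ⊆ Ux ∧ Ux ⊆ G ∧
      IsGood F J t₀ Ux := by
    intro x
    obtain ⟨Ux, hxU, hUxG, hUx⟩ := hgood x (hKF x.2) G (hG.mem_nhds (htG x.2.1))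
    obtain ⟨Cx, hCx, hCxc, hCxU⟩ := exists_mem_nhds_isClosed_subset (hUx.1.mem_nhds hxU)
    exact ⟨Ux, Cx, mem_interior_iff_mem_nhds.2 hCx, hCxc, hCxU, hUxG, hUx⟩
  choose Uc Cc hxC hCcl hCU hUcG hUcg using h1
  obtain ⟨X₀, hX₀⟩ := hKc.elim_finite_subcover (fun x => interior (Cc x))
    (fun x => isOpen_interior) fun x hx => mem_iUnion.2 ⟨⟨x, hx⟩, hxC ⟨x, hx⟩⟩
  let UI : P ⊕ X₀ → Set Z := Sum.elim U fun x => Uc x.1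
  let CI : P ⊕ X₀ → Set Z := Sum.elim (fun p => closure (W p)) fun x => Cc x.1
  have hUIg : ∀ i, IsGood F J t₀ (UI i) := by
    rintro (p | x)
    exacts [hUg p, hUcg x.1]
  have hUIG : ∀ i, UI i ⊆ G := by
    rintro (p | x)
    exacts [hUG p, hUcG x.1]
  have hCIc : ∀ i, IsClosed (CI i) := by
    rintro (p | x)
    exacts [isClosed_closure, hCcl x.1]
  have hCU' : ∀ i, ∀ z ∈ F t₀, z ∈ CI i → z ∈ UI i := by
    rintro (p | x) z hz hzC
    exacts [hWc p ⟨hzC, hFJ t₀ ht₀ hz⟩, hCU x.1 hzC]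
  have hidx : ∀ x : K, ∃ i, x.1 ∈ interior (CI i) := by
    intro x
    obtain ⟨y, hy, hxy⟩ := mem_iUnion₂.1 (hX₀ x.2)
    exact ⟨Sum.inr ⟨y, hy⟩, hxy⟩
  choose ι hι using hidx
  -- Membership in `O x` preserves lying in a coarse set `UI i` and avoiding a closed shrinking `CI
  -- i`. A member of the fine cover inside `O x` that touches `CI i` must therefore lie in `UI i`.
  let O : K → Set Z := fun x => {z | z ∈ G ∧ z ∉ Q ∧ z ∈ interior (CI (ι x)) ∧
    ∀ i, (x.1 ∈ UI i → z ∈ UI i) ∧ (x.1 ∉ CI i → z ∉ CI i)}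
  have hO : ∀ x : K, O x ∈ 𝓝 x.1 := by
    intro x
    have hxF := hKF x.2
    rw [hF] at hxF
    have a1 : ∀ᶠ z in 𝓝 x.1, z ∈ G := hG.mem_nhds (htG x.2.1)
    have a2 : ∀ᶠ z in 𝓝 x.1, z ∉ Q := hQ.isOpen_compl.mem_nhds hxF.2
    have a3 : ∀ᶠ z in 𝓝 x.1, z ∈ interior (CI (ι x)) := isOpen_interior.mem_nhds (hι x)
    have a4 : ∀ᶠ z in 𝓝 x.1, ∀ i, (x.1 ∈ UI i → z ∈ UI i) ∧ (x.1 ∉ CI i → z ∉ CI i) := by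
      refine Filter.eventually_all.2 fun i => Filter.Eventually.and ?_ ?_
      · by_cases h : x.1 ∈ UI i
        · filter_upwards [(hUIg i).1.mem_nhds h] with z hz _ using hz
        · simp [h]
      · by_cases h : x.1 ∈ CI i
        · simp [h]
        · filter_upwards [(hCIc i).isOpen_compl.mem_nhds h] with z hz _ using hz
    filter_upwards [a1, a2, a3, a4] with z b1 b2 b3 b4 using ⟨b1, b2, b3, b4⟩
  have h2 : ∀ x : K, ∃ Wx Wx' : Set Z, x.1 ∈ Wx' ∧ Wx' ⊆ Wx ∧ IsCompact (closure Wx') ∧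
      closure Wx' ⊆ Wx ∧ Wx ⊆ O x ∧ IsGood F J t₀ Wx ∧ IsGood F J t₀ Wx' := by
    intro x
    obtain ⟨Wx, hxW, hWO, hWx⟩ := hgood x (hKF x.2) (O x) (hO x)
    obtain ⟨L, hL, hLW, hLc⟩ := local_compact_nhds (hWx.1.mem_nhds hxW)
    obtain ⟨Wx', hxW', hW'L, hWx'⟩ := hgood x (hKF x.2) L hL
    have hcl : closure Wx' ⊆ L := closure_minimal hW'L hLc.isClosed
    exact ⟨Wx, Wx', hxW', hW'L.trans hLW, hLc.of_isClosed_subset isClosed_closure hcl,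
      hcl.trans hLW, hWO, hWx, hWx'⟩
  choose Wc Wc' hxW' hWcs hWcc hWccl hWcO hWcg hWcg' using h2
  obtain ⟨X₁, hX₁⟩ := hKc.elim_finite_subcover (fun x => Wc' x)
    (fun x => (hWcg' x).1) fun x hx => mem_iUnion.2 ⟨⟨x, hx⟩, hxW' ⟨x, hx⟩⟩
  let V : P ⊕ X₁ → Set Z := Sum.elim W fun x => Wc x.1
  let V' : P ⊕ X₁ → Set Z := Sum.elim W' fun x => Wc' x.1
  have hVg : ∀ m, IsGood F J t₀ (V m) := by
    rintro (p | x)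
    exacts [hWg p, hWcg x.1]
  have hV'g : ∀ m, IsGood F J t₀ (V' m) := by
    rintro (p | x)
    exacts [hW'g p, hWcg' x.1]
  have hV'V : ∀ m, V' m ⊆ V m := by
    rintro (p | x)
    exacts [hW'W p, hWcs x.1]
  have hVG : ∀ m, V m ⊆ G := by
    rintro (p | x)
    exacts [(hWU p).trans (hUG p), fun z hz => (hWcO x.1 hz).1]
  -- The star-refinement property: two meeting members of the fine cover lie in one coarse good set,
  -- on which cocycles are exact.
  have hpair : ∀ m n, (V m ∩ V n).Nonempty → ∃ i, V m ∪ V n ⊆ UI i := by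
    have core : ∀ (y : K) i z, z ∈ Wc y → z ∈ CI i → Wc y ⊆ UI i := by
      intro y i z hz hzC w hw
      have hy : y.1 ∈ CI i := by
        by_contra h
        exact ((hWcO y hz).2.2.2 i).2 h hzC
      exact ((hWcO y hw).2.2.2 i).1 (hCU' i y (hKF y.2) hy)
    rintro (p | x) (q | y) ⟨z, hz1, hz2⟩
    · obtain rfl := hdisj p q ⟨z, hz1, hz2⟩
      exact ⟨Sum.inl p, union_subset (hWU p) (hWU p)⟩
    · exact ⟨Sum.inl p, union_subset (hWU p) (core y.1 (Sum.inl p) z hz2 (subset_closure hz1))⟩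
    · exact ⟨Sum.inl q, union_subset (core x.1 (Sum.inl q) z hz1 (subset_closure hz2)) (hWU q)⟩
    · have hzC : z ∈ CI (ι x.1) := interior_subset (hWcO x.1 hz1).2.2.1
      exact ⟨ι x.1, union_subset (core x.1 _ z hz1 hzC) (core y.1 _ z hz2 hzC)⟩
  have hclV : ∀ m, closure (V' m) ∩ (f ⁻¹' J \ Q) ⊆ V m := by
    rintro (p | x)
    · exact hW'c p
    · exact inter_subset_left.trans (hWccl x.1)
  -- conditions valid for `t` near `t₀`
  have e1 : ∀ᶠ t in 𝓝[J] t₀, ∀ m, (F t ∩ V m).Nonempty ∧ IsPreconnected (F t ∩ V m) :=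
    Filter.eventually_all.2 fun m => (hVg m).2.mono fun t h => ⟨h.1, h.2.1⟩
  have e1' : ∀ᶠ t in 𝓝[J] t₀, ∀ m, (F t ∩ V' m).Nonempty ∧ IsPreconnected (F t ∩ V' m) :=
    Filter.eventually_all.2 fun m => (hV'g m).2.mono fun t h => ⟨h.1, h.2.1⟩
  have e2 : ∀ᶠ t in 𝓝[J] t₀, ∀ i, Coc (F t ∩ UI i) ≤ Ex (F t ∩ UI i) :=
    Filter.eventually_all.2 fun m => (hUIg m).2.mono fun t h => h.2.2
  have e3 : ∀ᶠ t in 𝓝[J] t₀, t ∈ J → F t ∩ G ⊆ ⋃ m, V' m := by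
    -- What the fine cover and `N` leave of `closure G` is compact and disjoint from the central
    -- fibre, hence from nearby ones.
    have hc : IsCompact (closure G \ ((⋃ x ∈ X₁, Wc' x) ∪ N)) :=
      hGc.diff ((isOpen_biUnion fun x _ => (hWcg' x).1).union hN)
    refine (IsCompact.eventually_disjoint_fiber hf hc (t₀ := t₀) ?_ J).mono fun t ht htJ z hz => ?_
    · rintro z ⟨-, hz2⟩ hzt
      rw [mem_union, not_or] at hz2
      exact hz2.1 (hX₁ ⟨hzt, hz2.2⟩)
    · have hzt : f z = t := by
        have := hz.1
        rw [hF] at this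
        exact this.1
      by_contra hcon
      refine ht z ⟨subset_closure hz.2, ?_⟩ hzt
      rintro (h | h)
      · obtain ⟨x, hx, hzx⟩ := mem_iUnion₂.1 h
        exact hcon (mem_iUnion.2 ⟨Sum.inr ⟨x, hx⟩, hzx⟩)
      · obtain ⟨p, hp⟩ := mem_iUnion.1 (hNJ ⟨h, hFJ t htJ hz.1⟩)
        exact hcon (mem_iUnion.2 ⟨Sum.inl p, hp⟩)
  have e4 : ∀ {T : P ⊕ X₁ → Set Z}, (∀ m, IsOpen (T m)) → ∀ᶠ t in 𝓝[J] t₀, ∀ m n p,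
      (F t₀ ∩ T m ∩ T n ∩ T p).Nonempty → (F t ∩ T m ∩ T n ∩ T p).Nonempty := by
    intro T hT
    refine Filter.eventually_all.2 fun m => Filter.eventually_all.2 fun n =>
      Filter.eventually_all.2 fun p => ?_
    by_cases h : (F t₀ ∩ T m ∩ T n ∩ T p).Nonempty
    · have := hmeet (T m ∩ T n ∩ T p) (((hT m).inter (hT n)).inter (hT p))
        (by simpa only [inter_assoc] using h)
      exact this.mono fun t ht _ => by simpa only [inter_assoc] using ht
    · simp [h]
  -- An index from `X₁` makes the intersection of the closures compact, so if it misses the central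
  -- fibre it misses the nearby ones. If all indices come from `P` there is no compactness, but
  -- disjointness forces the three indices to coincide.
  have e5 : ∀ᶠ t in 𝓝[J] t₀, t ∈ J → ∀ m n p,
      (F t ∩ V' m ∩ V' n ∩ V' p).Nonempty → (F t₀ ∩ V m ∩ V n ∩ V p).Nonempty := by
    have base : ∀ m n p, (∃ x : X₁, m = Sum.inr x ∨ n = Sum.inr x ∨ p = Sum.inr x) →
        ∀ᶠ t in 𝓝[J] t₀, (F t ∩ V' m ∩ V' n ∩ V' p).Nonempty →
          (F t₀ ∩ V m ∩ V n ∩ V p).Nonempty := by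
      intro m n p hx
      by_cases h : (F t₀ ∩ V m ∩ V n ∩ V p).Nonempty
      · simp [h]
      set C := closure (V' m) ∩ closure (V' n) ∩ closure (V' p) with hC
      have hcl : IsClosed C := (isClosed_closure.inter isClosed_closure).inter isClosed_closure
      obtain ⟨x, hx⟩ := hx
      have hCx : C ⊆ closure (Wc' x.1) := by
        rcases hx with rfl | rfl | rfl
        exacts [fun z hz => hz.1.1, fun z hz => hz.1.2, fun z hz => hz.2]
      have hCc : IsCompact C := (hWcc x.1).of_isClosed_subset hcl hCx
      refine (IsCompact.eventually_disjoint_fiber hf hCc (t₀ := t₀) ?_ J).mono ?_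
      · intro z hz hzt
        have hzQ : z ∉ Q := (hWcO x.1 (hWccl x.1 (hCx hz))).2.1
        have hzF : z ∈ F t₀ := by rw [hF]; exact ⟨hzt, hzQ⟩
        have hzJ := hFJ t₀ ht₀ hzF
        exact h ⟨z, ⟨⟨hzF, hclV m ⟨hz.1.1, hzJ⟩⟩, hclV n ⟨hz.1.2, hzJ⟩⟩, hclV p ⟨hz.2, hzJ⟩⟩
      · rintro t ht ⟨z, ⟨⟨hz, hm⟩, hn⟩, hp⟩
        rw [hF] at hz
        exact absurd hz.1 (ht z ⟨⟨subset_closure hm, subset_closure hn⟩, subset_closure hp⟩)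
    have hne : ∀ m, (F t₀ ∩ V m).Nonempty := fun m => (e1.self_of_nhdsWithin ht₀ m).1
    have : ∀ᶠ t in 𝓝[J] t₀, ∀ m n p, (∃ x : X₁, m = Sum.inr x ∨ n = Sum.inr x ∨ p = Sum.inr x) →
        (F t ∩ V' m ∩ V' n ∩ V' p).Nonempty → (F t₀ ∩ V m ∩ V n ∩ V p).Nonempty := by
      refine Filter.eventually_all.2 fun m => Filter.eventually_all.2 fun n =>
        Filter.eventually_all.2 fun p => ?_
      by_cases hx : ∃ x : X₁, m = Sum.inr x ∨ n = Sum.inr x ∨ p = Sum.inr x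
      · exact (base m n p hx).mono fun t ht _ => ht
      · simp [hx]
    refine this.mono fun t ht _ m n p hmnp => ?_
    by_cases hx : ∃ x : X₁, m = Sum.inr x ∨ n = Sum.inr x ∨ p = Sum.inr x
    · exact ht m n p hx hmnp
    · obtain ⟨z, ⟨⟨hz, hm⟩, hn⟩, hp⟩ := hmnp
      rcases m with m | m
      · rcases n with n | n
        · rcases p with p | p
          · obtain rfl := hdisj m n ⟨z, hW'W _ hm, hW'W _ hn⟩
            obtain rfl := hdisj m p ⟨z, hW'W _ hm, hW'W _ hp⟩
            obtain ⟨w, hw, hw'⟩ := hne (Sum.inl m)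
            exact ⟨w, ⟨⟨hw, hw'⟩, hw'⟩, hw'⟩
          · exact absurd ⟨p, Or.inr (Or.inr rfl)⟩ hx
        · exact absurd ⟨n, Or.inr (Or.inl rfl)⟩ hx
      · exact absurd ⟨m, Or.inl rfl⟩ hx
  have hF₀ : F t₀ ∩ G = F t₀ := inter_eq_left.2 fun z hz => by
    rw [hF] at hz
    exact htG hz.1
  -- exactness on unions of two members
  have hexact : ∀ t, (∀ i, Coc (F t ∩ UI i) ≤ Ex (F t ∩ UI i)) → ∀ m n,
      (F t ∩ G ∩ V m ∩ V n).Nonempty → Coc (F t ∩ G) ≤ Ex (F t ∩ G ∩ (V m ∪ V n)) := by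
    rintro t ht m n ⟨z, ⟨-, h1⟩, h2⟩
    obtain ⟨i, hi⟩ := hpair m n ⟨z, h1, h2⟩
    exact (Coc_mono (inter_subset_inter_right _ (hUIG i))).trans ((ht i).trans
      (Ex_mono fun z hz => ⟨hz.1.1, hi hz.2⟩))
  have hred : ∀ t m, F t ∩ G ∩ V m = F t ∩ V m := fun t m => by
    rw [inter_assoc, inter_eq_right.2 (hVG m)]
  have hred' : ∀ t m, F t ∩ G ∩ V' m = F t ∩ V' m := fun t m => by
    rw [inter_assoc, inter_eq_right.2 ((hV'V m).trans (hVG m))]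
  filter_upwards [e1, e1', e2, e3, e4 fun m => (hVg m).1, e4 fun m => (hV'g m).1, e5,
    self_mem_nhdsWithin] with t h1 h1' h2 h3 h4 h4' h5 htJ
  have c3 := h3 htJ
  have c3' : F t₀ ∩ G ⊆ ⋃ m, V' m := e3.self_of_nhdsWithin ht₀ ht₀
  have c5 := h5 htJ
  have c1 := e1.self_of_nhdsWithin ht₀
  have c1' := e1'.self_of_nhdsWithin ht₀
  have c2 := e2.self_of_nhdsWithin ht₀
  -- Nonempty intersections pass from the central fibre to nearby ones within one cover, but back
  -- only from `V'` to `V`. Hence the target is covered by `V` in the first inequality and by `V'`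
  -- in the second.
  refine ⟨le_antisymm ?_ ?_, fun u hu => ?_⟩
  · rw [← hF₀]
    refine rank_H1_le (V' := V') (V := V) (U := V) (fun m => (hV'g m).1) (fun m => (hVg m).1) hV'V
      c3 (c3'.trans (iUnion_mono hV'V)) ?_ ?_ (hexact t h2) ?_ ?_
    · intro m; rw [hred]; exact (h1 m).2
    · intro m; rw [hred]; exact (c1 m).2
    · intro m n h
      rw [hred'] at h; rw [hred]
      simpa [inter_assoc] using c5 m n n (by simpa [inter_assoc] using h)
    · intro m n p h
      rw [hred] at h; rw [hred]
      exact h4 m n p h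
  · rw [← hF₀]
    refine rank_H1_le (V' := V') (V := V) (U := V') (fun m => (hV'g m).1) (fun m => (hV'g m).1)
      hV'V c3' c3 ?_ ?_ (hexact t₀ c2) ?_ ?_
    · intro m; rw [hred]; exact (c1 m).2
    · intro m; rw [hred']; exact (h1' m).2
    · intro m n h
      rw [hred'] at h; rw [hred']
      simpa [inter_assoc] using h4' m n n (by simpa [inter_assoc] using h)
    · intro m n p h
      rw [hred'] at h; rw [hred]
      exact c5 m n p h
  · rw [← hF₀]
    refine exists_locally_const_transfer (V := V') (U := V') (fun m => (hV'g m).1) c3' c3 ?_ ?_ ?_ hu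
    · intro m; rw [hred']; exact (h1' m).2
    · intro m; rw [hred', hred']; exact ⟨fun _ => (h1' m).1, fun _ => (c1' m).1⟩
    · intro m n h
      rw [hred'] at h; rw [hred']
      simpa [inter_assoc] using h4' m n n (by simpa [inter_assoc] using h)

end LocalConstancy


/-! ### Alexander–Spanier and singular cohomology in degree one -/

section Bridge

theorem continuous_stdSimplex_coord {n : ℕ} (i : Fin n) :
    Continuous fun s : stdSimplex ℝ (Fin n) => s.1 i :=
  (continuous_apply i).comp continuous_subtype_val

theorem coboundary_one_apply {Z : Type*} [TopologicalSpace Z] (φ : SingularCochain Z 1)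
    (σ : C(stdSimplex ℝ (Fin 3), Z)) : coboundary Z 1 φ σ =
      φ (σ.comp (face 1 0)) - φ (σ.comp (face 1 1)) + φ (σ.comp (face 1 2)) := by
  have : coboundary Z 1 φ σ = ∑ i : Fin 3, (-1 : ℝ) ^ (i : ℕ) * φ (σ.comp (face 1 i)) := rfl
  rw [this, Fin.sum_univ_three]
  simp
  ring

theorem coboundary_zero_apply {Z : Type*} [TopologicalSpace Z] (φ : SingularCochain Z 0)
    (σ : C(stdSimplex ℝ (Fin 2), Z)) : coboundary Z 0 φ σ =
      φ (σ.comp (face 0 0)) - φ (σ.comp (face 0 1)) := by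
  have : coboundary Z 0 φ σ = ∑ i : Fin 2, (-1 : ℝ) ^ (i : ℕ) * φ (σ.comp (face 0 i)) := rfl
  rw [this, Fin.sum_univ_two]
  simp
  ring

/-! ### Affine singular simplices -/

section Affine

variable {V : Type*} [AddCommGroup V] [Module ℝ V] [TopologicalSpace V]
  [IsTopologicalAddGroup V] [ContinuousSMul ℝ V] {K : Set V}

/-- The affine singular simplex of a convex set with given vertices. -/
noncomputable def affSimplex (hK : Convex ℝ K) {n : ℕ} (a : Fin (n + 1) → K) :
    C(stdSimplex ℝ (Fin (n + 1)), K) :=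
  ⟨fun s => ⟨∑ i, s.1 i • (a i : V), hK.sum_mem (fun i _ => s.2.1 i) s.2.2 fun i _ => (a i).2⟩, by
    refine Continuous.subtype_mk ?_ _
    exact continuous_finsetSum _ fun i _ => (continuous_stdSimplex_coord i).smul continuous_const⟩

theorem affSimplex_pair (hK : Convex ℝ K) (p q : K) (s : stdSimplex ℝ (Fin 2)) :
    (affSimplex hK ![p, q] s).1 = s.1 0 • p.1 + s.1 1 • q.1 := by
  have : (affSimplex hK ![p, q] s).1 = ∑ i : Fin 2, s.1 i • ((![p, q] : Fin 2 → K) i : V) := rfl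
  rw [this, Fin.sum_univ_two]
  rfl

theorem affSimplex_face (hK : Convex ℝ K) {n : ℕ} (a : Fin (n + 2) → K) (i : Fin (n + 2)) :
    (affSimplex hK a).comp (face n i) = affSimplex hK (a ∘ i.succAbove) := by
  classical
  ext s
  change ∑ j, (FunOnFinite.linearMap ℝ ℝ i.succAbove s.1) j • (a j : V) =
    ∑ j, s.1 j • (a (i.succAbove j) : V)
  rw [Fin.sum_univ_succAbove _ i]
  have h1 : (FunOnFinite.linearMap ℝ ℝ i.succAbove s.1) i = 0 := by
    rw [FunOnFinite.linearMap_apply_apply]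
    refine Finset.sum_eq_zero fun j hj => ?_
    exact absurd (Finset.mem_filter.1 hj).2 (Fin.succAbove_ne i j)
  have h2 : ∀ j, (FunOnFinite.linearMap ℝ ℝ i.succAbove s.1) (i.succAbove j) = s.1 j := by
    intro j
    rw [FunOnFinite.linearMap_apply_apply, Finset.sum_eq_single j]
    · intro k hk hkj
      exact absurd (Fin.succAbove_right_injective (Finset.mem_filter.1 hk).2) hkj
    · simp
  simp [h1, h2]

variable {Z : Type*} [TopologicalSpace Z]

/-- This is the cocycle condition on the affine 2-simplex with vertices `a`, `b`, `c`. -/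
theorem cocycle_add {F : SingularCochain Z 1} (hF : coboundary Z 1 F = 0) (hK : Convex ℝ K)
    (σ : C(K, Z)) (a b c : K) :
    F (σ.comp (affSimplex hK ![a, c])) =
      F (σ.comp (affSimplex hK ![a, b])) + F (σ.comp (affSimplex hK ![b, c])) := by
  have h := congrFun hF (σ.comp (affSimplex hK ![a, b, c]))
  have e0 : (![a, b, c] : Fin 3 → K) ∘ Fin.succAbove 0 = ![b, c] := by
    ext i; fin_cases i <;> rfl
  have e1 : (![a, b, c] : Fin 3 → K) ∘ Fin.succAbove 1 = ![a, c] := by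
    ext i; fin_cases i <;> rfl
  have e2 : (![a, b, c] : Fin 3 → K) ∘ Fin.succAbove 2 = ![a, b] := by
    ext i; fin_cases i <;> rfl
  rw [coboundary_one_apply, Pi.zero_apply] at h
  simp only [ContinuousMap.comp_assoc, affSimplex_face, e0, e1, e2] at h
  linarith

end Affine

variable {Z : Type*} [TopologicalSpace Z]

/-- The vertices of the standard 1-simplex. -/
abbrev vtx (n : ℕ) (i : Fin (n + 1)) : stdSimplex ℝ (Fin (n + 1)) := stdSimplex.vertex i

theorem Coc_univ_stdSimplex_le (n : ℕ) :
    Coc (univ : Set (stdSimplex ℝ (Fin (n + 1)))) ≤ Ex univ := by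
  classical
  refine Coc_le_Ex_of_homeo (S' := stdSimplex ℝ (Fin (n + 1))) (g := Subtype.val)
    (g' := fun x => if h : x ∈ stdSimplex ℝ (Fin (n + 1)) then ⟨x, h⟩ else vtx n 0)
    (by fun_prop) ?_ (fun x _ => x.2) (fun _ _ => mem_univ _) (fun x _ => ?_)
    (StarConvex.Coc_le_Ex (o := (vtx n 0).1) ((convex_stdSimplex ℝ _) (vtx n 0).2))
  · rw [continuousOn_iff_continuous_domRestrict]
    convert continuous_id using 1
    ext1 x
    simp
  · simp

/-- The period of a cocycle along a singular 1-simplex. -/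
noncomputable def period (φ : Z → Z → ℝ) (σ : C(stdSimplex ℝ (Fin 2), Z)) : ℝ :=
  prim univ (vtx 1 0) (fun a b => φ (σ a) (σ b)) (vtx 1 1)

theorem period_eq {φ : Z → Z → ℝ} {σ : C(stdSimplex ℝ (Fin 2), Z)}
    {w : stdSimplex ℝ (Fin 2) → ℝ} (hw : IsPrim univ (fun a b => φ (σ a) (σ b)) w) :
    period φ σ = w (vtx 1 1) - w (vtx 1 0) :=
  prim_eq isPreconnected_univ (mem_univ _) (mem_univ _) hw

theorem face_vtx (n : ℕ) (i : Fin (n + 2)) (j : Fin (n + 1)) :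
    face n i (vtx n j) = vtx (n + 1) (i.succAbove j) := stdSimplex.map_vertex _ _

/-- Pulled back to a 2-simplex the cocycle has a primitive, and the period of each face is a
difference of its values at two vertices; the alternating sum telescopes. -/
theorem coboundary_period {φ : Z → Z → ℝ} (hφ : φ ∈ Coc (univ : Set Z)) :
    coboundary Z 1 (period φ) = 0 := by
  funext τ
  obtain ⟨w, hw⟩ := Coc_univ_stdSimplex_le 2
    (Coc.pullback (S' := univ) hφ τ.continuous.continuousOn fun _ _ => mem_univ _)
  have hf : ∀ i, period φ (τ.comp (face 1 i)) =
      w (vtx 2 (i.succAbove 1)) - w (vtx 2 (i.succAbove 0)) := by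
    intro i
    rw [period_eq (w := w ∘ face 1 i), Function.comp, Function.comp, face_vtx, face_vtx]
    exact hw.pullback (S' := univ) (face 1 i).continuous.continuousOn fun _ _ => mem_univ _
  rw [coboundary_one_apply, hf, hf, hf]
  have e0 : (0 : Fin 3).succAbove (0 : Fin 2) = 1 := rfl
  have e1 : (0 : Fin 3).succAbove (1 : Fin 2) = 2 := rfl
  have e2 : (1 : Fin 3).succAbove (0 : Fin 2) = 0 := rfl
  have e3 : (1 : Fin 3).succAbove (1 : Fin 2) = 2 := rfl
  have e4 : (2 : Fin 3).succAbove (0 : Fin 2) = 0 := rfl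
  have e5 : (2 : Fin 3).succAbove (1 : Fin 2) = 1 := rfl
  rw [e0, e1, e2, e3, e4, e5, Pi.zero_apply]
  ring

/-- Local contractibility of a subset. -/
def LocContr (S : Set Z) : Prop :=
  ∀ x ∈ S, ∀ O ∈ 𝓝 x, ∃ U ∈ 𝓝[S] x, U ⊆ O ∩ S ∧ ∃ o, ∃ H : Z × ℝ → Z,
    ContinuousOn H (U ×ˢ Icc (0 : ℝ) 1) ∧ MapsTo H (U ×ˢ Icc (0 : ℝ) 1) U ∧
    (∀ y ∈ U, H (y, 1) = y) ∧ ∀ y ∈ U, H (y, 0) = o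

theorem LocContr.transfer {Z' : Type*} [TopologicalSpace Z'] {S : Set Z} {S' : Set Z'}
    (h : LocContr S) {g : Z → Z'} {g' : Z' → Z}
    (hg : ContinuousOn g S) (hg' : ContinuousOn g' S') (hm : MapsTo g S S') (hm' : MapsTo g' S' S)
    (hl : ∀ x ∈ S, g' (g x) = x) (hr : ∀ x ∈ S', g (g' x) = x) : LocContr S' := by
  intro x hx O hO
  have h1 : g ⁻¹' O ∈ 𝓝[S] (g' x) := hg _ (hm' hx) (by rw [hr x hx]; exact hO)
  obtain ⟨O₁, hO₁, hxO₁, hsub⟩ := mem_nhdsWithin.1 h1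
  obtain ⟨U, hU, hUO, o, H, hHc, hHm, hH1, hH0⟩ := h _ (hm' hx) O₁ (hO₁.mem_nhds hxO₁)
  refine ⟨S' ∩ g' ⁻¹' U, ?_, ?_, g o, fun p => g (H (g' p.1, p.2)), ?_, ?_, ?_, ?_⟩
  · exact Filter.inter_mem self_mem_nhdsWithin (((hg' x hx).tendsto_nhdsWithin hm') hU)
  · rintro y ⟨hy, hyU⟩
    have h2 := hUO hyU
    refine ⟨?_, hy⟩
    have := hsub h2
    rwa [mem_preimage, hr y hy] at this
  · refine hg.comp (hHc.comp ?_ ?_) ?_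
    · exact (hg'.comp continuousOn_fst fun p hp => hp.1.1).prodMk continuousOn_snd
    · exact fun p hp => ⟨hp.1.2, hp.2⟩
    · exact fun p hp => (hUO (hHm (x := (g' p.1, p.2)) ⟨hp.1.2, hp.2⟩)).2
  · intro p hp
    have := hHm (x := (g' p.1, p.2)) ⟨hp.1.2, hp.2⟩
    exact ⟨hm (hUO this).2, by rw [mem_preimage, hl _ (hUO this).2]; exact this⟩
  · rintro y ⟨hy, hyU⟩
    simp [hH1 _ hyU, hr y hy]
  · rintro y ⟨hy, hyU⟩
    simp [hH0 _ hyU]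

/-- The three faces of a constant 2-simplex are equal and enter with signs `+`, `-`, `+`. -/
theorem SingularCocycle.const {F : SingularCochain Z 1} (hF : coboundary Z 1 F = 0) (o : Z) :
    F (ContinuousMap.const _ o) = 0 := by
  have h := congrFun hF (ContinuousMap.const _ o)
  rw [coboundary_one_apply, Pi.zero_apply] at h
  simp only [ContinuousMap.const_comp] at h
  linarith

theorem stdSimplex_two_eq (s : stdSimplex ℝ (Fin 2)) : s.1 0 = 1 - s.1 1 := by
  have := s.2.2
  rw [Fin.sum_univ_two] at this
  linarith

/-- Contracting paths. -/
noncomputable def conePath {U : Set Z} {H : Z × ℝ → Z} (hH : ContinuousOn H (U ×ˢ Icc (0 : ℝ) 1))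
    (y : U) : C(stdSimplex ℝ (Fin 2), Z) :=
  ⟨fun s => H (y, s.1 1), by
    refine hH.comp_continuous (continuous_const.prodMk (continuous_stdSimplex_coord 1))
      fun s => ⟨y.2, ?_⟩
    exact mem_Icc_of_mem_stdSimplex s.2 1⟩

/-- The contraction sweeps the path over a square. Cutting the square along a diagonal gives two
triangles; the top edge is the path, the bottom edge is constant and contributes zero, and the
vertical sides are the two cone paths. -/
theorem SingularCocycle.eq_sub_of_contraction {F : SingularCochain Z 1}
    (hF : coboundary Z 1 F = 0) {U : Set Z} {H : Z × ℝ → Z}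
    (hH : ContinuousOn H (U ×ˢ Icc (0 : ℝ) 1))
    (h1 : ∀ x ∈ U, H (x, 1) = x) {o : Z} (h0 : ∀ x ∈ U, H (x, 0) = o)
    {σ : C(stdSimplex ℝ (Fin 2), Z)} (hσ : ∀ s, σ s ∈ U) :
    F σ = F (conePath hH ⟨σ (vtx 1 1), hσ _⟩) - F (conePath hH ⟨σ (vtx 1 0), hσ _⟩) := by
  classical
  have hK : Convex ℝ (stdSimplex ℝ (Fin 2) ×ˢ Icc (0 : ℝ) 1) :=
    (convex_stdSimplex ℝ _).prod (convex_Icc 0 1)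
  let Θ : C((stdSimplex ℝ (Fin 2) ×ˢ Icc (0 : ℝ) 1 : Set _), Z) :=
    ⟨fun p => H (σ ⟨p.1.1, p.2.1⟩, p.1.2), by
      refine hH.comp_continuous (by fun_prop) fun p => ⟨hσ _, p.2.2⟩⟩
  let pt : stdSimplex ℝ (Fin 2) → Icc (0 : ℝ) 1 → (stdSimplex ℝ (Fin 2) ×ˢ Icc (0 : ℝ) 1 : Set _) :=
    fun s t => ⟨(s.1, t.1), s.2, t.2⟩
  have hΘ : ∀ p q (s : stdSimplex ℝ (Fin 2)) (x : stdSimplex ℝ (Fin 2)) (t : ℝ),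
      (∀ i, s.1 0 * p.1.1 i + s.1 1 * q.1.1 i = x.1 i) → s.1 0 * p.1.2 + s.1 1 * q.1.2 = t →
      (Θ.comp (affSimplex hK ![p, q])) s = H (σ x, t) := by
    intro p q s x t h2 h3
    have e : (affSimplex hK ![p, q] s).1 = (x.1, t) := by
      rw [affSimplex_pair]
      refine Prod.ext (funext fun i => ?_) ?_
      · simpa using h2 i
      · simpa using h3
    change H (σ ⟨(affSimplex hK ![p, q] s).1.1, _⟩, (affSimplex hK ![p, q] s).1.2) = _
    congr 2
    · congr 1
      exact Subtype.ext (congrArg Prod.fst e)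
    · exact congrArg Prod.snd e
  let I0 : Icc (0 : ℝ) 1 := ⟨0, by simp⟩
  let I1 : Icc (0 : ℝ) 1 := ⟨1, by simp⟩
  have hside : ∀ i : Fin 2, Θ.comp (affSimplex hK ![pt (vtx 1 i) I0, pt (vtx 1 i) I1]) =
      conePath hH ⟨σ (vtx 1 i), hσ _⟩ := by
    intro i
    ext s
    refine hΘ _ _ s (vtx 1 i) (s.1 1) ?_ ?_
    · intro j
      have := stdSimplex_two_eq s
      simp only [pt]
      rw [this]; ring
    · simp [pt, I0, I1]
  have htop : Θ.comp (affSimplex hK ![pt (vtx 1 0) I1, pt (vtx 1 1) I1]) = σ := by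
    ext s
    rw [hΘ _ _ s s 1, h1 _ (hσ s)]
    · intro j
      fin_cases j <;> simp [pt]
    · have := stdSimplex_two_eq s
      simp only [pt, I1]
      rw [this]; ring
  have hbot : Θ.comp (affSimplex hK ![pt (vtx 1 0) I0, pt (vtx 1 1) I0]) =
      ContinuousMap.const _ o := by
    ext s
    rw [hΘ _ _ s s 0, h0 _ (hσ s)]
    · rfl
    · intro j
      fin_cases j <;> simp [pt]
    · simp [pt, I0]
  have a1 := cocycle_add hF hK Θ (pt (vtx 1 0) I0) (pt (vtx 1 0) I1) (pt (vtx 1 1) I1)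
  have a2 := cocycle_add hF hK Θ (pt (vtx 1 0) I0) (pt (vtx 1 1) I0) (pt (vtx 1 1) I1)
  rw [hside, htop] at a1
  rw [hside, hbot, SingularCocycle.const hF] at a2
  linarith

/-- On a locally contractible space, the first singular cohomology is the first
Alexander–Spanier cohomology. -/
theorem nonempty_H1_equiv_singularH1 (hZ : LocContr (univ : Set Z)) :
    Nonempty (H1 (univ : Set Z) ≃ₗ[ℝ] SingularH1 Z) := by
  classical
  -- The isomorphism is integration of cocycles along singular 1-simplices.
  let P : Coc (univ : Set Z) →ₗ[ℝ] LinearMap.ker (coboundary Z 1) :=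
    { toFun := fun φ => ⟨period φ.1, coboundary_period φ.2⟩
      map_add' := fun φ ψ => by
        ext σ
        exact prim_add isPreconnected_univ (mem_univ _) (mem_univ _)
          (Coc_univ_stdSimplex_le 1 (Coc.pullback (S' := univ) φ.2 σ.continuous.continuousOn
            fun _ _ => mem_univ _))
          (Coc_univ_stdSimplex_le 1 (Coc.pullback (S' := univ) ψ.2 σ.continuous.continuousOn
            fun _ _ => mem_univ _))
      map_smul' := fun r φ => by
        ext σ
        exact prim_smul isPreconnected_univ (mem_univ _) (mem_univ _)
          (Coc_univ_stdSimplex_le 1 (Coc.pullback (S' := univ) φ.2 σ.continuous.continuousOn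
            fun _ _ => mem_univ _)) r }
  let L : Coc (univ : Set Z) →ₗ[ℝ] SingularH1 Z := (Submodule.mkQ _).comp P
  refine nonempty_H1_equiv_of_surjective L ?_ ?_
  · -- surjectivity
    intro q
    obtain ⟨⟨F, hF⟩, rfl⟩ := Submodule.mkQ_surjective _ q
    have hF' : coboundary Z 1 F = 0 := hF
    have hU := fun x : Z => hZ x (mem_univ x) univ Filter.univ_mem
    choose U hU hUO o H hHc hHm hH1 hH0 using hU
    simp only [nhdsWithin_univ] at hU
    -- Integrating `F` along the contracting paths gives a local primitive `f x` on `U x`; the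
    -- cocycle `φ` records its increments from `x`.
    let f : Z → Z → ℝ := fun x y => if h : y ∈ U x then F (conePath (hHc x) ⟨y, h⟩) else 0
    have hf : ∀ x, ∀ σ : C(stdSimplex ℝ (Fin 2), Z), (∀ s, σ s ∈ U x) →
        F σ = f x (σ (vtx 1 1)) - f x (σ (vtx 1 0)) := by
      intro x σ hσ
      rw [SingularCocycle.eq_sub_of_contraction hF' (hHc x) (hH1 x) (hH0 x) hσ]
      simp [f, hσ]
    let φ : Z → Z → ℝ := fun x y => f x y - f x x
    have hφ : φ ∈ Coc (univ : Set Z) := by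
      intro x _
      simp only [nhdsWithin_univ]
      filter_upwards [eventually_eventually_nhds.2 (hU x)] with y hy
      -- `U x ∩ U y` need not be connected, so a contractible neighbourhood of `y` inside it is
      -- used. There `f x` and `f y` differ by a constant, both being integrals of `F`.
      obtain ⟨U', hU', hUsub, o', H', hH'c, hH'm, hH'1, hH'0⟩ :=
        hZ y (mem_univ y) _ (Filter.inter_mem hy (hU y))
      rw [nhdsWithin_univ] at hU'
      have hyU' : y ∈ U' := mem_of_mem_nhds hU'
      filter_upwards [hU'] with z hz
      have key : ∀ w (hw : w ∈ U'), f x w - f x o' = f y w - f y o' := by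
        intro w hw
        have hm : ∀ s, conePath hH'c ⟨w, hw⟩ s ∈ U' := fun s =>
          hH'm (x := (w, s.1 1)) ⟨hw, mem_Icc_of_mem_stdSimplex s.2 1⟩
        have e1 : conePath hH'c ⟨w, hw⟩ (vtx 1 1) = w := by
          simp [conePath, hH'1 w hw]
        have e0 : conePath hH'c ⟨w, hw⟩ (vtx 1 0) = o' := by
          simp [conePath, hH'0 w hw]
        have b1 := hf x _ fun s => (hUsub (hm s)).1.1
        have b2 := hf y _ fun s => (hUsub (hm s)).1.2
        rw [e1, e0] at b1 b2
        linarith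
      have k1 := key z hz
      have k2 := key y hyU'
      simp only [φ]
      linarith
    refine ⟨⟨φ, hφ⟩, ?_⟩
    have hper : period φ = F := by
      funext σ
      have hK := convex_stdSimplex ℝ (Fin 2)
      -- The integral of `F` over the initial segment of `σ` ending at `a`; it is a primitive of the
      -- pullback of `φ`, with total increment `F σ`.
      set w : stdSimplex ℝ (Fin 2) → ℝ := fun a => F (σ.comp (affSimplex hK ![vtx 1 0, a]))
      have hw : IsPrim univ (fun a b => φ (σ a) (σ b)) w := by
        intro a _
        rw [nhdsWithin_univ]
        have hn : σ ⁻¹' U (σ a) ∈ 𝓝 a := σ.continuous.continuousAt (hU (σ a))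
        obtain ⟨ε, hε, hball⟩ := Metric.mem_nhds_iff.1 hn
        filter_upwards [Metric.ball_mem_nhds a hε] with b hb
        have hadd := cocycle_add hF' hK σ (vtx 1 0) a b
        have hin : ∀ s, (σ.comp (affSimplex hK ![a, b])) s ∈ U (σ a) := by
          intro s
          refine hball ?_
          have : (affSimplex hK ![a, b] s).1 ∈ Metric.ball a.1 ε := by
            have e : (affSimplex hK ![a, b] s).1 = s.1 0 • a.1 + s.1 1 • b.1 := by
              rw [affSimplex_pair]
            rw [e]
            refine convex_ball a.1 ε (Metric.mem_ball_self hε) hb (s.2.1 0) (s.2.1 1) ?_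
            have := stdSimplex_two_eq s
            linarith
          exact this
        have h3 := hf (σ a) _ hin
        have e1 : (σ.comp (affSimplex hK ![a, b])) (vtx 1 1) = σ b := by
          refine congrArg σ (Subtype.ext ?_)
          rw [affSimplex_pair]; simp
        have e0 : (σ.comp (affSimplex hK ![a, b])) (vtx 1 0) = σ a := by
          refine congrArg σ (Subtype.ext ?_)
          rw [affSimplex_pair]; simp
        rw [e1, e0] at h3
        simp only [w, φ]
        linarith
      rw [period_eq hw]
      have hw0 : w (vtx 1 0) = 0 := by
        have := cocycle_add hF' hK σ (vtx 1 0) (vtx 1 0) (vtx 1 0)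
        simp only [w]
        linarith
      have hw1 : w (vtx 1 1) = F σ := by
        simp only [w]
        congr 1
        ext s
        refine congrArg σ (Subtype.ext ?_)
        rw [affSimplex_pair]
        ext j
        fin_cases j <;> simp
      rw [hw0, hw1, sub_zero]
    simp only [L, LinearMap.comp_apply, P, LinearMap.coe_mk, AddHom.coe_mk, hper]
  · intro φ
    have hL : L φ = 0 ↔ ∃ g, coboundary Z 0 g = period φ.1 := by
      simp only [L, LinearMap.comp_apply, Submodule.mkQ_apply, Submodule.Quotient.mk_eq_zero]
      rfl
    rw [hL]
    have hδ : ∀ (g : SingularCochain Z 0) (σ : C(stdSimplex ℝ (Fin 2), Z)),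
        coboundary Z 0 g σ = g (ContinuousMap.const _ (σ (vtx 1 1))) -
          g (ContinuousMap.const _ (σ (vtx 1 0))) := by
      intro g σ
      have hc : ∀ i : Fin 2, σ.comp (face 0 i) =
          ContinuousMap.const _ (σ (vtx 1 (i.succAbove 0))) := by
        intro i
        ext s
        have : s = vtx 0 0 := Subsingleton.elim _ _
        rw [this, ContinuousMap.comp_apply, face_vtx]; rfl
      rw [coboundary_zero_apply, hc, hc]
      have e0 : (0 : Fin 2).succAbove (0 : Fin 1) = 1 := rfl
      have e1 : (1 : Fin 2).succAbove (0 : Fin 1) = 0 := rfl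
      rw [e0, e1]
    constructor
    · rintro ⟨g, hg⟩
      refine ⟨fun z => g (ContinuousMap.const _ z), fun x _ => ?_⟩
      -- Near `x` the function `φ x` is a primitive of `φ`. Comparing the period of a contracting
      -- path computed with it and with `g` shows that `φ x` and `g` differ by a constant.
      obtain ⟨O, hO, hxO, hprim⟩ := Coc.exists_local_prim φ.2 (mem_univ x)
      obtain ⟨U, hU, hUO, o, H, hHc, hHm, hH1, hH0⟩ := hZ x (mem_univ x) O (hO.mem_nhds hxO)
      have key : ∀ y (hy : y ∈ U), φ.1 x y - φ.1 x o =
          g (ContinuousMap.const _ y) - g (ContinuousMap.const _ o) := by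
        intro y hy
        have e1 : conePath hHc ⟨y, hy⟩ (vtx 1 1) = y := by
          simp [conePath, hH1 y hy]
        have e0 : conePath hHc ⟨y, hy⟩ (vtx 1 0) = o := by
          simp [conePath, hH0 y hy]
        have h2 := congrFun hg (conePath hHc ⟨y, hy⟩)
        rw [hδ, e1, e0, period_eq (w := fun s => φ.1 x (conePath hHc ⟨y, hy⟩ s))] at h2
        · rw [e1, e0] at h2; exact h2.symm
        · refine hprim.pullback (S' := univ) (conePath hHc ⟨y, hy⟩).continuous.continuousOn ?_
          intro s _
          refine ⟨(hUO ?_).1, mem_univ _⟩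
          exact hHm (x := (y, s.1 1)) ⟨hy, mem_Icc_of_mem_stdSimplex s.2 1⟩
      filter_upwards [hU] with y hy
      have k1 := key y hy
      have k2 := key x (mem_of_mem_nhdsWithin (mem_univ x) hU)
      have k3 := Coc.self_eq_zero φ.2 (mem_univ x)
      linarith
    · rintro ⟨h, hh⟩
      refine ⟨fun ρ => h (ρ (vtx 0 0)), ?_⟩
      funext σ
      rw [hδ, period_eq (w := h ∘ σ)]
      · rfl
      · exact hh.pullback (S' := univ) σ.continuous.continuousOn fun _ _ => mem_univ _

/-- The first Betti number of a locally contractible subset. -/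
theorem b1_eq_finrank_H1 {Z' : Type*} [TopologicalSpace Z'] {S : Set Z} (hS : LocContr S)
    (e : Z' ≃ₜ S) : b1 Z' = Module.finrank ℝ (H1 S) := by
  classical
  -- The inverse of `e` is extended to all of `Z` by a default point, which is missing when the
  -- space is empty.
  rcases isEmpty_or_nonempty Z' with h | ⟨⟨z₀⟩⟩
  · obtain ⟨E⟩ := nonempty_H1_equiv_singularH1 (Z := Z') fun x => (h.false x).elim
    have h1 : Subsingleton (H1 (univ : Set Z')) :=
      Submodule.Quotient.subsingleton_iff.2 (eq_top_iff.2 fun φ _ => ⟨0, fun x _ => (h.false x).elim⟩)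
    have h2 : Subsingleton (H1 S) :=
      Submodule.Quotient.subsingleton_iff.2 (eq_top_iff.2 fun φ _ =>
        ⟨0, fun x hx => (h.false (e.symm ⟨x, hx⟩)).elim⟩)
    rw [b1, ← E.finrank_eq, Module.finrank_zero_of_subsingleton, Module.finrank_zero_of_subsingleton]
  · let g : Z → Z' := fun x => if h : x ∈ S then e.symm ⟨x, h⟩ else z₀
    let g' : Z' → Z := fun x => (e x).1
    have hg : ContinuousOn g S := by
      rw [continuousOn_iff_continuous_domRestrict]
      convert e.symm.continuous using 1
      ext1 x
      simp [g]
    have hg' : ContinuousOn g' univ := by fun_prop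
    have hm' : MapsTo g' univ S := fun x _ => (e x).2
    have hl : ∀ x ∈ S, g' (g x) = x := fun x hx => by simp [g, g', hx]
    have hr : ∀ x ∈ (univ : Set Z'), g (g' x) = x := fun x _ => by simp [g, g']
    obtain ⟨E⟩ := nonempty_H1_equiv_singularH1
      (hS.transfer hg hg' (fun _ _ => mem_univ _) hm' hl hr)
    obtain ⟨E'⟩ := nonempty_H1_equiv hg hg' (fun _ _ => mem_univ _) hm' hl hr
    rw [b1, ← E.finrank_eq, E'.finrank_eq]

end Bridge


/-- Euclidean 3-space. -/
abbrev E3 : Type := EuclideanSpace ℝ (Fin 3)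

/-! ### Punctured balls in `ℝ³` -/

section PuncturedBall

/-- The radial contraction of `ℝ³` onto an open ball. -/
noncomputable def radial (a : E3) (ρ : ℝ) (v : E3) : E3 := a + (ρ / (1 + ‖v‖)) • v

theorem continuous_radial (a : E3) (ρ : ℝ) : Continuous (radial a ρ) := by
  unfold radial
  have : ∀ v : E3, 1 + ‖v‖ ≠ 0 := fun v => by positivity
  fun_prop (disch := assumption)

/-- On sets stable under positive scaling the radial contraction is undone by `w ↦ w / (ρ - ‖w‖)`.
It carries connectedness of complements of points and lines from `ℝ³` to balls. -/
theorem radial_image (a : E3) {ρ : ℝ} (hρ : 0 < ρ) {C : Set E3}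
    (hC : ∀ c : ℝ, 0 < c → ∀ v, c • v ∈ C ↔ v ∈ C) :
    radial a ρ '' C = {x | x ∈ Metric.ball a ρ ∧ x - a ∈ C} := by
  ext x
  constructor
  · rintro ⟨v, hv, rfl⟩
    have h1 : 0 < 1 + ‖v‖ := by positivity
    refine ⟨?_, ?_⟩
    · rw [mem_ball_iff_norm, radial, add_sub_cancel_left, norm_smul, Real.norm_eq_abs,
        abs_of_pos (div_pos hρ h1), div_mul_eq_mul_div, div_lt_iff₀ h1]
      nlinarith [norm_nonneg v]
    · rw [radial, add_sub_cancel_left]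
      exact (hC _ (div_pos hρ h1) v).2 hv
  · rintro ⟨hx, hxC⟩
    rw [mem_ball_iff_norm] at hx
    have h2 : 0 < ρ - ‖x - a‖ := by linarith
    have h1 : 0 < 1 / (ρ - ‖x - a‖) := by positivity
    refine ⟨(1 / (ρ - ‖x - a‖)) • (x - a), (hC _ h1 _).2 hxC, ?_⟩
    have h3 : ρ / (1 + ‖(1 / (ρ - ‖x - a‖)) • (x - a)‖) = ρ - ‖x - a‖ := by
      rw [norm_smul, Real.norm_eq_abs, abs_of_pos h1]
      field_simp
      ring
    rw [radial, h3, smul_smul, mul_one_div_cancel h2.ne', one_smul, add_sub_cancel]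

theorem one_lt_rank_E3 : 1 < Module.rank ℝ E3 := by
  rw [← Module.finrank_eq_rank ℝ E3]
  simp

theorem isPreconnected_punctured_ball (a : E3) {ρ : ℝ} (hρ : 0 < ρ) :
    IsPreconnected (Metric.ball a ρ \ {a}) := by
  have h := radial_image a hρ (C := {0}ᶜ) (fun c hc v => by simp [hc.ne'])
  have h2 : IsPreconnected ({0}ᶜ : Set E3) :=
    (isConnected_compl_singleton_of_one_lt_rank one_lt_rank_E3 0).isPreconnected
  have h3 := h2.image _ (continuous_radial a ρ).continuousOn
  rw [h] at h3
  convert h3 using 1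
  ext x
  simp [sub_eq_zero]

/-- The span of `e` has codimension at least two in `ℝ³`, so its complement is connected, and it is
stable under scaling. -/
theorem isPreconnected_ball_diff_line (a : E3) {ρ : ℝ} (hρ : 0 < ρ) (e : E3) :
    IsPreconnected {x | x ∈ Metric.ball a ρ ∧ ∀ s : ℝ, x - a ≠ s • e} := by
  have h := radial_image a hρ (C := {v | ∀ s : ℝ, v ≠ s • e}) (fun c hc v => by
    constructor
    · intro h s hs
      exact h (c * s) (by rw [hs, smul_smul])
    · intro h s hs
      refine h (c⁻¹ * s) ?_
      rw [← smul_smul, ← hs, smul_smul, inv_mul_cancel₀ hc.ne', one_smul])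
  have h2 : IsPreconnected {v : E3 | ∀ s : ℝ, v ≠ s • e} := by
    have hr : 1 < Module.rank ℝ (E3 ⧸ Submodule.span ℝ {e}) := by
      have h1 := Submodule.finrank_quotient_add_finrank (Submodule.span ℝ {e})
      have h2 : Module.finrank ℝ (Submodule.span ℝ ({e} : Set E3)) ≤ 1 := by
        have := finrank_span_le_card (R := ℝ) ({e} : Set E3)
        simpa using this
      rw [← Module.finrank_eq_rank]
      have h3 : Module.finrank ℝ E3 = 3 := by simp
      have : 1 < Module.finrank ℝ (E3 ⧸ Submodule.span ℝ {e}) := by omega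
      exact_mod_cast this
    have := (isConnected_compl_of_one_lt_codim hr).isPreconnected
    convert this using 1
    ext v
    simp only [mem_ofPred_eq, mem_compl_iff, SetLike.mem_coe, Submodule.mem_span_singleton]
    exact ⟨fun h ⟨s, hs⟩ => h s hs.symm, fun h s hs => h ⟨s, hs.symm⟩⟩
  have h3 := h2.image _ (continuous_radial a ρ).continuousOn
  rw [h] at h3
  exact h3

theorem isClosed_ray (a e : E3) (he : e ≠ 0) : IsClosed {x : E3 | ∃ s : ℝ, 0 ≤ s ∧ x - a = s • e} := by
  have h : IsClosedEmbedding fun s : ℝ => s • e := isClosedEmbedding_smul_left he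
  have h1 : IsClosed ((fun s : ℝ => s • e) '' Ici 0) := h.isClosedMap _ isClosed_Ici
  have h2 : {x : E3 | ∃ s : ℝ, 0 ≤ s ∧ x - a = s • e} =
      (fun x => x - a) ⁻¹' ((fun s : ℝ => s • e) '' Ici 0) := by
    ext x
    simp only [mem_ofPred_eq, mem_preimage, mem_image, mem_Ici]
    exact ⟨fun ⟨s, h, h'⟩ => ⟨s, h, h'.symm⟩, fun ⟨s, h, h'⟩ => ⟨s, h, h'.symm⟩⟩
  rw [h2]
  exact h1.preimage (by fun_prop)

/-- A ball slit along a ray is star-shaped. -/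
theorem Coc_ball_slit_le (a e : E3) {ρ : ℝ} (he : ‖e‖ = ρ / 2) (hρ : 0 < ρ) :
    Coc (Metric.ball a ρ ∩ {x : E3 | ∃ s : ℝ, 0 ≤ s ∧ x - a = s • e}ᶜ) ≤
      Ex (Metric.ball a ρ ∩ {x : E3 | ∃ s : ℝ, 0 ≤ s ∧ x - a = s • e}ᶜ) := by
  have he0 : e ≠ 0 := by
    intro h
    rw [h, norm_zero] at he
    linarith
  -- The centre lies opposite to the slit: a segment from it that hit the slit would have to end on
  -- the slit.
  refine StarConvex.Coc_le_Ex (o := a - e) ?_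
  rintro x ⟨hx, hxr⟩ α β hα hβ hαβ
  refine ⟨convex_ball a ρ ?_ hx hα hβ hαβ, ?_⟩
  · rw [mem_ball_iff_norm, sub_sub_cancel_left, norm_neg, he]; linarith
  · rintro ⟨s, hs, h⟩
    have h1 : β • (x - a) = (s + α) • e := by
      have : α • (a - e) + β • x - a = β • (x - a) - α • e := by
        have h2 : a = α • a + β • a := by rw [← add_smul, hαβ, one_smul]
        nth_rewrite 2 [h2]
        module
      rw [this] at h
      rw [add_smul, ← h]; abel
    rcases eq_or_lt_of_le hβ with h0 | h0
    · rw [← h0, zero_smul] at h1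
      have : s + α ≠ 0 := by linarith
      exact (smul_ne_zero this he0) h1.symm
    · refine hxr ⟨(s + α) / β, by positivity, ?_⟩
      rw [div_eq_inv_mul, ← smul_smul, ← h1, smul_smul, inv_mul_cancel₀ h0.ne', one_smul]

/-- The vanishing of `H¹(S²)` in disguise. The punctured ball is the union of the balls slit along
two opposite rays; both are star-shaped, and they overlap in the ball minus a line, which is
connected. -/
theorem Coc_punctured_ball_le (a : E3) {ρ : ℝ} (hρ : 0 < ρ) :
    Coc (Metric.ball a ρ \ {a}) ≤ Ex (Metric.ball a ρ \ {a}) := by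
  intro φ hφ
  set e : E3 := EuclideanSpace.single 0 (ρ / 2)
  have he : ‖e‖ = ρ / 2 := by simp [e, abs_of_pos hρ]
  have he0 : e ≠ 0 := by
    intro h
    rw [h, norm_zero] at he
    linarith
  have he' : ‖-e‖ = ρ / 2 := by rw [norm_neg, he]
  have hsub : ∀ e' : E3, Metric.ball a ρ ∩ {x : E3 | ∃ s : ℝ, 0 ≤ s ∧ x - a = s • e'}ᶜ ⊆
      Metric.ball a ρ \ {a} := by
    rintro e' x ⟨hx, hxr⟩
    refine ⟨hx, ?_⟩
    rintro rfl
    exact hxr ⟨0, le_rfl, by simp⟩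
  have h1 := Coc_ball_slit_le a e he hρ (Coc_mono (hsub e) hφ)
  have h2 := Coc_ball_slit_le a (-e) he' hρ (Coc_mono (hsub (-e)) hφ)
  have h3 := Ex_union (isClosed_ray a e he0).isOpen_compl
    (isClosed_ray a (-e) (neg_ne_zero.2 he0)).isOpen_compl ?_ h1 h2
  · refine Ex_mono ?_ h3
    rintro x ⟨hx, hxa⟩
    refine ⟨hx, ?_⟩
    by_contra hcon
    rw [← compl_inter, notMem_compl_iff] at hcon
    obtain ⟨⟨s, hs, h⟩, s', hs', h'⟩ := hcon
    have : (s + s') • e = 0 := by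
      rw [add_smul, ← h, h', smul_neg, neg_add_cancel]
    have h0 : s + s' = 0 := (smul_eq_zero.1 this).resolve_right he0
    have : s = 0 := by linarith
    rw [this, zero_smul, sub_eq_zero] at h
    exact hxa h
  · convert isPreconnected_ball_diff_line a hρ e using 1
    ext x
    constructor
    · rintro ⟨⟨hx, h1⟩, h2⟩
      refine ⟨hx, fun s hs => ?_⟩
      rcases le_total 0 s with h | h
      · exact h1 ⟨s, h, hs⟩
      · exact h2 ⟨-s, by linarith, by rw [hs]; module⟩
    · rintro ⟨hx, h⟩
      refine ⟨⟨hx, fun ⟨s, _, hs⟩ => h s hs⟩, fun ⟨s, _, hs⟩ => h (-s) (by rw [hs]; module)⟩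

end PuncturedBall

/-! ### Removing points with simply connected links -/

section Removal

variable {Z : Type*} [TopologicalSpace Z]

theorem nhdsWithin_inter_open {S U : Set Z} (hU : IsOpen U) {x : Z} (hx : x ∈ U) :
    𝓝[S ∩ U] x = 𝓝[S] x :=
  nhdsWithin_inter_of_mem' (mem_nhdsWithin_of_mem_nhds (hU.mem_nhds hx))

/-- Removing finitely many points with simply connected links does not change the first
cohomology. -/
theorem nonempty_H1_equiv_diff {S P : Set Z} (hP : IsClosed P) (hPS : P ⊆ S)
    (hlink : ∀ p ∈ P, ∀ O ∈ 𝓝 p, ∃ U, IsOpen U ∧ p ∈ U ∧ U ⊆ O ∧ U ∩ P ⊆ {p} ∧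
      IsClosed ({p} : Set Z) ∧
      IsPreconnected ((S \ P) ∩ U) ∧ Coc ((S \ P) ∩ U) ≤ Ex ((S \ P) ∩ U)) :
    Nonempty (H1 S ≃ₗ[ℝ] H1 (S \ P)) := by
  classical
  have hnh : ∀ x ∉ P, 𝓝[S \ P] x = 𝓝[S] x := fun x hx =>
    nhdsWithin_inter_open hP.isOpen_compl hx
  let R : Coc S →ₗ[ℝ] Coc (S \ P) := Submodule.inclusion (Coc_mono sdiff_subset)
  refine nonempty_H1_equiv_of_surjective ((Submodule.mkQ _).comp R) ?_ ?_
  · intro q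
    obtain ⟨ψ, rfl⟩ := Submodule.mkQ_surjective _ q
    choose! U hU hpU hUO hUP hpc hpre hexU using fun p (hp : p ∈ P) =>
      hlink p hp univ Filter.univ_mem
    choose! k hk using fun p (hp : p ∈ P) =>
      (hexU p hp (Coc_mono inter_subset_left ψ.2) : ∃ k, IsPrim _ ψ.1 k)
    -- The cocycle is extended over a removed point `p` by a primitive `k p` on its punctured
    -- neighbourhood, read as the increment from `p`.
    let φ : Z → Z → ℝ := fun x y => if x ∈ P then (if y = x then 0 else k x y) else ψ.1 x y
    have hφ : φ ∈ Coc S := by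
      intro x hx
      by_cases hxP : x ∈ P
      · filter_upwards [self_mem_nhdsWithin,
          mem_nhdsWithin_of_mem_nhds ((hU x hxP).mem_nhds (hpU x hxP))] with y hyS hyU
        by_cases hyx : y = x
        · subst hyx
          exact Filter.Eventually.of_forall fun z => by simp [φ, hxP]
        · have hyP : y ∉ P := fun h => hyx (hUP x hxP ⟨hyU, h⟩)
          have h1 := hk x hxP y ⟨⟨hyS, hyP⟩, hyU⟩
          rw [nhdsWithin_inter_open (hU x hxP) hyU, hnh y hyP] at h1
          filter_upwards [h1, mem_nhdsWithin_of_mem_nhds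
            ((hpc x hxP).isOpen_compl.mem_nhds hyx)] with z hz hzx
          have hzx' : z ≠ x := hzx
          simp only [φ, hxP, hyP, hyx, hzx', if_true, if_false, hz]
          ring
      · have h1 := ψ.2 x ⟨hx, hxP⟩
        rw [hnh x hxP] at h1
        filter_upwards [h1, mem_nhdsWithin_of_mem_nhds (hP.isOpen_compl.mem_nhds hxP)]
          with y hy hyP
        have hyP' : y ∉ P := hyP
        rw [hnh y hyP] at hy
        simpa only [φ, hxP, hyP', if_false] using hy
    refine ⟨⟨φ, hφ⟩, ?_⟩
    refine (Submodule.Quotient.eq _).2 ⟨0, fun x hx => ?_⟩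
    exact Filter.Eventually.of_forall fun y => by simp [R, φ, hx.2]
  · intro φ
    simp only [LinearMap.comp_apply, Submodule.mkQ_apply, Submodule.Quotient.mk_eq_zero]
    constructor
    · rintro ⟨h, hh⟩
      have hh' : IsPrim (S \ P) φ.1 h := hh
      -- On the connected punctured neighbourhood the primitive `h` differs from `φ p` by a constant
      -- `c`. Since `φ p p = 0`, that constant is the right value at `p`.
      have hloc : ∀ p ∈ P, ∃ U, IsOpen U ∧ p ∈ U ∧ U ∩ P ⊆ {p} ∧ IsPrim (U ∩ S) φ.1 (φ.1 p) ∧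
          ∃ c, ∀ y ∈ (S \ P) ∩ U, h y = φ.1 p y + c := by
        intro p hp
        obtain ⟨O, hO, hpO, hprim⟩ := Coc.exists_local_prim φ.2 (hPS hp)
        obtain ⟨U, hU, hpU, hUO, hUP, -, hpre, -⟩ := hlink p hp O (hO.mem_nhds hpO)
        have hprim' : IsPrim (U ∩ S) φ.1 (φ.1 p) := hprim.mono (inter_subset_inter_left _ hUO)
        refine ⟨U, hU, hpU, hUP, hprim', ?_⟩
        rcases ((S \ P) ∩ U).eq_empty_or_nonempty with h0 | ⟨w, hw⟩
        · exact ⟨0, by simp [h0]⟩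
        · refine ⟨h w - φ.1 p w, fun y hy => ?_⟩
          have hs : (S \ P) ∩ U ⊆ U ∩ S := fun z hz => ⟨hz.2, hz.1.1⟩
          have := (hh'.mono inter_subset_left).sub_const hpre (hprim'.mono hs) hw hy
          linarith
      choose! U hU hpU hUP hprim c hc using hloc
      refine ⟨fun x => if x ∈ P then c x else h x, ?_⟩
      refine IsPrim.of_local fun x hx => ?_
      by_cases hxP : x ∈ P
      · refine ⟨U x ∩ S, ?_, _, hprim x hxP, ⟨hpU x hxP, hx⟩, c x, ?_⟩
        · exact mem_nhdsWithin.2 ⟨U x, hU x hxP, hpU x hxP, subset_rfl⟩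
        · rintro y ⟨hyU, hyS⟩
          by_cases hyP : y ∈ P
          · have : y = x := hUP x hxP ⟨hyU, hyP⟩
            subst this
            simp [hyP, Coc.self_eq_zero φ.2 hyS]
          · simp [hyP, hc x hxP y ⟨⟨hyS, hyP⟩, hyU⟩]
      · refine ⟨S \ P, ?_, h, hh', ⟨hx, hxP⟩, 0, fun y hy => by simp [hy.2]⟩
        exact Filter.inter_mem self_mem_nhdsWithin
          (mem_nhdsWithin_of_mem_nhds (hP.isOpen_compl.mem_nhds hxP))
    · rintro ⟨h, hh⟩
      exact ⟨h, hh.mono sdiff_subset⟩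

end Removal


/-! ### Tori as quotients of `ℝ³` -/

section TorusChart

variable {Z : Type*} [TopologicalSpace Z]

/-- The standard basis vectors of `ℝ³`. -/
noncomputable abbrev stdVec (i : Fin 3) : E3 := EuclideanSpace.single i 1

/-- `q` exhibits `T` as the quotient of `ℝ³` by a subgroup of finite index of `ℤ³`. -/
structure IsTorusChart (T : Set Z) (q : E3 → Z) (N : ℕ) : Prop where
  continuous : Continuous q
  range_eq : range q = T
  map_nhds : ∀ x, Filter.map q (𝓝 x) = 𝓝[T] (q x)
  pos : 0 < N
  period : ∀ i x, q (x + (N : ℝ) • stdVec i) = q x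
  deck : ∀ x y, q x = q y → ∀ z, q (z + (y - x)) = q z
  integral : ∀ x y, q x = q y → ∀ i, ∃ k : ℤ, y i - x i = k

variable {T : Set Z} {q : E3 → Z} {N : ℕ}

theorem IsTorusChart.mem (h : IsTorusChart T q N) (x : E3) : q x ∈ T := h.range_eq ▸ mem_range_self x

theorem IsTorusChart.isPrim_iff (h : IsTorusChart T q N) {φ : Z → Z → ℝ} {u : Z → ℝ} :
    IsPrim T φ u ↔ IsPrim univ (fun a b => φ (q a) (q b)) (u ∘ q) := by
  constructor
  · exact fun hu => hu.pullback h.continuous.continuousOn fun x _ => h.mem x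
  · intro hu x hx
    obtain ⟨a, rfl⟩ := (h.range_eq ▸ hx : x ∈ range q)
    rw [← h.map_nhds, Filter.eventually_map]
    simpa using hu a (mem_univ a)

theorem IsTorusChart.mem_Coc_iff (h : IsTorusChart T q N) {φ : Z → Z → ℝ} :
    φ ∈ Coc T ↔ (fun a b => φ (q a) (q b)) ∈ Coc (univ : Set E3) := by
  constructor
  · exact fun hu => Coc.pullback hu h.continuous.continuousOn fun x _ => h.mem x
  · intro hu x hx
    obtain ⟨a, rfl⟩ := (h.range_eq ▸ hx : x ∈ range q)
    rw [← h.map_nhds, Filter.eventually_map]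
    have := hu a (mem_univ a)
    rw [nhdsWithin_univ] at this
    filter_upwards [this] with b hb
    rw [nhdsWithin_univ] at hb
    rw [← h.map_nhds, Filter.eventually_map]
    exact hb

theorem Coc_univ_E3_le : Coc (univ : Set E3) ≤ Ex univ :=
  StarConvex.Coc_le_Ex (o := 0) (convex_univ (mem_univ _))

/-- The translations under which `q` is invariant. -/
def periods (q : E3 → Z) : AddSubgroup E3 where
  carrier := {v | ∀ z, q (z + v) = q z}
  add_mem' := fun {a b} ha hb z => by rw [← add_assoc, hb, ha]
  zero_mem' := by simp
  neg_mem' := fun {a} ha z => by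
    have := ha (z + -a)
    rw [neg_add_cancel_right] at this
    exact this.symm

/-- The first cohomology of a 3-torus is `ℝ³`. -/
theorem IsTorusChart.nonempty_H1_equiv (h : IsTorusChart T q N) :
    Nonempty (H1 T ≃ₗ[ℝ] (Fin 3 → ℝ)) := by
  classical
  -- The primitive on `ℝ³` of the pulled-back cocycle, vanishing at `0`. It is additive along
  -- periods (`hshift`), and its values on the vectors `N eᵢ` give the isomorphism.
  let f : (Z → Z → ℝ) → E3 → ℝ := fun φ => prim univ 0 (fun a b => φ (q a) (q b))
  have hex : ∀ φ ∈ Coc T, (fun a b => φ (q a) (q b)) ∈ Ex (univ : Set E3) := fun φ hφ =>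
    Coc_univ_E3_le (h.mem_Coc_iff.1 hφ)
  have hf : ∀ φ ∈ Coc T, IsPrim univ (fun a b => φ (q a) (q b)) (f φ) := fun φ hφ =>
    isPrim_prim 0 (hex φ hφ)
  have hf_eq : ∀ φ (u : E3 → ℝ), IsPrim univ (fun a b => φ (q a) (q b)) u → ∀ x,
      f φ x = u x - u 0 := fun φ u hu x =>
    prim_eq isPreconnected_univ (mem_univ _) (mem_univ _) hu
  have hshift : ∀ φ ∈ Coc T, ∀ v ∈ periods q, ∀ x, f φ (x + v) = f φ x + f φ v := by
    intro φ hφ v hv x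
    have h1 : IsPrim univ (fun a b => φ (q a) (q b)) (fun x => f φ (x + v)) := by
      have := (hf φ hφ).pullback (g := fun x : E3 => x + v) (S' := univ) (by fun_prop)
        fun _ _ => mem_univ _
      simp only [hv _] at this
      exact this
    have h2 := hf_eq φ _ h1 x
    rw [zero_add] at h2
    linarith
  let L : Coc T →ₗ[ℝ] (Fin 3 → ℝ) :=
    { toFun := fun φ i => f φ.1 ((N : ℝ) • stdVec i)
      map_add' := fun φ ψ => by
        funext i
        exact prim_add isPreconnected_univ (mem_univ _) (mem_univ _) (hex _ φ.2) (hex _ ψ.2)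
      map_smul' := fun r φ => by
        funext i
        exact prim_smul isPreconnected_univ (mem_univ _) (mem_univ _) (hex _ φ.2) r }
  refine nonempty_H1_equiv_of_surjective L ?_ ?_
  · intro v
    -- The linear form with `ℓ (N eᵢ) = v i`.
    let ℓ : E3 →ₗ[ℝ] ℝ :=
      { toFun := fun w => ∑ i, v i / N * w i
        map_add' := fun a b => by
          simp [mul_add, Finset.sum_add_distrib]
        map_smul' := fun r a => by
          simp only [PiLp.smul_apply, smul_eq_mul, RingHom.id_apply, Finset.mul_sum]
          exact Finset.sum_congr rfl fun i _ => by ring }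
    have hs : ∀ x, ∃ a, x ∈ T → q a = x := fun x => by
      by_cases hx : x ∈ T
      · obtain ⟨a, ha⟩ := (h.range_eq ▸ hx : x ∈ range q)
        exact ⟨a, fun _ => ha⟩
      · exact ⟨0, fun h => absurd h hx⟩
    choose s hs using hs
    -- The form `ℓ` descends to the torus as a germ near the diagonal. The short vector `w` is
    -- unique: two candidates differ by an integral vector of norm less than one.
    let φ : Z → Z → ℝ := fun x y =>
      if hw : ∃ w : E3, ‖w‖ < 1 / 4 ∧ q (s x + w) = y then ℓ hw.choose else 0
    have hφ : ∀ a w : E3, ‖w‖ < 1 / 4 → φ (q a) (q (a + w)) = ℓ w := by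
      intro a w hw
      have h1 : q (s (q a)) = q a := hs _ (h.mem a)
      have h2 : q (s (q a) + w) = q (a + w) := by
        have := h.deck a (s (q a)) h1.symm (a + w)
        rw [← this]
        congr 1
        abel
      have hex : ∃ w' : E3, ‖w'‖ < 1 / 4 ∧ q (s (q a) + w') = q (a + w) := ⟨w, hw, h2⟩
      have h3 := hex.choose_spec
      have h4 : hex.choose = w := by
        have h5 := h.integral _ _ (h3.2.trans h2.symm)
        have h6 : ‖w - hex.choose‖ < 1 := by
          calc ‖w - hex.choose‖ ≤ ‖w‖ + ‖hex.choose‖ := norm_sub_le _ _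
            _ < 1 := by linarith [h3.1]
        ext i
        obtain ⟨k, hk⟩ := h5 i
        have h7 : |(k : ℝ)| < 1 := by
          rw [← hk]
          calc |(s (q a) + w) i - (s (q a) + hex.choose) i| = ‖(w - hex.choose) i‖ := by
                rw [Real.norm_eq_abs]; congr 1; simp
            _ ≤ ‖w - hex.choose‖ := PiLp.norm_apply_le _ i
            _ < 1 := h6
          
        have h8 : k = 0 := by
          have : |k| < 1 := by exact_mod_cast h7
          exact Int.abs_lt_one_iff.1 this
        rw [h8] at hk
        simp only [PiLp.add_apply, Int.cast_zero] at hk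
        linarith
      simp only [φ]
      rw [dif_pos hex, h4]
    have hprim : IsPrim univ (fun a b => φ (q a) (q b)) ℓ := by
      intro a _
      rw [nhdsWithin_univ]
      filter_upwards [Metric.ball_mem_nhds a (show (0 : ℝ) < 1 / 4 by norm_num)] with b hb
      have := hφ a (b - a) (by rwa [mem_ball_iff_norm] at hb)
      rw [add_sub_cancel] at this
      rw [this, map_sub]
    refine ⟨⟨φ, h.mem_Coc_iff.2 (Ex_le_Coc _ ⟨_, hprim⟩)⟩, ?_⟩
    funext i
    change f φ _ = _
    have hN : (N : ℝ) ≠ 0 := by exact_mod_cast h.pos.ne'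
    rw [hf_eq φ _ hprim]
    simp only [map_zero, sub_zero]
    change ∑ j, v j / N * ((N : ℝ) • stdVec i) j = v i
    rw [Finset.sum_eq_single i]
    · simp [hN]
    · intro j _ hji
      simp [hji]
    · simp
  · intro φ
    constructor
    · intro h0
      have hN : ∀ i, (N : ℝ) • stdVec i ∈ periods q := fun i x => h.period i x
      let F : periods q →+ ℝ :=
        { toFun := fun v => f φ.1 v
          map_zero' := by
            have := hf_eq φ.1 _ (hf φ.1 φ.2) 0
            simpa using this
          map_add' := fun v w => hshift φ.1 φ.2 w w.2 v }
      have hF : ∀ i, F ⟨_, hN i⟩ = 0 := fun i => congrFun h0 i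
      have hzero : ∀ x y, q x = q y → f φ.1 (y - x) = 0 := by
        intro x y hxy
        have hper : y - x ∈ periods q := fun z => h.deck x y hxy z
        choose k hk using h.integral x y hxy
        -- Periods are integral, so `N` times a period is an integral combination of the vectors `N
        -- eᵢ`. A homomorphism to `ℝ` killing those kills every period, and the primitive descends.
        have h1 : N • (⟨y - x, hper⟩ : periods q) = ∑ i, k i • ⟨_, hN i⟩ := by
          apply Subtype.ext
          rw [AddSubgroup.coe_nsmul, AddSubgroup.val_finsetSum]
          ext j
          simp only [AddSubgroup.coe_zsmul]
          rw [show (N • (y - x)) j = N * (y j - x j) by simp, hk j]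
          simp [Fin.sum_univ_three]
          fin_cases j <;> simp <;> ring
        have h2 := congrArg F h1
        rw [map_nsmul, map_sum] at h2
        simp only [map_zsmul, hF, smul_zero, Finset.sum_const_zero, nsmul_eq_mul] at h2
        have hN' : (N : ℝ) ≠ 0 := by exact_mod_cast h.pos.ne'
        exact (mul_eq_zero.1 h2).resolve_left hN'
      have hinv : ∀ x y, q x = q y → f φ.1 x = f φ.1 y := by
        intro x y hxy
        have h1 := hshift φ.1 φ.2 (y - x) (fun z => h.deck x y hxy z) x
        rw [hzero x y hxy, add_sub_cancel, add_zero] at h1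
        exact h1.symm
      have hg : ∃ g : Z → ℝ, ∀ x, g (q x) = f φ.1 x := by
        refine ⟨Function.extend q (f φ.1) 0, fun x => ?_⟩
        have : Function.FactorsThrough (f φ.1) q := fun a b hab => hinv a b hab
        exact this.extend_apply 0 x
      obtain ⟨g, hg⟩ := hg
      refine ⟨g, h.isPrim_iff.2 ?_⟩
      have : g ∘ q = f φ.1 := funext hg
      rw [this]
      exact hf φ.1 φ.2
    · rintro ⟨g, hg⟩
      funext i
      change f φ.1 _ = 0
      rw [hf_eq φ.1 _ (h.isPrim_iff.1 hg)]
      simp only [Function.comp]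
      have := h.period i 0
      rw [zero_add] at this
      rw [this, sub_self]

/-- Two points of such a ball differ by less than one in each coordinate, while points with the same
image differ by integers. -/
theorem IsTorusChart.injOn_ball (h : IsTorusChart T q N) (a : E3) {ρ : ℝ} (hρ : ρ ≤ 1 / 2) :
    InjOn q (Metric.ball a ρ) := by
  intro x hx y hy hxy
  rw [mem_ball_iff_norm] at hx hy
  have h1 : ‖y - x‖ < 1 := by
    calc ‖y - x‖ = ‖(y - a) - (x - a)‖ := by congr 1; abel
      _ ≤ ‖y - a‖ + ‖x - a‖ := norm_sub_le _ _
      _ < 1 := by linarith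
  ext i
  obtain ⟨k, hk⟩ := h.integral x y hxy i
  have h2 : |(k : ℝ)| < 1 := by
    rw [← hk]
    calc |y i - x i| = ‖(y - x) i‖ := by rw [Real.norm_eq_abs]; simp
      _ ≤ ‖y - x‖ := PiLp.norm_apply_le _ i
      _ < 1 := h1
  have h3 : k = 0 := by
    have : |k| < 1 := by exact_mod_cast h2
    exact Int.abs_lt_one_iff.1 this
  rw [h3, Int.cast_zero] at hk
  linarith

theorem IsTorusChart.image_mem_nhdsWithin (h : IsTorusChart T q N) {O : Set E3} {a : E3}
    (hO : O ∈ 𝓝 a) : q '' O ∈ 𝓝[T] (q a) := by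
  rw [← h.map_nhds]
  exact Filter.image_mem_map hO

theorem IsTorusChart.map_nhdsWithin (h : IsTorusChart T q N) {O : Set E3} (hO : IsOpen O)
    {a : E3} (ha : a ∈ O) : Filter.map q (𝓝 a) = 𝓝[q '' O] (q a) := by
  rw [h.map_nhds]
  refine le_antisymm ?_ (nhdsWithin_mono _ ?_)
  · exact le_inf nhdsWithin_le_nhds
      (Filter.le_principal_iff.2 (h.image_mem_nhdsWithin (hO.mem_nhds ha)))
  · rintro _ ⟨b, _, rfl⟩
    exact h.mem b

/-- Small open subsets of `ℝ³` have the same cohomological properties as their images. -/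
theorem IsTorusChart.Coc_image_le (h : IsTorusChart T q N) {O : Set E3} (hO : IsOpen O)
    (hinj : InjOn q O) (hex : Coc O ≤ Ex O) : Coc (q '' O) ≤ Ex (q '' O) := by
  classical
  intro φ hφ
  obtain ⟨u, hu⟩ := hex (Coc.pullback hφ h.continuous.continuousOn (mapsTo_image q O))
  have hv : ∃ v : Z → ℝ, ∀ a ∈ O, v (q a) = u a := by
    refine ⟨fun z => if hz : ∃ a ∈ O, q a = z then u hz.choose else 0, fun a ha => ?_⟩
    have hz : ∃ b ∈ O, q b = q a := ⟨a, ha, rfl⟩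
    have := hinj hz.choose_spec.1 ha hz.choose_spec.2
    simp only [dif_pos hz, this]
  obtain ⟨v, hv⟩ := hv
  refine ⟨v, ?_⟩
  rintro _ ⟨a, ha, rfl⟩
  rw [← h.map_nhdsWithin hO ha, Filter.eventually_map]
  have h1 := hu a ha
  rw [hO.nhdsWithin_eq ha] at h1
  filter_upwards [h1, hO.mem_nhds ha] with b hb hbO
  rw [hb, hv a ha, hv b hbO]

theorem IsTorusChart.countable_preimage (h : IsTorusChart T q N) (p : Z) :
    (q ⁻¹' {p}).Countable := by
  rcases (q ⁻¹' {p}).eq_empty_or_nonempty with h0 | ⟨a, ha⟩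
  · rw [h0]; exact countable_empty
  refine (countable_range fun k : Fin 3 → ℤ => a + WithLp.toLp 2 fun i => (k i : ℝ)).mono ?_
  intro x hx
  have hxa : q a = q x := by
    rw [mem_preimage, mem_singleton_iff] at ha hx
    rw [ha, hx]
  choose k hk using h.integral a x hxa
  refine ⟨k, ?_⟩
  ext i
  simp only [PiLp.add_apply]
  rw [← hk i]
  ring

/-- The fibres of `q` are countable, and the complement of a countable subset of `ℝ³` is connected.
-/
theorem IsTorusChart.isPreconnected_diff (h : IsTorusChart T q N) {P : Set Z} (hP : P.Countable) :
    IsPreconnected (T \ P) := by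
  have h1 : (q ⁻¹' P).Countable := by
    rw [← biUnion_preimage_singleton]
    exact hP.biUnion fun p _ => h.countable_preimage p
  have h2 := (h1.isConnected_compl_of_one_lt_rank one_lt_rank_E3).isPreconnected.image q
    h.continuous.continuousOn
  convert h2 using 1
  rw [← h.range_eq, ← preimage_compl, image_preimage_eq_inter_range, inter_comm]
  rfl

theorem IsTorusChart.isPreconnected (h : IsTorusChart T q N) : IsPreconnected T := by
  simpa using h.isPreconnected_diff countable_empty

theorem IsTorusChart.subset_closure_diff (h : IsTorusChart T q N) {P : Set Z} (hP : P.Countable) :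
    T ⊆ closure (T \ P) := by
  have h1 : (q ⁻¹' P).Countable := by
    rw [← biUnion_preimage_singleton]
    exact hP.biUnion fun p _ => h.countable_preimage p
  have h2 : Dense (q ⁻¹' P)ᶜ := h1.dense_compl ℝ
  rw [← h.range_eq]
  rintro _ ⟨x, rfl⟩
  refine closure_mono ?_ (image_closure_subset_closure_image h.continuous
    (mem_image_of_mem q (h2 x)))
  rintro _ ⟨y, hy, rfl⟩
  exact ⟨mem_range_self y, hy⟩

theorem IsTorusChart.exists_isOpen_inter_eq (h : IsTorusChart T q N) {O : Set E3}
    (hO : IsOpen O) : ∃ U, IsOpen U ∧ T ∩ U = q '' O := by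
  have : ∀ z ∈ q '' O, ∃ U, IsOpen U ∧ z ∈ U ∧ U ∩ T ⊆ q '' O := by
    rintro _ ⟨b, hb, rfl⟩
    obtain ⟨U, hU, hbU, hUT⟩ := mem_nhdsWithin.1
      (h.image_mem_nhdsWithin (hO.mem_nhds hb))
    exact ⟨U, hU, hbU, hUT⟩
  choose! U hU hzU hUT using this
  refine ⟨⋃ z ∈ q '' O, U z, isOpen_biUnion hU, ?_⟩
  apply Subset.antisymm
  · rintro z ⟨hzT, hz⟩
    obtain ⟨w, hw, hzw⟩ := mem_iUnion₂.1 hz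
    exact hUT w hw ⟨hzw, hzT⟩
  · intro z hz
    refine ⟨?_, mem_iUnion₂.2 ⟨z, hz, hzU z hz⟩⟩
    obtain ⟨b, _, rfl⟩ := hz
    exact h.mem b

/-- Punctured neighbourhoods in a 3-torus. -/
theorem IsTorusChart.exists_link (h : IsTorusChart T q N) [T1Space Z] {P : Set Z} (hP : P.Finite)
    {p : Z} (hp : p ∈ P) (hpT : p ∈ T) {O : Set Z} (hO : O ∈ 𝓝 p) :
    ∃ U, IsOpen U ∧ p ∈ U ∧ U ⊆ O ∧ U ∩ P ⊆ {p} ∧ ((T \ P) ∩ U).Nonempty ∧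
      IsPreconnected ((T \ P) ∩ U) ∧ Coc ((T \ P) ∩ U) ≤ Ex ((T \ P) ∩ U) := by
  obtain ⟨a, rfl⟩ := (h.range_eq ▸ hpT : p ∈ range q)
  have h1 : O ∩ (P \ {q a})ᶜ ∈ 𝓝 (q a) := Filter.inter_mem hO
    ((hP.subset sdiff_subset).isClosed.isOpen_compl.mem_nhds (by simp))
  obtain ⟨O', hO'O, hO', haO'⟩ := mem_nhds_iff.1 h1
  obtain ⟨ρ, hρ, hball⟩ := Metric.mem_nhds_iff.1
    (h.continuous.continuousAt.preimage_mem_nhds (hO'.mem_nhds haO'))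
  set B := Metric.ball a (min ρ (1 / 2)) with hB
  have hρ' : 0 < min ρ (1 / 2) := lt_min hρ (by norm_num)
  have hBO : q '' B ⊆ O' := by
    rintro _ ⟨b, hb, rfl⟩
    exact hball (Metric.ball_subset_ball (min_le_left _ _) hb)
  have haB : a ∈ B := Metric.mem_ball_self hρ'
  have hinj : InjOn q B := h.injOn_ball a (min_le_right _ _)
  obtain ⟨U, hU, hTU⟩ := h.exists_isOpen_inter_eq (O := B) Metric.isOpen_ball
  have hUP : U ∩ O' ∩ P ⊆ {q a} := by
    rintro z ⟨⟨_, hz⟩, hzP⟩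
    by_contra hza
    exact (hO'O hz).2 ⟨hzP, hza⟩
  have hkey : (T \ P) ∩ (U ∩ O') = q '' (B \ {a}) := by
    apply Subset.antisymm
    · rintro z ⟨⟨hzT, hzP⟩, hzU, _⟩
      obtain ⟨b, hb, rfl⟩ := (hTU ▸ (⟨hzT, hzU⟩ : z ∈ T ∩ U) : z ∈ q '' B)
      exact ⟨b, ⟨hb, by rintro rfl; exact hzP hp⟩, rfl⟩
    · rintro _ ⟨b, ⟨hb, hba⟩, rfl⟩
      have hbU : q b ∈ T ∩ U := hTU ▸ mem_image_of_mem q hb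
      have hbO : q b ∈ O' := hBO (mem_image_of_mem q hb)
      refine ⟨⟨hbU.1, fun hbP => hba ?_⟩, hbU.2, hbO⟩
      exact hinj hb haB (hUP ⟨⟨hbU.2, hbO⟩, hbP⟩)
  have haU : q a ∈ T ∩ U := hTU ▸ mem_image_of_mem q haB
  refine ⟨U ∩ O', hU.inter hO', ⟨haU.2, haO'⟩, fun z hz => (hO'O hz.2).1, hUP, ?_, ?_, ?_⟩
  · rw [hkey, image_nonempty]
    have hne : (𝓝[≠] a).NeBot := inferInstance
    obtain ⟨b, hb1, hb2⟩ := (Filter.nonempty_of_mem (Filter.inter_mem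
      (mem_nhdsWithin_of_mem_nhds (Metric.isOpen_ball.mem_nhds haB)) self_mem_nhdsWithin) :
        (B ∩ {a}ᶜ).Nonempty)
    exact ⟨b, hb1, hb2⟩
  · rw [hkey]
    exact (isPreconnected_punctured_ball a hρ').image q h.continuous.continuousOn
  · rw [hkey]
    exact h.Coc_image_le (Metric.isOpen_ball.sdiff isClosed_singleton)
      (hinj.mono sdiff_subset) (Coc_punctured_ball_le a hρ')

/-- Removing finitely many points from a 3-torus does not change its first cohomology. -/
theorem IsTorusChart.nonempty_H1_diff_equiv (h : IsTorusChart T q N) [T1Space Z] {P : Set Z}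
    (hP : P.Finite) : Nonempty (H1 (T \ P) ≃ₗ[ℝ] (Fin 3 → ℝ)) := by
  have hPT : (T ∩ P).Finite := hP.subset inter_subset_right
  obtain ⟨e⟩ := nonempty_H1_equiv_diff (S := T) (P := T ∩ P) hPT.isClosed inter_subset_left
    fun p hp O hO => by
      obtain ⟨U, h1, h2, h3, h4, _, h6, h7⟩ := h.exists_link hPT hp hp.1 hO
      exact ⟨U, h1, h2, h3, h4, isClosed_singleton, h6, h7⟩
  rw [sdiff_self_inter] at e
  obtain ⟨e'⟩ := h.nonempty_H1_equiv
  exact ⟨e.symm.trans e'⟩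

end TorusChart


/-! ### Spaces glued at points and their dual graph -/

section Wedge

variable {Z V E : Type*} [TopologicalSpace Z]

/-- The coboundary of a multigraph with edges `E` joining `s e` to `t e`. -/
def graphCoboundary (s t : E → V) : (V → ℝ) →ₗ[ℝ] (E → ℝ) where
  toFun k e := k (s e) - k (t e)
  map_add' a b := by funext e; simp; ring
  map_smul' r a := by funext e; simp; ring

/-- The sets `T v`, closed in their union, meet exactly in the points `p e`, `p e` being a point of `T (s e)` and
`T (t e)` only. -/
structure IsWedge (T : V → Set Z) (p : E → Z) (s t : E → V) : Prop where
  mem_of_mem_closure : ∀ v, ∀ x ∈ ⋃ w, T w, x ∈ closure (T v) → x ∈ T v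
  injective : Function.Injective p
  mem_source : ∀ e, p e ∈ T (s e)
  mem_target : ∀ e, p e ∈ T (t e)
  ne : ∀ e, s e ≠ t e
  exists_edge : ∀ v w x, v ≠ w → x ∈ T v → x ∈ T w →
    ∃ e, p e = x ∧ ((s e = v ∧ t e = w) ∨ (s e = w ∧ t e = v))

variable {T : V → Set Z} {p : E → Z} {s t : E → V}

/-- For finitely many relatively closed pieces the neighbourhood filter of the union is the supremum
of those of the pieces through the point. -/
theorem isPrim_iUnion_iff [Finite V]
    (hT : ∀ v, ∀ x ∈ ⋃ w, T w, x ∈ closure (T v) → x ∈ T v) {φ : Z → Z → ℝ} {h : Z → ℝ} :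
    IsPrim (⋃ v, T v) φ h ↔ ∀ v, IsPrim (T v) φ h := by
  constructor
  · exact fun H v => H.mono (subset_iUnion T v)
  · intro H x hxS
    rw [nhdsWithin_iUnion, Filter.eventually_iSup]
    intro v
    by_cases hx : x ∈ T v
    · exact H v x hx
    · have : (closure (T v))ᶜ ∈ 𝓝 x :=
        isClosed_closure.isOpen_compl.mem_nhds fun h => hx (hT v x hxS h)
      filter_upwards [mem_nhdsWithin_of_mem_nhds this, self_mem_nhdsWithin] with y h1 h2
      exact absurd (subset_closure h2) h1

theorem IsWedge.eventually_notMem [Finite E] [T1Space Z] (_h : IsWedge T p s t) (x : Z) (A : Set Z) :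
    ∀ᶠ y in 𝓝[A] x, y = x ∨ y ∉ range p := by
  have : (range p \ {x})ᶜ ∈ 𝓝 x :=
    ((finite_range p).subset sdiff_subset).isClosed.isOpen_compl.mem_nhds (by simp)
  filter_upwards [mem_nhdsWithin_of_mem_nhds this] with y hy
  by_contra! hcon
  exact hy ⟨hcon.2, hcon.1⟩

theorem IsWedge.eq_of_mem (h : IsWedge T p s t) {x : Z} (hx : x ∉ range p) {v w : V}
    (hv : x ∈ T v) (hw : x ∈ T w) : v = w := by
  by_contra hne
  obtain ⟨e, he, _⟩ := h.exists_edge v w x hne hv hw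
  exact hx ⟨e, he⟩

theorem IsWedge.nhdsWithin_eq [Finite V] (h : IsWedge T p s t) {x : Z} (hx : x ∉ range p) {v : V}
    (hv : x ∈ T v) : 𝓝[⋃ v, T v] x = 𝓝[T v] x := by
  rw [nhdsWithin_iUnion]
  refine le_antisymm (iSup_le fun w => ?_) (le_iSup (fun v => 𝓝[T v] x) v)
  by_cases hw : x ∈ T w
  · rw [h.eq_of_mem hx hv hw]
  · have : 𝓝[T w] x = ⊥ := by
      by_contra hcon
      exact hw (h.mem_of_mem_closure w x (mem_iUnion.2 ⟨v, hv⟩)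
        (mem_closure_iff_nhdsWithin_neBot.2 ⟨hcon⟩))
    rw [this]
    exact bot_le

/-- One-cocycles on the pieces of a wedge can be glued. -/
theorem IsWedge.exists_glue [Finite V] [Finite E] [T1Space Z] (h : IsWedge T p s t)
    (c : V → Z → Z → ℝ) (hc : ∀ v, c v ∈ Coc (T v)) :
    ∃ φ ∈ Coc (⋃ v, T v), ∀ v, ∀ x ∈ T v, ∀ᶠ y in 𝓝[T v] x, φ x y = c v x y := by
  classical
  -- Near any point `x` the second argument is either `x` itself, where cocycles vanish, or not a
  -- node, and then it lies in a single piece. So the choice of a common piece is harmless.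
  let φ : Z → Z → ℝ := fun x y => if H : ∃ v, x ∈ T v ∧ y ∈ T v then c H.choose x y else 0
  have hself : ∀ x, φ x x = 0 := by
    intro x
    by_cases H : ∃ v, x ∈ T v ∧ x ∈ T v
    · simp only [φ, dif_pos H]
      exact Coc.self_eq_zero (hc _) H.choose_spec.1
    · simp only [φ, dif_neg H]
  have hφ : ∀ v, ∀ x ∈ T v, ∀ y ∈ T v, y = x ∨ y ∉ range p → φ x y = c v x y := by
    rintro v x hx y hy (rfl | hyp)
    · rw [hself, Coc.self_eq_zero (hc v) hx]
    · have H : ∃ v, x ∈ T v ∧ y ∈ T v := ⟨v, hx, hy⟩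
      simp only [φ, dif_pos H]
      rw [h.eq_of_mem hyp H.choose_spec.2 hy]
  have hev : ∀ v, ∀ x ∈ T v, ∀ᶠ y in 𝓝[T v] x, φ x y = c v x y := by
    intro v x hx
    filter_upwards [h.eventually_notMem x (T v), self_mem_nhdsWithin] with y h1 h2
    exact hφ v x hx y h2 h1
  refine ⟨φ, ?_, hev⟩
  intro x hxS
  rw [nhdsWithin_iUnion, Filter.eventually_iSup]
  intro v
  by_cases hx : x ∈ T v
  · filter_upwards [h.eventually_notMem x (T v), self_mem_nhdsWithin, hc v x hx,
      eventually_eventually_nhdsWithin.2 (hev v x hx)] with y h1 h2 h3 h4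
    rcases h1 with rfl | h1
    · exact Filter.Eventually.of_forall fun z => by rw [hself, zero_add]
    · rw [h.nhdsWithin_eq h1 h2]
      filter_upwards [h3, h4, hev v y h2] with z h5 h6 h7
      rw [h6, h7, h5, hφ v x hx y h2 (Or.inr h1)]
  · have : (closure (T v))ᶜ ∈ 𝓝 x :=
      isClosed_closure.isOpen_compl.mem_nhds fun h' => hx (h.mem_of_mem_closure v x hxS h')
    filter_upwards [mem_nhdsWithin_of_mem_nhds this, self_mem_nhdsWithin] with y h1 h2
    exact absurd (subset_closure h2) h1

/-- The first cohomology of a wedge of connected spaces. -/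
theorem IsWedge.nonempty_H1_equiv [Fintype V] [Finite E] [T1Space Z] (h : IsWedge T p s t)
    (hconn : ∀ v, IsPreconnected (T v)) (hne : ∀ v, (T v).Nonempty) :
    Nonempty (H1 (⋃ v, T v) ≃ₗ[ℝ]
      ((v : V) → H1 (T v)) × ((E → ℝ) ⧸ LinearMap.range (graphCoboundary s t))) := by
  classical
  have _ : Fintype E := Fintype.ofFinite E
  choose b hb using hne
  -- The normalized primitive is linear only on exact cocycles; extending it linearly to all
  -- functions makes the map `D` below defined everywhere.
  have hP : ∀ v, ∃ P : (Z → Z → ℝ) →ₗ[ℝ] (Z → ℝ), ∀ φ ∈ Ex (T v), ∀ x ∈ T v,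
      P φ x = prim (T v) (b v) φ x := by
    intro v
    let f : Ex (T v) →ₗ[ℝ] (Z → ℝ) :=
      { toFun := fun φ x => if x ∈ T v then prim (T v) (b v) φ.1 x else 0
        map_add' := fun φ ψ => by
          funext x
          by_cases hx : x ∈ T v
          · simp only [if_pos hx, Pi.add_apply]
            exact prim_add (hconn v) (hb v) hx φ.2 ψ.2
          · simp [hx]
        map_smul' := fun r φ => by
          funext x
          by_cases hx : x ∈ T v
          · simp only [if_pos hx, Pi.smul_apply]
            exact prim_smul (hconn v) (hb v) hx φ.2 r
          · simp [hx] }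
    obtain ⟨P, hP⟩ := LinearMap.exists_extend f
    refine ⟨P, fun φ hφ x hx => ?_⟩
    have : P φ = f ⟨φ, hφ⟩ := by rw [← hP]; rfl
    rw [this]
    simp [f, hx]
  choose P hP using hP
  have hPprim : ∀ v, ∀ φ ∈ Ex (T v), IsPrim (T v) φ (P v φ) := fun v φ hφ =>
    (isPrim_prim (b v) hφ).congr fun x hx => (hP v φ hφ x hx).symm
  have hPeq : ∀ v φ u, IsPrim (T v) φ u → ∀ x ∈ T v, P v φ x = u x - u (b v) := fun v φ u hu x hx => by
    rw [hP v φ ⟨u, hu⟩ x hx, prim_eq (hconn v) (hb v) hx hu]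
  -- The mismatch, at each node, of the normalized primitives on its two pieces. Modulo changes of
  -- the constants, that is modulo the graph coboundary, it is the obstruction to gluing them.
  let D : (Z → Z → ℝ) →ₗ[ℝ] (E → ℝ) := LinearMap.pi fun e =>
    (LinearMap.proj (p e)).comp (P (s e)) - (LinearMap.proj (p e)).comp (P (t e))
  have hD : ∀ φ e, D φ e = P (s e) φ (p e) - P (t e) φ (p e) := fun φ e => rfl
  have hle : ∀ v, Coc (⋃ v, T v) ≤ Coc (T v) := fun v => Coc_mono (subset_iUnion T v)
  let R : Coc (⋃ v, T v) →ₗ[ℝ] ((v : V) → H1 (T v)) := LinearMap.pi fun v =>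
    (Submodule.mkQ _).comp (Submodule.inclusion (hle v))
  let L := R.prod ((LinearMap.range (graphCoboundary s t)).mkQ.comp (D.comp (Submodule.subtype _)))
  have hR : ∀ φ : Coc (⋃ v, T v), R φ = 0 ↔ ∀ v, φ.1 ∈ Ex (T v) := by
    intro φ
    rw [funext_iff]
    refine forall_congr' fun v => ?_
    change Submodule.Quotient.mk _ = _ ↔ _
    rw [Pi.zero_apply, Submodule.Quotient.mk_eq_zero]
    rfl
  refine nonempty_H1_equiv_of_surjective L ?_ ?_
  · have hR_surj : Function.Surjective R := by
      intro y
      choose c hc using fun v => Submodule.mkQ_surjective _ (y v)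
      obtain ⟨φ, hφ, hφc⟩ := h.exists_glue (fun v => (c v).1) fun v => (c v).2
      refine ⟨⟨φ, hφ⟩, ?_⟩
      funext v
      rw [← hc v]
      refine (Submodule.Quotient.eq _).2 ?_
      refine ⟨0, fun x hx => ?_⟩
      filter_upwards [hφc v x hx] with y hy
      simpa [sub_eq_zero] using hy
    have hker : ∀ g : E → ℝ, ∃ φ : Coc (⋃ v, T v), R φ = 0 ∧
        D φ.1 - g ∈ LinearMap.range (graphCoboundary s t) := by
      intro g
      -- Primitives need not be continuous: the value `g e` placed at the node `p e`, on the source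
      -- piece only, produces the prescribed mismatch.
      let u : V → Z → ℝ := fun v z => ∑ e, if s e = v ∧ z = p e then g e else 0
      obtain ⟨φ, hφ, hφc⟩ := h.exists_glue (fun v x y => u v y - u v x) fun v =>
        Ex_le_Coc _ ⟨u v, fun x _ => Filter.Eventually.of_forall fun y => rfl⟩
      have hprim : ∀ v, IsPrim (T v) φ (u v) := fun v x hx => hφc v x hx
      refine ⟨⟨φ, hφ⟩, (hR _).2 fun v => ⟨_, hprim v⟩, fun v => - u v (b v), ?_⟩
      funext e
      have h1 : u (s e) (p e) = g e := by
        simp only [u]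
        rw [Finset.sum_eq_single e]
        · simp
        · intro e' _ hne
          rw [if_neg]
          rintro ⟨_, h2⟩
          exact hne (h.injective h2).symm
        · simp
      have h2 : u (t e) (p e) = 0 := by
        refine Finset.sum_eq_zero fun e' _ => if_neg ?_
        rintro ⟨h3, h4⟩
        rw [← h.injective h4] at h3
        exact h.ne e h3
      simp only [Pi.sub_apply, hD]
      rw [hPeq _ _ _ (hprim _) _ (h.mem_source e), hPeq _ _ _ (hprim _) _ (h.mem_target e), h1, h2]
      simp only [graphCoboundary, LinearMap.coe_mk, AddHom.coe_mk]
      ring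
    rintro ⟨y, g⟩
    obtain ⟨φ₁, h1⟩ := hR_surj y
    obtain ⟨g, rfl⟩ := Submodule.mkQ_surjective _ g
    obtain ⟨φ₂, h2, h3⟩ := hker (g - D φ₁.1)
    refine ⟨φ₁ + φ₂, Prod.ext ?_ ?_⟩
    · change R (φ₁ + φ₂) = y
      rw [map_add, h1, h2]
      funext v
      exact add_zero _
    · refine (Submodule.Quotient.eq _).2 ?_
      convert h3 using 1
      change D (φ₁.1 + φ₂.1) - g = _
      rw [map_add]
      abel
  · intro φ
    have h0 : L φ = 0 ↔ R φ = 0 ∧ D φ.1 ∈ LinearMap.range (graphCoboundary s t) := by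
      rw [← Submodule.Quotient.mk_eq_zero]
      exact Prod.ext_iff
    rw [h0, hR]
    constructor
    · rintro ⟨h1, k, hk⟩
      -- The graph cochain `k` supplies the constants that make the primitives on the pieces agree
      -- at the nodes.
      let u : V → Z → ℝ := fun v x => P v φ.1 x - k v
      have hu : ∀ v w x, x ∈ T v → x ∈ T w → u v x = u w x := by
        intro v w x hv hw
        by_cases hvw : v = w
        · rw [hvw]
        obtain ⟨e, rfl, ⟨rfl, rfl⟩ | ⟨rfl, rfl⟩⟩ := h.exists_edge v w x hvw hv hw
        all_goals
          have := congrFun hk e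
          rw [hD] at this
          simp only [graphCoboundary, LinearMap.coe_mk, AddHom.coe_mk] at this
          simp only [u]
          linarith
      let g : Z → ℝ := fun x => if H : ∃ v, x ∈ T v then u H.choose x else 0
      have hg : ∀ v, ∀ x ∈ T v, g x = u v x := by
        intro v x hx
        have H : ∃ v, x ∈ T v := ⟨v, hx⟩
        simp only [g, dif_pos H]
        exact hu _ _ x H.choose_spec hx
      refine ⟨g, (isPrim_iUnion_iff h.mem_of_mem_closure).2 fun v => ?_⟩
      exact ((hPprim v _ (h1 v)).add_const (-k v)).congr fun x hx => by
        rw [hg v x hx, ← sub_eq_add_neg]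
    · rintro ⟨u, hu⟩
      have hu' := fun v => (isPrim_iUnion_iff h.mem_of_mem_closure).1 hu v
      refine ⟨fun v => ⟨u, hu' v⟩, fun v => - u (b v), ?_⟩
      funext e
      rw [hD, hPeq _ _ _ (hu' _) _ (h.mem_source e), hPeq _ _ _ (hu' _) _ (h.mem_target e)]
      simp only [graphCoboundary, LinearMap.coe_mk, AddHom.coe_mk]
      ring

/-- The first Betti number of a wedge of spaces with first Betti number 3. -/
theorem IsWedge.finrank_H1 [Fintype V] [Fintype E] [T1Space Z] (h : IsWedge T p s t)
    (hconn : ∀ v, IsPreconnected (T v)) (hne : ∀ v, (T v).Nonempty)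
    (hH1 : ∀ v, Nonempty (H1 (T v) ≃ₗ[ℝ] (Fin 3 → ℝ))) :
    Module.Finite ℝ (H1 (⋃ v, T v)) ∧ Module.finrank ℝ (H1 (⋃ v, T v)) =
      2 * Fintype.card V + Fintype.card E +
        Module.finrank ℝ (LinearMap.ker (graphCoboundary s t)) := by
  classical
  obtain ⟨e⟩ := h.nonempty_H1_equiv hconn hne
  let e' : ∀ v, H1 (T v) ≃ₗ[ℝ] (Fin 3 → ℝ) := fun v => (hH1 v).some
  let e₂ := e.trans ((LinearEquiv.piCongrRight e').prodCongr (LinearEquiv.refl ℝ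
    ((E → ℝ) ⧸ LinearMap.range (graphCoboundary s t))))
  refine ⟨Module.Finite.equiv e₂.symm, ?_⟩
  rw [e₂.finrank_eq, Module.finrank_prod, Module.finrank_pi_fintype]
  have h1 := Submodule.finrank_quotient_add_finrank (LinearMap.range (graphCoboundary s t))
  have h2 := LinearMap.finrank_range_add_finrank_ker (graphCoboundary s t)
  simp only [Module.finrank_fintype_fun_eq_card, Finset.sum_const, Finset.card_univ, smul_eq_mul,
    Fintype.card_fin] at h1 h2 ⊢
  omega

theorem one_le_finrank_ker_graphCoboundary [Finite V] [Nonempty V] (s t : E → V) :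
    1 ≤ Module.finrank ℝ (LinearMap.ker (graphCoboundary s t)) := by
  refine Submodule.one_le_finrank_iff.2 fun h => ?_
  have h1 : (fun _ => 1 : V → ℝ) ∈ LinearMap.ker (graphCoboundary s t) := by
    rw [LinearMap.mem_ker]
    funext e
    simp [graphCoboundary]
  rw [h, Submodule.mem_bot] at h1
  exact one_ne_zero (congrFun h1 (Classical.arbitrary V))

/-- A kernel element is constant along edges. If it were not constant, the pieces where it takes one
value and the remaining pieces would cover the connected union, so a piece of one kind would meet
one of the other, and the edge at their common point gives a contradiction. -/
theorem IsWedge.finrank_ker_graphCoboundary [Finite V] [Nonempty V]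
    (h : IsWedge T p s t) (hne : ∀ v, (T v).Nonempty) (hS : IsPreconnected (⋃ v, T v)) :
    Module.finrank ℝ (LinearMap.ker (graphCoboundary s t)) = 1 := by
  refine le_antisymm ?_ (one_le_finrank_ker_graphCoboundary s t)
  have v₀ : V := Classical.arbitrary V
  have hk : ∀ k ∈ LinearMap.ker (graphCoboundary s t), ∀ v, k v = k v₀ := by
    intro k hk v
    by_contra hv
    have hcl : ∀ A : Set V, IsClosed (⋃ v ∈ A, closure (T v)) := fun A =>
      A.toFinite.isClosed_biUnion fun v _ => isClosed_closure
    obtain ⟨x, hxS, hx1, hx2⟩ := isPreconnected_closed_iff.1 hS _ _ (hcl {w | k w = k v₀})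
      (hcl {w | k w ≠ k v₀}) (by
        rintro x hx
        obtain ⟨w, hw⟩ := mem_iUnion.1 hx
        by_cases hkw : k w = k v₀
        · exact Or.inl (mem_iUnion₂.2 ⟨w, hkw, subset_closure hw⟩)
        · exact Or.inr (mem_iUnion₂.2 ⟨w, hkw, subset_closure hw⟩))
      (by
        obtain ⟨x, hx⟩ := hne v₀
        exact ⟨x, mem_iUnion.2 ⟨v₀, hx⟩, mem_iUnion₂.2 ⟨v₀, rfl, subset_closure hx⟩⟩)
      (by
        obtain ⟨x, hx⟩ := hne v
        exact ⟨x, mem_iUnion.2 ⟨v, hx⟩, mem_iUnion₂.2 ⟨v, hv, subset_closure hx⟩⟩)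
    obtain ⟨w, hw, hxw⟩ := mem_iUnion₂.1 hx1
    obtain ⟨w', hw', hxw'⟩ := mem_iUnion₂.1 hx2
    replace hxw := h.mem_of_mem_closure w x hxS hxw
    replace hxw' := h.mem_of_mem_closure w' x hxS hxw'
    have hne' : w ≠ w' := by
      rintro rfl
      exact hw' hw
    have hedge : ∀ e, k (s e) = k (t e) := fun e => by
      have := congrFun (LinearMap.mem_ker.1 hk) e
      simpa [graphCoboundary, sub_eq_zero] using this
    obtain ⟨e, _, ⟨rfl, rfl⟩ | ⟨rfl, rfl⟩⟩ := h.exists_edge w w' x hne' hxw hxw'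
    · exact hw' ((hedge e).symm.trans hw)
    · exact hw' ((hedge e).trans hw)
  have : LinearMap.ker (graphCoboundary s t) ≤ Submodule.span ℝ {(fun _ => 1 : V → ℝ)} := by
    intro k hk'
    refine Submodule.mem_span_singleton.2 ⟨k v₀, ?_⟩
    funext v
    simp [hk k hk' v]
  refine (Submodule.finrank_mono this).trans ?_
  simpa using finrank_span_le_card (R := ℝ) {(fun _ => 1 : V → ℝ)}

theorem le_finrank_ker_graphCoboundary [Fintype V] [Fintype E] (s t : E → V) :
    Fintype.card V ≤
      Module.finrank ℝ (LinearMap.ker (graphCoboundary s t)) + Fintype.card E := by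
  have h2 := LinearMap.finrank_range_add_finrank_ker (graphCoboundary s t)
  have h1 := Submodule.finrank_le (LinearMap.range (graphCoboundary s t))
  simp only [Module.finrank_fintype_fun_eq_card] at h1 h2
  omega

theorem finrank_ker_graphCoboundary_of_isEmpty [Fintype V] [IsEmpty E] (s t : E → V) :
    Module.finrank ℝ (LinearMap.ker (graphCoboundary s t)) = Fintype.card V := by
  have : LinearMap.ker (graphCoboundary s t) = ⊤ := by
    rw [eq_top_iff]
    intro k _
    rw [LinearMap.mem_ker]
    exact Subsingleton.elim _ _
  rw [this, finrank_top, Module.finrank_fintype_fun_eq_card]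

/-- Removing some of the points at which the pieces of a wedge meet. -/
theorem IsWedge.diff (h : IsWedge T p s t) (Q : Set Z) :
    IsWedge (fun v => T v \ Q) (fun e : {e // p e ∉ Q} => p e) (fun e => s e) (fun e => t e) where
  mem_of_mem_closure v x hx hxv := by
    obtain ⟨w, hw⟩ := mem_iUnion.1 hx
    exact ⟨h.mem_of_mem_closure v x (mem_iUnion.2 ⟨w, hw.1⟩) (closure_mono sdiff_subset hxv), hw.2⟩
  injective a b hab := Subtype.ext (h.injective hab)
  mem_source e := ⟨h.mem_source e, e.2⟩
  mem_target e := ⟨h.mem_target e, e.2⟩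
  ne e := h.ne e
  exists_edge v w x hvw hv hw := by
    obtain ⟨e, he, h'⟩ := h.exists_edge v w x hvw hv.1 hw.1
    exact ⟨⟨e, by rw [he]; exact hv.2⟩, he, h'⟩

end Wedge


/-! ### The Morse lemma with a Lipschitz square root -/

section MorseLemma

set_option maxSynthPendingDepth 3

variable {E : Type*} [NormedAddCommGroup E] [NormedSpace ℝ E]

/-- Taylor's formula of order two with a symmetric second order coefficient depending Lipschitz
continuously on the point. -/
theorem exists_taylor_two {f : E → ℝ} (hf : ContDiffAt ℝ ∞ f 0) :
    ∃ ρ > 0, ∃ (A : E → E →L[ℝ] E →L[ℝ] ℝ) (K : NNReal), LipschitzOnWith K A (Metric.ball 0 ρ) ∧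
      A 0 = fderiv ℝ (fderiv ℝ f) 0 ∧ (∀ x ∈ Metric.ball (0 : E) ρ, ∀ u v, A x u v = A x v u) ∧
      ∀ x ∈ Metric.ball (0 : E) ρ, f x = f 0 + fderiv ℝ f 0 x + 1 / 2 * A x x x := by
  have hf3 : ContDiffAt ℝ 3 f 0 := contDiffAt_infty.1 hf 3
  set G := fderiv ℝ (fderiv ℝ f) with hG
  have hG1 : ContDiffAt ℝ 1 G 0 := by
    have h2 : ContDiffAt ℝ 2 (fderiv ℝ f) 0 := hf3.fderiv_right (by norm_num)
    exact h2.fderiv_right (by norm_num)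
  obtain ⟨K, t, ht, hK⟩ := hG1.exists_lipschitzOnWith
  have hev := hf3.eventually (by simp)
  obtain ⟨ρ, hρ, hball⟩ := Metric.mem_nhds_iff.1 (Filter.inter_mem ht hev)
  have hKb : LipschitzOnWith K G (Metric.ball 0 ρ) := hK.mono fun x hx => (hball hx).1
  have hfb : ∀ x ∈ Metric.ball (0 : E) ρ, ContDiffAt ℝ 3 f x := fun x hx => (hball hx).2
  have hseg : ∀ x ∈ Metric.ball (0 : E) ρ, ∀ s ∈ Icc (0 : ℝ) 1, s • x ∈ Metric.ball (0 : E) ρ := by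
    intro x hx s hs
    rw [mem_ball_zero_iff] at hx ⊢
    rw [norm_smul, Real.norm_eq_abs, abs_of_nonneg hs.1]
    nlinarith [norm_nonneg x, hs.2]
  have hcont : ∀ x ∈ Metric.ball (0 : E) ρ,
      ContinuousOn (fun s : ℝ => (2 * (1 - s)) • G (s • x)) (Icc 0 1) := by
    intro x hx
    refine ContinuousOn.smul (f := fun s : ℝ => 2 * (1 - s)) (g := fun s : ℝ => G (s • x))
      (by fun_prop) ?_
    exact hKb.continuousOn.comp (f := fun s : ℝ => s • x) (by fun_prop) fun s hs => hseg x hx s hs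
  have hint : ∀ x ∈ Metric.ball (0 : E) ρ,
      IntervalIntegrable (fun s : ℝ => (2 * (1 - s)) • G (s • x)) MeasureTheory.volume 0 1 :=
    fun x hx => by
      refine ContinuousOn.intervalIntegrable ?_
      rw [uIcc_of_le zero_le_one]
      exact hcont x hx
  -- The integral form of Taylor's remainder. The weight `2 (1 - s)` has integral one, so the value
  -- at `0` is the Hessian.
  let A : E → E →L[ℝ] E →L[ℝ] ℝ := fun x => ∫ s in (0 : ℝ)..1, (2 * (1 - s)) • G (s • x)
  have heval : ∀ x ∈ Metric.ball (0 : E) ρ, ∀ u v,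
      A x u v = ∫ s in (0 : ℝ)..1, 2 * (1 - s) * G (s • x) u v := by
    intro x hx u v
    let ev : (E →L[ℝ] E →L[ℝ] ℝ) →L[ℝ] ℝ :=
      (ContinuousLinearMap.apply ℝ ℝ v).comp (ContinuousLinearMap.apply ℝ (E →L[ℝ] ℝ) u)
    exact (ev.intervalIntegral_comp_comm (hint x hx)).symm
  refine ⟨ρ, hρ, A, 2 * K, ?_, ?_, ?_, ?_⟩
  · refine LipschitzOnWith.of_dist_le_mul fun x hx y hy => ?_
    rw [dist_eq_norm, dist_eq_norm]
    change ‖(∫ s in (0 : ℝ)..1, (2 * (1 - s)) • G (s • x)) -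
      ∫ s in (0 : ℝ)..1, (2 * (1 - s)) • G (s • y)‖ ≤ _
    rw [← intervalIntegral.integral_sub (hint x hx) (hint y hy)]
    have : ∀ s ∈ uIoc (0 : ℝ) 1, ‖(2 * (1 - s)) • G (s • x) - (2 * (1 - s)) • G (s • y)‖ ≤
        2 * K * ‖x - y‖ := by
      intro s hs
      rw [uIoc_of_le zero_le_one] at hs
      have hs' : s ∈ Icc (0 : ℝ) 1 := ⟨hs.1.le, hs.2⟩
      rw [← smul_sub, norm_smul, Real.norm_eq_abs, abs_of_nonneg (by linarith [hs.2])]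
      have h1 := hKb.dist_le_mul _ (hseg x hx s hs') _ (hseg y hy s hs')
      rw [dist_eq_norm, dist_eq_norm, ← smul_sub, norm_smul, Real.norm_eq_abs,
        abs_of_nonneg hs'.1] at h1
      have h2 : s * ‖x - y‖ ≤ ‖x - y‖ := mul_le_of_le_one_left (norm_nonneg _) hs.2
      have h3 : ‖G (s • x) - G (s • y)‖ ≤ K * ‖x - y‖ :=
        h1.trans (mul_le_mul_of_nonneg_left h2 K.2)
      have h4 : 0 ≤ ‖G (s • x) - G (s • y)‖ := norm_nonneg _
      nlinarith [hs.1]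
    simpa using intervalIntegral.norm_integral_le_of_norm_le_const this
  · change ∫ s in (0 : ℝ)..1, (2 * (1 - s)) • G (s • 0) = G 0
    simp only [smul_zero]
    rw [intervalIntegral.integral_smul_const]
    have : ∫ s in (0 : ℝ)..1, 2 * (1 - s) = 1 := by
      rw [intervalIntegral.integral_const_mul]
      rw [intervalIntegral.integral_sub (by simp) (by simp)]
      norm_num [integral_id]
    rw [this, one_smul]
  · intro x hx u v
    rw [heval x hx, heval x hx]
    refine intervalIntegral.integral_congr fun s hs => ?_
    rw [uIcc_of_le zero_le_one] at hs
    have := (hfb _ (hseg x hx s hs)).isSymmSndFDerivAt (by norm_num)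
    exact congrArg _ (this.eq u v)
  · intro x hx
    have hderiv : ∀ s ∈ uIcc (0 : ℝ) 1, HasDerivAt
        (fun s : ℝ => (1 - s) * fderiv ℝ f (s • x) x + f (s • x)) ((1 - s) * G (s • x) x x) s := by
      intro s hs
      rw [uIcc_of_le zero_le_one] at hs
      have hsx := hfb _ (hseg x hx s hs)
      have h0 : HasDerivAt (fun s : ℝ => s • x) x s := by
        simpa using (hasDerivAt_id s).smul_const x
      have h1 : HasDerivAt (fun s : ℝ => f (s • x)) (fderiv ℝ f (s • x) x) s :=
        (hsx.differentiableAt (by simp)).hasFDerivAt.comp_hasDerivAt s h0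
      have hd : DifferentiableAt ℝ (fderiv ℝ f) (s • x) :=
        (hsx.fderiv_right (m := 2) (by norm_num)).differentiableAt (by simp)
      have h2 : HasDerivAt (fun s : ℝ => fderiv ℝ f (s • x)) (G (s • x) x) s :=
        hd.hasFDerivAt.comp_hasDerivAt s h0
      have h3 : HasDerivAt (fun s : ℝ => fderiv ℝ f (s • x) x) (G (s • x) x x) s := by
        have := h2.clm_apply (hasDerivAt_const s x)
        simpa using this
      have h4 : HasDerivAt (fun s : ℝ => 1 - s) (-1) s := by
        simpa using (hasDerivAt_id s).const_sub 1
      have := (h4.mul h3).add h1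
      refine this.congr_deriv ?_
      ring
    have hii : IntervalIntegrable (fun s : ℝ => (1 - s) * G (s • x) x x) MeasureTheory.volume 0 1 := by
      refine ContinuousOn.intervalIntegrable ?_
      rw [uIcc_of_le zero_le_one]
      refine ContinuousOn.mul (by fun_prop) ?_
      have : ContinuousOn (fun s : ℝ => G (s • x)) (Icc 0 1) :=
        hKb.continuousOn.comp (f := fun s : ℝ => s • x) (by fun_prop) fun s hs => hseg x hx s hs
      exact (this.clm_apply continuousOn_const).clm_apply continuousOn_const
    have := intervalIntegral.integral_eq_sub_of_hasDerivAt hderiv hii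
    rw [heval x hx]
    have h2 : ∫ s in (0 : ℝ)..1, 2 * (1 - s) * G (s • x) x x =
        2 * ∫ s in (0 : ℝ)..1, (1 - s) * G (s • x) x x := by
      rw [← intervalIntegral.integral_const_mul]
      simp only [mul_assoc]
    rw [h2, this]
    simp
    ring

/-- The operators that are symmetric for the bilinear form `H`. -/
def symmetricOperators (H : E →L[ℝ] E →L[ℝ] ℝ) : Submodule ℝ (E →L[ℝ] E) where
  carrier := {B | ∀ u v, H (B u) v = H u (B v)}
  add_mem' := fun {a b} ha hb u v => by simp [ha u v, hb u v]
  zero_mem' := fun u v => by simp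
  smul_mem' := fun r a ha u v => by simp [ha u v]

theorem isClosed_symmetricOperators (H : E →L[ℝ] E →L[ℝ] ℝ) :
    IsClosed (symmetricOperators H : Set (E →L[ℝ] E)) := by
  have : (symmetricOperators H : Set (E →L[ℝ] E)) = ⋂ u, ⋂ v, {B | H (B u) v = H u (B v)} := by
    ext B
    simp [symmetricOperators]
  rw [this]
  refine isClosed_iInter fun u => isClosed_iInter fun v => isClosed_eq ?_ ?_
  · exact (H.continuous.comp (ContinuousLinearMap.apply ℝ E u).continuous).clm_apply
      continuous_const
  · exact (H u).continuous.comp (ContinuousLinearMap.apply ℝ E v).continuous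

/-- Symmetric operators near the identity have a symmetric square root depending Lipschitz
continuously on the operator. -/
theorem exists_sqrt_symmetricOperators [CompleteSpace E] (H : E →L[ℝ] E →L[ℝ] ℝ) :
    ∃ (g : symmetricOperators H → symmetricOperators H) (K : NNReal) (s : Set (symmetricOperators H)),
      s ∈ 𝓝 ⟨ContinuousLinearMap.id ℝ E, fun _ _ => rfl⟩ ∧ LipschitzOnWith K g s ∧
      g ⟨ContinuousLinearMap.id ℝ E, fun _ _ => rfl⟩ = ⟨ContinuousLinearMap.id ℝ E, fun _ _ => rfl⟩ ∧
      ∀ B ∈ s, ((g B : E →L[ℝ] E).comp (g B : E →L[ℝ] E)) = B := by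
  have _ : CompleteSpace (symmetricOperators H) :=
    (isClosed_symmetricOperators H).completeSpace_coe
  set W := symmetricOperators H
  set I : W := ⟨ContinuousLinearMap.id ℝ E, fun _ _ => rfl⟩ with hI
  let sq : W → W := fun B => ⟨(B : E →L[ℝ] E).comp (B : E →L[ℝ] E), fun u v => by
    simp only [ContinuousLinearMap.comp_apply]
    rw [B.2, B.2]⟩
  let L : W ≃L[ℝ] W := ContinuousLinearEquiv.smulLeft (Units.mk0 (2 : ℝ) two_ne_zero)
  have hL : ∀ B : W, L B = (2 : ℝ) • B := fun B => rfl
  -- Squaring has derivative `2` at the identity. The inverse function theorem is applied inside the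
  -- space of symmetric operators, so that the root is symmetric too. The estimate rests on `x² - y²
  -- - 2(x - y) = (x - 1)(x - y) + (x - y)(y - 1)`.
  have hstrict : HasStrictFDerivAt sq (L : W →L[ℝ] W) I := by
    refine .of_isLittleO ?_
    rw [Asymptotics.isLittleO_iff]
    intro c hc
    have h1 : ∀ᶠ x : W × W in 𝓝 (I, I), ‖x.1 - I‖ < c / 2 ∧ ‖x.2 - I‖ < c / 2 := by
      have := Filter.Eventually.prod_nhds (Metric.ball_mem_nhds I (half_pos hc))
        (Metric.ball_mem_nhds I (half_pos hc))
      filter_upwards [this] with x hx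
      rwa [dist_eq_norm, dist_eq_norm] at hx
    filter_upwards [h1] with x hx
    have h2 : ((sq x.1 - sq x.2 - L (x.1 - x.2) : W) : E →L[ℝ] E) =
        ((x.1 - I : W) : E →L[ℝ] E).comp ((x.1 - x.2 : W) : E →L[ℝ] E) +
          ((x.1 - x.2 : W) : E →L[ℝ] E).comp ((x.2 - I : W) : E →L[ℝ] E) := by
      ext v
      simp [sq, hL, hI, two_smul]
      abel
    calc ‖sq x.1 - sq x.2 - L (x.1 - x.2)‖
        = ‖((x.1 - I : W) : E →L[ℝ] E).comp ((x.1 - x.2 : W) : E →L[ℝ] E) +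
          ((x.1 - x.2 : W) : E →L[ℝ] E).comp ((x.2 - I : W) : E →L[ℝ] E)‖ := by
          rw [← h2]; rfl
      _ ≤ ‖x.1 - I‖ * ‖x.1 - x.2‖ + ‖x.1 - x.2‖ * ‖x.2 - I‖ :=
          (norm_add_le _ _).trans (add_le_add (ContinuousLinearMap.opNorm_comp_le _ _)
            (ContinuousLinearMap.opNorm_comp_le _ _))
      _ ≤ c * ‖x.1 - x.2‖ := by nlinarith [norm_nonneg (x.1 - x.2)]
  have hsqI : sq I = I := rfl
  have hg := hstrict.to_localInverse
  obtain ⟨K, s, hs, hK⟩ := hg.exists_lipschitzOnWith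
  rw [hsqI] at hs
  have hright := hstrict.eventually_right_inverse
  rw [hsqI] at hright
  refine ⟨hstrict.localInverse sq L I, K, s ∩ {B | sq (hstrict.localInverse sq L I B) = B},
    Filter.inter_mem hs hright, hK.mono inter_subset_left, ?_, ?_⟩
  · have := hstrict.localInverse_apply_image
    rwa [hsqI] at this
  · intro B hB
    exact congrArg Subtype.val hB.2

/-- The Morse lemma. -/
theorem exists_morse_chart [FiniteDimensional ℝ E] {f : E → ℝ} (hf : ContDiffAt ℝ ∞ f 0)
    (hcrit : fderiv ℝ f 0 = 0)
    (hnd : ∀ v, (∀ w, fderiv ℝ (fderiv ℝ f) 0 v w = 0) → v = 0) :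
    ∃ Φ : OpenPartialHomeomorph E E, 0 ∈ Φ.source ∧ Φ 0 = 0 ∧
      ∀ x ∈ Φ.source, f x = f 0 + 1 / 2 * fderiv ℝ (fderiv ℝ f) 0 (Φ x) (Φ x) := by
  classical
  have _ : CompleteSpace E := FiniteDimensional.complete ℝ E
  obtain ⟨ρ, hρ, A, K, hAK, hA0, hsymm, hfA⟩ := exists_taylor_two hf
  set H := fderiv ℝ (fderiv ℝ f) 0 with hH
  have h0 : (0 : E) ∈ Metric.ball (0 : E) ρ := Metric.mem_ball_self hρ
  have hHs : ∀ u v, H u v = H v u := by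
    intro u v
    rw [← hA0]
    exact hsymm 0 h0 u v
  have hfin : Module.finrank ℝ E = Module.finrank ℝ (E →L[ℝ] ℝ) := by
    rw [← (LinearMap.toContinuousLinearMap (𝕜 := ℝ) (E := E) (F' := ℝ)).finrank_eq]
    exact Subspace.dual_finrank_eq.symm
  have hinj : Function.Injective H := by
    rw [injective_iff_map_eq_zero]
    intro v hv
    exact hnd v fun w => by rw [hv]; rfl
  let He : E ≃L[ℝ] (E →L[ℝ] ℝ) :=
    (LinearEquiv.ofInjectiveOfFinrankEq (H : E →ₗ[ℝ] (E →L[ℝ] ℝ)) hinj hfin).toContinuousLinearEquiv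
  have hHe : ∀ v, He v = H v := fun v => rfl
  have hHe' : ∀ ℓ, H (He.symm ℓ) = ℓ := fun ℓ => by rw [← hHe, He.apply_symm_apply]
  -- `C₀ x = H⁻¹ A x` is symmetric for `H` and is the identity at `0`. If `Q x` is its symmetric
  -- square root, then `A x (x, x) = H (Q x x, Q x x)`, so `x ↦ Q x x` is the Morse chart.
  let C₀ : E → E →L[ℝ] E := fun x => (He.symm : (E →L[ℝ] ℝ) →L[ℝ] E).comp (A x)
  have hC₀ : ∀ x ∈ Metric.ball (0 : E) ρ, C₀ x ∈ symmetricOperators H := by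
    intro x hx u v
    change H (He.symm (A x u)) v = H u (He.symm (A x v))
    rw [hHs u, hHe', hHe', hsymm x hx]
  set I : symmetricOperators H := ⟨ContinuousLinearMap.id ℝ E, fun _ _ => rfl⟩ with hI
  let C : E → symmetricOperators H := fun x =>
    if hx : x ∈ Metric.ball (0 : E) ρ then ⟨C₀ x, hC₀ x hx⟩ else I
  have hC : ∀ x ∈ Metric.ball (0 : E) ρ, ((C x : symmetricOperators H) : E →L[ℝ] E) = C₀ x :=
    fun x hx => by simp only [C, dif_pos hx]
  have hC0 : C 0 = I := by
    apply Subtype.ext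
    rw [hC 0 h0]
    ext v
    change He.symm (A 0 v) = v
    rw [hA0, ← hHe, He.symm_apply_apply]
  obtain ⟨K₁, hK₁⟩ : ∃ K₁ : NNReal, LipschitzOnWith K₁ C (Metric.ball 0 ρ) := by
    refine ⟨‖(He.symm : (E →L[ℝ] ℝ) →L[ℝ] E)‖₊ * K, LipschitzOnWith.of_dist_le_mul fun x hx y hy => ?_⟩
    rw [Subtype.dist_eq, hC x hx, hC y hy, dist_eq_norm]
    have h1 : C₀ x - C₀ y = (He.symm : (E →L[ℝ] ℝ) →L[ℝ] E).comp (A x - A y) := by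
      simp only [C₀, ContinuousLinearMap.comp_sub]
    rw [h1]
    refine (ContinuousLinearMap.opNorm_comp_le _ _).trans ?_
    have h2 := hAK.dist_le_mul x hx y hy
    rw [dist_eq_norm] at h2
    rw [NNReal.coe_mul, mul_assoc]
    exact mul_le_mul_of_nonneg_left h2 (norm_nonneg _)
  obtain ⟨g, K₂, s, hs, hK₂, hgI, hg⟩ := exists_sqrt_symmetricOperators H
  have hCcont : ContinuousAt C 0 := hK₁.continuousOn.continuousAt (Metric.ball_mem_nhds 0 hρ)
  have hpre : C ⁻¹' s ∈ 𝓝 0 := hCcont.preimage_mem_nhds (by rw [hC0]; exact hs)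
  obtain ⟨ρ₁, hρ₁, hball⟩ := Metric.mem_nhds_iff.1 (Filter.inter_mem hpre (Metric.ball_mem_nhds 0 hρ))
  set U := Metric.ball (0 : E) ρ₁
  have hUs : ∀ x ∈ U, C x ∈ s := fun x hx => (hball hx).1
  have hUρ : U ⊆ Metric.ball 0 ρ := fun x hx => (hball hx).2
  let Q : E → E →L[ℝ] E := fun x => (g (C x) : E →L[ℝ] E)
  have hQ0 : Q 0 = ContinuousLinearMap.id ℝ E := by
    simp only [Q]
    rw [hC0, hgI]
  have hQ : LipschitzOnWith (K₂ * K₁) Q U := by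
    have h1 : LipschitzOnWith (K₂ * K₁) (g ∘ C) U := hK₂.comp (hK₁.mono hUρ) hUs
    refine LipschitzOnWith.of_dist_le_mul fun x hx y hy => ?_
    exact h1.dist_le_mul x hx y hy
  have hU : U ∈ 𝓝 (0 : E) := Metric.ball_mem_nhds 0 hρ₁
  have hQc : ContinuousAt Q 0 := hQ.continuousOn.continuousAt hU
  -- A Lipschitz `Q` suffices here: at the origin the variation of `Q` is multiplied by a small
  -- vector.
  have hstrict : HasStrictFDerivAt (fun x => Q x x)
      ((ContinuousLinearEquiv.refl ℝ E : E ≃L[ℝ] E) : E →L[ℝ] E) 0 := by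
    refine .of_isLittleO ?_
    rw [Asymptotics.isLittleO_iff]
    intro c hc
    set k : ℝ := ((K₂ * K₁ : NNReal) : ℝ)
    have hk : 0 ≤ k := NNReal.coe_nonneg _
    have h1 : ∀ᶠ x in 𝓝 (0 : E), x ∈ U ∧ ‖Q x - ContinuousLinearMap.id ℝ E‖ < c / 2 ∧
        -- The `+ 1` avoids division by a Lipschitz constant that may be zero.
        ‖x‖ < c / 2 / (k + 1) := by
      refine Filter.Eventually.and hU (Filter.Eventually.and ?_ ?_)
      · have := hQc.preimage_mem_nhds (Metric.ball_mem_nhds _ (half_pos hc))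
        filter_upwards [this] with x hx
        rwa [mem_preimage, mem_ball_iff_norm, hQ0] at hx
      · have := Metric.ball_mem_nhds (0 : E) (show 0 < c / 2 / (k + 1) by positivity)
        filter_upwards [this] with x hx
        rwa [mem_ball_zero_iff] at hx
    have h2 := Filter.Eventually.prod_nhds h1 h1
    filter_upwards [h2] with x hx
    obtain ⟨⟨hx1, hx2, _⟩, hy1, _, hy3⟩ := hx
    have h3 : Q x.1 x.1 - Q x.2 x.2 - (x.1 - x.2) =
        (Q x.1 - ContinuousLinearMap.id ℝ E) (x.1 - x.2) + (Q x.1 - Q x.2) x.2 := by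
      simp only [sub_apply, map_sub, ContinuousLinearMap.id_apply]
      abel
    have h4 := hQ.dist_le_mul _ hx1 _ hy1
    rw [dist_eq_norm, dist_eq_norm] at h4
    have h5 : ‖(Q x.1 - Q x.2) x.2‖ ≤ k * ‖x.1 - x.2‖ * ‖x.2‖ :=
      ((Q x.1 - Q x.2).le_opNorm _).trans (mul_le_mul_of_nonneg_right h4 (norm_nonneg _))
    have h6 : ‖(Q x.1 - ContinuousLinearMap.id ℝ E) (x.1 - x.2)‖ ≤ c / 2 * ‖x.1 - x.2‖ :=
      (ContinuousLinearMap.le_opNorm _ _).trans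
        (mul_le_mul_of_nonneg_right hx2.le (norm_nonneg _))
    have h7 : k * ‖x.2‖ ≤ c / 2 := by
      have : (k + 1) * ‖x.2‖ ≤ c / 2 := by
        rw [lt_div_iff₀ (by positivity)] at hy3
        linarith
      linarith [norm_nonneg x.2, add_mul k 1 ‖x.2‖]
    change ‖Q x.1 x.1 - Q x.2 x.2 - (x.1 - x.2)‖ ≤ _
    rw [h3]
    refine (norm_add_le _ _).trans ?_
    nlinarith [norm_nonneg (x.1 - x.2)]
  let Φ := hstrict.toOpenPartialHomeomorph (fun x => Q x x)
  have hΦ : ∀ x, Φ x = Q x x := fun x => rfl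
  have hΦ0 : (0 : E) ∈ Φ.source := hstrict.mem_toOpenPartialHomeomorph_source
  refine ⟨Φ.restrOpen U Metric.isOpen_ball, ⟨hΦ0, Metric.mem_ball_self hρ₁⟩, ?_, ?_⟩
  · change Φ 0 = 0
    rw [hΦ, map_zero]
  · rintro x ⟨_, hxU⟩
    change f x = f 0 + 1 / 2 * H (Φ x) (Φ x)
    rw [hΦ, hfA x (hUρ hxU), hcrit]
    have h1 : H (Q x x) (Q x x) = A x x x := by
      have h2 := (g (C x)).2 (Q x x) x
      change H (Q x (Q x x)) x = H (Q x x) (Q x x) at h2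
      rw [← h2]
      have h3 : Q x (Q x x) = C₀ x x := by
        rw [← hC x (hUρ hxU), ← hg _ (hUs x hxU)]
        rfl
      rw [h3]
      exact congrFun (congrArg DFunLike.coe (hHe' (A x x))) x
    rw [h1]
    simp

end MorseLemma


/-! ### Local models and the index of a cut point -/

section LocalModels

variable {Z : Type*} [TopologicalSpace Z]

/-- Near `p`, the function `f` is the projection `E3 × ℝ → ℝ` in suitable coordinates. -/
def RegularAt (f : Z → ℝ) (p : Z) : Prop :=
  ∃ Ψ : OpenPartialHomeomorph Z (E3 × ℝ), p ∈ Ψ.source ∧ ∀ x ∈ Ψ.source, f x = (Ψ x).2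

/-- Near `p`, the function `f` is `σ (|x|² - y²)` in suitable coordinates `(x, y) ∈ E3 × ℝ`. -/
def NodeAt (σ : ℝ) (f : Z → ℝ) (p : Z) : Prop :=
  ∃ Ψ : OpenPartialHomeomorph Z (E3 × ℝ), p ∈ Ψ.source ∧ Ψ p = 0 ∧
    ∀ x ∈ Ψ.source, f x = σ * (‖(Ψ x).1‖ ^ 2 - (Ψ x).2 ^ 2)

/-- Near `p`, the function `f - f p` is a nondegenerate diagonal quadratic form in suitable
coordinates. -/
def MorseAt (w : Fin 4 → ℝ) (f : Z → ℝ) (p : Z) : Prop :=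
  ∃ Ψ : OpenPartialHomeomorph Z (Fin 4 → ℝ), p ∈ Ψ.source ∧ Ψ p = 0 ∧
    ∀ x ∈ Ψ.source, f x = f p + ∑ i, w i * (Ψ x i) ^ 2

theorem MorseAt.comp_perm {w : Fin 4 → ℝ} {f : Z → ℝ} {p : Z} (h : MorseAt w f p)
    (e : Equiv.Perm (Fin 4)) : MorseAt (w ∘ e) f p := by
  obtain ⟨Ψ, hp, h0, hf⟩ := h
  let L : (Fin 4 → ℝ) ≃L[ℝ] (Fin 4 → ℝ) := (LinearEquiv.funCongrLeft ℝ ℝ e).toContinuousLinearEquiv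
  have hL : ∀ x i, L x i = x (e i) := fun x i => rfl
  refine ⟨Ψ.transHomeomorph L.toHomeomorph, hp, ?_, ?_⟩
  · change L (Ψ p) = 0
    rw [h0, map_zero]
  · intro x hx
    rw [hf x hx]
    change _ = f p + ∑ i, (w ∘ e) i * (L (Ψ x) i) ^ 2
    simp only [hL, Function.comp]
    rw [Equiv.sum_comp e (fun i => w i * (Ψ x i) ^ 2)]

theorem exists_perm_signs (b : Fin 4 → Bool) : ∃ e : Equiv.Perm (Fin 4), ∃ s : Bool,
    (b ∘ e = fun _ => s) ∨ (b ∘ e = ![s, s, s, !s]) ∨ (b ∘ e = ![true, true, false, false]) := by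
  revert b
  decide

/-- Up to permuting coordinates, four signs are all equal, or three against one, or two against two.
-/
theorem MorseAt.normal_form {w : Fin 4 → ℝ} (hw : ∀ i, w i = -1 ∨ w i = 1) {f : Z → ℝ} {p : Z}
    (h : MorseAt w f p) : ∃ σ : ℝ, (σ = 1 ∨ σ = -1) ∧
      (MorseAt (fun _ => σ) f p ∨ MorseAt ![σ, σ, σ, -σ] f p ∨ MorseAt ![1, 1, -1, -1] f p) := by
  classical
  let b : Fin 4 → Bool := fun i => decide (w i = 1)
  let val : Bool → ℝ := fun s => if s then 1 else -1
  have hb : w = val ∘ b := by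
    funext i
    rcases hw i with hi | hi <;> simp [b, val, hi]
  obtain ⟨e, s, hs⟩ := exists_perm_signs b
  have h' := h.comp_perm e
  rw [hb, Function.comp_assoc] at h'
  refine ⟨val s, by cases s <;> simp [val], ?_⟩
  rcases hs with hs | hs | hs
  · left
    rw [hs] at h'
    exact h'
  · right; left
    rw [hs] at h'
    convert h' using 1
    funext i
    fin_cases i <;> cases s <;> simp [val]
  · right; right
    rw [hs] at h'
    convert h' using 1
    funext i
    fin_cases i <;> simp [val]

theorem MorseAt.nodeAt {σ : ℝ} {f : Z → ℝ} {p : Z} (h : MorseAt ![σ, σ, σ, -σ] f p)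
    (hfp : f p = 0) : NodeAt σ f p := by
  obtain ⟨Ψ, hp, h0, hf⟩ := h
  let L : (Fin 4 → ℝ) ≃ₜ E3 × ℝ :=
    { toFun := fun x => (WithLp.toLp 2 ![x 0, x 1, x 2], x 3)
      invFun := fun y => ![y.1 0, y.1 1, y.1 2, y.2]
      left_inv := fun x => by
        funext i
        fin_cases i <;> rfl
      right_inv := fun y => by
        refine Prod.ext ?_ rfl
        ext i
        fin_cases i <;> rfl
      continuous_toFun := by
        refine Continuous.prodMk ((PiLp.continuous_toLp 2 _).comp ?_) (continuous_apply 3)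
        refine continuous_pi fun i => ?_
        fin_cases i <;> simp <;> fun_prop
      continuous_invFun := by
        refine continuous_pi fun i => ?_
        fin_cases i <;> simp <;> fun_prop }
  refine ⟨Ψ.transHomeomorph L, hp, ?_, ?_⟩
  · change L (Ψ p) = 0
    rw [h0]
    refine Prod.ext ?_ rfl
    ext i
    fin_cases i <;> rfl
  · intro x hx
    rw [hf x hx, hfp]
    change _ = σ * (‖(WithLp.toLp 2 ![Ψ x 0, Ψ x 1, Ψ x 2] : E3)‖ ^ 2 - (Ψ x 3) ^ 2)
    rw [EuclideanSpace.norm_sq_eq]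
    simp [Fin.sum_univ_four, Fin.sum_univ_three]
    ring

/-- A point of the fibre `f = 0` is a cut point if small punctured neighbourhoods are not
connected. -/
def IsCutPoint (f : Z → ℝ) (p : Z) : Prop :=
  ∃ O₀ ∈ 𝓝 p, ∀ O ∈ 𝓝 p, O ⊆ O₀ → ¬ IsPreconnected ((f ⁻¹' {0} ∩ O) \ {p})

/-- The zero set of a definite form is the point itself, so its punctured neighbourhood is empty and
in particular preconnected. -/
theorem not_isCutPoint_of_definite {σ : ℝ} (hσ : σ = 1 ∨ σ = -1) {f : Z → ℝ} {p : Z}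
    (hfp : f p = 0) (h : MorseAt (fun _ => σ) f p) : ¬ IsCutPoint f p := by
  rintro ⟨O₀, hO₀, hcut⟩
  obtain ⟨Ψ, hp, h0, hf⟩ := h
  refine hcut (O₀ ∩ Ψ.source) (Filter.inter_mem hO₀ (Ψ.open_source.mem_nhds hp))
    inter_subset_left ?_
  have : (f ⁻¹' {0} ∩ (O₀ ∩ Ψ.source)) \ {p} = ∅ := by
    rw [eq_empty_iff_forall_notMem]
    rintro x ⟨⟨hx0, _, hx⟩, hxp⟩
    rw [mem_preimage, mem_singleton_iff, hf x hx, hfp, zero_add, ← Finset.mul_sum] at hx0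
    have hσ0 : σ ≠ 0 := by rcases hσ with rfl | rfl <;> norm_num
    have h1 := (mul_eq_zero.1 hx0).resolve_left hσ0
    rw [Finset.sum_eq_zero_iff_of_nonneg fun i _ => sq_nonneg _] at h1
    refine hxp (Ψ.injOn hx hp ?_)
    rw [h0]
    funext i
    exact pow_eq_zero_iff two_ne_zero |>.1 (h1 i (Finset.mem_univ i))
  rw [this]
  exact isPreconnected_empty

/-- This cone is `(0, a) × S¹ × S¹` in polar coordinates, and circles are connected. -/
theorem isPreconnected_saddle_cone (a : ℝ) :
    IsPreconnected {y : Fin 4 → ℝ | y 0 ^ 2 + y 1 ^ 2 = y 2 ^ 2 + y 3 ^ 2 ∧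
      0 < y 0 ^ 2 + y 1 ^ 2 ∧ y 0 ^ 2 + y 1 ^ 2 < a ^ 2 ∧ 0 < a} := by
  have hs : IsPreconnected (Metric.sphere (0 : ℂ) 1) :=
    isPreconnected_sphere (by rw [Complex.rank_real_complex]; norm_num) 0 1
  have h1 : IsPreconnected (Ioo 0 a ×ˢ (Metric.sphere (0 : ℂ) 1 ×ˢ Metric.sphere (0 : ℂ) 1)) :=
    isPreconnected_Ioo.prod (hs.prod hs)
  let F : ℝ × ℂ × ℂ → (Fin 4 → ℝ) := fun x =>
    ![x.1 * x.2.1.re, x.1 * x.2.1.im, x.1 * x.2.2.re, x.1 * x.2.2.im]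
  have hF : Continuous F := by
    refine continuous_pi fun i => ?_
    fin_cases i <;> simp [F] <;> fun_prop
  convert h1.image F hF.continuousOn using 1
  have hsph : ∀ z : ℂ, z ∈ Metric.sphere (0 : ℂ) 1 ↔ z.re ^ 2 + z.im ^ 2 = 1 := by
    intro z
    rw [mem_sphere_zero_iff_norm, ← sq_eq_sq₀ (norm_nonneg z) zero_le_one, ← Complex.normSq_eq_norm_sq,
      Complex.normSq_apply, one_pow, ← sq, ← sq]
  apply Subset.antisymm
  · rintro y ⟨h1, h2, h3, ha⟩
    set r := √(y 0 ^ 2 + y 1 ^ 2) with hr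
    have hr0 : 0 < r := Real.sqrt_pos.2 h2
    have hr2 : r ^ 2 = y 0 ^ 2 + y 1 ^ 2 := Real.sq_sqrt h2.le
    refine ⟨(r, ⟨y 0 / r, y 1 / r⟩, ⟨y 2 / r, y 3 / r⟩), ⟨⟨hr0, ?_⟩, ?_, ?_⟩, ?_⟩
    · exact lt_of_pow_lt_pow_left₀ 2 ha.le (by rw [hr2]; exact h3)
    · rw [hsph]
      field_simp
      linarith
    · rw [hsph]
      field_simp
      linarith
    · funext i
      fin_cases i <;> simp [F] <;> field_simp
  · rintro _ ⟨⟨r, u, v⟩, ⟨hr, hu, hv⟩, rfl⟩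
    rw [hsph] at hu hv
    have hr0 : 0 < r := hr.1
    have e1 : (r * u.re) ^ 2 + (r * u.im) ^ 2 = r ^ 2 := by
      rw [mul_pow, mul_pow, ← mul_add, hu, mul_one]
    have e2 : (r * v.re) ^ 2 + (r * v.im) ^ 2 = r ^ 2 := by
      rw [mul_pow, mul_pow, ← mul_add, hv, mul_one]
    refine ⟨e1.trans e2.symm, ?_, ?_, hr.1.trans hr.2⟩
    · exact lt_of_lt_of_eq (by positivity) e1.symm
    · exact lt_of_eq_of_lt e1 (pow_lt_pow_left₀ hr.2 hr0.le two_ne_zero)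

theorem not_isCutPoint_of_saddle {f : Z → ℝ} {p : Z}
    (hfp : f p = 0) (h : MorseAt ![1, 1, -1, -1] f p) : ¬ IsCutPoint f p := by
  rintro ⟨O₀, hO₀, hcut⟩
  obtain ⟨Ψ, hp, h0, hf⟩ := h
  have hpt : (0 : Fin 4 → ℝ) ∈ Ψ.target := h0 ▸ Ψ.map_source hp
  have hp' : Ψ.symm 0 = p := by rw [← h0, Ψ.left_inv hp]
  have hnhds : Ψ.target ∩ Ψ.symm ⁻¹' O₀ ∈ 𝓝 (0 : Fin 4 → ℝ) := by
    refine Filter.inter_mem (Ψ.open_target.mem_nhds hpt) ?_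
    exact (Ψ.symm.continuousAt hpt).preimage_mem_nhds (by rw [hp']; exact hO₀)
  obtain ⟨a, ha, hball⟩ := Metric.mem_nhds_iff.1 hnhds
  -- A product of two discs rather than a ball: it meets the cone exactly in the polar model.
  set D : Set (Fin 4 → ℝ) := {y | y 0 ^ 2 + y 1 ^ 2 < a ^ 2 ∧ y 2 ^ 2 + y 3 ^ 2 < a ^ 2} with hD
  have hDball : D ⊆ Metric.ball 0 a := by
    rintro y ⟨h1, h2⟩
    rw [mem_ball_zero_iff, pi_norm_lt_iff ha]
    intro i
    rw [Real.norm_eq_abs, ← abs_of_pos ha, ← sq_lt_sq]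
    fin_cases i <;> simp only [Fin.zero_eta, Fin.mk_one, Fin.reduceFinMk] <;> nlinarith
  have hDopen : IsOpen D := by
    have h1 : IsOpen {y : Fin 4 → ℝ | y 0 ^ 2 + y 1 ^ 2 < a ^ 2} :=
      isOpen_lt (by fun_prop) (by fun_prop)
    have h2 : IsOpen {y : Fin 4 → ℝ | y 2 ^ 2 + y 3 ^ 2 < a ^ 2} :=
      isOpen_lt (by fun_prop) (by fun_prop)
    exact h1.inter h2
  have hDt : D ⊆ Ψ.target := fun y hy => (hball (hDball hy)).1
  have h0D : (0 : Fin 4 → ℝ) ∈ D := by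
    constructor <;> simp <;> positivity
  refine hcut (Ψ.symm '' D) ?_ ?_ ?_
  · refine (Ψ.symm.isOpen_image_of_subset_source hDopen hDt).mem_nhds ?_
    exact ⟨0, h0D, hp'⟩
  · rintro _ ⟨y, hy, rfl⟩
    exact (hball (hDball hy)).2
  · have hc := (isPreconnected_saddle_cone a).image Ψ.symm (Ψ.symm.continuousOn.mono ?_)
    · convert hc using 1
      apply Subset.antisymm
      · rintro _ ⟨⟨hy0, y, hy, rfl⟩, hyp⟩
        refine ⟨y, ?_, rfl⟩
        rw [mem_preimage, mem_singleton_iff, hf _ (Ψ.map_target (hDt hy)), hfp,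
          Ψ.right_inv (hDt hy), Fin.sum_univ_four] at hy0
        simp at hy0
        have e : y 0 ^ 2 + y 1 ^ 2 = y 2 ^ 2 + y 3 ^ 2 := by linarith
        refine ⟨e, ?_, hy.1, ha⟩
        by_contra hcon
        push Not at hcon
        refine hyp ?_
        have hy00 : y = 0 := by
          funext i
          have : y i ^ 2 = 0 := by
            fin_cases i <;> simp only [Fin.zero_eta, Fin.mk_one, Fin.reduceFinMk] <;>
              nlinarith [sq_nonneg (y 0), sq_nonneg (y 1), sq_nonneg (y 2), sq_nonneg (y 3)]
          simpa using this
        rw [hy00]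
        exact hp'
      · rintro _ ⟨y, ⟨h1, h2, h3, _⟩, rfl⟩
        have hyD : y ∈ D := ⟨h3, h1 ▸ h3⟩
        refine ⟨⟨?_, y, hyD, rfl⟩, ?_⟩
        · rw [mem_preimage, mem_singleton_iff, hf _ (Ψ.map_target (hDt hyD)), hfp,
            Ψ.right_inv (hDt hyD), Fin.sum_univ_four]
          simp
          linarith
        · intro hcon
          have : y = 0 := by
            rw [← Ψ.right_inv (hDt hyD), mem_singleton_iff.1 hcon, h0]
          rw [this] at h2
          simp at h2
    · rintro y ⟨h1, h2, h3, _⟩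
      exact hDt ⟨h3, h1 ▸ h3⟩

/-- Being a local cut point of the fibre determines the index up to sign: only with three signs
against one is the punctured cone disconnected. -/
theorem nodeAt_of_morseAt {w : Fin 4 → ℝ} (hw : ∀ i, w i = -1 ∨ w i = 1) {f : Z → ℝ} {p : Z}
    (hfp : f p = 0) (h : MorseAt w f p) (hcut : IsCutPoint f p) :
    NodeAt 1 f p ∨ NodeAt (-1) f p := by
  obtain ⟨σ, hσ, h | h | h⟩ := h.normal_form hw
  · exact absurd hcut (not_isCutPoint_of_definite hσ hfp h)
  · rcases hσ with rfl | rfl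
    · exact Or.inl (h.nodeAt hfp)
    · exact Or.inr (h.nodeAt hfp)
  · exact absurd hcut (not_isCutPoint_of_saddle hfp h)

end LocalModels

/-! ### From the smooth structure to local models -/

section Manifold

variable {X : Type*} [TopologicalSpace X] [ChartedSpace (EuclideanSpace ℝ (Fin 4)) X]
  {π : X → ℝ}

theorem contDiffAt_chart [IsManifold (𝓡 4) ∞ X] (hπ : ContMDiff (𝓡 4) 𝓘(ℝ, ℝ) ∞ π) (p : X) :
    ContDiffAt ℝ ∞ (π ∘ (extChartAt (𝓡 4) p).symm) (extChartAt (𝓡 4) p p) := by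
  have h := (contMDiffAt_iff.1 (hπ p)).2
  have h3 : range (𝓡 4) = univ := by simp
  rw [h3, contDiffWithinAt_univ] at h
  exact h

theorem isCritical_iff [IsManifold (𝓡 4) ∞ X] (hπ : ContMDiff (𝓡 4) 𝓘(ℝ, ℝ) ∞ π) (p : X) :
    IsCritical π p ↔ fderiv ℝ (π ∘ (extChartAt (𝓡 4) p).symm) (extChartAt (𝓡 4) p p) = 0 := by
  have h : MDifferentiableAt (𝓡 4) 𝓘(ℝ, ℝ) π p := (hπ p).mdifferentiableAt (by simp)
  rw [IsCritical, h.mfderiv]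
  have h2 : writtenInExtChartAt (𝓡 4) 𝓘(ℝ, ℝ) p π = π ∘ (extChartAt (𝓡 4) p).symm := by
    rfl
  rw [h2]
  have h3 : range (𝓡 4) = univ := by simp
  rw [h3, fderivWithin_univ]
  rfl

/-- The implicit function theorem in a chart, with the three-dimensional kernel of the derivative
identified with `ℝ³`. -/
theorem regularAt_of_not_isCritical [IsManifold (𝓡 4) ∞ X] (hπ : ContMDiff (𝓡 4) 𝓘(ℝ, ℝ) ∞ π)
    {p : X} (hp : ¬ IsCritical π p) : RegularAt π p := by
  rw [isCritical_iff hπ] at hp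
  set F := π ∘ (extChartAt (𝓡 4) p).symm with hF
  set a := extChartAt (𝓡 4) p p with ha
  have hcd : ContDiffAt ℝ ∞ F a := contDiffAt_chart hπ p
  have hs : HasStrictFDerivAt F (fderiv ℝ F a) a := hcd.hasStrictFDerivAt (by simp)
  have hsurj : Function.Surjective (fderiv ℝ F a) := by
    obtain ⟨v, hv⟩ : ∃ v, fderiv ℝ F a v ≠ 0 := by
      by_contra! hcon
      exact hp (ContinuousLinearMap.ext hcon)
    intro y
    refine ⟨(y / fderiv ℝ F a v) • v, ?_⟩
    rw [map_smul, smul_eq_mul, div_mul_cancel₀ _ hv]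
  have hr : (fderiv ℝ F a).range = ⊤ := LinearMap.range_eq_top.2 hsurj
  let Φ := hs.implicitToOpenPartialHomeomorph F (fderiv ℝ F a) hr
  have hΦ : ∀ x, (Φ x).1 = F x := fun x => rfl
  have hfin : Module.finrank ℝ (fderiv ℝ F a).ker = Module.finrank ℝ E3 := by
    have := LinearMap.finrank_range_add_finrank_ker (fderiv ℝ F a : EuclideanSpace ℝ (Fin 4) →ₗ[ℝ] ℝ)
    have h1 : LinearMap.range (fderiv ℝ F a : EuclideanSpace ℝ (Fin 4) →ₗ[ℝ] ℝ) = ⊤ := hr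
    rw [h1, finrank_top] at this
    simp at this ⊢
    omega
  let L : (fderiv ℝ F a).ker ≃L[ℝ] E3 := ContinuousLinearEquiv.ofFinrankEq hfin
  let M : ℝ × (fderiv ℝ F a).ker ≃ₜ E3 × ℝ :=
    ((Homeomorph.refl ℝ).prodCongr L.toHomeomorph).trans (Homeomorph.prodComm _ _)
  let Ψ := ((chartAt (EuclideanSpace ℝ (Fin 4)) p).trans Φ).transHomeomorph M
  have hpc : p ∈ (chartAt (EuclideanSpace ℝ (Fin 4)) p).source := mem_chart_source _ p
  have hac : a = chartAt (EuclideanSpace ℝ (Fin 4)) p p := by simp [ha]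
  refine ⟨Ψ, ?_, ?_⟩
  · change p ∈ ((chartAt (EuclideanSpace ℝ (Fin 4)) p).trans Φ).source
    rw [OpenPartialHomeomorph.trans_source]
    refine ⟨hpc, ?_⟩
    rw [mem_preimage, ← hac]
    exact hs.mem_implicitToOpenPartialHomeomorph_source hr
  · intro x hx
    change x ∈ ((chartAt (EuclideanSpace ℝ (Fin 4)) p).trans Φ).source at hx
    rw [OpenPartialHomeomorph.trans_source] at hx
    change π x = F (chartAt (EuclideanSpace ℝ (Fin 4)) p x)
    simp [hF, (chartAt (EuclideanSpace ℝ (Fin 4)) p).left_inv hx.1]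

/-- The Morse chart turns `π` into its Hessian form, and Sylvester's theorem diagonalizes that form
with entries `±1`. -/
theorem morseAt_of_isCritical [IsManifold (𝓡 4) ∞ X] (hπ : ContMDiff (𝓡 4) 𝓘(ℝ, ℝ) ∞ π)
    {p : X} (hp : IsCritical π p) (hnd : ∀ v, (∀ w, hessian π p v w = 0) → v = 0) :
    ∃ w : Fin 4 → ℝ, (∀ i, w i = -1 ∨ w i = 1) ∧ MorseAt w π p := by
  rw [isCritical_iff hπ] at hp
  unfold hessian at hnd
  set F := π ∘ (extChartAt (𝓡 4) p).symm with hF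
  set a := extChartAt (𝓡 4) p p with ha
  have hcd : ContDiffAt ℝ ∞ F a := contDiffAt_chart hπ p
  set G : EuclideanSpace ℝ (Fin 4) → ℝ := fun x => F (a + x) with hG
  have hG1 : fderiv ℝ G = fun x => fderiv ℝ F (a + x) := by
    funext x
    exact fderiv_comp_add_left a
  have hG2 : fderiv ℝ (fderiv ℝ G) 0 = fderiv ℝ (fderiv ℝ F) a := by
    rw [hG1, fderiv_comp_add_left a, add_zero]
  have hGcd : ContDiffAt ℝ ∞ G 0 := by
    refine ContDiffAt.comp (g := F) (f := fun x => a + x) 0 ?_ (by fun_prop)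
    simpa using hcd
  obtain ⟨Φ, h0, hΦ0, hΦ⟩ := exists_morse_chart hGcd (by rw [hG1]; simpa using hp)
    (by rw [hG2]; exact hnd)
  rw [hG2] at hΦ
  set H := fderiv ℝ (fderiv ℝ F) a with hH
  have hsymm : ∀ u v, H u v = H v u := fun u v =>
    ((contDiffAt_infty.1 hcd 2).isSymmSndFDerivAt (by norm_num)).eq u v
  let B : LinearMap.BilinForm ℝ (EuclideanSpace ℝ (Fin 4)) :=
    LinearMap.mk₂ ℝ (fun u v => 1 / 2 * H u v) (fun a b c => by simp; ring)
      (fun r a b => by simp; ring) (fun a b c => by simp; ring) (fun r a b => by simp; ring)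
  have hBsymm : ∀ u v, B u v = B v u := fun u v => by
    change 1 / 2 * H u v = 1 / 2 * H v u
    rw [hsymm]
  have hass : QuadraticMap.associated (R := ℝ) B.toQuadraticMap = B :=
    QuadraticMap.associated_left_inverse ℝ hBsymm
  obtain ⟨w, hw, ⟨ie⟩⟩ := QuadraticForm.equivalent_one_neg_one_weighted_sum_squared
    B.toQuadraticMap (by
      rw [hass]
      intro u hu
      refine hnd u fun v => ?_
      have : 1 / 2 * H u v = 0 := hu v
      linarith)
  have hfr : Module.finrank ℝ (EuclideanSpace ℝ (Fin 4)) = 4 := by simp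
  let cast : Fin 4 ≃ Fin (Module.finrank ℝ (EuclideanSpace ℝ (Fin 4))) := finCongr hfr.symm
  let L : EuclideanSpace ℝ (Fin 4) ≃L[ℝ] (Fin 4 → ℝ) :=
    (ie.toLinearEquiv.trans (LinearEquiv.funCongrLeft ℝ ℝ cast)).toContinuousLinearEquiv
  have hL : ∀ x, 1 / 2 * H x x = ∑ i, w (cast i) * (L x i) ^ 2 := by
    intro x
    have h1 : QuadraticMap.weightedSumSquares ℝ w (ie x) = 1 / 2 * H x x := ie.map_app x
    rw [← h1, QuadraticMap.weightedSumSquares_apply,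
      ← Equiv.sum_comp cast]
    refine Finset.sum_congr rfl fun i _ => ?_
    rw [smul_eq_mul, sq]
    rfl
  let τ : EuclideanSpace ℝ (Fin 4) ≃ₜ EuclideanSpace ℝ (Fin 4) := Homeomorph.addLeft (-a)
  let Ψ := ((chartAt (EuclideanSpace ℝ (Fin 4)) p).trans
    (τ.transOpenPartialHomeomorph Φ)).transHomeomorph L.toHomeomorph
  have hpc : p ∈ (chartAt (EuclideanSpace ℝ (Fin 4)) p).source := mem_chart_source _ p
  have hac : a = chartAt (EuclideanSpace ℝ (Fin 4)) p p := by simp [ha]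
  have hΨ : ∀ x, Ψ x = L (Φ (-a + chartAt (EuclideanSpace ℝ (Fin 4)) p x)) := fun x => rfl
  have hsrc : ∀ x, x ∈ Ψ.source ↔ x ∈ (chartAt (EuclideanSpace ℝ (Fin 4)) p).source ∧
      -a + chartAt (EuclideanSpace ℝ (Fin 4)) p x ∈ Φ.source := by
    intro x
    change x ∈ ((chartAt (EuclideanSpace ℝ (Fin 4)) p).trans
      (τ.transOpenPartialHomeomorph Φ)).source ↔ _
    rw [OpenPartialHomeomorph.trans_source]
    rfl
  have hG0 : G 0 = π p := by
    simp [hG, hF, ha]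
  refine ⟨w ∘ cast, fun i => hw _, Ψ, ?_, ?_, ?_⟩
  · rw [hsrc, ← hac, neg_add_cancel]
    exact ⟨hpc, h0⟩
  · rw [hΨ, ← hac, neg_add_cancel, hΦ0, map_zero]
  · intro x hx
    rw [hsrc] at hx
    have h1 := hΦ _ hx.2
    rw [hG0, hL] at h1
    rw [hΨ]
    simp only [Function.comp]
    rw [← h1]
    simp [hG, hF, (chartAt (EuclideanSpace ℝ (Fin 4)) p).left_inv hx.1]

end Manifold


/-! ### The fibres of the local models -/

section ModelFibers

/-- The neck `|x|² - y² = τ`, `|y| < a`. -/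
theorem neck_good {a τ : ℝ} (ha : 0 < a) (h0 : 0 ≤ τ) (hτ : τ < 3 * a ^ 2) {A : Set (E3 × ℝ)}
    (hA : A = {z | (‖z.1‖ < 2 * a ∧ |z.2| < a) ∧ ‖z.1‖ ^ 2 - z.2 ^ 2 = τ}) :
    A.Nonempty ∧ IsPreconnected A ∧ Coc A ≤ Ex A := by
  -- The bound on `‖z.1‖` is automatic, since `‖x‖² = τ + y² < 3a² + a²`.
  have hmem : ∀ z : E3 × ℝ, z ∈ A ↔ |z.2| < a ∧ ‖z.1‖ ^ 2 - z.2 ^ 2 = τ := by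
    intro z
    rw [hA]
    refine ⟨fun h => ⟨h.1.2, h.2⟩, fun h => ⟨⟨?_, h.1⟩, h.2⟩⟩
    have h1 : z.2 ^ 2 < a ^ 2 := by
      rw [sq_lt_sq, abs_of_pos ha]
      exact h.1
    refine lt_of_pow_lt_pow_left₀ 2 (by positivity) ?_
    nlinarith [h.2]
  -- At `τ = 0` the fibre is a cone, star-shaped about its vertex. For `τ > 0` it is a neck `S² ×
  -- (-a, a)`, identified with the punctured ball of radius `2a` by taking `y + a` as the new
  -- radius.
  rcases h0.eq_or_lt with rfl | h0
  · have hmem0 : (0 : E3 × ℝ) ∈ A := (hmem 0).2 ⟨by simpa using ha, by simp⟩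
    have hstar : StarConvex ℝ (0 : E3 × ℝ) A := by
      rw [starConvex_zero_iff]
      intro z hz c hc0 hc1
      rw [hmem] at hz ⊢
      refine ⟨?_, ?_⟩
      · change |c * z.2| < a
        rw [abs_mul, abs_of_nonneg hc0]
        nlinarith [abs_nonneg z.2, hz.1]
      · change ‖c • z.1‖ ^ 2 - (c * z.2) ^ 2 = 0
        rw [norm_smul, Real.norm_eq_abs, mul_pow, mul_pow, sq_abs]
        linear_combination c ^ 2 * hz.2
    exact ⟨⟨0, hmem0⟩, (hstar.isPathConnected hmem0).isConnected.isPreconnected,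
      StarConvex.Coc_le_Ex hstar⟩
  · let g : E3 × ℝ → E3 := fun z => ((z.2 + a) / ‖z.1‖) • z.1
    let g' : E3 → E3 × ℝ := fun v => ((√(τ + (‖v‖ - a) ^ 2) / ‖v‖) • v, ‖v‖ - a)
    have hpos : ∀ z ∈ A, 0 < ‖z.1‖ := by
      intro z hz
      rw [hmem] at hz
      refine (norm_nonneg _).lt_of_ne fun h => ?_
      rw [← h] at hz
      nlinarith [hz.2, sq_nonneg z.2]
    have hnorm : ∀ z ∈ A, ‖z.1‖ = √(τ + z.2 ^ 2) := by
      intro z hz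
      rw [← ((hmem z).1 hz).2, sub_add_cancel, Real.sqrt_sq (norm_nonneg _)]
    have hgnorm : ∀ z ∈ A, ‖g z‖ = z.2 + a := by
      intro z hz
      have h1 := hpos z hz
      have h2 := abs_lt.1 ((hmem z).1 hz).1
      change ‖((z.2 + a) / ‖z.1‖) • z.1‖ = _
      rw [norm_smul, Real.norm_eq_abs, abs_of_pos (div_pos (by linarith) h1),
        div_mul_cancel₀ _ h1.ne']
    have hball : ∀ v : E3, v ∈ Metric.ball (0 : E3) (2 * a) \ {0} ↔ 0 < ‖v‖ ∧ ‖v‖ < 2 * a := by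
      intro v
      rw [mem_sdiff, mem_ball_zero_iff, mem_singleton_iff, norm_pos_iff]
      exact and_comm
    have hg : ContinuousOn g A := by
      have h1 : ContinuousOn (fun z : E3 × ℝ => (z.2 + a) / ‖z.1‖) A :=
        ContinuousOn.div (by fun_prop) (by fun_prop) fun z hz => (hpos z hz).ne'
      exact ContinuousOn.smul (f := fun z : E3 × ℝ => (z.2 + a) / ‖z.1‖) (g := fun z => z.1) h1
        continuous_fst.continuousOn
    have hg' : ContinuousOn g' (Metric.ball 0 (2 * a) \ {0}) := by
      refine ContinuousOn.prodMk ?_ (by fun_prop)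
      have h1 : ContinuousOn (fun v : E3 => √(τ + (‖v‖ - a) ^ 2) / ‖v‖)
          (Metric.ball 0 (2 * a) \ {0}) :=
        ContinuousOn.div (by fun_prop) (by fun_prop) fun v hv => ((hball v).1 hv).1.ne'
      exact ContinuousOn.smul (f := fun v : E3 => √(τ + (‖v‖ - a) ^ 2) / ‖v‖) (g := fun v => v) h1
        continuousOn_id
    have hm : MapsTo g A (Metric.ball 0 (2 * a) \ {0}) := by
      intro z hz
      have h2 := abs_lt.1 ((hmem z).1 hz).1
      rw [hball, hgnorm z hz]
      constructor <;> linarith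
    have hm' : MapsTo g' (Metric.ball 0 (2 * a) \ {0}) A := by
      intro v hv
      rw [hball] at hv
      rw [hmem]
      refine ⟨?_, ?_⟩
      · change |‖v‖ - a| < a
        rw [abs_lt]
        constructor <;> linarith
      · change ‖(√(τ + (‖v‖ - a) ^ 2) / ‖v‖) • v‖ ^ 2 - (‖v‖ - a) ^ 2 = τ
        rw [norm_smul, Real.norm_eq_abs, abs_of_nonneg (by positivity),
          div_mul_cancel₀ _ hv.1.ne', Real.sq_sqrt (by positivity)]
        ring
    have hl : ∀ z ∈ A, g' (g z) = z := by
      intro z hz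
      have h1 := hpos z hz
      have h2 := abs_lt.1 ((hmem z).1 hz).1
      have h3 : z.2 + a ≠ 0 := by linarith
      refine Prod.ext ?_ ?_
      · change (√(τ + (‖g z‖ - a) ^ 2) / ‖g z‖) • g z = z.1
        rw [hgnorm z hz, add_sub_cancel_right, ← hnorm z hz]
        change (‖z.1‖ / (z.2 + a)) • ((z.2 + a) / ‖z.1‖) • z.1 = z.1
        rw [smul_smul, div_mul_div_comm, mul_comm ‖z.1‖, div_self (by positivity), one_smul]
      · change ‖g z‖ - a = z.2
        rw [hgnorm z hz, add_sub_cancel_right]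
    have himage : A = g' '' (Metric.ball 0 (2 * a) \ {0}) := by
      apply Subset.antisymm
      · exact fun z hz => ⟨g z, hm hz, hl z hz⟩
      · rintro _ ⟨v, hv, rfl⟩
        exact hm' hv
    refine ⟨?_, ?_, ?_⟩
    · rw [himage, image_nonempty]
      refine ⟨EuclideanSpace.single 0 a, (hball _).2 ?_⟩
      rw [PiLp.norm_single, Real.norm_eq_abs, abs_of_pos ha]
      constructor <;> linarith
    · rw [himage]
      exact (isPreconnected_punctured_ball 0 (by positivity)).image g' hg'
    · exact Coc_le_Ex_of_homeo hg hg' hm hm' hl (Coc_punctured_ball_le 0 (by positivity))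

/-- One sheet of `|x|² - y² = -τ`, `|x| < a`. -/
theorem sheet_good {a τ κ : ℝ} (hκ : κ = 1 ∨ κ = -1) (ha : 0 < a) (h0 : 0 ≤ τ)
    (hτ : τ < 3 * a ^ 2) {A : Set (E3 × ℝ)}
    (hA : A = {z | (‖z.1‖ < a ∧ 0 < κ * z.2 ∧ κ * z.2 < 2 * a) ∧ z.2 ^ 2 - ‖z.1‖ ^ 2 = τ}) :
    A.Nonempty ∧ IsPreconnected A ∧ Coc A ≤ Ex A := by
  have hκ2 : κ * κ = 1 := by rcases hκ with rfl | rfl <;> norm_num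
  -- A sheet is a graph over the ball `‖x‖ < a`. At `τ = 0` the condition `0 < κ y` removes the
  -- vertex and leaves a punctured ball.
  let g' : E3 → E3 × ℝ := fun x => (x, κ * √(‖x‖ ^ 2 + τ))
  have hsheet : ∀ z ∈ A, g' z.1 = z := by
    intro z hz
    rw [hA] at hz
    refine Prod.ext rfl ?_
    change κ * √(‖z.1‖ ^ 2 + τ) = z.2
    have h1 : ‖z.1‖ ^ 2 + τ = (κ * z.2) ^ 2 := by
      rw [mul_pow, sq κ, hκ2, one_mul]
      linarith [hz.2]
    rw [h1, Real.sqrt_sq hz.1.2.1.le, ← mul_assoc, hκ2, one_mul]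
  have hgA : ∀ x : E3, ‖x‖ < a → 0 < ‖x‖ ^ 2 + τ → g' x ∈ A := by
    intro x hx hpos
    rw [hA]
    have h1 : κ * (κ * √(‖x‖ ^ 2 + τ)) = √(‖x‖ ^ 2 + τ) := by rw [← mul_assoc, hκ2, one_mul]
    refine ⟨⟨hx, ?_, ?_⟩, ?_⟩
    · change 0 < κ * (κ * √(‖x‖ ^ 2 + τ))
      rw [h1]
      exact Real.sqrt_pos.2 hpos
    · change κ * (κ * √(‖x‖ ^ 2 + τ)) < 2 * a
      rw [h1, Real.sqrt_lt' (by positivity)]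
      nlinarith [norm_nonneg x]
    · change (κ * √(‖x‖ ^ 2 + τ)) ^ 2 - ‖x‖ ^ 2 = τ
      rw [mul_pow, sq κ, hκ2, one_mul, Real.sq_sqrt hpos.le]
      ring
  have hg' : Continuous g' := by fun_prop
  have main : ∀ B : Set E3, (∀ x, x ∈ B ↔ ‖x‖ < a ∧ 0 < ‖x‖ ^ 2 + τ) → B.Nonempty →
      IsPreconnected B → Coc B ≤ Ex B → A.Nonempty ∧ IsPreconnected A ∧ Coc A ≤ Ex A := by
    intro B hB hBne hBc hBe
    have hm : MapsTo Prod.fst A B := by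
      intro z hz
      rw [hA] at hz
      rw [hB]
      refine ⟨hz.1.1, ?_⟩
      have : z.2 ≠ 0 := by
        intro h
        have := hz.1.2.1
        rw [h, mul_zero] at this
        exact lt_irrefl _ this
      have h2 : 0 < z.2 ^ 2 := by positivity
      linarith [hz.2]
    have hm' : MapsTo g' B A := fun x hx => hgA x ((hB x).1 hx).1 ((hB x).1 hx).2
    have himage : A = g' '' B := by
      apply Subset.antisymm
      · exact fun z hz => ⟨z.1, hm hz, hsheet z hz⟩
      · rintro _ ⟨v, hv, rfl⟩
        exact hm' hv
    refine ⟨himage ▸ hBne.image g', himage ▸ hBc.image g' hg'.continuousOn, ?_⟩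
    exact Coc_le_Ex_of_homeo continuous_fst.continuousOn hg'.continuousOn hm hm' hsheet hBe
  rcases h0.eq_or_lt with rfl | h0
  · refine main (Metric.ball 0 a \ {0}) (fun x => ?_) ?_ (isPreconnected_punctured_ball 0 ha)
      (Coc_punctured_ball_le 0 ha)
    · rw [mem_sdiff, mem_ball_zero_iff, mem_singleton_iff, add_zero, ← ne_eq, ← norm_pos_iff]
      exact and_congr_right fun _ => ⟨fun h => by positivity, fun h => by
        refine (norm_nonneg x).lt_of_ne fun h' => ?_
        rw [← h'] at h
        simp at h⟩
    · refine ⟨EuclideanSpace.single 0 (a / 2), ?_, ?_⟩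
      · rw [mem_ball_zero_iff, PiLp.norm_single, Real.norm_eq_abs,
          abs_of_pos (half_pos ha)]
        linarith
      · rw [mem_singleton_iff, ← norm_eq_zero, PiLp.norm_single, Real.norm_eq_abs,
          abs_of_pos (half_pos ha)]
        positivity
  · refine main (Metric.ball 0 a) (fun x => ?_) ⟨0, Metric.mem_ball_self ha⟩
      (convex_ball _ _).isPreconnected
      (StarConvex.Coc_le_Ex ((convex_ball _ _) (Metric.mem_ball_self ha)))
    rw [mem_ball_zero_iff]
    exact ⟨fun h => ⟨h, by positivity⟩, fun h => h.1⟩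

theorem slice_good {a : E3} {b ρ t : ℝ} (hρ : 0 < ρ) (ht : |t - b| < ρ) {A : Set (E3 × ℝ)}
    (hA : A = {z | (‖z.1 - a‖ < ρ ∧ |z.2 - b| < ρ) ∧ z.2 = t}) :
    A.Nonempty ∧ IsPreconnected A ∧ Coc A ≤ Ex A := by
  have hA' : A = Metric.ball a ρ ×ˢ {t} := by
    rw [hA]
    ext z
    rw [mem_prod, mem_ball_iff_norm, mem_singleton_iff]
    constructor
    · exact fun h => ⟨h.1.1, h.2⟩
    · rintro ⟨h1, h2⟩
      exact ⟨⟨h1, by rw [h2]; exact ht⟩, h2⟩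
  have hconv : Convex ℝ A := by
    rw [hA']
    exact (convex_ball _ _).prod (convex_singleton _)
  have hmem : (a, t) ∈ A := by
    rw [hA']
    exact ⟨Metric.mem_ball_self hρ, rfl⟩
  exact ⟨⟨_, hmem⟩, hconv.isPreconnected, StarConvex.Coc_le_Ex (hconv hmem)⟩

end ModelFibers

/-! ### Good neighbourhoods from charts -/

section ChartGood

variable {Z : Type*} [TopologicalSpace Z]

theorem isGood_chart {Y : Type*} [TopologicalSpace Y] {f : Z → ℝ} {Q : Set Z} {F : ℝ → Set Z}
    (hF : ∀ t, F t = f ⁻¹' {t} \ Q) {J : Set ℝ} {t₀ : ℝ} (Ψ : OpenPartialHomeomorph Z Y)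
    {D : Set Y} (hD : IsOpen D) (hDt : D ⊆ Ψ.target) {m : Y → ℝ}
    (hm : ∀ z ∈ D, f (Ψ.symm z) = m z) (hQ : ∀ z ∈ D, Ψ.symm z ∉ Q)
    (hgood : ∀ᶠ t in 𝓝[J] t₀, ({z | z ∈ D ∧ m z = t}).Nonempty ∧
      IsPreconnected {z | z ∈ D ∧ m z = t} ∧
      Coc {z | z ∈ D ∧ m z = t} ≤ Ex {z | z ∈ D ∧ m z = t}) :
    IsGood F J t₀ (Ψ.symm '' D) := by
  refine ⟨Ψ.symm.isOpen_image_of_subset_source hD hDt, ?_⟩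
  filter_upwards [hgood] with t ht
  set A := {z | z ∈ D ∧ m z = t}
  have hAD : A ⊆ D := fun z hz => hz.1
  have himage : F t ∩ Ψ.symm '' D = Ψ.symm '' A := by
    apply Subset.antisymm
    · rintro _ ⟨hz, z, hzD, rfl⟩
      rw [hF] at hz
      exact ⟨z, ⟨hzD, by rw [← hm z hzD]; exact hz.1⟩, rfl⟩
    · rintro _ ⟨z, ⟨hzD, hzt⟩, rfl⟩
      rw [hF]
      exact ⟨⟨by rw [mem_preimage, hm z hzD, hzt]; rfl, hQ z hzD⟩, z, hzD, rfl⟩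
  have hcont : ContinuousOn Ψ.symm A := Ψ.symm.continuousOn.mono (hAD.trans hDt)
  have hcont' : ContinuousOn Ψ (Ψ.symm '' A) := Ψ.continuousOn.mono (by
    rintro _ ⟨z, hz, rfl⟩
    exact Ψ.map_target (hDt (hAD hz)))
  rw [himage]
  refine ⟨ht.1.image _, ht.2.1.image _ hcont, ?_⟩
  refine Coc_le_Ex_of_homeo hcont' hcont (S' := A) ?_ (mapsTo_image _ _) ?_ ht.2.2
  · rintro _ ⟨z, hz, rfl⟩
    rwa [Ψ.right_inv (hDt (hAD hz))]
  · rintro _ ⟨z, hz, rfl⟩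
    rw [Ψ.right_inv (hDt (hAD hz))]

variable {f : Z → ℝ} {Q : Set Z} {F : ℝ → Set Z}

theorem exists_ball_subset_chart {Y : Type*} [PseudoMetricSpace Y] (Ψ : OpenPartialHomeomorph Z Y)
    {p : Z} (hp : p ∈ Ψ.source) {O : Set Z} (hO : O ∈ 𝓝 p) :
    ∃ r > 0, Metric.ball (Ψ p) r ⊆ Ψ.target ∧ Ψ.symm '' Metric.ball (Ψ p) r ⊆ O := by
  have h1 : Ψ.target ∩ Ψ.symm ⁻¹' O ∈ 𝓝 (Ψ p) := by
    refine Filter.inter_mem (Ψ.open_target.mem_nhds (Ψ.map_source hp)) ?_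
    refine (Ψ.symm.continuousAt (Ψ.map_source hp)).preimage_mem_nhds ?_
    rwa [Ψ.left_inv hp]
  obtain ⟨r, hr, hball⟩ := Metric.mem_nhds_iff.1 h1
  refine ⟨r, hr, fun z hz => (hball hz).1, ?_⟩
  rintro _ ⟨z, hz, rfl⟩
  exact (hball hz).2

theorem RegularAt.exists_isGood (hF : ∀ t, F t = f ⁻¹' {t} \ Q) (hQ : IsClosed Q) (J : Set ℝ)
    {p : Z} (h : RegularAt f p) (hpQ : p ∉ Q) {O : Set Z} (hO : O ∈ 𝓝 p) :
    ∃ U, p ∈ U ∧ U ⊆ O ∧ IsGood F J (f p) U := by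
  obtain ⟨Ψ, hp, hf⟩ := h
  obtain ⟨r, hr, hrt, hrO⟩ := exists_ball_subset_chart Ψ hp
    (Filter.inter_mem hO (hQ.isOpen_compl.mem_nhds hpQ))
  have hball : Metric.ball (Ψ p) r = {z | ‖z.1 - (Ψ p).1‖ < r ∧ |z.2 - (Ψ p).2| < r} := by
    ext z
    rw [Metric.mem_ball, Prod.dist_eq, max_lt_iff, dist_eq_norm, Real.dist_eq]
    rfl
  refine ⟨Ψ.symm '' Metric.ball (Ψ p) r, ⟨Ψ p, Metric.mem_ball_self hr, Ψ.left_inv hp⟩,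
    fun z hz => (hrO hz).1, ?_⟩
  refine isGood_chart hF Ψ Metric.isOpen_ball hrt (m := Prod.snd) (fun z hz => ?_)
    (fun z hz => (hrO ⟨z, hz, rfl⟩).2) ?_
  · rw [hf _ (Ψ.map_target (hrt hz)), Ψ.right_inv (hrt hz)]
  · have : ∀ᶠ t in 𝓝 (f p), |t - (Ψ p).2| < r := by
      rw [← hf p hp]
      filter_upwards [Metric.ball_mem_nhds (f p) hr] with t ht
      rwa [Metric.mem_ball, Real.dist_eq] at ht
    filter_upwards [mem_nhdsWithin_of_mem_nhds this] with t ht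
    exact slice_good hr ht (by rw [hball]; rfl)

theorem eventually_mul_lt {σ c : ℝ} (hc : 0 < c) : ∀ᶠ t in 𝓝 (0 : ℝ), σ * t < c := by
  have : Filter.Tendsto (fun t => σ * t) (𝓝 (0 : ℝ)) (𝓝 (σ * 0)) :=
    (continuous_const.mul continuous_id).tendsto 0
  rw [mul_zero] at this
  exact this.eventually (gt_mem_nhds hc)

/-- Only parameters with `0 ≤ σ t` are allowed: on this side the fibre is a cone or a neck, never
two sheets. -/
theorem NodeAt.exists_isGood_neck (hF : ∀ t, F t = f ⁻¹' {t} \ Q) (hQ : IsClosed Q) {σ : ℝ}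
    (hσ : σ = 1 ∨ σ = -1)
    {p : Z} (h : NodeAt σ f p) (hpQ : p ∉ Q) {O : Set Z} (hO : O ∈ 𝓝 p) :
    ∃ U, p ∈ U ∧ U ⊆ O ∧ IsGood F {t | 0 ≤ σ * t} 0 U := by
  have hσ2 : σ * σ = 1 := by rcases hσ with rfl | rfl <;> norm_num
  obtain ⟨Ψ, hp, h0, hf⟩ := h
  obtain ⟨r, hr, hrt, hrO⟩ := exists_ball_subset_chart Ψ hp
    (Filter.inter_mem hO (hQ.isOpen_compl.mem_nhds hpQ))
  rw [h0] at hrt hrO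
  set a := r / 2
  have ha : 0 < a := half_pos hr
  set D : Set (E3 × ℝ) := {z | ‖z.1‖ < 2 * a ∧ |z.2| < a} with hD
  have hDb : D ⊆ Metric.ball 0 r := by
    rintro z ⟨h1, h2⟩
    rw [mem_ball_zero_iff, Prod.norm_def, max_lt_iff, Real.norm_eq_abs]
    constructor <;> simp only [a] at h1 h2 <;> linarith
  have hDo : IsOpen D := by
    have h1 : IsOpen {z : E3 × ℝ | ‖z.1‖ < 2 * a} := isOpen_lt (by fun_prop) (by fun_prop)
    have h2 : IsOpen {z : E3 × ℝ | |z.2| < a} := isOpen_lt (by fun_prop) (by fun_prop)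
    exact h1.inter h2
  refine ⟨Ψ.symm '' D, ⟨0, ⟨by simpa using ha, by simpa using ha⟩, by rw [← h0, Ψ.left_inv hp]⟩, ?_, ?_⟩
  · rintro _ ⟨z, hz, rfl⟩
    exact (hrO ⟨z, hDb hz, rfl⟩).1
  · refine isGood_chart hF Ψ hDo (hDb.trans hrt) (m := fun z => σ * (‖z.1‖ ^ 2 - z.2 ^ 2))
      (fun z hz => ?_) (fun z hz => (hrO ⟨z, hDb hz, rfl⟩).2) ?_
    · rw [hf _ (Ψ.map_target (hrt (hDb hz))), Ψ.right_inv (hrt (hDb hz))]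
    · filter_upwards [self_mem_nhdsWithin,
        mem_nhdsWithin_of_mem_nhds (eventually_mul_lt (show 0 < 3 * a ^ 2 by positivity))]
        with t ht0 ht
      refine neck_good ha ht0 ht ?_
      ext z
      refine and_congr_right fun _ => ⟨fun h => ?_, fun h => ?_⟩
      · rw [← h, ← mul_assoc, hσ2, one_mul]
      · rw [h, ← mul_assoc, hσ2, one_mul]

/-- The half of a neighbourhood of a node containing one of the two sheets. -/
def halfBox (κ a : ℝ) : Set (E3 × ℝ) := {z | ‖z.1‖ < a ∧ 0 < κ * z.2 ∧ κ * z.2 < 2 * a}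

theorem isOpen_halfBox (κ a : ℝ) : IsOpen (halfBox κ a) := by
  have h1 : IsOpen {z : E3 × ℝ | ‖z.1‖ < a} := isOpen_lt (by fun_prop) (by fun_prop)
  have h2 : IsOpen {z : E3 × ℝ | 0 < κ * z.2} := isOpen_lt (by fun_prop) (by fun_prop)
  have h3 : IsOpen {z : E3 × ℝ | κ * z.2 < 2 * a} := isOpen_lt (by fun_prop) (by fun_prop)
  exact h1.inter (h2.inter h3)

theorem isGood_halfBox (hF : ∀ t, F t = f ⁻¹' {t} \ Q) {σ κ : ℝ} (hσ : σ = 1 ∨ σ = -1)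
    (hκ : κ = 1 ∨ κ = -1) (Ψ : OpenPartialHomeomorph Z (E3 × ℝ))
    (hf : ∀ x ∈ Ψ.source, f x = σ * (‖(Ψ x).1‖ ^ 2 - (Ψ x).2 ^ 2)) {a : ℝ} (ha : 0 < a)
    (hD : halfBox κ a ⊆ Ψ.target) (hQ : ∀ z ∈ halfBox κ a, Ψ.symm z ∉ Q) :
    IsGood F {t | 0 ≤ -σ * t} 0 (Ψ.symm '' halfBox κ a) := by
  have hσ2 : σ * σ = 1 := by rcases hσ with rfl | rfl <;> norm_num
  refine isGood_chart hF Ψ (isOpen_halfBox κ a) hD (m := fun z => σ * (‖z.1‖ ^ 2 - z.2 ^ 2))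
    (fun z hz => ?_) hQ ?_
  · rw [hf _ (Ψ.map_target (hD hz)), Ψ.right_inv (hD hz)]
  · filter_upwards [self_mem_nhdsWithin,
      mem_nhdsWithin_of_mem_nhds (eventually_mul_lt (show 0 < 3 * a ^ 2 by positivity))]
      with t ht0 ht
    refine sheet_good hκ ha ht0 ht ?_
    ext z
    refine and_congr_right fun _ => ⟨fun h => ?_, fun h => ?_⟩
    · rw [← h]
      linear_combination (z.2 ^ 2 - ‖z.1‖ ^ 2) * (- hσ2)
    · linear_combination (- σ) * h + t * hσ2

/-- The closed box is compact inside the chart, so its image is already closed. Besides enlarging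
the box, passing to the closure adds only points with `y = 0`. -/
theorem closure_chart_image_subset [T2Space Z] (Ψ : OpenPartialHomeomorph Z (E3 × ℝ)) {κ a r : ℝ}
    (hκ : κ = 1 ∨ κ = -1) (har : 2 * a < r) (hrt : Metric.ball 0 r ⊆ Ψ.target) :
    closure (Ψ.symm '' halfBox κ a) ⊆ Ψ.symm '' {z | ‖z.1‖ ≤ a ∧ 0 ≤ κ * z.2 ∧ κ * z.2 ≤ 2 * a} := by
  rcases le_or_gt a 0 with ha | ha
  · have : halfBox κ a = ∅ := by
      rw [eq_empty_iff_forall_notMem]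
      rintro z ⟨h1, _⟩
      linarith [norm_nonneg z.1]
    rw [this]
    simp
  set C : Set (E3 × ℝ) := {z | ‖z.1‖ ≤ a ∧ 0 ≤ κ * z.2 ∧ κ * z.2 ≤ 2 * a} with hC
  have hCb : C ⊆ Metric.closedBall 0 (2 * a) := by
    rintro z ⟨h1, h2, h3⟩
    rw [mem_closedBall_zero_iff, Prod.norm_def, max_le_iff, Real.norm_eq_abs]
    refine ⟨by linarith, ?_⟩
    rw [abs_le]
    rcases hκ with rfl | rfl <;> constructor <;> linarith
  have hCc : IsClosed C := by
    have h1 : IsClosed {z : E3 × ℝ | ‖z.1‖ ≤ a} := isClosed_le (by fun_prop) (by fun_prop)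
    have h2 : IsClosed {z : E3 × ℝ | 0 ≤ κ * z.2} := isClosed_le (by fun_prop) (by fun_prop)
    have h3 : IsClosed {z : E3 × ℝ | κ * z.2 ≤ 2 * a} := isClosed_le (by fun_prop) (by fun_prop)
    exact h1.inter (h2.inter h3)
  have hCcomp : IsCompact C := (isCompact_closedBall _ _).of_isClosed_subset hCc hCb
  have hCt : C ⊆ Ψ.target := (hCb.trans (Metric.closedBall_subset_ball har)).trans hrt
  have : IsClosed (Ψ.symm '' C) := (hCcomp.image_of_continuousOn (Ψ.symm.continuousOn.mono hCt)).isClosed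
  refine closure_minimal (image_mono ?_) this
  rintro z ⟨h1, h2, h3⟩
  exact ⟨h1.le, h2.le, h3.le⟩

end ChartGood


/-! ### Comparing fibres on one side of the singular value -/

section FiberComparison

variable {Z : Type*} [TopologicalSpace Z]

theorem halfBox_mono {κ a b : ℝ} (h : a ≤ b) : halfBox κ a ⊆ halfBox κ b :=
  fun _ hz => ⟨hz.1.trans_le h, hz.2.1, hz.2.2.trans_le (by linarith)⟩

theorem halfBox_subset_ball {κ a r : ℝ} (hκ : κ = 1 ∨ κ = -1) (h : 2 * a ≤ r) :
    halfBox κ a ⊆ Metric.ball 0 r := by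
  rintro z ⟨h1, h2, h3⟩
  have := norm_nonneg z.1
  rw [mem_ball_zero_iff, Prod.norm_def, max_lt_iff, Real.norm_eq_abs, abs_lt]
  rcases hκ with rfl | rfl <;> refine ⟨?_, ?_, ?_⟩ <;> linarith

set_option maxHeartbeats 800000 in
/-- The first cohomology of the fibres near a singular fibre, on one side `0 ≤ s t` of it, where on
this side the nodes in `P` with sign `-s` are removed from the singular fibre. -/
theorem rank_H1_fiber_near_zero [T2Space Z] [LocallyCompactSpace Z] {f : Z → ℝ}
    (hf : Continuous f) {s : ℝ} (hs : s = 1 ∨ s = -1) {P : Set Z} (hP : P.Finite) {σ : Z → ℝ}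
    (hσ : ∀ p ∈ P, σ p = 1 ∨ σ p = -1) (hnode : ∀ p ∈ P, NodeAt (σ p) f p)
    (hreg : ∀ x, f x = 0 → x ∉ P → RegularAt f x) (hK : IsCompact (f ⁻¹' {0}))
    {G : Set Z} (hG : IsOpen G) (hGc : IsCompact (closure G)) (htG : f ⁻¹' {0} ⊆ G)
    {Q : Set Z} (hQdef : Q = {p ∈ P | σ p = -s}) :
    ∀ᶠ t in 𝓝[{t | 0 ≤ s * t}] 0,
      Module.rank ℝ (H1 ((f ⁻¹' {t} \ Q) ∩ G)) = Module.rank ℝ (H1 (f ⁻¹' {0} \ Q)) ∧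
      ∀ u : Z → ℕ, (∀ x ∈ (f ⁻¹' {t} \ Q) ∩ G, ∀ᶠ y in 𝓝[(f ⁻¹' {t} \ Q) ∩ G] x, u y = u x) →
        ∃ v : Z → ℕ, (∀ x ∈ f ⁻¹' {0} \ Q, ∀ᶠ y in 𝓝[f ⁻¹' {0} \ Q] x, v y = v x) ∧
          u '' ((f ⁻¹' {t} \ Q) ∩ G) ⊆ v '' (f ⁻¹' {0} \ Q) := by
  classical
  have hQP : Q ⊆ P := by
    rw [hQdef]
    exact fun p hp => hp.1
  have hQfin : Q.Finite := hP.subset hQP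
  have hQσ : ∀ p ∈ Q, NodeAt (-s) f p := by
    rintro p hp
    have := hnode p (hQP hp)
    rw [hQdef] at hp
    rwa [hp.2] at this
  have hs2 : s * s = 1 := by rcases hs with rfl | rfl <;> norm_num
  have hs' : -s = 1 ∨ -s = -1 := by rcases hs with rfl | rfl <;> norm_num
  set J : Set ℝ := {t | 0 ≤ s * t} with hJ
  set F : ℝ → Set Z := fun t => f ⁻¹' {t} \ Q with hFdef
  have hF : ∀ t, F t = f ⁻¹' {t} \ Q := fun t => rfl
  obtain ⟨V, hV, hVdisj⟩ := hQfin.t2_separation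
  have hchart : ∀ p : Q, ∃ Ψ : OpenPartialHomeomorph Z (E3 × ℝ), ∃ r > 0, p.1 ∈ Ψ.source ∧
      Ψ p.1 = 0 ∧ (∀ x ∈ Ψ.source, f x = -s * (‖(Ψ x).1‖ ^ 2 - (Ψ x).2 ^ 2)) ∧
      Metric.ball 0 r ⊆ Ψ.target ∧
      Ψ.symm '' Metric.ball 0 r ⊆ G ∩ V p.1 ∩ (Q \ {p.1})ᶜ := by
    intro p
    obtain ⟨Ψ, hp, h0, hΨ⟩ := hQσ p p.2
    have hfp : f p = 0 := by
      rw [hΨ _ hp, h0]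
      simp
    obtain ⟨r, hr, hrt, hrO⟩ := exists_ball_subset_chart Ψ hp (O := G ∩ V p.1 ∩ (Q \ {p.1})ᶜ)
      (Filter.inter_mem (Filter.inter_mem (hG.mem_nhds (htG hfp)) ((hV p.1).2.mem_nhds (hV p.1).1))
        ((hQfin.subset sdiff_subset).isClosed.isOpen_compl.mem_nhds (by simp)))
    rw [h0] at hrt hrO
    exact ⟨Ψ, r, hr, hp, h0, hΨ, hrt, hrO⟩
  choose Ψ r hr hpΨ hΨ0 hΨf hrt hrO using hchart
  -- On the side `0 ≤ s t` a removed node has two sheets, indexed by the sign of `y`.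
  let sg : Bool → ℝ := fun b => if b then 1 else -1
  have hsg : ∀ b, sg b = 1 ∨ sg b = -1 := by
    intro b
    cases b <;> simp [sg]
  let H : Q × Bool → ℝ → Set Z := fun i a => (Ψ i.1).symm '' halfBox (sg i.2) a
  have hbox : ∀ (i : Q × Bool) a, 2 * a ≤ r i.1 → halfBox (sg i.2) a ⊆ (Ψ i.1).target :=
    fun i a ha => (halfBox_subset_ball (hsg _) ha).trans (hrt _)
  have hsymm0 : ∀ p : Q, (Ψ p).symm 0 = p.1 := fun p => by rw [← hΨ0 p, (Ψ p).left_inv (hpΨ p)]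
  have hnotQ : ∀ (p : Q) z, z ∈ Metric.ball 0 (r p) → (Ψ p).symm z ∈ Q → z = 0 := by
    intro p z hz hzQ
    by_contra hz0
    refine (hrO p ⟨z, hz, rfl⟩).2 ⟨hzQ, fun h => hz0 ?_⟩
    rw [← (Ψ p).right_inv (hrt p hz), mem_singleton_iff.1 h, hΨ0]
  have hgoodH : ∀ i a, 0 < a → 2 * a ≤ r i.1 → IsGood F J 0 (H i a) := by
    intro i a ha har
    have := isGood_halfBox hF hs' (hsg i.2) (Ψ i.1) (hΨf i.1) ha (hbox i a har) (fun z hz hzQ => by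
      have := hnotQ i.1 z (halfBox_subset_ball (hsg _) har hz) hzQ
      rw [this] at hz
      simpa using hz.2.1)
    rwa [neg_neg] at this
  -- On this side `s f = y² - ‖x‖² ≥ 0`, so `y = 0` only at the node, which is removed. This
  -- separates the two half-boxes.
  have hsheet : ∀ (p : Q) z, z ∈ Metric.ball 0 (r p) → (Ψ p).symm z ∈ f ⁻¹' J \ Q → z.2 ≠ 0 := by
    intro p z hz hzJ h2
    have h3 : 0 ≤ s * f ((Ψ p).symm z) := hzJ.1
    rw [hΨf _ _ ((Ψ p).map_target (hrt p hz)), (Ψ p).right_inv (hrt p hz), h2] at h3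
    have h4 : ‖z.1‖ ^ 2 ≤ 0 := by nlinarith
    have h5 : ‖z.1‖ = 0 := by
      have := sq_nonneg ‖z.1‖
      exact pow_eq_zero_iff two_ne_zero |>.1 (le_antisymm h4 this)
    have h6 : z = 0 := Prod.ext (norm_eq_zero.1 h5) h2
    rw [h6, hsymm0] at hzJ
    exact hzJ.2 p.2
  have hclos : ∀ i a b, a < b → 0 < b → 2 * b ≤ r i.1 →
      closure (H i a) ∩ (f ⁻¹' J \ Q) ⊆ H i b := by
    rintro i a b hab hb hbr _ ⟨hz, hzJ⟩
    obtain ⟨z, ⟨h1, h2, h3⟩, rfl⟩ := closure_chart_image_subset (Ψ i.1) (hsg i.2)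
      (show 2 * a < r i.1 by linarith) (hrt i.1) hz
    have hzb : z ∈ Metric.ball 0 (r i.1) := by
      rw [mem_ball_zero_iff, Prod.norm_def, max_lt_iff, Real.norm_eq_abs, abs_lt]
      rcases hsg i.2 with h | h <;> rw [h] at h2 h3 <;> refine ⟨?_, ?_, ?_⟩ <;> linarith
    have hz2 := hsheet i.1 z hzb hzJ
    refine ⟨z, ⟨h1.trans_lt hab, ?_, by linarith⟩, rfl⟩
    refine h2.lt_of_ne fun h => hz2 ?_
    rcases hsg i.2 with h' | h' <;> rw [h'] at h <;> linarith
  have hHO : ∀ i a, 2 * a ≤ r i.1 → H i a ⊆ G ∩ V i.1.1 := by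
    rintro i a har _ ⟨z, hz, rfl⟩
    exact (hrO i.1 ⟨z, halfBox_subset_ball (hsg _) har hz, rfl⟩).1
  have _ : Finite Q := hQfin.to_subtype
  let N : Set Z := ⋃ p : Q, (Ψ p).symm '' Metric.ball 0 (r p / 16)
  have hballs : ∀ p : Q, Metric.ball (0 : E3 × ℝ) (r p / 16) ⊆ Metric.ball 0 (r p) := fun p =>
    Metric.ball_subset_ball (by linarith [hr p])
  -- The nested half-boxes of sizes `r/16`, `r/8`, `r/4` describe the two ends at each removed node.
  -- Nodes that are kept have sign `s` and are surrounded by necks.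
  refine rank_H1_fiber_eventually_eq hf (J := J) (t₀ := 0) (by simp [hJ]) hQfin.isClosed hF hK ?_
    (P := Q × Bool) (W' := fun i => H i (r i.1 / 16)) (W := fun i => H i (r i.1 / 8))
    (U := fun i => H i (r i.1 / 4)) ?_ ?_ ?_ ?_ ?_ ?_ ?_ ?_ (N := N) ?_ ?_ ?_ hG hGc htG ?_
  · intro e he O hO
    by_cases heP : e ∈ P
    · have hσe : σ e = s := by
        have h1 : σ e ≠ -s := fun h => he.2 (by rw [hQdef]; exact ⟨heP, h⟩)
        clear * - h1 hs hσ heP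
        rcases hσ e heP with h | h <;> rcases hs with rfl | rfl
        · exact h
        · exact absurd (h.trans (neg_neg 1).symm) h1
        · exact absurd h h1
        · exact h
      have := (hnode e heP).exists_isGood_neck hF hQfin.isClosed (hσ e heP) he.2 hO
      rwa [hσe] at this
    · have := (hreg e he.1 heP).exists_isGood hF hQfin.isClosed J he.2 hO
      rwa [show f e = 0 from he.1] at this
  · exact fun i => hgoodH i _ (by have := hr i.1; positivity) (by linarith [hr i.1])
  · exact fun i => hgoodH i _ (by have := hr i.1; positivity) (by linarith [hr i.1])
  · exact fun i => hgoodH i _ (by have := hr i.1; positivity) (by linarith [hr i.1])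
  · exact fun i => image_mono (halfBox_mono (by linarith [hr i.1]))
  · exact fun i => image_mono (halfBox_mono (by linarith [hr i.1]))
  · exact fun i => hclos i _ _ (by linarith [hr i.1]) (by linarith [hr i.1]) (by linarith [hr i.1])
  · exact fun i => hclos i _ _ (by linarith [hr i.1]) (by linarith [hr i.1]) (by linarith [hr i.1])
  · rintro ⟨p, b⟩ ⟨q, b'⟩ ⟨x, hx, hx'⟩
    have h1 := (hHO _ _ (by linarith [hr p]) hx).2
    have h2 := (hHO _ _ (by linarith [hr q]) hx').2
    have hpq : p = q := by
      by_contra hne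
      exact disjoint_left.1 (hVdisj p.2 q.2 fun h => hne (Subtype.ext h)) h1 h2
    subst hpq
    obtain ⟨z, hz, rfl⟩ := hx
    obtain ⟨z', hz', h3⟩ := hx'
    have h4 : z' = z := (Ψ p).symm.injOn (hbox (p, b') _ (by linarith [hr p]) hz')
      (hbox (p, b) _ (by linarith [hr p]) hz) h3
    subst h4
    have h5 := hz.2.1
    have h6 := hz'.2.1
    refine Prod.ext rfl ?_
    cases b <;> cases b' <;> simp [sg] at h5 h6 ⊢ <;> linarith
  · exact isOpen_iUnion fun p => (Ψ p).symm.isOpen_image_of_subset_source Metric.isOpen_ball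
      ((hballs p).trans (hrt p))
  · rintro x ⟨_, hx⟩
    exact mem_iUnion.2 ⟨⟨x, hx⟩, 0, Metric.mem_ball_self (by linarith [hr ⟨x, hx⟩]), hsymm0 _⟩
  · rintro x ⟨hxN, hxJ⟩
    obtain ⟨p, z, hz, rfl⟩ := mem_iUnion.1 hxN
    have hz2 := hsheet p z (hballs p hz) hxJ
    rw [mem_ball_zero_iff, Prod.norm_def, max_lt_iff, Real.norm_eq_abs, abs_lt] at hz
    rcases lt_or_gt_of_ne hz2 with h | h
    · refine mem_iUnion.2 ⟨(p, false), z, ⟨hz.1, ?_, ?_⟩, rfl⟩ <;> simp [sg] <;> linarith [hr p]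
    · refine mem_iUnion.2 ⟨(p, true), z, ⟨hz.1, ?_, ?_⟩, rfl⟩ <;> simp [sg] <;> linarith [hr p]
  · exact fun i x hx => (hHO i _ (by linarith [hr i.1]) hx).1

end FiberComparison


/-! ### Periodic maps of `ℝ³` -/

section PeriodicChart

variable {Z : Type*} [TopologicalSpace Z]

theorem isCompact_cube (N : ℝ) : IsCompact {x : E3 | ∀ i, 0 ≤ x i ∧ x i ≤ N} := by
  have h : IsCompact (Icc (0 : Fin 3 → ℝ) fun _ => N) := isCompact_Icc
  convert h.image (PiLp.continuous_toLp 2 (fun _ : Fin 3 => ℝ)) using 1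
  ext x
  constructor
  · intro hx
    exact ⟨fun i => x i, ⟨fun i => (hx i).1, fun i => (hx i).2⟩, rfl⟩
  · rintro ⟨y, hy, rfl⟩ i
    exact ⟨hy.1 i, hy.2 i⟩

theorem exists_mem_cube {Y : Type*} {q : E3 → Y} {N : ℕ} (hN : 0 < N)
    (hper : ∀ i, (N : ℝ) • stdVec i ∈ periods q) (x : E3) :
    ∃ v ∈ periods q, ∀ i, 0 ≤ (x + v) i ∧ (x + v) i ≤ N := by
  have hN' : (0 : ℝ) < N := by exact_mod_cast hN
  refine ⟨∑ i, (-⌊x i / N⌋) • ((N : ℝ) • stdVec i),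
    sum_mem fun i _ => zsmul_mem (hper i) _, fun i => ?_⟩
  have h1 : (x + ∑ i, (-⌊x i / N⌋) • ((N : ℝ) • stdVec i)) i = x i - ⌊x i / N⌋ * N := by
    rw [PiLp.add_apply, Fin.sum_univ_three]
    fin_cases i <;> simp <;> ring
  rw [h1]
  have h2 := Int.floor_le (x i / N)
  have h3 := Int.lt_floor_add_one (x i / N)
  rw [le_div_iff₀ hN'] at h2
  rw [div_lt_iff₀ hN'] at h3
  constructor <;> linarith

/-- A continuous map of `ℝ³` to a Hausdorff space whose fibres are the cosets of a sublattice of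
finite index of `ℤ³` parametrizes a 3-torus. -/
theorem isTorusChart_range [T2Space Z] {q : E3 → Z} {N : ℕ} (hc : Continuous q) (hN : 0 < N)
    (hper : ∀ i x, q (x + (N : ℝ) • stdVec i) = q x)
    (hdeck : ∀ x y, q x = q y → ∀ z, q (z + (y - x)) = q z)
    (hint : ∀ x y, q x = q y → ∀ i, ∃ k : ℤ, y i - x i = k) : IsTorusChart (range q) q N where
  continuous := hc
  range_eq := rfl
  pos := hN
  period := hper
  deck := hdeck
  integral := hint
  map_nhds x := by
    refine le_antisymm (le_inf hc.continuousAt (Filter.le_principal_iff.2 ?_)) ?_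
    · exact Filter.mem_map.2 (Filter.univ_mem' fun y => mem_range_self y)
    · intro S hS
      obtain ⟨O, hOS, hO, hxO⟩ := mem_nhds_iff.1 (Filter.mem_map.1 hS)
      -- Openness onto the image comes from compactness: the part of the fundamental cube outside
      -- the saturation `O'` has a closed image missing `q x`.
      set O' : Set E3 := {y | ∃ v ∈ periods q, y + v ∈ O} with hO'
      have hO'o : IsOpen O' := by
        have : O' = ⋃ v ∈ periods q, (fun y => y + v) ⁻¹' O := by
          ext y
          simp [hO']
        rw [this]
        exact isOpen_biUnion fun v _ => hO.preimage (by fun_prop)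
      set C := {x : E3 | ∀ i, 0 ≤ x i ∧ x i ≤ (N : ℝ)}
      have hcl : IsClosed (q '' (C \ O')) :=
        (((isCompact_cube N).diff hO'o).image hc).isClosed
      have hO'S : ∀ y ∈ O', q y ∈ S := by
        rintro y ⟨v, hv, hyv⟩
        rw [← hv y]
        exact hOS hyv
      have hx : q x ∉ q '' (C \ O') := by
        rintro ⟨y, ⟨_, hyO⟩, hyx⟩
        exact hyO ⟨x - y, fun z => hdeck y x hyx z, by rwa [add_sub_cancel]⟩
      filter_upwards [mem_nhdsWithin_of_mem_nhds (hcl.isOpen_compl.mem_nhds hx),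
        self_mem_nhdsWithin] with z hz hzr
      obtain ⟨y, rfl⟩ := hzr
      obtain ⟨v, hv, hyC⟩ := exists_mem_cube hN (fun i x => hper i x) y
      rw [← hv y] at hz ⊢
      refine hO'S _ ?_
      by_contra hcon
      exact hz ⟨y + v, ⟨hyC, hcon⟩, rfl⟩

theorem IsTorusChart.isCompact {T : Set Z} {q : E3 → Z} {N : ℕ} (h : IsTorusChart T q N) :
    IsCompact T := by
  have h1 : T = q '' {x : E3 | ∀ i, 0 ≤ x i ∧ x i ≤ (N : ℝ)} := by
    apply Subset.antisymm
    · rw [← h.range_eq]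
      rintro _ ⟨x, rfl⟩
      obtain ⟨v, hv, hx⟩ := exists_mem_cube h.pos (fun i x => h.period i x) x
      exact ⟨x + v, hx, hv x⟩
    · rintro _ ⟨x, _, rfl⟩
      exact h.mem x
  rw [h1]
  exact (isCompact_cube N).image h.continuous

end PeriodicChart

/-! ### The three tori in `Y` and their nodes -/

section Planes

variable {τ : Fin 3 → ℂ}

theorem mk_eq_mk_iff {τ : ℂ} (hτ : 0 < τ.im) (a b a' b' : ℝ) :
    (QuotientAddGroup.mk ((a : ℂ) + b * τ) : EllipticCurve τ) =
      QuotientAddGroup.mk ((a' : ℂ) + b' * τ) ↔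
      (∃ m : ℤ, a' - a = m) ∧ ∃ n : ℤ, b' - b = n := by
  rw [QuotientAddGroup.eq, AddSubgroup.mem_closure_pair]
  constructor
  · rintro ⟨m, n, h⟩
    have him := congrArg Complex.im h
    have hre := congrArg Complex.re h
    simp at him hre
    have hn : b' - b = n := by
      have : (b' - b - n) * τ.im = 0 := by linarith
      rcases mul_eq_zero.1 this with h | h
      · linarith
      · exact absurd h hτ.ne'
    refine ⟨⟨m, ?_⟩, n, hn⟩
    rw [← hn] at hre
    linarith
  · rintro ⟨⟨m, hm⟩, n, hn⟩
    refine ⟨m, n, ?_⟩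
    have hm' : (a' : ℂ) - a = m := by exact_mod_cast hm
    have hn' : (b' : ℂ) - b = n := by exact_mod_cast hn
    simp only [zsmul_eq_mul]
    rw [← hm', ← hn']
    ring

/-- The coordinates of `planeMap` with respect to `1, τ`. -/
noncomputable def planeCoord (i : Fin 3) (s : ℝ) : ℝ × ℝ := ![(s, 0), (0, -s), (1 / 2 - s, s)] i

theorem planeMap_apply (i : Fin 3) (s : E3) (j : Fin 3) :
    planeMap τ i s j = QuotientAddGroup.mk
      (((planeCoord i (s j)).1 : ℂ) + ((planeCoord i (s j)).2 : ℂ) * τ j) := by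
  unfold planeMap
  congr 1
  fin_cases i <;> simp [planeBase, planeDir, planeCoord]
  ring

theorem planeMap_eq_iff (hτ : ∀ j, 0 < (τ j).im) (i i' : Fin 3) (s s' : E3) :
    planeMap τ i s = planeMap τ i' s' ↔ ∀ j,
      (∃ m : ℤ, (planeCoord i' (s' j)).1 - (planeCoord i (s j)).1 = m) ∧
      ∃ n : ℤ, (planeCoord i' (s' j)).2 - (planeCoord i (s j)).2 = n := by
  rw [funext_iff]
  refine forall_congr' fun j => ?_
  rw [planeMap_apply, planeMap_apply, mk_eq_mk_iff (hτ j)]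

theorem continuous_planeMap (i : Fin 3) : Continuous (planeMap τ i) := by
  refine continuous_pi fun j => ?_
  unfold planeMap
  refine continuous_quotient_mk'.comp ?_
  fun_prop

theorem planeMap_eq_self_iff (hτ : ∀ j, 0 < (τ j).im) (i : Fin 3) (s s' : E3) :
    planeMap τ i s = planeMap τ i s' ↔ ∀ j, ∃ k : ℤ, s' j - s j = k := by
  rw [planeMap_eq_iff hτ]
  refine forall_congr' fun j => ?_
  constructor
  · rintro ⟨⟨m, hm⟩, n, hn⟩
    fin_cases i
    · exact ⟨m, hm⟩
    · refine ⟨-n, ?_⟩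
      simp [planeCoord] at hn
      push_cast
      linarith
    · exact ⟨n, hn⟩
  · rintro ⟨k, hk⟩
    fin_cases i
    · exact ⟨⟨k, hk⟩, 0, by simp [planeCoord]⟩
    · refine ⟨⟨0, by simp [planeCoord]⟩, -k, ?_⟩
      simp [planeCoord]
      linarith
    · refine ⟨⟨-k, ?_⟩, k, hk⟩
      simp [planeCoord]
      linarith

/-- The parameter, on the plane `i`, of the node with the plane `i'`. -/
noncomputable def nodeParam (i i' : Fin 3) : ℝ :=
  ![![0, 0, 1 / 2], ![0, 0, 1 / 2], ![0, 1 / 2, 0]] i i'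

/-- In the basis `1, τ` the directions are `(1, 0)`, `(0, -1)`, `(-1, 1)`. Any two have determinant
`±1`, so in each coordinate an intersection determines both parameters modulo `ℤ`. -/
theorem planeMap_eq_iff_of_lt (hτ : ∀ j, 0 < (τ j).im) {i i' : Fin 3} (hi : i < i') (s s' : E3) :
    planeMap τ i s = planeMap τ i' s' ↔
      ∀ j, (∃ k : ℤ, s j - nodeParam i i' = k) ∧ ∃ k : ℤ, s' j - nodeParam i' i = k := by
  rw [planeMap_eq_iff hτ]
  refine forall_congr' fun j => ?_
  have hcases : (i = 0 ∧ i' = 1) ∨ (i = 0 ∧ i' = 2) ∨ (i = 1 ∧ i' = 2) := by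
    revert hi
    revert i i'
    decide
  rcases hcases with ⟨rfl, rfl⟩ | ⟨rfl, rfl⟩ | ⟨rfl, rfl⟩ <;> constructor <;>
    rintro ⟨⟨m, hm⟩, n, hn⟩ <;> simp [planeCoord, nodeParam] at hm hn ⊢
  · exact ⟨⟨-m, by push_cast; linarith⟩, -n, by push_cast; linarith⟩
  · exact ⟨⟨-m, by push_cast; linarith⟩, -n, by push_cast; linarith⟩
  · exact ⟨⟨-m - n, by push_cast; linarith⟩, n, by linarith⟩
  · exact ⟨⟨-m - n, by push_cast; linarith⟩, n, by linarith⟩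
  · exact ⟨⟨n + m - 1 + 0, by push_cast; linarith⟩, -m, by push_cast; linarith⟩
  · exact ⟨⟨-n, by push_cast; linarith⟩, m + n + 1, by push_cast; linarith⟩

theorem planeMap_eq_iff_of_ne (hτ : ∀ j, 0 < (τ j).im) {i i' : Fin 3} (hi : i ≠ i') (s s' : E3) :
    planeMap τ i s = planeMap τ i' s' ↔
      ∀ j, (∃ k : ℤ, s j - nodeParam i i' = k) ∧ ∃ k : ℤ, s' j - nodeParam i' i = k := by
  rcases lt_or_gt_of_ne hi with h | h
  · exact planeMap_eq_iff_of_lt hτ h s s'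
  · rw [eq_comm, planeMap_eq_iff_of_lt hτ h]
    exact forall_congr' fun j => and_comm

/-- The diagonal vector. -/
noncomputable def diag (a : ℝ) : E3 := WithLp.toLp 2 fun _ => a

@[simp] theorem diag_apply (a : ℝ) (j : Fin 3) : diag a j = a := rfl

/-- The three pairs of planes. -/
def pairFst : Fin 3 → Fin 3 := ![0, 0, 1]

/-- The three pairs of planes. -/
def pairSnd : Fin 3 → Fin 3 := ![1, 2, 2]

theorem pair_lt (k : Fin 3) : pairFst k < pairSnd k := by
  revert k
  decide

theorem exists_pair {i i' : Fin 3} (h : i ≠ i') :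
    ∃ k, (pairFst k = i ∧ pairSnd k = i') ∨ (pairFst k = i' ∧ pairSnd k = i) := by
  revert i i'
  decide

theorem pair_injective {k k' : Fin 3} (h : pairFst k = pairFst k') (h' : pairSnd k = pairSnd k') :
    k = k' := by
  revert k k'
  decide

/-- The three nodes. -/
noncomputable def node (τ : Fin 3 → ℂ) (k : Fin 3) : Torus τ :=
  planeMap τ (pairFst k) (diag (nodeParam (pairFst k) (pairSnd k)))

theorem planeMap_nodeParam (hτ : ∀ j, 0 < (τ j).im) {i i' : Fin 3} (h : i ≠ i') :
    planeMap τ i (diag (nodeParam i i')) = planeMap τ i' (diag (nodeParam i' i)) := by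
  rw [planeMap_eq_iff_of_ne hτ h]
  exact fun j => ⟨⟨0, by simp⟩, 0, by simp⟩

theorem node_eq_snd (hτ : ∀ j, 0 < (τ j).im) (k : Fin 3) :
    node τ k = planeMap τ (pairSnd k) (diag (nodeParam (pairSnd k) (pairFst k))) :=
  planeMap_nodeParam hτ (pair_lt k).ne

theorem planeMap_eq_node_of_ne (hτ : ∀ j, 0 < (τ j).im) {i i' : Fin 3} (hi : i ≠ i') {s s' : E3}
    (h : planeMap τ i s = planeMap τ i' s') : planeMap τ i s = planeMap τ i (diag (nodeParam i i')) := by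
  rw [planeMap_eq_self_iff hτ]
  rw [planeMap_eq_iff_of_ne hτ hi] at h
  intro j
  obtain ⟨⟨k, hk⟩, _⟩ := h j
  exact ⟨-k, by push_cast; rw [← hk, diag_apply]; ring⟩

theorem mem_nodes_iff (hτ : ∀ j, 0 < (τ j).im) (y : Torus τ) : y ∈ nodes τ ↔ ∃ k, node τ k = y := by
  constructor
  · rintro ⟨i, i', hi, ⟨s, rfl⟩, s', hs'⟩
    have h1 := planeMap_eq_node_of_ne hτ hi hs'.symm
    obtain ⟨k, ⟨rfl, rfl⟩ | ⟨rfl, rfl⟩⟩ := exists_pair hi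
    · exact ⟨k, h1.symm⟩
    · exact ⟨k, by rw [node_eq_snd hτ, h1]⟩
  · rintro ⟨k, rfl⟩
    refine ⟨pairFst k, pairSnd k, (pair_lt k).ne, mem_range_self _, ?_⟩
    rw [node_eq_snd hτ]
    exact mem_range_self _

/-- The parameters of the nodes, on each of the planes. -/
def IsNodeParam (s : E3) : Prop :=
  (∀ j, ∃ k : ℤ, s j = k) ∨ ∀ j, ∃ k : ℤ, s j - 1 / 2 = k

/-- On each plane the two nodes have parameters `0` and `1/2` in some order, so the set of node
parameters is the same for the three planes. -/
theorem planeMap_mem_nodes_iff (hτ : ∀ j, 0 < (τ j).im) (i : Fin 3) (s : E3) :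
    planeMap τ i s ∈ nodes τ ↔ IsNodeParam s := by
  have h1 : planeMap τ i s ∈ nodes τ ↔ ∃ i', i ≠ i' ∧ ∀ j, ∃ k : ℤ, s j - nodeParam i i' = k := by
    constructor
    · rintro ⟨a, b, hab, ⟨u, hu⟩, ⟨v, hv⟩⟩
      by_cases ha : i = a
      · subst ha
        exact ⟨b, hab, fun j => ((planeMap_eq_iff_of_ne hτ hab s v).1 hv.symm j).1⟩
      · exact ⟨a, ha, fun j => ((planeMap_eq_iff_of_ne hτ ha s u).1 hu.symm j).1⟩
    · rintro ⟨i', hi, h⟩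
      refine ⟨i, i', hi, mem_range_self _, diag (nodeParam i' i), ?_⟩
      rw [eq_comm, planeMap_eq_iff_of_ne hτ hi]
      exact fun j => ⟨h j, 0, by simp⟩
  rw [h1]
  constructor
  · rintro ⟨i', hi, h⟩
    have : nodeParam i i' = 0 ∨ nodeParam i i' = 1 / 2 := by
      fin_cases i <;> fin_cases i' <;> simp [nodeParam]
    rcases this with h' | h' <;> rw [h'] at h
    · left
      simpa using h
    · right
      exact h
  · rintro (h | h)
    · have : ∃ i', i ≠ i' ∧ nodeParam i i' = 0 := by
        fin_cases i
        · exact ⟨1, by decide, by simp [nodeParam]⟩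
        · exact ⟨0, by decide, by simp [nodeParam]⟩
        · exact ⟨0, by decide, by simp [nodeParam]⟩
      obtain ⟨i', hi, h'⟩ := this
      refine ⟨i', hi, ?_⟩
      rw [h']
      simpa using h
    · have : ∃ i', i ≠ i' ∧ nodeParam i i' = 1 / 2 := by
        fin_cases i
        · exact ⟨2, by decide, by simp [nodeParam]⟩
        · exact ⟨2, by decide, by simp [nodeParam]⟩
        · exact ⟨1, by decide, by simp [nodeParam]⟩
      obtain ⟨i', hi, h'⟩ := this
      refine ⟨i', hi, ?_⟩
      rwa [h']

theorem nodeParam_ne {i i' i'' : Fin 3} (h : i ≠ i') (h' : i ≠ i'') (h'' : i' ≠ i'') :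
    ¬ ∃ k : ℤ, nodeParam i i' - nodeParam i i'' = k := by
  have h1 : ∀ x : ℝ, x = 1 / 2 ∨ x = -(1 / 2) → ¬ ∃ k : ℤ, x = k := by
    rintro x hx ⟨k, rfl⟩
    have h2 : (2 * k : ℝ) = 1 ∨ (2 * k : ℝ) = -1 := by
      rcases hx with h | h
      · left; linarith
      · right; linarith
    rcases h2 with h | h
    · have : 2 * k = 1 := by exact_mod_cast h
      omega
    · have : 2 * k = -1 := by exact_mod_cast h
      omega
  refine h1 _ ?_
  clear h1
  fin_cases i <;> fin_cases i' <;> fin_cases i'' <;> simp [nodeParam] at h h' h'' ⊢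

/-- The plane `i''` does not pass through the node of the planes `i` and `i'`. -/
theorem node_unique (hτ : ∀ j, 0 < (τ j).im) {i i' i'' : Fin 3} (h : i ≠ i') (h' : i ≠ i'')
    (h'' : i' ≠ i'') {s s' s'' : E3} (h1 : planeMap τ i s = planeMap τ i' s') :
    planeMap τ i s ≠ planeMap τ i'' s'' := by
  intro h2
  rw [planeMap_eq_iff_of_ne hτ h] at h1
  rw [planeMap_eq_iff_of_ne hτ h'] at h2
  obtain ⟨⟨a, ha⟩, _⟩ := h1 0
  obtain ⟨⟨b, hb⟩, _⟩ := h2 0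
  refine nodeParam_ne h h' h'' ⟨b - a, ?_⟩
  push_cast
  linarith

/-- If two nodes coincided, the planes through one would be those through the other, since by
`node_unique` no third plane passes through a node. -/
theorem node_injective (hτ : ∀ j, 0 < (τ j).im) : Function.Injective (node τ) := by
  intro k k' h
  have key : ∀ a b c d : Fin 3, a < b → c < d → planeMap τ a (diag (nodeParam a b)) =
      planeMap τ c (diag (nodeParam c d)) → a = c ∧ b = d := by
    intro a b c d hab hcd h1
    have e1 := planeMap_nodeParam hτ hab.ne
    have e2 := planeMap_nodeParam hτ hcd.ne
    have hc : c = a ∨ c = b := by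
      by_contra! hcon
      exact node_unique hτ hab.ne hcon.1.symm hcon.2.symm e1 h1
    have hd : d = a ∨ d = b := by
      by_contra! hcon
      exact node_unique hτ hab.ne hcon.1.symm hcon.2.symm e1 (h1.trans e2)
    rcases hc with rfl | rfl <;> rcases hd with rfl | rfl
    · exact absurd hcd (lt_irrefl _)
    · exact ⟨rfl, rfl⟩
    · exact absurd (hab.trans hcd) (lt_irrefl _)
    · exact absurd hcd (lt_irrefl _)
  obtain ⟨h1, h2⟩ := key _ _ _ _ (pair_lt k) (pair_lt k') h
  exact pair_injective h1 h2

end Planes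


/-! ### Coverings of the necklace -/

section Covers

theorem t2Space_of_isCoveringMap {W B : Type*} [TopologicalSpace W] [TopologicalSpace B]
    [T2Space B] {d : W → B} (hd : IsCoveringMap d) : T2Space W := by
  refine ⟨fun x y hxy => ?_⟩
  by_cases h : d x = d y
  · exact hd.isSeparatedMap x y h hxy
  · obtain ⟨u, v, hu, hv, hxu, hyv, huv⟩ := t2_separation h
    exact ⟨d ⁻¹' u, d ⁻¹' v, hu.preimage hd.continuous, hv.preimage hd.continuous, hxu, hyv,
      huv.preimage d⟩

variable {τ : Fin 3 → ℂ}

/-- The parametrization of the 3-torus `L_i` as a subset of the union. -/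
noncomputable def planeMapUnion (τ : Fin 3 → ℂ) (i : Fin 3) : C(E3, unionTori τ) where
  toFun s := ⟨planeMap τ i s, mem_iUnion.2 ⟨i, mem_range_self s⟩⟩
  continuous_toFun := (continuous_planeMap i).subtype_mk _

theorem planeMapUnion_eq_iff {i i' : Fin 3} {s s' : E3} :
    planeMapUnion τ i s = planeMapUnion τ i' s' ↔ planeMap τ i s = planeMap τ i' s' :=
  Subtype.ext_iff

variable {W : Type*} [TopologicalSpace W] {d : W → unionTori τ}

/-- The 3-tori in a covering of the union of the three 3-tori, together with their images. -/
def CoverTorus (d : W → unionTori τ) : Type _ :=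
  {v : Fin 3 × Set W // ∃ g : C(E3, W), d ∘ g = planeMapUnion τ v.1 ∧ range g = v.2}

/-- Over the torus `L_i` the two parameters differ by an integral vector, and translation by it does
not change the projected map; uniqueness of lifts does the rest. -/
theorem lift_shift (hd : IsCoveringMap d) {i : Fin 3} {g g' : C(E3, W)}
    (hg : d ∘ g = planeMapUnion τ i) (hg' : d ∘ g' = planeMapUnion τ i)
    (hτ : ∀ j, 0 < (τ j).im) {s s' : E3} (h : g s = g' s') (z : E3) : g' (z + (s' - s)) = g z := by
  have h1 : planeMap τ i s = planeMap τ i s' := by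
    rw [← planeMapUnion_eq_iff, ← congrFun hg s, ← congrFun hg' s']
    simp only [Function.comp, h]
  rw [planeMap_eq_self_iff hτ] at h1
  have h2 : (fun z => g' (z + (s' - s))) = g := by
    refine hd.eq_of_comp_eq (by fun_prop) g.continuous ?_ s ?_
    · rw [hg]
      funext z
      change (d ∘ g') (z + (s' - s)) = _
      rw [hg', planeMapUnion_eq_iff, planeMap_eq_self_iff hτ]
      intro j
      obtain ⟨k, hk⟩ := h1 j
      refine ⟨-k, ?_⟩
      push_cast
      rw [← hk]
      simp
    · simp [h]
  exact congrFun h2 z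

/-- Along each axis infinitely many integral points map into one finite fibre, so two coincide and
give a period `n j`. The product of the `n j` is a common period for the three axes. -/
theorem isTorusChart_lift [T2Space W] (hd : IsCoveringMap d) (hτ : ∀ j, 0 < (τ j).im)
    (hfin : ∀ x, (d ⁻¹' {x}).Finite) {i : Fin 3} {g : C(E3, W)} (hg : d ∘ g = planeMapUnion τ i) :
    ∃ N, IsTorusChart (range g) g N := by
  have hdeck : ∀ x y, g x = g y → ∀ z, g (z + (y - x)) = g z := fun x y hxy z =>
    lift_shift hd hg hg hτ hxy z
  have hint : ∀ x y, g x = g y → ∀ i, ∃ k : ℤ, y i - x i = k := by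
    intro x y hxy
    rw [← planeMap_eq_self_iff hτ i, ← planeMapUnion_eq_iff, ← congrFun hg x, ← congrFun hg y]
    simp only [Function.comp, hxy]
  have hper : ∀ j, ∃ n : ℕ, 0 < n ∧ (n : ℝ) • stdVec j ∈ periods g := by
    intro j
    have hmaps : ∀ n : ℕ, g ((n : ℝ) • stdVec j) ∈ d ⁻¹' {planeMapUnion τ i 0} := by
      intro n
      rw [mem_preimage, mem_singleton_iff]
      change (d ∘ g) _ = _
      rw [hg, planeMapUnion_eq_iff, planeMap_eq_self_iff hτ]
      intro l
      refine ⟨if l = j then -n else 0, ?_⟩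
      by_cases hl : l = j
      · subst hl; simp
      · simp [hl]
    obtain ⟨a, _, b, _, hab, h⟩ := infinite_univ.exists_ne_map_eq_of_mapsTo
      (fun n _ => hmaps n) (hfin (planeMapUnion τ i 0))
    have key : ∀ a b : ℕ, a < b → g ((a : ℝ) • stdVec j) = g ((b : ℝ) • stdVec j) →
        ∃ n : ℕ, 0 < n ∧ (n : ℝ) • stdVec j ∈ periods g := by
      intro a b hab h
      refine ⟨b - a, by omega, fun z => ?_⟩
      rw [Nat.cast_sub hab.le, sub_smul]
      exact hdeck _ _ h z
    rcases lt_or_gt_of_ne hab with h' | h'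
    · exact key a b h' h
    · exact key b a h' h.symm
  choose n hn hnp using hper
  refine ⟨∏ j, n j, isTorusChart_range g.continuous (Finset.prod_pos fun j _ => hn j) ?_ hdeck hint⟩
  intro j
  have : ((∏ j, n j : ℕ) : ℝ) • stdVec j = (∏ k ∈ Finset.univ.erase j, n k) • ((n j : ℝ) • stdVec j) := by
    rw [← Nat.cast_smul_eq_nsmul ℝ, smul_smul, ← Nat.cast_mul, Finset.prod_erase_mul _ _ (Finset.mem_univ j)]
  rw [this]
  exact nsmul_mem (hnp j) _

/-- Existence is lifting over the simply connected `ℝ³`. Two lifts through `x` are translates of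
each other by `lift_shift`, so they have the same image. -/
theorem existsUnique_coverTorus (hd : IsCoveringMap d) (hτ : ∀ j, 0 < (τ j).im) {i : Fin 3}
    {x : W} (hx : d x ∈ range (planeMapUnion τ i)) :
    ∃! v : CoverTorus d, v.1.1 = i ∧ x ∈ v.1.2 := by
  obtain ⟨s, hs⟩ := hx
  obtain ⟨g, ⟨hgs, hg⟩, _⟩ := hd.existsUnique_continuousMap_lifts (planeMapUnion τ i) s x hs.symm
  refine ⟨⟨(i, range g), g, hg, rfl⟩, ⟨rfl, s, hgs⟩, ?_⟩
  rintro ⟨⟨i', T⟩, g', hg', hT⟩ ⟨hi, hxT⟩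
  simp only at hi hxT hT hg'
  subst hi hT
  obtain ⟨s', hs'⟩ := hxT
  apply Subtype.ext
  refine Prod.ext rfl ?_
  apply Subset.antisymm
  · rintro _ ⟨z, rfl⟩
    exact ⟨_, lift_shift hd hg' hg hτ (hs'.trans hgs.symm) z⟩
  · rintro _ ⟨z, rfl⟩
    exact ⟨_, lift_shift hd hg hg' hτ (hgs.trans hs'.symm) z⟩

theorem CoverTorus.mem_range_of_mem (v : CoverTorus d) {x : W} (hx : x ∈ v.1.2) :
    d x ∈ range (planeMapUnion τ v.1.1) := by
  obtain ⟨g, hg, hT⟩ := v.2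
  rw [← hT] at hx
  obtain ⟨s, rfl⟩ := hx
  exact ⟨s, (congrFun hg s).symm⟩

theorem CoverTorus.surjOn (v : CoverTorus d) (s : E3) : ∃ x ∈ v.1.2, d x = planeMapUnion τ v.1.1 s := by
  obtain ⟨g, hg, hT⟩ := v.2
  exact ⟨g s, hT ▸ mem_range_self s, congrFun hg s⟩

omit [TopologicalSpace W] in
theorem finite_fiber {r : ℕ} (hr : 0 < r) (hdeg : ∀ x, Nat.card (d ⁻¹' {x}) = r)
    (x : unionTori τ) : (d ⁻¹' {x}).Finite := by
  have := Nat.finite_of_card_ne_zero (α := d ⁻¹' {x}) (by rw [hdeg]; exact hr.ne')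
  exact toFinite _

/-- Every torus over `L_i` contains a point over the image of `0`, and there are `3r` pairs of an
index `i` and such a point. Each index `i` occurs. -/
theorem finite_and_card_coverTorus (hd : IsCoveringMap d) (hτ : ∀ j, 0 < (τ j).im) {r : ℕ}
    (hr : 0 < r) (hdeg : ∀ x, Nat.card (d ⁻¹' {x}) = r) :
    Finite (CoverTorus d) ∧ 3 ≤ Nat.card (CoverTorus d) ∧ Nat.card (CoverTorus d) ≤ 3 * r := by
  have hfin : ∀ x, Finite (d ⁻¹' {x}) := fun x => (finite_fiber hr hdeg x).to_subtype
  let F : (Σ i : Fin 3, d ⁻¹' {planeMapUnion τ i 0}) → CoverTorus d := fun x =>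
    (existsUnique_coverTorus hd hτ (i := x.1) (x := x.2.1) ⟨0, x.2.2.symm⟩).choose
  have hF : Function.Surjective F := by
    intro v
    obtain ⟨x, hx, hxs⟩ := v.surjOn 0
    refine ⟨⟨v.1.1, x, hxs⟩, ?_⟩
    have h := existsUnique_coverTorus hd hτ (i := v.1.1) (x := x) ⟨0, hxs.symm⟩
    exact h.unique h.choose_spec.1 ⟨rfl, hx⟩
  have hfinV : Finite (CoverTorus d) := Finite.of_surjective F hF
  refine ⟨hfinV, ?_, ?_⟩
  · have hsurj : Function.Surjective fun v : CoverTorus d => v.1.1 := by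
      intro i
      have hne : Nonempty (d ⁻¹' {planeMapUnion τ i 0}) :=
        (Nat.card_pos_iff.1 (by rw [hdeg]; exact hr)).1
      obtain ⟨x, hx⟩ := hne
      obtain ⟨v, ⟨hv, _⟩, _⟩ := existsUnique_coverTorus hd hτ (i := i) (x := x) ⟨0, hx.symm⟩
      exact ⟨v, hv⟩
    have := Nat.card_le_card_of_surjective _ hsurj
    simpa using this
  · have := Nat.card_le_card_of_surjective F hF
    rw [Nat.card_sigma] at this
    simpa [hdeg] using this

/-- The points over the nodes. -/
def CoverNode (d : W → unionTori τ) : Type _ := {x : W // (d x : Torus τ) ∈ nodes τ}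

omit [TopologicalSpace W] in
theorem card_coverNode (hτ : ∀ j, 0 < (τ j).im) {r : ℕ}
    (hdeg : ∀ x, Nat.card (d ⁻¹' {x}) = r) (hr : 0 < r) :
    Finite (CoverNode d) ∧ Nat.card (CoverNode d) = 3 * r := by
  have hfin : ∀ x, Finite (d ⁻¹' {x}) := fun x => (finite_fiber hr hdeg x).to_subtype
  have hmem : ∀ k, node τ k ∈ unionTori τ := fun k => mem_iUnion.2 ⟨pairFst k, mem_range_self _⟩
  let F : (Σ k : Fin 3, d ⁻¹' {⟨node τ k, hmem k⟩}) → CoverNode d := fun x =>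
    ⟨x.2.1, by
      rw [show d x.2.1 = _ from x.2.2]
      exact (mem_nodes_iff hτ _).2 ⟨x.1, rfl⟩⟩
  have hF : Function.Bijective F := by
    constructor
    · rintro ⟨k, x, hx⟩ ⟨k', x', hx'⟩ h
      have h1 : x = x' := congrArg Subtype.val h
      subst h1
      have h2 : node τ k = node τ k' := congrArg Subtype.val (hx.symm.trans hx')
      obtain rfl := node_injective hτ h2
      rfl
    · rintro ⟨x, hx⟩
      obtain ⟨k, hk⟩ := (mem_nodes_iff hτ _).1 hx
      exact ⟨⟨k, x, Subtype.ext hk.symm⟩, rfl⟩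
  refine ⟨Finite.of_surjective F hF.2, ?_⟩
  rw [← Nat.card_eq_of_bijective F hF, Nat.card_sigma]
  simp [hdeg]

/-- A covering of the union of the three 3-tori is a wedge of 3-tori. -/
theorem exists_isWedge_cover [T2Space W] (hd : IsCoveringMap d) (hτ : ∀ j, 0 < (τ j).im)
    (hfin : ∀ x, (d ⁻¹' {x}).Finite) :
    (∃ s t : CoverNode d → CoverTorus d,
      IsWedge (fun v : CoverTorus d => v.1.2) (fun e : CoverNode d => e.1) s t) ∧
      (∀ v : CoverTorus d, ∃ q N, IsTorusChart v.1.2 q N) ∧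
      ⋃ v : CoverTorus d, v.1.2 = univ := by
  have hchart : ∀ v : CoverTorus d, ∃ q N, IsTorusChart v.1.2 q N := by
    intro v
    obtain ⟨g, hg, hT⟩ := v.2
    obtain ⟨N, hN⟩ := isTorusChart_lift hd hτ hfin hg
    exact ⟨g, N, hT ▸ hN⟩
  have hclosed : ∀ v : CoverTorus d, IsClosed v.1.2 := by
    intro v
    obtain ⟨q, N, h⟩ := hchart v
    exact h.isCompact.isClosed
  have hk : ∀ e : CoverNode d, ∃ k, node τ k = d e.1 := fun e => (mem_nodes_iff hτ _).1 e.2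
  choose k hk using hk
  have hs : ∀ e : CoverNode d, d e.1 ∈ range (planeMapUnion τ (pairFst (k e))) := fun e =>
    ⟨diag (nodeParam (pairFst (k e)) (pairSnd (k e))), Subtype.ext (hk e)⟩
  have ht : ∀ e : CoverNode d, d e.1 ∈ range (planeMapUnion τ (pairSnd (k e))) := fun e =>
    ⟨diag (nodeParam (pairSnd (k e)) (pairFst (k e))), Subtype.ext (by
      rw [← hk e, node_eq_snd hτ]
      rfl)⟩
  have hs' := fun e => existsUnique_coverTorus hd hτ (hs e)
  have ht' := fun e => existsUnique_coverTorus hd hτ (ht e)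
  choose s hs1 hs2 using hs'
  choose t ht1 ht2 using ht'
  refine ⟨⟨s, t, ?_⟩, hchart, ?_⟩
  · refine ⟨fun v x _ hx => (hclosed v).closure_eq ▸ hx, Subtype.val_injective, fun e => (hs1 e).2,
      fun e => (ht1 e).2, ?_, ?_⟩
    · intro e h
      have h1 := (hs1 e).1
      have h2 := (ht1 e).1
      simp only [h] at h1
      exact (pair_lt (k e)).ne (h1.symm.trans h2)
    · intro v w x hvw hxv hxw
      obtain ⟨a, ha⟩ := v.mem_range_of_mem hxv
      obtain ⟨b, hb⟩ := w.mem_range_of_mem hxw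
      have hi : v.1.1 ≠ w.1.1 := by
        intro h
        exact hvw ((existsUnique_coverTorus hd hτ (v.mem_range_of_mem hxv)).unique ⟨rfl, hxv⟩
          ⟨h.symm, hxw⟩)
      have hab : planeMap τ v.1.1 a = planeMap τ w.1.1 b :=
        planeMapUnion_eq_iff.1 (ha.trans hb.symm)
      have hxn : (d x : Torus τ) = planeMap τ v.1.1 (diag (nodeParam v.1.1 w.1.1)) := by
        rw [← planeMap_eq_node_of_ne hτ hi hab, ← ha]
        rfl
      have hx : (d x : Torus τ) ∈ nodes τ := by
        rw [← ha]
        exact ⟨v.1.1, w.1.1, hi, ⟨a, rfl⟩, ⟨b, hab.symm⟩⟩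
      refine ⟨⟨x, hx⟩, rfl, ?_⟩
      have hkx := hk ⟨x, hx⟩
      obtain ⟨k', ⟨h1, h2⟩ | ⟨h1, h2⟩⟩ := exists_pair hi
      · have hkk : k ⟨x, hx⟩ = k' := by
          apply node_injective hτ
          rw [hkx, hxn, node, h1, h2]
        left
        refine ⟨((hs2 ⟨x, hx⟩) v ⟨?_, hxv⟩).symm, ((ht2 ⟨x, hx⟩) w ⟨?_, hxw⟩).symm⟩
        · rw [hkk, h1]
        · rw [hkk, h2]
      · have hkk : k ⟨x, hx⟩ = k' := by
          apply node_injective hτ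
          rw [hkx, hxn, node_eq_snd hτ, h1, h2]
        right
        refine ⟨((hs2 ⟨x, hx⟩) w ⟨?_, hxw⟩).symm, ((ht2 ⟨x, hx⟩) v ⟨?_, hxv⟩).symm⟩
        · rw [hkk, h1]
        · rw [hkk, h2]
  · refine eq_univ_of_forall fun x => ?_
    obtain ⟨i, s, hs⟩ := mem_iUnion.1 (d x).2
    obtain ⟨v, ⟨_, hv⟩, _⟩ := existsUnique_coverTorus hd hτ (i := i) (x := x) ⟨s, Subtype.ext hs⟩
    exact mem_iUnion.2 ⟨v, hv⟩

end Covers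


/-! ### Recognizing the dual graph -/

section DualGraph

variable {W V E : Type*} [TopologicalSpace W] [T2Space W] [Finite V] [Finite E]
  {T : V → Set W} {p : E → W} {s t : E → V}

omit [T2Space W] in
-- A punctured ball in `ℝ³` is connected, so a manifold point is not a local cut point, whereas a
-- node is.
theorem exists_isPreconnected_punctured_of_mem_manifoldLocus {x : W} (hx : x ∈ manifoldLocus W)
    {O : Set W} (hO : O ∈ 𝓝 x) : ∃ O' ∈ 𝓝 x, O' ⊆ O ∧ IsPreconnected (O' \ {x}) := by
  obtain ⟨U, hU, hxU, ⟨ψ⟩⟩ := hx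
  have hg : IsOpenEmbedding (fun a => (ψ.symm a : W)) :=
    hU.isOpenEmbedding_subtypeVal.comp ψ.symm.isOpenEmbedding
  obtain ⟨a, ha⟩ : ∃ a, (ψ.symm a : W) = x := ⟨ψ ⟨x, hxU⟩, by simp⟩
  obtain ⟨ρ, hρ, hball⟩ := Metric.mem_nhds_iff.1
    (hg.continuous.continuousAt.preimage_mem_nhds (x := a) (by simpa only [ha] using hO))
  refine ⟨(fun a => (ψ.symm a : W)) '' Metric.ball a ρ, ?_, image_subset_iff.2 hball, ?_⟩
  · rw [← ha]
    exact (hg.isOpenMap _ Metric.isOpen_ball).mem_nhds ⟨a, Metric.mem_ball_self hρ, rfl⟩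
  · have := (isPreconnected_punctured_ball a hρ).image _ hg.continuous.continuousOn
    rwa [image_sdiff hg.injective, image_singleton, ha] at this

omit [T2Space W] in
theorem IsWedge.isClosed_others (hcl : ∀ v, IsClosed (T v)) (v : V) :
    IsClosed (⋃ w ∈ {w | w ≠ v}, T w) :=
  (toFinite _).isClosed_biUnion fun w _ => hcl w

/-- Near the node, one torus and the union of the others are closed sets meeting only in that node,
and both still have points nearby after its removal. -/
theorem IsWedge.eventually_cut (h : IsWedge T p s t)
    (hch : ∀ v, ∃ q N, IsTorusChart (T v) q N) (hun : ⋃ v, T v = univ) (e : E) :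
    ∃ O₀ ∈ 𝓝 (p e), ∀ O ∈ 𝓝 (p e), O ⊆ O₀ → ¬ IsPreconnected (O \ {p e}) := by
  have hcl : ∀ v, IsClosed (T v) := fun v => by
    obtain ⟨q, N, hq⟩ := hch v
    exact hq.isCompact.isClosed
  refine ⟨(range p \ {p e})ᶜ, ((toFinite _).isClosed.isOpen_compl.mem_nhds (by simp)), ?_⟩
  intro O hO hOO hpre
  have hmeet : ∀ v, p e ∈ T v → (O ∩ (T v \ range p)).Nonempty := by
    intro v hv
    obtain ⟨q, N, hq⟩ := hch v
    exact mem_closure_iff_nhds.1 (hq.subset_closure_diff (finite_range p).countable hv) O hO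
  obtain ⟨x, hxO, hxT, hx⟩ := hmeet _ (h.mem_source e)
  obtain ⟨y, hyO, hyT, hy⟩ := hmeet _ (h.mem_target e)
  obtain ⟨z, ⟨hzO, hz⟩, hz1, hz2⟩ := isPreconnected_closed_iff.1 hpre _ _ (hcl (s e))
    (IsWedge.isClosed_others hcl (s e)) (fun z _ => by
      obtain ⟨v, hv⟩ := mem_iUnion.1 (hun.ge (mem_univ z))
      by_cases hvs : v = s e
      · exact Or.inl (hvs ▸ hv)
      · exact Or.inr (mem_biUnion hvs hv))
    ⟨x, ⟨hxO, fun hxe => hx ⟨e, hxe.symm⟩⟩, hxT⟩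
    ⟨y, ⟨hyO, fun hye => hy ⟨e, hye.symm⟩⟩, mem_biUnion (x := t e) (h.ne e).symm hyT⟩
  simp only [mem_iUnion] at hz2
  obtain ⟨w, hw, hzw⟩ := hz2
  obtain ⟨e', he', _⟩ := h.exists_edge _ _ z hw hzw hz1
  exact hOO hzO ⟨⟨e', he'⟩, hz⟩

omit [Finite E] in
-- Away from the nodes only one torus is present nearby; a small ball of its chart embeds as an open
-- set, and an open ball is homeomorphic to `ℝ³`.
theorem IsWedge.mem_manifoldLocus (h : IsWedge T p s t)
    (hch : ∀ v, ∃ q N, IsTorusChart (T v) q N) (hun : ⋃ v, T v = univ) {x : W}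
    (hx : x ∉ range p) : x ∈ manifoldLocus W := by
  have hcl : ∀ v, IsClosed (T v) := fun v => by
    obtain ⟨q, N, hq⟩ := hch v
    exact hq.isCompact.isClosed
  obtain ⟨v, hv⟩ := mem_iUnion.1 (hun.ge (mem_univ x))
  obtain ⟨q, N, hq⟩ := hch v
  have hO : IsOpen (⋃ w ∈ {w | w ≠ v}, T w)ᶜ := (IsWedge.isClosed_others hcl v).isOpen_compl
  have hOT : (⋃ w ∈ {w | w ≠ v}, T w)ᶜ ⊆ T v := by
    intro z hz
    obtain ⟨w, hw⟩ := mem_iUnion.1 (hun.ge (mem_univ z))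
    by_contra hzv
    exact hz (mem_biUnion (x := w) (fun hwv => hzv (hwv ▸ hw)) hw)
  have hxO : x ∈ (⋃ w ∈ {w | w ≠ v}, T w)ᶜ := by
    intro hxw
    simp only [mem_iUnion] at hxw
    obtain ⟨w, hw, hxw⟩ := hxw
    exact hw (h.eq_of_mem hx hxw hv)
  obtain ⟨a, rfl⟩ := (hq.range_eq ▸ hv : x ∈ range q)
  obtain ⟨ρ, hρ, hball⟩ := Metric.mem_nhds_iff.1
    (hq.continuous.continuousAt.preimage_mem_nhds (hO.mem_nhds hxO))
  have hρ' : 0 < min ρ (1 / 4) := lt_min hρ (by norm_num)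
  have hball' : Metric.ball a (min ρ (1 / 4)) ⊆ q ⁻¹' (⋃ w ∈ {w | w ≠ v}, T w)ᶜ :=
    (Metric.ball_subset_ball (min_le_left _ _)).trans hball
  set B := OpenPartialHomeomorph.univBall a (min ρ (1 / 4))
  have hBs : B.source = univ := OpenPartialHomeomorph.univBall_source a _
  have hBt : B.target = Metric.ball a (min ρ (1 / 4)) :=
    OpenPartialHomeomorph.univBall_target a hρ'
  have hBmem : ∀ z, B z ∈ Metric.ball a (min ρ (1 / 4)) := fun z =>
    hBt ▸ B.map_source (by simp [hBs])
  have hinj := hq.injOn_ball a (ρ := min ρ (1 / 4)) ((min_le_right _ _).trans (by norm_num))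
  have hf : IsOpenEmbedding fun z => q (B z) := by
    refine .of_continuous_injective_isOpenMap
      (hq.continuous.comp (OpenPartialHomeomorph.continuous_univBall a _)) ?_ ?_
    · intro z z' hzz
      exact B.injOn (by simp [hBs]) (by simp [hBs]) (hinj (hBmem z) (hBmem z') hzz)
    · rw [isOpenMap_iff_nhds_le]
      intro z
      have h1 : 𝓝 (q (B z)) = 𝓝[T v] (q (B z)) :=
        (nhdsWithin_eq_nhds.2 (Filter.mem_of_superset (hO.mem_nhds (hball' (hBmem z))) hOT)).symm
      have h2 : Filter.map (fun z => q (B z)) (𝓝 z) = Filter.map q (Filter.map B (𝓝 z)) := rfl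
      rw [h1, h2, B.map_nhds_eq (by simp [hBs]), hq.map_nhds]
  refine ⟨range fun z => q (B z), hf.isOpen_range, ⟨0, ?_⟩, ⟨hf.isEmbedding.toHomeomorph.symm⟩⟩
  exact congrArg q (OpenPartialHomeomorph.univBall_apply_zero a _)

theorem IsWedge.manifoldLocus_eq (h : IsWedge T p s t)
    (hch : ∀ v, ∃ q N, IsTorusChart (T v) q N) (hun : ⋃ v, T v = univ) :
    manifoldLocus W = (range p)ᶜ := by
  apply Subset.antisymm
  · rintro _ hx ⟨e, rfl⟩
    obtain ⟨O₀, hO₀, hcut⟩ := h.eventually_cut hch hun e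
    obtain ⟨O, hO, hOO, hpre⟩ := exists_isPreconnected_punctured_of_mem_manifoldLocus hx hO₀
    exact hcut O hO hOO hpre
  · exact fun x hx => h.mem_manifoldLocus hch hun hx

/-- A connected set avoiding the nodes cannot leave its torus, and the torus minus the nodes is
connected and dense in it. -/
theorem IsWedge.closure_connectedComponentIn (h : IsWedge T p s t)
    (hch : ∀ v, ∃ q N, IsTorusChart (T v) q N) (hun : ⋃ v, T v = univ) {x : W} {v : V}
    (hx : x ∉ range p) (hv : x ∈ T v) :
    closure (connectedComponentIn (range p)ᶜ x) = T v := by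
  have hcl : ∀ v, IsClosed (T v) := fun v => by
    obtain ⟨q, N, hq⟩ := hch v
    exact hq.isCompact.isClosed
  obtain ⟨q, N, hq⟩ := hch v
  have hxc : x ∈ connectedComponentIn (range p)ᶜ x := mem_connectedComponentIn hx
  have hsub : connectedComponentIn (range p)ᶜ x ⊆ T v := by
    intro y hy
    by_contra hyv
    obtain ⟨w, hw⟩ := mem_iUnion.1 (hun.ge (mem_univ y))
    have hwv : w ≠ v := fun hwv => hyv (hwv ▸ hw)
    obtain ⟨z, hz, hz1, hz2⟩ := isPreconnected_closed_iff.1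
      (isPreconnected_connectedComponentIn (x := x) (F := (range p)ᶜ)) _ _ (hcl v)
      (IsWedge.isClosed_others hcl v) (fun z _ => by
        obtain ⟨w', hw'⟩ := mem_iUnion.1 (hun.ge (mem_univ z))
        by_cases hvs : w' = v
        · exact Or.inl (hvs ▸ hw')
        · exact Or.inr (mem_biUnion hvs hw')) ⟨x, hxc, hv⟩ ⟨y, hy, mem_biUnion hwv hw⟩
    simp only [mem_iUnion] at hz2
    obtain ⟨w', hw', hzw⟩ := hz2
    exact hw' (h.eq_of_mem (connectedComponentIn_subset _ _ hz) hzw hz1)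
  apply Subset.antisymm
  · exact closure_minimal hsub (hcl v)
  · refine (hq.subset_closure_diff (finite_range p).countable).trans (closure_mono ?_)
    exact (hq.isPreconnected_diff (finite_range p).countable).subset_connectedComponentIn
      ⟨hv, hx⟩ fun y hy => hy.2

omit [T2Space W] [Finite V] in
theorem IsWedge.diff_range_nonempty (hch : ∀ v, ∃ q N, IsTorusChart (T v) q N) (p : E → W) (v : V) :
    (T v \ range p).Nonempty := by
  obtain ⟨q, N, hq⟩ := hch v
  exact closure_nonempty_iff.1
    ⟨q 0, hq.subset_closure_diff (finite_range p).countable (hq.mem 0)⟩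

theorem IsWedge.manifoldComponents_eq (h : IsWedge T p s t)
    (hch : ∀ v, ∃ q N, IsTorusChart (T v) q N) (hun : ⋃ v, T v = univ) :
    manifoldComponents W = range T := by
  rw [manifoldComponents, h.manifoldLocus_eq hch hun]
  ext M
  constructor
  · rintro ⟨x, hx, rfl⟩
    obtain ⟨v, hv⟩ := mem_iUnion.1 (hun.ge (mem_univ x))
    exact ⟨v, (h.closure_connectedComponentIn hch hun hx hv).symm⟩
  · rintro ⟨v, rfl⟩
    obtain ⟨x, hv, hx⟩ := IsWedge.diff_range_nonempty hch p v
    exact ⟨x, hx, (h.closure_connectedComponentIn hch hun hx hv).symm⟩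

omit [T2Space W] [Finite V] in
theorem IsWedge.injective_components (h : IsWedge T p s t)
    (hch : ∀ v, ∃ q N, IsTorusChart (T v) q N) : Function.Injective T := by
  intro v w hvw
  obtain ⟨x, hv, hx⟩ := IsWedge.diff_range_nonempty hch p v
  exact h.eq_of_mem hx hv (hvw ▸ hv)

theorem IsWedge.ncard_vertexSet (h : IsWedge T p s t)
    (hch : ∀ v, ∃ q N, IsTorusChart (T v) q N) (hun : ⋃ v, T v = univ) :
    (dualGraph W).vertexSet.ncard = Nat.card V := by
  change (manifoldComponents W).ncard = _
  rw [h.manifoldComponents_eq hch hun, ← Nat.card_coe_set_eq,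
    Nat.card_range_of_injective (h.injective_components hch)]

theorem IsWedge.ncard_edgeSet (h : IsWedge T p s t)
    (hch : ∀ v, ∃ q N, IsTorusChart (T v) q N) (hun : ⋃ v, T v = univ) :
    (dualGraph W).edgeSet.ncard = Nat.card E := by
  have hE : (dualGraph W).edgeSet = range fun e => (s(T (s e), T (t e)), p e) := by
    ext ⟨m, x⟩
    rw [Graph.edge_mem_iff_exists_isLink]
    constructor
    · rintro ⟨M, M', hm, hne, hM, hM', hx⟩
      rw [h.manifoldComponents_eq hch hun] at hM hM'
      obtain ⟨v, rfl⟩ := hM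
      obtain ⟨w, rfl⟩ := hM'
      simp only at hm hx
      subst hm
      obtain ⟨e, rfl, ⟨rfl, rfl⟩ | ⟨rfl, rfl⟩⟩ :=
        h.exists_edge v w x (fun hvw => hne (congrArg T hvw)) hx.1 hx.2
      · exact ⟨e, rfl⟩
      · exact ⟨e, Prod.ext Sym2.eq_swap rfl⟩
    · rintro ⟨e, he⟩
      rw [← he]
      refine ⟨T (s e), T (t e), rfl, (h.injective_components hch).ne (h.ne e), ?_, ?_,
        h.mem_source e, h.mem_target e⟩ <;>
      · rw [h.manifoldComponents_eq hch hun]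
        exact mem_range_self _
  rw [hE, ← Nat.card_coe_set_eq, Nat.card_range_of_injective]
  exact fun e e' hee => h.injective (congrArg Prod.snd hee)

end DualGraph


/-! ### Compactness and connectedness of the connected sum -/

section ConnectedSum

theorem norm_le_norm_of_abs_le {a b : E3} (h : ∀ j, |a j| ≤ |b j|) : ‖a‖ ≤ ‖b‖ := by
  rw [EuclideanSpace.norm_eq, EuclideanSpace.norm_eq]
  exact Real.sqrt_le_sqrt (Finset.sum_le_sum fun j _ => by
    simpa only [Real.norm_eq_abs] using pow_le_pow_left₀ (abs_nonneg _) (h j) 2)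

/-- The complement of the balls removed from the universal cover of each 3-torus. -/
def outside : Set E3 := {x | ∀ s, IsNodeParam s → 1 / 8 ≤ ‖x - s‖}

theorem isClosed_outside : IsClosed outside := by
  simp only [outside, Set.ofPred_forall]
  refine isClosed_iInter fun s => isClosed_iInter fun _ => ?_
  exact isClosed_le continuous_const (by fun_prop)

theorem IsNodeParam.exists_eq {s : E3} (h : IsNodeParam s) (j : Fin 3) : ∃ k : ℤ, s j = k / 2 := by
  rcases h with h | h
  · obtain ⟨k, hk⟩ := h j
    exact ⟨2 * k, by rw [hk]; push_cast; ring⟩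
  · obtain ⟨k, hk⟩ := h j
    exact ⟨2 * k + 1, by push_cast; linarith⟩

theorem mem_outside_of_apply {x : E3} {k : ℤ} (j : Fin 3) (h : x j = k / 2 + 1 / 4) :
    x ∈ outside := by
  intro s hs
  obtain ⟨n, hn⟩ := hs.exists_eq j
  refine le_trans ?_ (PiLp.norm_apply_le (x - s) j)
  rw [PiLp.sub_apply, h, hn, Real.norm_eq_abs, le_abs]
  rcases le_or_gt n k with h1 | h1
  · have : (n : ℝ) ≤ k := by exact_mod_cast h1
    left; linarith
  · have : (k : ℝ) + 1 ≤ n := by exact_mod_cast h1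
    right; linarith

/-- Slide the first coordinate to the midpoint `m` of its half-unit interval, then move in the plane
`y 0 = m` to the plane `y 1 = 1/4`. Both planes keep distance at least `1/4` from all node
parameters. -/
theorem isPreconnected_outside : IsPreconnected outside := by
  refine isPreconnected_of_forall (diag (1 / 4)) fun x hx => ?_
  set k : ℤ := ⌊2 * x 0⌋
  have hk1 : (k : ℝ) ≤ 2 * x 0 := Int.floor_le _
  have hk2 : 2 * x 0 < k + 1 := Int.lt_floor_add_one _
  set m : ℝ := k / 2 + 1 / 4 with hm
  let A : Set E3 := {y | y 1 = x 1 ∧ y 2 = x 2 ∧ y 0 ∈ uIcc (x 0) m}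
  let B : Set E3 := {y | y 0 = m}
  let C : Set E3 := {y | y 1 = 1 / 4}
  have hlin : ∀ j, IsLinearMap ℝ fun y : E3 => y j := fun j => ⟨fun _ _ => rfl, fun _ _ => rfl⟩
  have hA : IsPreconnected A :=
    ((convex_singleton (x 1)).is_linear_preimage (hlin 1) |>.inter
      (((convex_singleton (x 2)).is_linear_preimage (hlin 2)).inter
        ((convex_uIcc _ _).is_linear_preimage (hlin 0)))).isPreconnected
  have hB : IsPreconnected B := ((convex_singleton m).is_linear_preimage (hlin 0)).isPreconnected
  have hC : IsPreconnected C :=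
    ((convex_singleton (1 / 4 : ℝ)).is_linear_preimage (hlin 1)).isPreconnected
  refine ⟨A ∪ B ∪ C, ?_, Or.inr rfl, Or.inl (Or.inl ⟨rfl, rfl, left_mem_uIcc⟩),
    (hA.union (WithLp.toLp 2 ![m, x 1, x 2]) (show _ ∈ A from ⟨rfl, rfl, right_mem_uIcc⟩)
      (show _ ∈ B from rfl) hB).union (WithLp.toLp 2 ![m, 1 / 4, 1 / 4])
      (Or.inr (show _ ∈ B from rfl)) (show _ ∈ C from rfl) hC⟩
  rintro y ((⟨h1, h2, h0⟩ | h) | h)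
  · intro s hs
    -- If the first coordinate is still within `1/8` of that of `s`, the slide has been moving away
    -- from it, so the distance to `s` has not decreased.
    by_cases hy : 1 / 8 ≤ |y 0 - s 0|
    · exact hy.trans (PiLp.norm_apply_le (y - s) 0)
    · refine (hx s hs).trans (norm_le_norm_of_abs_le fun j => ?_)
      fin_cases j
      · push Not at hy
        obtain ⟨n, hn⟩ := hs.exists_eq 0
        change |x 0 - s 0| ≤ |y 0 - s 0|
        rw [abs_lt] at hy
        rw [hn] at hy ⊢
        rcases le_or_gt n k with h3 | h3
        · have h3 : (n : ℝ) ≤ k := by exact_mod_cast h3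
          rcases mem_uIcc.1 h0 with h0 | h0
          · rw [abs_of_nonneg (by linarith), abs_of_nonneg (by linarith)]
            linarith
          · linarith
        · have h3 : (k : ℝ) + 1 ≤ n := by exact_mod_cast h3
          rcases mem_uIcc.1 h0 with h0 | h0
          · linarith
          · rw [abs_of_nonpos (by linarith), abs_of_nonpos (by linarith)]
            linarith
      · change |x 1 - s 1| ≤ |y 1 - s 1|
        rw [h1]
      · change |x 2 - s 2| ≤ |y 2 - s 2|
        rw [h2]
  · exact mem_outside_of_apply 0 h
  · exact mem_outside_of_apply (k := 0) 1 (by rw [show y 1 = 1 / 4 from h]; norm_num)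

/-- Distinct node parameters are at least `1/2` apart, so the sphere of radius `1/8` around one of
them stays at least `3/8` from the others. -/
theorem IsNodeParam.add_mem_outside {s u : E3} (hs : IsNodeParam s) (hu : ‖u‖ = 1 / 8) :
    s + u ∈ outside := by
  intro s' hs'
  by_cases h : s = s'
  · rw [h, add_sub_cancel_left, hu]
  · obtain ⟨j, hj⟩ : ∃ j, s j ≠ s' j := by
      by_contra! hcon
      exact h (PiLp.ext hcon)
    have h1 : 1 / 2 ≤ |s j - s' j| := by
      obtain ⟨n, hn⟩ := hs.exists_eq j
      obtain ⟨n', hn'⟩ := hs'.exists_eq j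
      have : n - n' ≠ 0 := by
        intro h0
        apply hj
        rw [hn, hn', sub_eq_zero.1 h0]
      have h2 : (1 : ℝ) ≤ |((n - n' : ℤ) : ℝ)| := by
        exact_mod_cast Int.one_le_abs this
      rw [hn, hn', ← sub_div, abs_div, abs_two]
      push_cast at h2
      linarith
    have h2 : |s j - s' j| ≤ ‖s - s'‖ := PiLp.norm_apply_le (s - s') j
    have h3 : ‖s - s'‖ ≤ ‖s + u - s'‖ + ‖u‖ := by
      rw [show s - s' = (s + u - s') - u by abel]
      exact norm_sub_le _ _
    linarith

variable {τ : Fin 3 → ℂ}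

/-- The parametrization of the `i`-th summand of the disjoint union. -/
noncomputable def planeMapSigma (τ : Fin 3 → ℂ) (i : Fin 3) (s : E3) : DisjointTori τ :=
  ⟨i, planeMap τ i s, mem_range_self s⟩

theorem continuous_planeMapSigma (i : Fin 3) : Continuous (planeMapSigma τ i) :=
  continuous_sigmaMk.comp ((continuous_planeMap i).subtype_mk _)

theorem planeMapSigma_mem_puncturedTori_iff (hτ : ∀ j, 0 < (τ j).im) (i : Fin 3) (x : E3) :
    planeMapSigma τ i x ∈ puncturedTori τ ↔ x ∈ outside := by
  constructor
  · intro h s hs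
    by_contra! hlt
    exact h ⟨s, x - s, (planeMap_mem_nodes_iff hτ i s).2 hs, hlt, by
      rw [add_sub_cancel]
      rfl⟩
  · rintro h ⟨s, u, hs, hu, heq⟩
    have h1 : ∀ j, ∃ k : ℤ, (s + u) j - x j = k := (planeMap_eq_self_iff hτ i _ _).1 heq
    have h2 : IsNodeParam (x - u) := by
      rw [← planeMap_mem_nodes_iff hτ i, (planeMap_eq_self_iff hτ i (x - u) s).2 fun j => ?_]
      · exact hs
      · obtain ⟨k, hk⟩ := h1 j
        refine ⟨k, ?_⟩
        rw [← hk]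
        simp only [PiLp.add_apply, PiLp.sub_apply]
        ring
    have h3 := h _ h2
    rw [sub_sub_cancel] at h3
    linarith

theorem isTorusChart_planeMap (hτ : ∀ j, 0 < (τ j).im) {Z : Type*}
    [TopologicalSpace Z] [T2Space Z] (i : Fin 3) {q : E3 → Z} (hq : Continuous q)
    (h : ∀ s s', q s = q s' ↔ planeMap τ i s = planeMap τ i s') :
    IsTorusChart (range q) q 1 := by
  refine isTorusChart_range hq one_pos ?_ ?_ ?_
  · intro j x
    rw [h, planeMap_eq_self_iff hτ]
    intro k
    by_cases hkj : k = j
    · subst hkj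
      exact ⟨-1, by simp⟩
    · exact ⟨0, by simp [hkj]⟩
  · intro x y hxy z
    rw [h, planeMap_eq_self_iff hτ] at *
    intro j
    obtain ⟨k, hk⟩ := hxy j
    exact ⟨-k, by push_cast; rw [← hk]; simp⟩
  · intro x y hxy
    rwa [h, planeMap_eq_self_iff hτ] at hxy

theorem isCompact_puncturedTori (hτ : ∀ j, 0 < (τ j).im) : IsCompact (puncturedTori τ) := by
  have h1 : puncturedTori τ =
      ⋃ i, planeMapSigma τ i '' ({x : E3 | ∀ i, 0 ≤ x i ∧ x i ≤ (1 : ℕ)} ∩ outside) := by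
    apply Subset.antisymm
    · rintro ⟨i, _, x, rfl⟩ hx
      obtain ⟨v, hv, hy⟩ := exists_mem_cube (q := planeMap τ i) (N := 1) one_pos (fun j x => by
        rw [planeMap_eq_self_iff hτ]
        intro k
        by_cases hkj : k = j
        · subst hkj
          exact ⟨-1, by simp⟩
        · exact ⟨0, by simp [hkj]⟩) x
      have hyx : planeMapSigma τ i (x + v) = ⟨i, planeMap τ i x, mem_range_self x⟩ := by
        simp only [planeMapSigma, hv x]
      refine mem_iUnion.2 ⟨i, x + v, ⟨hy, ?_⟩, hyx⟩
      rw [← planeMapSigma_mem_puncturedTori_iff hτ i, hyx]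
      exact hx
    · refine iUnion_subset fun i => ?_
      rintro _ ⟨x, ⟨_, hx⟩, rfl⟩
      exact (planeMapSigma_mem_puncturedTori_iff hτ i x).2 hx
  rw [h1]
  exact isCompact_iUnion fun i =>
    ((isCompact_cube (1 : ℕ)).inter_right isClosed_outside).image (continuous_planeMapSigma i)

theorem compactSpace_connectedSum (hτ : ∀ j, 0 < (τ j).im) : CompactSpace (ConnectedSum τ) := by
  have := isCompact_iff_compactSpace.1 (isCompact_puncturedTori hτ)
  infer_instance

/-- The images of the three connected pieces cover the sum, and one glued point of a boundary sphere
joins each pair. -/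
theorem preconnectedSpace_connectedSum (hτ : ∀ j, 0 < (τ j).im) :
    PreconnectedSpace (ConnectedSum τ) := by
  let Φ : Fin 3 → outside → ConnectedSum τ := fun i x =>
    Quot.mk _ ⟨planeMapSigma τ i x, (planeMapSigma_mem_puncturedTori_iff hτ i x).2 x.2⟩
  have hΦ : ∀ i, Continuous (Φ i) := fun i => continuous_quot_mk.comp
    (((continuous_planeMapSigma i).comp continuous_subtype_val).subtype_mk _)
  have : PreconnectedSpace outside := Subtype.preconnectedSpace isPreconnected_outside
  have hpre : ∀ i, IsPreconnected (range (Φ i)) := fun i => isPreconnected_range (hΦ i)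
  have hmeet : ∀ i i', i ≠ i' → ∃ y, y ∈ range (Φ i) ∧ y ∈ range (Φ i') := by
    intro i i' hi
    let u : E3 := (1 / 8 : ℝ) • stdVec 0
    have hu : ‖u‖ = 1 / 8 := by
      simp only [u, norm_smul, stdVec, PiLp.norm_single, norm_one]
      norm_num
    let s := diag (nodeParam i i')
    let s' := diag (nodeParam i' i)
    have hss : planeMap τ i s = planeMap τ i' s' := planeMap_nodeParam hτ hi
    have hs : IsNodeParam s := (planeMap_mem_nodes_iff hτ i s).1
      ⟨i, i', hi, mem_range_self _, hss ▸ mem_range_self _⟩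
    have hs' : IsNodeParam s' := (planeMap_mem_nodes_iff hτ i' s').1
      ⟨i', i, hi.symm, mem_range_self _, hss ▸ mem_range_self _⟩
    refine ⟨_, ⟨⟨s + u, hs.add_mem_outside hu⟩, rfl⟩,
      ⟨⟨s' - u, sub_eq_add_neg s' u ▸ hs'.add_mem_outside (by rwa [norm_neg])⟩, ?_⟩⟩
    exact (Quot.sound ⟨hi, s, s', u, hss, hu, rfl, rfl⟩).symm
  refine ⟨?_⟩
  have huniv : (univ : Set (ConnectedSum τ)) = range (Φ 0) ∪ range (Φ 1) ∪ range (Φ 2) := by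
    symm
    refine eq_univ_of_forall fun y => ?_
    obtain ⟨⟨⟨i, _, x, rfl⟩, hx⟩, rfl⟩ := Quot.exists_rep y
    have : Quot.mk _ ⟨⟨i, planeMap τ i x, mem_range_self x⟩, hx⟩ ∈ range (Φ i) :=
      ⟨⟨x, (planeMapSigma_mem_puncturedTori_iff hτ i x).1 hx⟩, rfl⟩
    fin_cases i
    · exact Or.inl (Or.inl this)
    · exact Or.inl (Or.inr this)
    · exact Or.inr this
  rw [huniv]
  obtain ⟨y, hy, hy'⟩ := hmeet 0 1 (by decide)
  obtain ⟨z, hz, hz'⟩ := hmeet 0 2 (by decide)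
  exact ((hpre 0).union y hy hy' (hpre 1)).union z (Or.inl hz) hz' (hpre 2)

end ConnectedSum


/-! ### Properness of finite coverings and pullback of local models -/

section Coverings

/-- Over a small compact set the covering is a product with a finite set; compactness of `K` reduces
to finitely many of these. -/
theorem IsCoveringMap.isCompact_preimage {W B : Type*} [TopologicalSpace W] [TopologicalSpace B]
    [T2Space B] [LocallyCompactSpace B] {d : W → B} (hd : IsCoveringMap d)
    (hfin : ∀ x, (d ⁻¹' {x}).Finite) {K : Set B} (hK : IsCompact K) : IsCompact (d ⁻¹' K) := by
  suffices h : ∃ C, IsCompact C ∧ d ⁻¹' K ⊆ C by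
    obtain ⟨C, hC, hKC⟩ := h
    exact hC.of_isClosed_subset (hK.isClosed.preimage hd.continuous) hKC
  refine hK.induction_on (p := fun K => ∃ C, IsCompact C ∧ d ⁻¹' K ⊆ C) ⟨∅, by simp⟩ ?_ ?_ ?_
  · rintro s t hst ⟨C, hC, htC⟩
    exact ⟨C, hC, (preimage_mono hst).trans htC⟩
  · rintro s t ⟨C, hC, hsC⟩ ⟨C', hC', htC⟩
    exact ⟨C ∪ C', hC.union hC', union_subset_union hsC htC⟩
  · intro x _
    rcases isEmpty_or_nonempty (d ⁻¹' {x}) with hempty | hne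
    · obtain ⟨_, U, hxU, hU, _, H, hH⟩ := hd x
      refine ⟨U, mem_nhdsWithin_of_mem_nhds (hU.mem_nhds hxU), ∅, isCompact_empty, ?_⟩
      exact fun y hy => hempty.elim (H ⟨y, hy⟩).2
    · have _ : Finite (d ⁻¹' {x}) := (hfin x).to_subtype
      have _ := (hd x).1
      set e := (hd x).toTrivialization
      have hx : x ∈ e.baseSet := (hd x).mem_toTrivialization_baseSet
      obtain ⟨C, hC, hCe, hCc⟩ := local_compact_nhds (e.open_baseSet.mem_nhds hx)
      have hCt : C ×ˢ (univ : Set (d ⁻¹' {x})) ⊆ e.target := by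
        rintro ⟨b, i⟩ ⟨hb, _⟩
        exact e.mem_target.2 (hCe hb)
      refine ⟨C, mem_nhdsWithin_of_mem_nhds hC, e.toOpenPartialHomeomorph.symm '' (C ×ˢ univ),
        (hCc.prod isCompact_univ).image_of_continuousOn
          (e.toOpenPartialHomeomorph.symm.continuousOn.mono hCt), ?_⟩
      intro y hy
      have hys : y ∈ e.source := e.mem_source.2 (hCe hy)
      refine ⟨e y, ⟨?_, mem_univ _⟩, e.toOpenPartialHomeomorph.left_inv hys⟩
      rw [e.coe_fst hys]
      exact hy

variable {Z Z' : Type*} [TopologicalSpace Z] [TopologicalSpace Z'] {f : Z → ℝ} {c : Z' → Z}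

theorem RegularAt.comp (hc : IsLocalHomeomorph c) {x : Z'} (h : RegularAt f (c x)) :
    RegularAt (f ∘ c) x := by
  obtain ⟨Ψ, hx, hf⟩ := h
  obtain ⟨e, hxe, rfl⟩ := hc x
  exact ⟨e.trans Ψ, by simpa using ⟨hxe, hx⟩, fun y hy => hf _ (by simpa using hy.2)⟩

theorem NodeAt.comp (hc : IsLocalHomeomorph c) {σ : ℝ} {x : Z'} (h : NodeAt σ f (c x)) :
    NodeAt σ (f ∘ c) x := by
  obtain ⟨Ψ, hx, h0, hf⟩ := h
  obtain ⟨e, hxe, rfl⟩ := hc x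
  exact ⟨e.trans Ψ, by simpa using ⟨hxe, hx⟩, h0, fun y hy => hf _ (by simpa using hy.2)⟩

theorem RegularAt.sub_const {x : Z} (h : RegularAt f x) (a : ℝ) :
    RegularAt (fun y => f y - a) x := by
  obtain ⟨Ψ, hx, hf⟩ := h
  refine ⟨Ψ.trans ((Homeomorph.refl E3).prodCongr
    (Homeomorph.subRight a)).toOpenPartialHomeomorph, by simpa using hx, fun y hy => ?_⟩
  have hy' : y ∈ Ψ.source := by simpa using hy
  simp [hf y hy']

end Coverings

/-! ### Local contractibility of the fibres -/

section LocalContractibility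

variable {Z : Type*} [TopologicalSpace Z] {f : Z → ℝ}

/-- Straight segments in the chart towards the image of `p` stay in the level set by `hstar`. For
the models this holds because slices are affine and cones are homogeneous. -/
theorem exists_contraction (Ψ : OpenPartialHomeomorph Z (E3 × ℝ)) {p : Z} (hp : p ∈ Ψ.source)
    {m : E3 × ℝ → ℝ} (hm : ∀ x ∈ Ψ.source, f x = m (Ψ x))
    (hstar : ∀ z, m z = m (Ψ p) → ∀ θ ∈ Icc (0 : ℝ) 1, m (Ψ p + θ • (z - Ψ p)) = m (Ψ p))
    {O : Set Z} (hO : O ∈ 𝓝 p) :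
    ∃ U ∈ 𝓝[f ⁻¹' {f p}] p, U ⊆ O ∩ f ⁻¹' {f p} ∧ ∃ o, ∃ H : Z × ℝ → Z,
      ContinuousOn H (U ×ˢ Icc (0 : ℝ) 1) ∧ MapsTo H (U ×ˢ Icc (0 : ℝ) 1) U ∧
      (∀ y ∈ U, H (y, 1) = y) ∧ ∀ y ∈ U, H (y, 0) = o := by
  obtain ⟨r, hr, hrt, hrO⟩ := exists_ball_subset_chart Ψ hp hO
  set D := Ψ.symm '' Metric.ball (Ψ p) r
  have hD : IsOpen D := Ψ.symm.isOpen_image_of_subset_source Metric.isOpen_ball hrt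
  have hpD : p ∈ D := ⟨Ψ p, Metric.mem_ball_self hr, Ψ.left_inv hp⟩
  have hDΨ : ∀ y ∈ D, y ∈ Ψ.source ∧ Ψ y ∈ Metric.ball (Ψ p) r := by
    rintro _ ⟨z, hz, rfl⟩
    exact ⟨Ψ.map_target (hrt hz), by rwa [Ψ.right_inv (hrt hz)]⟩
  have hball : ∀ z ∈ Metric.ball (Ψ p) r, ∀ θ ∈ Icc (0 : ℝ) 1,
      Ψ p + θ • (z - Ψ p) ∈ Metric.ball (Ψ p) r := by
    intro z hz θ hθ
    rw [mem_ball_iff_norm] at hz ⊢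
    rw [add_sub_cancel_left, norm_smul, Real.norm_eq_abs, abs_of_nonneg hθ.1]
    exact (mul_le_of_le_one_left (norm_nonneg _) hθ.2).trans_lt hz
  refine ⟨f ⁻¹' {f p} ∩ D, Filter.inter_mem self_mem_nhdsWithin
    (mem_nhdsWithin_of_mem_nhds (hD.mem_nhds hpD)), fun y hy => ⟨hrO hy.2, hy.1⟩, p,
    fun y => Ψ.symm (Ψ p + y.2 • (Ψ y.1 - Ψ p)), ?_, ?_, ?_, ?_⟩
  · refine Ψ.symm.continuousOn.comp (t := Ψ.target) ?_ ?_
    · have h1 : ContinuousOn (fun y : Z × ℝ => Ψ y.1) ((f ⁻¹' {f p} ∩ D) ×ˢ Icc (0 : ℝ) 1) :=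
        Ψ.continuousOn.comp continuous_fst.continuousOn fun y hy => (hDΨ _ hy.1.2).1
      exact continuousOn_const.add (continuous_snd.continuousOn.smul (h1.sub continuousOn_const))
    · exact fun y hy => hrt (hball _ (hDΨ _ hy.1.2).2 _ hy.2)
  · rintro ⟨y, θ⟩ ⟨⟨hy, hyD⟩, hθ⟩
    have h1 := hball _ (hDΨ _ hyD).2 θ hθ
    refine ⟨?_, _, h1, rfl⟩
    have h2 : f y = f p := hy
    change f _ = f p
    rw [hm _ (Ψ.map_target (hrt h1)), Ψ.right_inv (hrt h1), hm p hp]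
    refine hstar _ ?_ θ hθ
    rw [← hm _ (hDΨ _ hyD).1, ← hm p hp, h2]
  · rintro y ⟨_, hyD⟩
    simp [Ψ.left_inv (hDΨ _ hyD).1]
  · rintro y ⟨_, hyD⟩
    simp [Ψ.left_inv hp]

theorem locContr_fiber {t : ℝ}
    (h : ∀ x, f x = t → RegularAt f x ∨ ∃ σ, NodeAt σ f x) : LocContr (f ⁻¹' {t}) := by
  intro x hx O hO
  obtain rfl : f x = t := hx
  rcases h x rfl with ⟨Ψ, hxΨ, hf⟩ | ⟨σ, Ψ, hxΨ, h0, hf⟩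
  · refine exists_contraction Ψ hxΨ (m := Prod.snd) hf (fun z hz θ _ => ?_) hO
    simp [hz]
  · refine exists_contraction Ψ hxΨ (m := fun z => σ * (‖z.1‖ ^ 2 - z.2 ^ 2)) hf
      (fun z hz θ hθ => ?_) hO
    rw [h0] at hz ⊢
    simp only [Prod.fst_zero, norm_zero, Prod.snd_zero, sub_zero, zero_add, Prod.smul_fst,
      Prod.smul_snd, norm_smul, smul_eq_mul, mul_pow, Real.norm_eq_abs, sq_abs] at hz ⊢
    linear_combination θ ^ 2 * hz

end LocalContractibility

/-! ### Fibres near a regular value -/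

section RegularFibers

variable {Z : Type*} [TopologicalSpace Z] [T2Space Z] [LocallyCompactSpace Z] {f : Z → ℝ}

/-- This is the comparison near a singular value with an empty set of nodes, applied on both sides.
-/
theorem rank_H1_fiber_near_regular (hf : Continuous f) {t₀ : ℝ}
    (hreg : ∀ x, f x = t₀ → RegularAt f x) (hK : IsCompact (f ⁻¹' {t₀})) {G : Set Z}
    (hG : IsOpen G) (hGc : IsCompact (closure G)) (htG : f ⁻¹' {t₀} ⊆ G) :
    ∀ᶠ t in 𝓝 t₀, Module.rank ℝ (H1 (f ⁻¹' {t} ∩ G)) = Module.rank ℝ (H1 (f ⁻¹' {t₀})) := by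
  have hpre : ∀ t, (fun y => f y - t₀) ⁻¹' {t} = f ⁻¹' {t + t₀} := fun t => by
    ext y
    simp [sub_eq_iff_eq_add]
  have h0 := hpre 0
  rw [zero_add] at h0
  have key : ∀ s : ℝ, s = 1 ∨ s = -1 → ∀ᶠ t in 𝓝[{t | 0 ≤ s * t}] 0,
      Module.rank ℝ (H1 (f ⁻¹' {t + t₀} ∩ G)) = Module.rank ℝ (H1 (f ⁻¹' {t₀})) := by
    intro s hs
    have := rank_H1_fiber_near_zero (f := fun y => f y - t₀) (by fun_prop) hs (P := ∅) finite_empty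
      (σ := fun _ => 1) (by simp) (by simp) (fun x hx _ => (hreg x (sub_eq_zero.1 hx)).sub_const t₀)
      (h0 ▸ hK) hG hGc (h0 ▸ htG) (Q := ∅) (by simp)
    filter_upwards [this] with t ht
    have ht' := ht.1
    rwa [sdiff_empty, sdiff_empty, hpre, h0] at ht'
  have h1 := key 1 (Or.inl rfl)
  have h2 := key (-1) (Or.inr rfl)
  have h3 : ∀ᶠ t in 𝓝 (0 : ℝ),
      Module.rank ℝ (H1 (f ⁻¹' {t + t₀} ∩ G)) = Module.rank ℝ (H1 (f ⁻¹' {t₀})) := by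
    rw [eventually_nhdsWithin_iff] at h1 h2
    filter_upwards [h1, h2] with t h1 h2
    rcases le_total 0 t with h | h
    · exact h1 (by simpa using h)
    · exact h2 (by simpa using h)
  have h4 : Filter.Tendsto (fun t => t - t₀) (𝓝 t₀) (𝓝 0) := by
    have : Continuous fun t : ℝ => t - t₀ := by fun_prop
    simpa using this.tendsto t₀
  filter_upwards [h4.eventually h3] with t ht
  rwa [sub_add_cancel] at ht

omit [T2Space Z] [LocallyCompactSpace Z] in
-- The boundary of `G` is compact and misses the fibre over `t₀`, hence nearby fibres, whose parts
-- inside `G` are therefore open and closed in them.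
theorem eventually_fiber_inter_eq (hf : Continuous f) {t₀ : ℝ} {G : Set Z} (hG : IsOpen G)
    (hGc : IsCompact (closure G)) (htG : f ⁻¹' {t₀} ⊆ G) :
    ∀ᶠ t in 𝓝 t₀, f ⁻¹' {t} ∩ G = f ⁻¹' {t} ∩ closure G := by
  have h := IsCompact.eventually_disjoint_fiber hf (hGc.diff hG) (t₀ := t₀)
    (fun z hz h => hz.2 (htG h)) univ
  rw [nhdsWithin_univ] at h
  filter_upwards [h] with t ht
  refine Subset.antisymm (inter_subset_inter_right _ subset_closure) fun z hz => ⟨hz.1, ?_⟩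
  by_contra hzG
  exact ht z ⟨hz.2, hzG⟩ hz.1

end RegularFibers

/-! ### Wedges and tori in a subspace, seen in the ambient space -/

section Push

variable {Z V E : Type*} [TopologicalSpace Z] {S : Set Z} {T : V → Set S} {p : E → S} {s t : E → V}

theorem IsWedge.push (h : IsWedge T p s t) :
    IsWedge (fun v => (Subtype.val '' T v : Set Z)) (fun e => (p e : Z)) s t := by
  refine ⟨?_, Subtype.val_injective.comp h.injective, fun e => mem_image_of_mem _ (h.mem_source e),
    fun e => mem_image_of_mem _ (h.mem_target e), h.ne, ?_⟩
  · intro v x hx hxv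
    obtain ⟨w, y, hy, rfl⟩ := mem_iUnion.1 hx
    refine mem_image_of_mem _ (h.mem_of_mem_closure v y (mem_iUnion.2 ⟨w, hy⟩) ?_)
    rw [IsInducing.subtypeVal.closure_eq_preimage_closure_image]
    exact hxv
  · rintro v w _ hvw ⟨x, hx, rfl⟩ ⟨y, hy, hyx⟩
    obtain rfl := Subtype.val_injective hyx
    obtain ⟨e, rfl, he⟩ := h.exists_edge v w _ hvw hx hy
    exact ⟨e, rfl, he⟩

theorem IsTorusChart.push [T2Space Z] {A : Set S} {q : E3 → S} {N : ℕ} (h : IsTorusChart A q N) :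
    IsTorusChart (Subtype.val '' A : Set Z) (fun x => (q x : Z)) N := by
  have := isTorusChart_range (q := fun x => (q x : Z)) (continuous_subtype_val.comp h.continuous)
    h.pos (fun i x => congrArg Subtype.val (h.period i x))
    (fun x y hxy z => congrArg Subtype.val (h.deck x y (Subtype.val_injective hxy) z))
    (fun x y hxy => h.integral x y (Subtype.val_injective hxy))
  rwa [show range (fun x => (q x : Z)) = Subtype.val '' A by
    rw [← h.range_eq, ← range_comp]; rfl] at this

end Push


/-! ### Betti numbers of wedges of tori -/

section WedgeOfTori

variable {Z V E : Type*} [TopologicalSpace Z] [T1Space Z] [Fintype V] {T : V → Set Z}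
  {p : E → Z} {s t : E → V} {Q : Set Z}

omit [T1Space Z] [Fintype V] in
theorem nonempty_diff_of_isTorusChart (hch : ∀ v, ∃ q N, IsTorusChart (T v) q N) (hQ : Q.Finite)
    (v : V) : (T v \ Q).Nonempty := by
  obtain ⟨q, N, hq⟩ := hch v
  exact closure_nonempty_iff.1 ⟨q 0, hq.subset_closure_diff hQ.countable (hq.mem 0)⟩

theorem IsWedge.finrank_H1_diff [Fintype E] (h : IsWedge T p s t)
    (hch : ∀ v, ∃ q N, IsTorusChart (T v) q N) (hQ : Q.Finite) :
    Module.finrank ℝ (H1 ((⋃ v, T v) \ Q)) = 2 * Fintype.card V + Nat.card {e // p e ∉ Q} +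
      Module.finrank ℝ (LinearMap.ker
        (graphCoboundary (fun e : {e // p e ∉ Q} => s e) (fun e => t e))) := by
  classical
  rw [iUnion_sdiff, Nat.card_eq_fintype_card]
  refine ((h.diff Q).finrank_H1 (fun v => ?_) (nonempty_diff_of_isTorusChart hch hQ)
    fun v => ?_).2
  · obtain ⟨q, N, hq⟩ := hch v
    exact hq.isPreconnected_diff hQ.countable
  · obtain ⟨q, N, hq⟩ := hch v
    exact hq.nonempty_H1_diff_equiv hQ

/-- A graph has at least as many components as vertices minus edges, so `2V + E + k ≥ 3V` whichever
points are removed. -/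
theorem IsWedge.le_finrank_H1_diff [Fintype E] (h : IsWedge T p s t)
    (hch : ∀ v, ∃ q N, IsTorusChart (T v) q N) (hQ : Q.Finite) :
    3 * Fintype.card V ≤ Module.finrank ℝ (H1 ((⋃ v, T v) \ Q)) := by
  classical
  have h1 := le_finrank_ker_graphCoboundary (fun e : {e // p e ∉ Q} => s e) (fun e => t e)
  rw [h.finrank_H1_diff hch hQ, Nat.card_eq_fintype_card]
  omega

theorem IsWedge.finrank_H1_diff_of_subset [Fintype E] (h : IsWedge T p s t)
    (hch : ∀ v, ∃ q N, IsTorusChart (T v) q N) (hQ : Q.Finite) (hp : range p ⊆ Q) :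
    Module.finrank ℝ (H1 ((⋃ v, T v) \ Q)) = 3 * Fintype.card V := by
  have : IsEmpty {e // p e ∉ Q} := ⟨fun e => e.2 (hp (mem_range_self _))⟩
  rw [h.finrank_H1_diff hch hQ, finrank_ker_graphCoboundary_of_isEmpty, Nat.card_of_isEmpty]
  omega

theorem IsWedge.finrank_H1_iUnion [Fintype E] (h : IsWedge T p s t)
    (hch : ∀ v, ∃ q N, IsTorusChart (T v) q N) :
    Module.finrank ℝ (H1 (⋃ v, T v)) = 2 * Fintype.card V + Fintype.card E +
      Module.finrank ℝ (LinearMap.ker (graphCoboundary s t)) := by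
  refine (h.finrank_H1 (fun v => ?_) (fun v => ?_) fun v => ?_).2
  · obtain ⟨q, N, hq⟩ := hch v
    exact hq.isPreconnected
  · obtain ⟨q, N, hq⟩ := hch v
    exact ⟨_, hq.mem 0⟩
  · obtain ⟨q, N, hq⟩ := hch v
    exact hq.nonempty_H1_equiv

omit [T1Space Z] in
/-- A locally constant function on a wedge in which two pieces meet takes fewer values than there
are pieces. -/
theorem IsWedge.ncard_image_lt (h : IsWedge T p s t)
    (hch : ∀ v, ∃ q N, IsTorusChart (T v) q N) (hQ : Q.Finite) {e : E} (he : p e ∉ Q) {u : Z → ℕ}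
    (hu : ∀ x ∈ (⋃ v, T v) \ Q, ∀ᶠ y in 𝓝[(⋃ v, T v) \ Q] x, u y = u x) :
    (u '' ((⋃ v, T v) \ Q)).Finite ∧ (u '' ((⋃ v, T v) \ Q)).ncard < Fintype.card V := by
  classical
  choose x hx using nonempty_diff_of_isTorusChart hch hQ
  have hsub : ∀ v, T v \ Q ⊆ (⋃ v, T v) \ Q := fun v =>
    sdiff_subset_sdiff_left (subset_iUnion T v)
  have hconst : ∀ v, ∀ y ∈ T v \ Q, u y = u (x v) := by
    intro v y hy
    obtain ⟨q, N, hq⟩ := hch v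
    exact eq_of_locally_const (hq.isPreconnected_diff hQ.countable)
      (fun z hz => (hu z (hsub v hz)).filter_mono (nhdsWithin_mono _ (hsub v))) hy (hx v)
  have hst : u (x (s e)) = u (x (t e)) :=
    (hconst _ _ ⟨h.mem_source e, he⟩).symm.trans (hconst _ _ ⟨h.mem_target e, he⟩)
  have himage : u '' ((⋃ v, T v) \ Q) ⊆
      ((Finset.univ.erase (s e)).image fun v => u (x v) : Finset ℕ) := by
    rintro _ ⟨y, ⟨hy, hyQ⟩, rfl⟩
    obtain ⟨v, hv⟩ := mem_iUnion.1 hy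
    rw [hconst v y ⟨hv, hyQ⟩, Finset.mem_coe, Finset.mem_image]
    by_cases hvs : v = s e
    · exact ⟨t e, by simpa using (h.ne e).symm, by rw [hvs, hst]⟩
    · exact ⟨v, by simpa using hvs, rfl⟩
  refine ⟨(Finset.finite_toSet _).subset himage, ?_⟩
  calc (u '' ((⋃ v, T v) \ Q)).ncard ≤ _ := ncard_le_ncard himage (Finset.finite_toSet _)
    _ ≤ (Finset.univ.erase (s e)).card := by
        rw [ncard_coe_finset]
        exact Finset.card_image_le
    _ < Fintype.card V := Finset.card_erase_lt_of_mem (Finset.mem_univ _)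

theorem finrank_H1_of_pairwise_disjoint (hch : ∀ v, ∃ q N, IsTorusChart (T v) q N)
    (hcl : ∀ v, IsClosed (T v)) (hT : ∀ v w x, x ∈ T v → x ∈ T w → v = w) :
    Module.finrank ℝ (H1 (⋃ v, T v)) = 3 * Fintype.card V := by
  have h : IsWedge T (Empty.elim : Empty → Z) Empty.elim Empty.elim :=
    ⟨fun v x _ hx => (hcl v).closure_eq ▸ hx, fun e => e.elim, fun e => e.elim, fun e => e.elim,
      fun e => e.elim, fun v w x hvw hv hw => absurd (hT v w x hv hw) hvw⟩
  rw [h.finrank_H1_iUnion hch, finrank_ker_graphCoboundary_of_isEmpty, Fintype.card_empty]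
  omega

end WedgeOfTori

/-! ### The singular fibre of a covering -/

section SingularFiber

universe u v

theorem isCutPoint_of_subtype {Z : Type*} [TopologicalSpace Z] {f : Z → ℝ} {x : f ⁻¹' {0}}
    (h : ∃ O₀ ∈ 𝓝 x, ∀ O ∈ 𝓝 x, O ⊆ O₀ → ¬ IsPreconnected (O \ {x})) : IsCutPoint f x := by
  obtain ⟨O₀, hO₀, hcut⟩ := h
  obtain ⟨O₁, hO₁, hsub⟩ := (mem_nhds_subtype _ _ _).1 hO₀
  refine ⟨O₁, hO₁, fun O hO hOO hpre => hcut (Subtype.val ⁻¹' O)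
    (continuous_subtype_val.continuousAt.preimage_mem_nhds hO) ((preimage_mono hOO).trans hsub) ?_⟩
  rw [← IsInducing.subtypeVal.isPreconnected_image]
  convert hpre using 1
  ext y
  constructor
  · rintro ⟨z, ⟨hz, hzx⟩, rfl⟩
    exact ⟨⟨z.2, hz⟩, fun h => hzx (Subtype.val_injective h)⟩
  · rintro ⟨⟨hy, hyO⟩, hyx⟩
    exact ⟨⟨y, hy⟩, ⟨hyO, fun h => hyx (congrArg Subtype.val h)⟩, rfl⟩

variable {X : Type v} [TopologicalSpace X] [T2Space X] {Xhat : Type u} [TopologicalSpace Xhat]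
  {τ : Fin 3 → ℂ} {π : X → ℝ} {c : Xhat → X}

/-- The structure of the singular fibre of a covering of the family. -/
theorem exists_isWedge_singular_fiber (hτ : ∀ j, 0 < (τ j).im) (e : π ⁻¹' {0} ≃ₜ unionTori τ)
    (hc : IsCoveringMap c) {r : ℕ} (hr : 0 < r) (hdeg : ∀ x, Nat.card (c ⁻¹' {x}) = r) :
    ∃ (V E : Type u) (_ : Fintype V) (_ : Fintype E) (T : V → Set Xhat) (p : E → Xhat)
      (s t : E → V), IsWedge T p s t ∧ (∀ v, ∃ q N, IsTorusChart (T v) q N) ∧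
      ⋃ v, T v = (π ∘ c) ⁻¹' {0} ∧
      (∀ x, x ∈ range p ↔ ∃ h : c x ∈ π ⁻¹' {0}, (e ⟨c x, h⟩ : Torus τ) ∈ nodes τ) ∧
      (∀ a, IsCutPoint (π ∘ c) (p a)) ∧
      (dualGraph (CoverFiber π c 0)).vertexSet.ncard = Fintype.card V ∧
      (dualGraph (CoverFiber π c 0)).edgeSet.ncard = Fintype.card E ∧
      3 ≤ Fintype.card V ∧ Fintype.card V ≤ 3 * r ∧ Fintype.card E = 3 * r := by
  have _ : T2Space (unionTori τ) := e.t2Space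
  have _ : T2Space Xhat := t2Space_of_isCoveringMap hc
  -- The covering restricted to the zero fibre is a covering of the union of the three tori, again
  -- of degree `r`.
  let d : CoverFiber π c 0 → unionTori τ := e ∘ (π ⁻¹' {0}).restrictPreimage c
  have hd : IsCoveringMap d := (hc.restrictPreimage _).homeomorph_comp e
  have hdeg' : ∀ y, Nat.card (d ⁻¹' {y}) = r := by
    intro y
    rw [← hdeg (e.symm y)]
    have hmem : ∀ x : CoverFiber π c 0, d x = y ↔ c x = e.symm y := fun x => by
      change e _ = y ↔ _
      rw [← e.eq_symm_apply, Subtype.ext_iff]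
      rfl
    refine Nat.card_congr ⟨fun x => ⟨x.1, (hmem x.1).1 x.2⟩,
      fun x => ⟨⟨x.1, ?_⟩, (hmem _).2 x.2⟩, fun _ => rfl, fun _ => rfl⟩
    have hx : c x.1 = e.symm y := x.2
    change π (c x.1) = 0
    rw [hx]
    exact (e.symm y).2
  have hfin := finite_fiber hr hdeg'
  obtain ⟨⟨s, t, hw⟩, hch, hun⟩ := exists_isWedge_cover hd hτ hfin
  obtain ⟨hV, hV3, hVr⟩ := finite_and_card_coverTorus hd hτ hr hdeg'
  obtain ⟨hE, hEr⟩ := card_coverNode hτ hdeg' hr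
  have hVF := Fintype.ofFinite (CoverTorus d)
  have hEF := Fintype.ofFinite (CoverNode d)
  have hvert := hw.ncard_vertexSet hch hun
  have hedge := hw.ncard_edgeSet hch hun
  rw [Nat.card_eq_fintype_card] at hV3 hVr hEr hvert hedge
  refine ⟨CoverTorus d, CoverNode d, hVF, hEF, _, _, s, t, hw.push, fun v => ?_, ?_, fun x => ?_,
    fun a => isCutPoint_of_subtype (hw.eventually_cut hch hun a), hvert, hedge, hV3, hVr, hEr⟩
  · obtain ⟨q, N, hq⟩ := hch v
    exact ⟨_, _, hq.push⟩
  · rw [← image_iUnion, hun, image_univ, Subtype.range_coe]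
  · constructor
    · rintro ⟨a, rfl⟩
      exact ⟨a.1.2, a.2⟩
    · rintro ⟨h, hx⟩
      exact ⟨⟨⟨x, h⟩, hx⟩, rfl⟩

end SingularFiber


/-! ### Fibres that are three disjoint tori -/

section DisjointTori

variable {Z : Type*} [TopologicalSpace Z] [T2Space Z] {τ : Fin 3 → ℂ} {S G : Set Z}

theorem exists_tori (hτ : ∀ j, 0 < (τ j).im) (e : S ≃ₜ DisjointTori τ) :
    ∃ T : Fin 3 → Set Z, (∀ i, ∃ q N, IsTorusChart (T i) q N) ∧ (∀ i, IsClosed (T i)) ∧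
      (∀ i j x, x ∈ T i → x ∈ T j → i = j) ∧ ⋃ i, T i = S := by
  let q : Fin 3 → E3 → Z := fun i s => e.symm (planeMapSigma τ i s)
  have hq : ∀ i j s s', q i s = q j s' ↔ planeMapSigma τ i s = planeMapSigma τ j s' :=
    fun i j s s' => Subtype.val_injective.eq_iff.trans e.symm.injective.eq_iff
  have hch : ∀ i, IsTorusChart (range (q i)) (q i) 1 := fun i =>
    isTorusChart_planeMap hτ i
      (continuous_subtype_val.comp (e.symm.continuous.comp (continuous_planeMapSigma i)))
      fun s s' => by
        rw [hq]
        simp only [planeMapSigma, Sigma.mk.injEq, heq_eq_eq, true_and]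
        exact Subtype.ext_iff
  refine ⟨fun i => range (q i), fun i => ⟨_, _, hch i⟩, fun i => (hch i).isCompact.isClosed, ?_, ?_⟩
  · rintro i j _ ⟨s, rfl⟩ ⟨s', hs⟩
    exact (congrArg Sigma.fst ((hq _ _ _ _).1 hs)).symm
  · apply Subset.antisymm
    · refine iUnion_subset fun i => ?_
      rintro _ ⟨s, rfl⟩
      exact (e.symm _).2
    · intro x hx
      rcases h : e ⟨x, hx⟩ with ⟨i, _, s, rfl⟩
      refine mem_iUnion.2 ⟨i, s, ?_⟩
      change ((e.symm ⟨i, planeMap τ i s, mem_range_self s⟩ : S) : Z) = x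
      rw [← h, e.symm_apply_apply]

theorem isCompact_of_homeomorph_disjointTori (hτ : ∀ j, 0 < (τ j).im) (e : S ≃ₜ DisjointTori τ) :
    IsCompact S := by
  obtain ⟨T, hch, -, -, rfl⟩ := exists_tori hτ e
  refine isCompact_iUnion fun i => ?_
  obtain ⟨q, N, hq⟩ := hch i
  exact hq.isCompact

theorem finrank_H1_of_homeomorph_disjointTori (hτ : ∀ j, 0 < (τ j).im)
    (e : S ≃ₜ DisjointTori τ) : Module.finrank ℝ (H1 S) = 9 := by
  obtain ⟨T, hch, hcl, hT, rfl⟩ := exists_tori hτ e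
  rw [finrank_H1_of_pairwise_disjoint hch hcl hT, Fintype.card_fin]

omit [T2Space Z] in
theorem subset_of_isPreconnected_of_inter_eq {A : Set Z} (hA : IsPreconnected A) (hAS : A ⊆ S)
    (hG : IsOpen G) (hSG : S ∩ G = S ∩ closure G) (hne : (A ∩ G).Nonempty) : A ⊆ G := by
  refine hA.subset_left_of_subset_union hG isClosed_closure.isOpen_compl
    (disjoint_compl_right.mono_left subset_closure) (fun x hx => ?_) hne
  by_cases h : x ∈ closure G
  · exact Or.inl (hSG.ge ⟨hAS hx, h⟩).2
  · exact Or.inr h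

/-- `S ∩ G` is open and closed in `S`, hence a union of some of the three tori, each of which
contributes `3`; reaching `9` takes all of them. -/
theorem subset_of_le_finrank_H1 (hτ : ∀ j, 0 < (τ j).im) (e : S ≃ₜ DisjointTori τ)
    (hG : IsOpen G) (hSG : S ∩ G = S ∩ closure G) (h9 : 9 ≤ Module.finrank ℝ (H1 (S ∩ G))) :
    S ⊆ G := by
  classical
  obtain ⟨T, hch, hcl, hT, rfl⟩ := exists_tori hτ e
  have hsub : ∀ i, (T i ∩ G).Nonempty → T i ⊆ G := fun i hi => by
    obtain ⟨q, N, hq⟩ := hch i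
    exact subset_of_isPreconnected_of_inter_eq hq.isPreconnected (subset_iUnion T i) hG hSG hi
  have h1 : (⋃ i, T i) ∩ G = ⋃ i : {i // T i ⊆ G}, T i := by
    apply Subset.antisymm
    · rintro x ⟨hx, hxG⟩
      obtain ⟨i, hi⟩ := mem_iUnion.1 hx
      exact mem_iUnion.2 ⟨⟨i, hsub i ⟨x, hi, hxG⟩⟩, hi⟩
    · exact iUnion_subset fun i => subset_inter (subset_iUnion T i) i.2
  rw [h1, finrank_H1_of_pairwise_disjoint (T := fun i : {i // T i ⊆ G} => T i) (fun i => hch i) (fun i => hcl i)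
    (fun i j x hi hj => Subtype.ext (hT _ _ x hi hj)), Fintype.card_subtype] at h9
  have h2 : (Finset.univ.filter fun i => T i ⊆ G) = Finset.univ := by
    rw [← Finset.card_eq_iff_eq_univ, Fintype.card_fin]
    refine le_antisymm ((Finset.card_le_univ _).trans (by simp)) ?_
    omega
  refine iUnion_subset fun i => ?_
  exact (Finset.mem_filter.1 (h2.ge (Finset.mem_univ i))).2

/-- The index of the torus. Transferring this function to the singular fibre detects whether two of
its tori are still joined at a node. -/
theorem exists_locally_const_three_values (hτ : ∀ j, 0 < (τ j).im) (e : S ≃ₜ DisjointTori τ) :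
    ∃ u : Z → ℕ, (∀ x ∈ S, ∀ᶠ y in 𝓝[S] x, u y = u x) ∧
      ∀ A : Set ℕ, u '' S ⊆ A → A.Finite → 3 ≤ A.ncard := by
  classical
  obtain ⟨T, hch, hcl, hT, rfl⟩ := exists_tori hτ e
  let u : Z → ℕ := fun x => if h : ∃ i, x ∈ T i then h.choose else 0
  have hu : ∀ i x, x ∈ T i → u x = i := by
    intro i x hx
    have h : ∃ i, x ∈ T i := ⟨i, hx⟩
    simp only [u, dif_pos h]
    rw [hT _ _ x h.choose_spec hx]
  refine ⟨u, fun x hx => ?_, fun A hA hfin => ?_⟩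
  · obtain ⟨i, hi⟩ := mem_iUnion.1 hx
    have h1 : IsOpen (⋃ j ∈ {j | j ≠ i}, T j)ᶜ :=
      ((toFinite _).isClosed_biUnion fun j _ => hcl j).isOpen_compl
    have h2 : x ∈ (⋃ j ∈ {j | j ≠ i}, T j)ᶜ := by
      intro h
      simp only [mem_iUnion] at h
      obtain ⟨j, hj, hxj⟩ := h
      exact hj (hT j i x hxj hi)
    filter_upwards [self_mem_nhdsWithin, mem_nhdsWithin_of_mem_nhds (h1.mem_nhds h2)] with y hy hyi
    obtain ⟨j, hj⟩ := mem_iUnion.1 hy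
    obtain rfl : j = i := by
      by_contra hji
      exact hyi (mem_biUnion (x := j) hji hj)
    rw [hu j y hj, hu j x hi]
  · have h1 : range (Fin.val : Fin 3 → ℕ) ⊆ A := by
      rintro _ ⟨i, rfl⟩
      obtain ⟨q, N, hq⟩ := hch i
      exact hA ⟨q 0, mem_iUnion.2 ⟨i, hq.mem 0⟩, hu i _ (hq.mem 0)⟩
    calc 3 = (range (Fin.val : Fin 3 → ℕ)).ncard := by
          rw [← Nat.card_coe_set_eq, Nat.card_range_of_injective Fin.val_injective, Nat.card_fin]
      _ ≤ A.ncard := ncard_le_ncard h1 hfin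

end DisjointTori

/-! ### The sign of the nodes and the absence of distant pieces -/

section Family

theorem isCoveringMap_id {B : Type*} [TopologicalSpace B] : IsCoveringMap (id : B → B) :=
  fun _ => IsEvenlyCovered.to_isEvenlyCovered_preimage (I := Unit)
    ⟨inferInstance, univ, mem_univ _, isOpen_univ, isOpen_univ, (Homeomorph.prodPUnit _).symm,
      fun _ => rfl⟩

universe v

variable {X : Type v} [TopologicalSpace X] [T2Space X]
  [ChartedSpace (EuclideanSpace ℝ (Fin 4)) X] {τ : Fin 3 → ℂ} {ε : ℝ} {π : X → ℝ}

theorem exists_isWedge_fiber_zero (hτ : ∀ j, 0 < (τ j).im) (hπ : IsNecklaceFamily τ ε π) :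
    ∃ (V E : Type v) (_ : Fintype V) (_ : Fintype E) (T : V → Set X) (p : E → X)
      (s t : E → V), IsWedge T p s t ∧ (∀ v, ∃ q N, IsTorusChart (T v) q N) ∧
      ⋃ v, T v = π ⁻¹' {0} ∧ range p = {x | IsCritical π x} ∧ (∀ a, IsCutPoint π (p a)) ∧
      Fintype.card V = 3 ∧ Fintype.card E = 3 := by
  obtain ⟨e, he⟩ := hπ.fiber_zero
  obtain ⟨V, E, hV, hE, T, p, s, t, hw, hch, hun, hp, hcut, -, -, h3, h3', hE3⟩ :=
    exists_isWedge_singular_fiber hτ e isCoveringMap_id one_pos fun x => by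
      change Nat.card ({x} : Set X) = 1
      simp
  refine ⟨V, E, hV, hE, T, p, s, t, hw, hch, hun, ?_, hcut, by omega, by omega⟩
  ext x
  rw [hp]
  constructor
  · rintro ⟨hx, hn⟩
    exact (he ⟨x, hx⟩).2 hn
  · intro hx
    have hx0 : π x = 0 := by
      by_contra h
      exact hπ.smooth_fiber x h hx
    exact ⟨hx0, (he ⟨x, hx0⟩).1 hx⟩

theorem isCompact_fiber (hτ : ∀ j, 0 < (τ j).im) (hπ : IsNecklaceFamily τ ε π) {t : ℝ}
    (ht : t ∈ Ioo (-ε) ε) : IsCompact (π ⁻¹' {t}) := by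
  rcases lt_trichotomy t 0 with h | rfl | h
  · obtain ⟨e⟩ := hπ.fiber_neg t ⟨ht.1, h⟩
    exact isCompact_of_homeomorph_disjointTori hτ e
  · obtain ⟨V, E, _, _, T, p, s, t, -, hch, hun, -⟩ := exists_isWedge_fiber_zero hτ hπ
    rw [← hun]
    refine isCompact_iUnion fun i => ?_
    obtain ⟨q, N, hq⟩ := hch i
    exact hq.isCompact
  · obtain ⟨e⟩ := hπ.fiber_pos t ⟨h, ht.2⟩
    have := compactSpace_connectedSum hτ
    exact isCompact_iff_compactSpace.2 e.symm.compactSpace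

omit [T2Space X] in
theorem isPreconnected_fiber (hτ : ∀ j, 0 < (τ j).im) (hπ : IsNecklaceFamily τ ε π) {t : ℝ}
    (ht : t ∈ Ioo 0 ε) : IsPreconnected (π ⁻¹' {t}) := by
  obtain ⟨e⟩ := hπ.fiber_pos t ht
  have := preconnectedSpace_connectedSum hτ
  have h1 := isPreconnected_univ.image _
    (continuous_subtype_val.comp e.symm.continuous).continuousOn
  rwa [image_univ, e.symm.surjective.range_comp, Subtype.range_coe] at h1

variable [IsManifold (𝓡 4) ∞ X]

omit [T2Space X] in
theorem regularAt_of_ne_zero (hπ : IsNecklaceFamily τ ε π) {x : X} (hx : π x ≠ 0) :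
    RegularAt π x :=
  regularAt_of_not_isCritical hπ.smooth (hπ.smooth_fiber x hx)

omit [IsManifold (𝓡 4) ∞ X] in
theorem exists_isOpen_superset_fiber (hτ : ∀ j, 0 < (τ j).im) (hπ : IsNecklaceFamily τ ε π)
    {t : ℝ} (ht : t ∈ Ioo (-ε) ε) :
    ∃ G, IsOpen G ∧ π ⁻¹' {t} ⊆ G ∧ IsCompact (closure G) := by
  have : LocallyCompactSpace X := ChartedSpace.locallyCompactSpace (EuclideanSpace ℝ (Fin 4)) X
  exact exists_isOpen_superset_and_isCompact_closure (isCompact_fiber hτ hπ ht)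

/-- The critical points are nodes around which the family passes from two sheets, for negative
values, to a neck. -/
theorem nodeAt_of_isCritical (hτ : ∀ j, 0 < (τ j).im) (hε : 0 < ε) (hπ : IsNecklaceFamily τ ε π)
    {x : X} (hx : IsCritical π x) : NodeAt 1 π x := by
  classical
  have : LocallyCompactSpace X := ChartedSpace.locallyCompactSpace (EuclideanSpace ℝ (Fin 4)) X
  have hcont : Continuous π := hπ.smooth.continuous
  obtain ⟨V, E, _, _, T, p, s, t, hw, hch, hun, hp, hcut, hV, hE⟩ :=
    exists_isWedge_fiber_zero hτ hπ
  have hzero : ∀ a, π (p a) = 0 := fun a => hun.le (mem_iUnion.2 ⟨_, hw.mem_source a⟩)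
  have hnode : ∀ a, NodeAt 1 π (p a) ∨ NodeAt (-1) π (p a) := fun a => by
    have hcr : IsCritical π (p a) := hp.le (mem_range_self a)
    obtain ⟨w, hw, hm⟩ := morseAt_of_isCritical hπ.smooth hcr (hπ.nondegenerate _ hcr)
    exact nodeAt_of_morseAt hw (hzero a) hm (hcut a)
  -- The signs are not yet known. On the negative side the nodes of sign `+1`, collected in `Q`, are
  -- removed, while those of sign `-1` would stay as necks.
  let σ : X → ℝ := fun x => if NodeAt 1 π x then 1 else -1
  have hσ : ∀ x, σ x = 1 ∨ σ x = -1 := fun x => by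
    by_cases h : NodeAt 1 π x
    · exact Or.inl (if_pos h)
    · exact Or.inr (if_neg h)
  obtain ⟨G, hG, htG, hGc⟩ := exists_isOpen_superset_fiber hτ hπ (t := 0) ⟨by linarith, hε⟩
  set Q : Set X := {x ∈ range p | σ x = -(-1)} with hQ
  have hQfin : Q.Finite := (finite_range p).subset fun x hx => hx.1
  have key := rank_H1_fiber_near_zero hcont (Or.inr rfl : (-1 : ℝ) = 1 ∨ (-1 : ℝ) = -1)
    (P := range p) (finite_range p) (σ := σ) (fun x _ => hσ x) (by
      rintro _ ⟨a, rfl⟩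
      by_cases h : NodeAt 1 π (p a)
      · simpa only [σ, if_pos h] using h
      · simpa only [σ, if_neg h] using (hnode a).resolve_left h)
    (fun y _ hyp => regularAt_of_not_isCritical hπ.smooth fun h => hyp (hp.ge h))
    (isCompact_fiber hτ hπ ⟨by linarith, hε⟩) hG hGc htG hQ
  have hle : 𝓝[<] (0 : ℝ) ≤ 𝓝[{t | 0 ≤ -1 * t}] 0 := nhdsWithin_mono _ fun t ht => by
    have : t < 0 := ht
    change 0 ≤ -1 * t
    linarith
  obtain ⟨y, ⟨⟨hrank, hval⟩, hyG⟩, hyε⟩ := (((key.filter_mono hle).and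
    ((eventually_fiber_inter_eq hcont hG hGc htG).filter_mono nhdsWithin_le_nhds)).and
    (Ioo_mem_nhdsLT (show -ε < 0 by linarith))).exists
  have hyQ : π ⁻¹' {y} \ Q = π ⁻¹' {y} := by
    refine sdiff_eq_left.2 (disjoint_left.2 ?_)
    rintro _ hxy ⟨⟨a, rfl⟩, -⟩
    exact hyε.2.ne ((show π (p a) = y from hxy).symm.trans (hzero a))
  rw [hyQ] at hrank hval
  obtain ⟨e⟩ := hπ.fiber_neg y hyε
  rw [← hun] at hrank hval
  -- The near part of `X_y` has the first Betti number of `X_0 \ Q`, at least `9` whatever the signs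
  -- are, so `X_y` has no distant piece.
  have hsub : π ⁻¹' {y} ⊆ G := by
    refine subset_of_le_finrank_H1 hτ e hG hyG ?_
    have h1 := hw.le_finrank_H1_diff hch hQfin
    rw [Module.finrank, hrank]
    rw [hV] at h1
    exact h1
  rw [inter_eq_left.2 hsub] at hval
  obtain ⟨u, hu, hu3⟩ := exists_locally_const_three_values hτ e
  obtain ⟨v, hv, huv⟩ := hval u hu
  -- A node of sign `-1` stays in `X_0 \ Q` and joins two of its three tori, so a locally constant
  -- function there has at most two values, against the three just transferred.
  by_contra hx1
  obtain ⟨a, rfl⟩ := hp.ge hx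
  have haQ : p a ∉ Q := by
    rintro ⟨-, h⟩
    simp only [σ, if_neg hx1] at h
    norm_num at h
  obtain ⟨h1, h2⟩ := hw.ncard_image_lt hch hQfin haQ hv
  have := hu3 _ huv h1
  omega

/-- This replaces properness of `π`. A connected fibre meeting `G` stays in it; a fibre of three
tori stays in it because the part in `G` already has first Betti number at least `9`. -/
theorem eventually_fiber_subset (hτ : ∀ j, 0 < (τ j).im) (hε : 0 < ε)
    (hπ : IsNecklaceFamily τ ε π) {t₀ : ℝ} (ht₀ : t₀ ∈ Ioo (-ε) ε) {G : Set X} (hG : IsOpen G)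
    (hGc : IsCompact (closure G)) (htG : π ⁻¹' {t₀} ⊆ G) : ∀ᶠ t in 𝓝 t₀, π ⁻¹' {t} ⊆ G := by
  have : LocallyCompactSpace X := ChartedSpace.locallyCompactSpace (EuclideanSpace ℝ (Fin 4)) X
  have hcont : Continuous π := hπ.smooth.continuous
  have hclop := eventually_fiber_inter_eq hcont hG hGc htG
  have hconn : ∀ x, π x = t₀ → RegularAt π x → ∀ᶠ t in 𝓝 t₀, t ∈ Ioo 0 ε → π ⁻¹' {t} ⊆ G := by
    rintro x rfl hx
    obtain ⟨U, hxU, hUG, -, hU⟩ := hx.exists_isGood (F := fun t => π ⁻¹' {t} \ ∅) (fun _ => rfl)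
      isClosed_empty univ (notMem_empty x) (hG.mem_nhds (htG rfl))
    rw [nhdsWithin_univ] at hU
    filter_upwards [hU, hclop] with t ht htG htε
    refine subset_of_isPreconnected_of_inter_eq (isPreconnected_fiber hτ hπ htε) subset_rfl hG htG ?_
    obtain ⟨z, hz, hzU⟩ := ht.1
    exact ⟨z, hz.1, hUG hzU⟩
  rcases lt_trichotomy t₀ 0 with h | rfl | h
  · obtain ⟨e₀⟩ := hπ.fiber_neg t₀ ⟨ht₀.1, h⟩
    filter_upwards [hclop, Ioo_mem_nhds ht₀.1 h, rank_H1_fiber_near_regular hcont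
      (fun x hx => regularAt_of_ne_zero hπ (hx.trans_lt h).ne) (isCompact_fiber hτ hπ ht₀) hG hGc
      htG] with t h1 h2 h3
    obtain ⟨e⟩ := hπ.fiber_neg t h2
    refine subset_of_le_finrank_H1 hτ e hG h1 ?_
    rw [Module.finrank, h3]
    exact (finrank_H1_of_homeomorph_disjointTori hτ e₀).ge
  · obtain ⟨V, E, _, _, T, p, s, t, hw, hch, hun, hp, hcut, hV, hE⟩ :=
      exists_isWedge_fiber_zero hτ hπ
    have hreg : ∀ x, x ∉ range p → RegularAt π x := fun x hx =>
      regularAt_of_not_isCritical hπ.smooth fun h => hx (hp.ge h)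
    have _ : Nonempty V := Fintype.card_pos_iff.1 (by omega)
    obtain ⟨x, hxT, hx⟩ := nonempty_diff_of_isTorusChart hch (finite_range p) (Classical.arbitrary V)
    have key := rank_H1_fiber_near_zero hcont (Or.inr rfl : (-1 : ℝ) = 1 ∨ (-1 : ℝ) = -1)
      (P := range p) (finite_range p) (σ := fun _ => 1) (by simp) (by
        rintro _ ⟨a, rfl⟩
        exact nodeAt_of_isCritical hτ hε hπ (hp.le (mem_range_self a)))
      (fun y _ hyp => hreg y hyp) (isCompact_fiber hτ hπ ht₀) hG hGc htG (Q := range p)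
      (by simp [Set.range])
    filter_upwards [hclop, Ioo_mem_nhds ht₀.1 ht₀.2,
      hconn x (hun.le (mem_iUnion.2 ⟨_, hxT⟩)) (hreg x hx),
      eventually_nhdsWithin_iff.1 key] with t h1 h2 h3 h4
    -- Around `t₀ = 0` both arguments are needed: the Betti number of `X_0` minus its nodes for
    -- negative `t`, connectedness for positive `t`.
    rcases lt_trichotomy t 0 with h | rfl | h
    · obtain ⟨e⟩ := hπ.fiber_neg t ⟨h2.1, h⟩
      refine subset_of_le_finrank_H1 hτ e hG h1 ?_
      have h5 := (h4 (show 0 ≤ -1 * t by linarith)).1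
      have h6 : π ⁻¹' {t} \ range p = π ⁻¹' {t} := by
        refine sdiff_eq_left.2 (disjoint_left.2 ?_)
        rintro _ hxy ⟨a, rfl⟩
        have h7 : π (p a) = 0 := hun.le (mem_iUnion.2 ⟨_, hw.mem_source a⟩)
        exact h.ne ((show π (p a) = t from hxy).symm.trans h7)
      rw [h6] at h5
      rw [Module.finrank, h5, ← hun]
      have h8 := hw.le_finrank_H1_diff hch (finite_range p)
      rw [hV] at h8
      exact h8
    · exact htG
    · exact h3 ⟨h, h2.2⟩
  · obtain ⟨x, hx⟩ : t₀ ∈ range π := hπ.range_eq ▸ ht₀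
    filter_upwards [Ioo_mem_nhds h ht₀.2, hconn x hx
      (regularAt_of_ne_zero hπ (by rw [hx]; exact h.ne'))] with t h1 h2 using h2 h1

end Family


/-! ### Betti numbers of the covered family -/

section CoveredFamily

universe u v

variable {X : Type v} [TopologicalSpace X] [T2Space X]
  [ChartedSpace (EuclideanSpace ℝ (Fin 4)) X] [IsManifold (𝓡 4) ∞ X]
  {τ : Fin 3 → ℂ} {ε : ℝ} {π : X → ℝ} {Xhat : Type u} [TopologicalSpace Xhat] {c : Xhat → X}

theorem locContr_coverFiber (hτ : ∀ j, 0 < (τ j).im) (hε : 0 < ε) (hπ : IsNecklaceFamily τ ε π)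
    (hc : IsCoveringMap c) (t : ℝ) : LocContr ((π ∘ c) ⁻¹' {t}) := by
  refine locContr_fiber fun x _ => ?_
  by_cases h : IsCritical π (c x)
  · exact Or.inr ⟨1, (nodeAt_of_isCritical hτ hε hπ h).comp hc.isLocalHomeomorph⟩
  · exact Or.inl ((regularAt_of_not_isCritical hπ.smooth h).comp hc.isLocalHomeomorph)

omit [T2Space X] [IsManifold (𝓡 4) ∞ X] in
theorem isPreconnected_fiber_zero (hτ : ∀ j, 0 < (τ j).im) (hπ : IsNecklaceFamily τ ε π) :
    IsPreconnected (π ⁻¹' {0}) := by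
  obtain ⟨e, -⟩ := hπ.fiber_zero
  have h1 : IsPreconnected (unionTori τ) := by
    have h2 : ∀ i, IsPreconnected (sLag τ i) := fun i =>
      isPreconnected_range (continuous_planeMap i)
    have h3 : ∀ i i', i ≠ i' → ∃ y, y ∈ sLag τ i ∧ y ∈ sLag τ i' := fun i i' hi =>
      ⟨_, mem_range_self (diag (nodeParam i i')),
        (planeMap_nodeParam hτ hi).symm ▸ mem_range_self _⟩
    refine IsPreconnected.iUnion_of_reflTransGen h2 fun i j => ?_
    by_cases h : i = j
    · exact h ▸ Relation.ReflTransGen.refl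
    · exact Relation.ReflTransGen.single (h3 i j h)
  have _ := Subtype.preconnectedSpace h1
  have h4 := isPreconnected_univ.image _
    (continuous_subtype_val.comp e.symm.continuous).continuousOn
  rwa [image_univ, e.symm.surjective.range_comp, Subtype.range_coe] at h4

/-- The first Betti numbers of the fibres of a covering of the family. -/
theorem finrank_H1_coverFiber (hτ : ∀ j, 0 < (τ j).im) (hε : 0 < ε)
    (hπ : IsNecklaceFamily τ ε π) (hc : IsCoveringMap c) {r : ℕ} (hr : 0 < r)
    (hdeg : ∀ x, Nat.card (c ⁻¹' {x}) = r) :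
    ∃ V k : ℕ, (dualGraph (CoverFiber π c 0)).vertexSet.ncard = V ∧
      (dualGraph (CoverFiber π c 0)).edgeSet.ncard = 3 * r ∧ 3 ≤ V ∧ V ≤ 3 * r ∧ 1 ≤ k ∧
      (IsPreconnected ((π ∘ c) ⁻¹' {0}) → k = 1) ∧
      (∀ t ∈ Ioo (-ε) 0, Module.finrank ℝ (H1 ((π ∘ c) ⁻¹' {t})) = 3 * V) ∧
      ∀ t ∈ Ico 0 ε, Module.finrank ℝ (H1 ((π ∘ c) ⁻¹' {t})) = 2 * V + 3 * r + k := by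
  have _ : T2Space Xhat := t2Space_of_isCoveringMap hc
  have _ : LocallyCompactSpace X :=
    ChartedSpace.locallyCompactSpace (EuclideanSpace ℝ (Fin 4)) X
  have hcfin : ∀ x, (c ⁻¹' {x}).Finite := fun x =>
    @toFinite _ _ (Nat.finite_of_card_ne_zero (by rw [hdeg]; exact hr.ne'))
  have hcpt : ∀ K : Set X, IsCompact K → IsCompact (c ⁻¹' K) := fun K hK =>
    IsCoveringMap.isCompact_preimage hc hcfin hK
  have hlh := hc.isLocalHomeomorph
  have _ : WeaklyLocallyCompactSpace Xhat := by
    refine ⟨fun x => ?_⟩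
    obtain ⟨K, hK, hxK⟩ := exists_compact_mem_nhds (c x)
    exact ⟨c ⁻¹' K, hcpt K hK, hc.continuous.continuousAt.preimage_mem_nhds hxK⟩
  have hcont : Continuous (π ∘ c) := hπ.smooth.continuous.comp hc.continuous
  -- A finite covering is proper, so the compact neighbourhoods and the control of nearby fibres
  -- pull back from `X` to `X̂`.
  have hneigh : ∀ t₀ ∈ Ioo (-ε) ε, IsCompact ((π ∘ c) ⁻¹' {t₀}) ∧ ∃ G : Set Xhat, IsOpen G ∧
      IsCompact (closure G) ∧ (π ∘ c) ⁻¹' {t₀} ⊆ G ∧ ∀ᶠ t in 𝓝 t₀, (π ∘ c) ⁻¹' {t} ⊆ G := by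
    intro t₀ ht₀
    obtain ⟨G, hG, htG, hGc⟩ := exists_isOpen_superset_fiber hτ hπ ht₀
    refine ⟨hcpt _ (isCompact_fiber hτ hπ ht₀), c ⁻¹' G, hG.preimage hc.continuous,
      (hcpt _ hGc).of_isClosed_subset isClosed_closure
        (hc.continuous.closure_preimage_subset G), preimage_mono htG, ?_⟩
    filter_upwards [eventually_fiber_subset hτ hε hπ ht₀ hG hGc htG] with t ht
      using preimage_mono ht
  have hloc : ∀ t₀ ∈ Ioo (-ε) ε, t₀ ≠ 0 → ∀ᶠ t in 𝓝 t₀,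
      Module.rank ℝ (H1 ((π ∘ c) ⁻¹' {t})) = Module.rank ℝ (H1 ((π ∘ c) ⁻¹' {t₀})) := by
    intro t₀ ht₀ hne
    obtain ⟨hK, G, hG, hGc, htG, hev⟩ := hneigh t₀ ht₀
    filter_upwards [hev, rank_H1_fiber_near_regular hcont (fun x hx =>
      (regularAt_of_ne_zero hπ (x := c x) (hx.trans_ne hne)).comp hlh) hK hG hGc htG] with t h1 h2
    rwa [inter_eq_left.2 h1] at h2
  have hconst : ∀ J : Set ℝ, IsPreconnected J → J ⊆ Ioo (-ε) ε → (∀ t ∈ J, t ≠ 0) →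
      ∀ t ∈ J, ∀ t' ∈ J, Module.rank ℝ (H1 ((π ∘ c) ⁻¹' {t})) =
        Module.rank ℝ (H1 ((π ∘ c) ⁻¹' {t'})) := fun J hJ hJε hJ0 t ht t' ht' =>
    eq_of_locally_const hJ (u := fun t => Module.rank ℝ (H1 ((π ∘ c) ⁻¹' {t})))
      (fun t₀ ht₀ => (hloc t₀ (hJε ht₀) (hJ0 t₀ ht₀)).filter_mono nhdsWithin_le_nhds) ht ht'
  obtain ⟨e, he⟩ := hπ.fiber_zero
  obtain ⟨V, E, _, _, T, p, s, t, hw, hch, hun, hp, -, hvert, hedge, hV3, hVr, hEr⟩ :=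
    exists_isWedge_singular_fiber hτ e hc hr hdeg
  have hcrit : ∀ x, x ∈ range p ↔ IsCritical π (c x) := by
    intro x
    rw [hp]
    constructor
    · rintro ⟨hx, hn⟩
      exact (he ⟨c x, hx⟩).2 hn
    · intro hx
      have hx0 : π (c x) = 0 := by
        by_contra h
        exact hπ.smooth_fiber _ h hx
      exact ⟨hx0, (he ⟨c x, hx0⟩).1 hx⟩
  have _ : Nonempty V := Fintype.card_pos_iff.1 (by omega)
  have h0 : (0 : ℝ) ∈ Ioo (-ε) ε := ⟨by linarith, hε⟩
  obtain ⟨hK, G, hG, hGc, htG, hev⟩ := hneigh 0 h0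
  have hnode : ∀ x ∈ range p, NodeAt 1 (π ∘ c) x := fun x hx =>
    (nodeAt_of_isCritical hτ hε hπ ((hcrit x).1 hx)).comp hlh
  have hreg : ∀ x, (π ∘ c) x = 0 → x ∉ range p → RegularAt (π ∘ c) x := fun x _ hx =>
    (regularAt_of_not_isCritical hπ.smooth fun h => hx ((hcrit x).2 h)).comp hlh
  -- For `t > 0` no node is removed: every cone opens into a neck, and the Betti number is that of
  -- the singular fibre.
  have hpos : ∀ᶠ t in 𝓝[>] (0 : ℝ),
      Module.rank ℝ (H1 ((π ∘ c) ⁻¹' {t})) = Module.rank ℝ (H1 ((π ∘ c) ⁻¹' {0})) := by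
    have key := rank_H1_fiber_near_zero hcont (Or.inl rfl : (1 : ℝ) = 1 ∨ (1 : ℝ) = -1)
      (finite_range p) (σ := fun _ => 1) (by simp) hnode hreg hK hG hGc htG (Q := ∅)
      (by norm_num)
    have hle : 𝓝[>] (0 : ℝ) ≤ 𝓝[{t | 0 ≤ 1 * t}] 0 := nhdsWithin_mono _ fun t ht => by
      have : 0 < t := ht
      change 0 ≤ 1 * t
      linarith
    filter_upwards [key.filter_mono hle, hev.filter_mono nhdsWithin_le_nhds] with t h1 h2
    have h3 := h1.1
    rwa [sdiff_empty, sdiff_empty, inter_eq_left.2 h2] at h3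
  -- For `t < 0` all nodes split into two sheets, so the comparison is with the singular fibre minus
  -- all nodes.
  have hneg : ∀ᶠ t in 𝓝[<] (0 : ℝ), Module.rank ℝ (H1 ((π ∘ c) ⁻¹' {t})) =
      Module.rank ℝ (H1 ((π ∘ c) ⁻¹' {0} \ range p)) := by
    have key := rank_H1_fiber_near_zero hcont (Or.inr rfl : (-1 : ℝ) = 1 ∨ (-1 : ℝ) = -1)
      (finite_range p) (σ := fun _ => 1) (by simp) hnode hreg hK hG hGc htG (Q := range p)
      (by simp [Set.range])
    have hle : 𝓝[<] (0 : ℝ) ≤ 𝓝[{t | 0 ≤ -1 * t}] 0 := nhdsWithin_mono _ fun t ht => by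
      have : t < 0 := ht
      change 0 ≤ -1 * t
      linarith
    filter_upwards [key.filter_mono hle, hev.filter_mono nhdsWithin_le_nhds,
      self_mem_nhdsWithin] with t h1 h2 h3
    have h4 := h1.1
    have h5 : (π ∘ c) ⁻¹' {t} \ range p = (π ∘ c) ⁻¹' {t} := by
      refine sdiff_eq_left.2 (disjoint_left.2 ?_)
      rintro _ hxy ⟨a, rfl⟩
      have h7 : (π ∘ c) (p a) = 0 := hun.le (mem_iUnion.2 ⟨_, hw.mem_source a⟩)
      have h8 : t < 0 := h3
      exact h8.ne ((show (π ∘ c) (p a) = t from hxy).symm.trans h7)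
    rwa [h5, inter_eq_left.2 h2] at h4
  have hzero := hw.finrank_H1_iUnion hch
  rw [hun, hEr] at hzero
  refine ⟨Fintype.card V, Module.finrank ℝ (LinearMap.ker (graphCoboundary s t)), hvert,
    hedge.trans hEr, hV3, hVr, one_le_finrank_ker_graphCoboundary s t, fun hpre => ?_,
    fun y hy => ?_, fun y hy => ?_⟩
  · rw [← hun] at hpre
    refine hw.finrank_ker_graphCoboundary (fun v => ?_) hpre
    obtain ⟨q, N, hq⟩ := hch v
    exact ⟨_, hq.mem 0⟩
  · obtain ⟨z, hz, hzε⟩ := (hneg.and (Ioo_mem_nhdsLT (show -ε < 0 by linarith))).exists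
    -- Local constancy on the connected interval of regular values carries the value found near `0`
    -- to all of it.
    have h1 := hconst (Ioo (-ε) 0) isPreconnected_Ioo (Ioo_subset_Ioo_right hε.le)
      (fun t ht => ht.2.ne) y hy z hzε
    rw [Module.finrank, h1, hz, ← hun]
    exact hw.finrank_H1_diff_of_subset hch (finite_range p) subset_rfl
  · rcases hy.1.eq_or_lt with rfl | hy0
    · exact hzero
    · obtain ⟨z, hz, hzε⟩ := (hpos.and (Ioo_mem_nhdsGT hε)).exists
      have h1 := hconst (Ioo 0 ε) isPreconnected_Ioo (Ioo_subset_Ioo_left (by linarith))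
        (fun t ht => ht.1.ne') y ⟨hy0, hy.2⟩ z hzε
      rw [Module.finrank, h1, hz]
      exact hzero

end CoveredFamily

end Necklace

/-! ### The theorem -/

theorem lemma2p2p1
    (τ : Fin 3 → ℂ) (hτ : ∀ j, 0 < (τ j).im)
    (hprod : (∏ j, τ j).im = 0 ∧ (∏ j, τ j).re < 0)
    (hprod' : (∏ j, (τ j - 1)).im = 0 ∧ 0 < (∏ j, (τ j - 1)).re)
    (ε : ℝ) (hε : 0 < ε)
    {X : Type*} [TopologicalSpace X] [T2Space X] [SecondCountableTopology X]
    [ChartedSpace (EuclideanSpace ℝ (Fin 4)) X] [IsManifold (𝓡 4) ∞ X]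
    (π : X → ℝ) (hπ : Necklace.IsNecklaceFamily τ ε π)
    {Xhat : Type*} [TopologicalSpace Xhat]
    (c : Xhat → X) (hc : IsCoveringMap c)
    (r : ℕ) (hr : 1 < r) (hdeg : ∀ x, Nat.card (c ⁻¹' {x}) = r) :
    let Γ := Necklace.dualGraph (Necklace.CoverFiber π c 0)
    Γ.edgeSet.ncard = 3 * r ∧
    (3 ≤ Γ.vertexSet.ncard ∧ Γ.vertexSet.ncard ≤ 3 * r) ∧
    (∀ t ∈ Ioo (-ε) 0,
      Necklace.b1 (Necklace.CoverFiber π c t) = 3 * Γ.vertexSet.ncard) ∧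
    (ConnectedSpace (Necklace.CoverFiber π c 0) → ∀ t ∈ Ico 0 ε,
      Necklace.b1 (Necklace.CoverFiber π c t) = 3 * r + 2 * Γ.vertexSet.ncard + 1) ∧
    (∀ t ∈ Ico 0 ε, 3 * r + 7 ≤ Necklace.b1 (Necklace.CoverFiber π c t)) ∧
    10 < 3 * r + 7 ∧
    Necklace.b1 (Necklace.unionTori τ) = 10 ∧
    Necklace.b1 (Necklace.ConnectedSum τ) = 10 := by
  intro Γ
  obtain ⟨V, k, hV, hE, hV3, hVr, hk, hconn, hneg, hpos⟩ :=
    Necklace.finrank_H1_coverFiber hτ hε hπ hc (by omega) hdeg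
  have hb : ∀ t, Necklace.b1 (Necklace.CoverFiber π c t) =
      Module.finrank ℝ (Necklace.H1 ((π ∘ c) ⁻¹' {t})) := fun t =>
    Necklace.b1_eq_finrank_H1 (Necklace.locContr_coverFiber hτ hε hπ hc t) (Homeomorph.refl _)
  -- For the identity covering `r = 1` forces `V = 3`, and the connected singular fibre has `k = 1`,
  -- so the formula gives `2·3 + 3 + 1 = 10`.
  have hten : ∀ t ∈ Ico 0 ε, Module.finrank ℝ (Necklace.H1 (π ⁻¹' {t})) = 10 := by
    obtain ⟨V, k, -, -, hV3, hVr, hk, hconn, -, hpos⟩ :=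
      Necklace.finrank_H1_coverFiber (r := 1) hτ hε hπ Necklace.isCoveringMap_id one_pos fun x => by
        change Nat.card ({x} : Set X) = 1
        simp
    intro t ht
    have h1 := hpos t ht
    rw [hconn (Necklace.isPreconnected_fiber_zero hτ hπ)] at h1
    rw [Function.comp_id] at h1
    omega
  have hloc : ∀ t, Necklace.LocContr (π ⁻¹' {t}) := fun t =>
    Necklace.locContr_coverFiber hτ hε hπ Necklace.isCoveringMap_id t
  refine ⟨hE, ⟨hV.symm ▸ hV3, hV.symm ▸ hVr⟩, fun t ht => ?_, fun hc0 t ht => ?_, fun t ht => ?_,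
    by omega, ?_, ?_⟩
  · rw [hb, hneg t ht, hV]
  · rw [hb, hpos t ht, hconn (isPreconnected_iff_preconnectedSpace.2 hc0.toPreconnectedSpace), hV]
    omega
  · rw [hb, hpos t ht]
    omega
  · obtain ⟨e, -⟩ := hπ.fiber_zero
    rw [Necklace.b1_eq_finrank_H1 (hloc 0) e.symm]
    exact hten 0 ⟨le_rfl, hε⟩
  · obtain ⟨e⟩ := hπ.fiber_pos (ε / 2) ⟨by linarith, by linarith⟩
    rw [Necklace.b1_eq_finrank_H1 (hloc (ε / 2)) e.symm]
    exact hten _ ⟨by linarith, by linarith⟩
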